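/- Let $V\subset\mathbb P^3_{\mathbb Q}$ be the complement of the line $t_0=t_1=0$ in the cubic surface $t_0^2t_2=t_1^2t_3$. For $\mathbf y=(y_0:y_1)\in\mathbb P^1(\mathbb Q)$ let $V_{\mathbf y}\subset V$ be the fibre over $\mathbf y$ of $(t_0:t_1:t_2:t_3)\mapsto(t_0:t_1)$ (an affine line), and let $V_0\subset V$ be the line $t_2=t_3=0$. Put $V_{\mathbf y,\mathbf y}=\mathrm{Sym}^2V_{\mathbf y}$, $V_{0,0}=\mathrm{Sym}^2V_0\subset\mathrm{Sym}^2V$, and let $\mathbb V\subset \mathrm{Sym}^2V$ be the subvariety of pairs lying in a common fibre. Let $\mathcal L$ be the line bundle on $\mathrm{Sym}^2 V$ induced by $\mathcal O(1)$ with its usual adelic metric, i.e. with height $H(\{x_1,x_2\})=(H_K(x_1)H_K(x_2))^{1/[K:\mathbb Q]}$, where $H_K$ is the usual height and $K$ is the smallest field over which $x_1,x_2$ are defined. Let $N_W(B)$ be the number of rational points (Galois-invariant pairs) of height at most $B$ on $W$. Give $\mathrm{Sym}^2\mathbb P^1$ the metrized line bundle induced in the same way from $\mathcal O(1)$ on $\mathbb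 P^1$. For a plane $P$ among $V_{\mathbf y,\mathbf y}$, $V_{0,0}$, $\mathrm{Sym}^2\mathbb P^1$ let $X=\mathrm{Proj}\,A(P,\mathcal L)$ be its natural compactification, where $A(P,\mathcal L)$ is the graded ring of those sections of the powers of $\mathcal L$ on $P$ whose norm is bounded on $P(\mathbb C)$. Let $a$ be the infimum of the $t$ for which $t[\mathcal L]+[K_X]$ is in the effective cone of $X$, let $b$ be the codimension of the minimal face of this cone containing $a[\mathcal L]+[K_X]$, and let $c=\frac{\gamma}{a\,(b-1)!}\,\delta\,\tau$ be the Batyrev–Tschinkel constant. Here $\gamma$ is the value at $[\mathcal L]$ of the characteristic function of the effective cone, $\delta=\#H^1(\mathrm{Gal}(\overline{\mathbb Q}/\mathbb Q),\mathrm{Pic}(X_{\overline{\mathbb Q}}))$ and $\tau$ is the Tamagawa number for the metric of $\mathcal L$. Then: 1. For each of these planes, $A(P,\mathcal L)$ is the homogeneous coordinate ring of $\mathrm{Sym}^2\mathbb P^1$ and is isomorphic, as a graded ring, to $\mathbb Q[x_0,x_1,x_2]$; so $X\cong\mathrm{Sym}^2\mathbb P^1\cong\mathbb P^2$, with $\mathcal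 L$ corresponding to $\mathcal O(1)$. Moreover $-K_X=3[\mathcal L]$, the Galois action on $\mathrm{Pic}(X_{\overline{\mathbb Q}})$ is trivial, and $a=3$, $b=1$. 2. $c(\mathrm{Sym}^2\mathbb P^1)=4/\zeta(3)$, $c(V_{0,0})=c(\mathrm{Sym}^2\mathbb P^1)$, and $c(V_{\mathbf y,\mathbf y})=c(\mathrm{Sym}^2\mathbb P^1)/H(\mathbf y)^9$ for all $\mathbf y\in\mathbb P^1(\mathbb Q)$. Consequently $\sum_{\mathbf y}c(V_{\mathbf y,\mathbf y})$ converges and $c(V_{0,0})+\sum_{\mathbf y\in\mathbb P^1(\mathbb Q)}c(V_{\mathbf y,\mathbf y})=c(\mathrm{Sym}^2\mathbb P^1)\bigl(\sum_{\mathbf y\in\mathbb P^1(\mathbb Q)}H(\mathbf y)^{-9}+1\bigr)$. 3. Each plane $P$ among $V_{\mathbf y,\mathbf y}$ and $V_{0,0}$ is strongly saturated, i.e. $N_{P\cap Z}(B)/N_P(B)\to0$ for every Zariski closed $Z\not\supseteq P$. For these planes and for $\mathrm{Sym}^2\mathbb P^1$ we have $N_P(B)\sim c(P)B^{a}(\log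 B)^{b-1}=c(P)B^3$. 4. The point count on $\mathrm{Sym}^2V$ is the one predicted by Batyrev and Tschinkel from these planes: as $B\to\infty$, $$N_{\mathrm{Sym}^2V}(B)\sim\Bigl(c(V_{0,0})+\sum_{\mathbf y\in\mathbb P^1(\mathbb Q)}c(V_{\mathbf y,\mathbf y})\Bigr)B^3,\qquad N_{\mathbb V}(B)\sim\sum_{\mathbf y\in\mathbb P^1(\mathbb Q)}c(V_{\mathbf y,\mathbf y})\,B^3,$$ and the rational points of $\mathrm{Sym}^2V$ outside $\mathbb V\cup V_{0,0}$ contribute only $o(B^3)$. -/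

import Mathlib

open scoped TensorProduct nonZeroDivisors

noncomputable section

/-! ## Divisors, canonical class and Batyrev--Tschinkel invariants of `Proj A`

`A` is a graded `k`-algebra with pieces `𝒜 n`; it is the homogeneous coordinate ring of the polarised
variety `(X, L) = (Proj A, 𝒪(1))`.  Everything below is expressed through homogeneous elements of `A`.
The invariants are those of the literature when `X` is a smooth projective variety (so that Weil
divisors are Cartier and `X` is its own desingularisation). -/

namespace PolarizedProj

variable {k A : Type} [Field k] [CommRing A] [Algebra k A] (𝒜 : ℕ → Submodule k A)

/-- A prime divisor on `Proj A`: a homogeneous prime ideal of height one which does not contain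
the irrelevant ideal. -/
@[ext]
structure PrimeDivisor where
  ideal : Ideal A
  isPrime : ideal.IsPrime
  homogeneous : Ideal.span {f | f ∈ ideal ∧ ∃ n, f ∈ 𝒜 n} = ideal
  relevant : ∃ n, 0 < n ∧ ∃ f ∈ 𝒜 n, f ∉ ideal
  height_one : ideal.height = 1

/-- The group of (Weil) divisors on `Proj A`. -/
abbrev WeilDiv : Type := PrimeDivisor 𝒜 →₀ ℤ

/-- The order of vanishing of `f` along a prime `p`: the largest `n` with `f ∈ pⁿ A_p`. -/
def ordAt (p : Ideal A) (f : A) : ℕ := sSup {n : ℕ | ∃ s, s ∉ p ∧ s * f ∈ p ^ n}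

/-- `f / g` is a non-zero rational function on `Proj A`, written as a fraction of homogeneous
elements of the same degree. -/
def IsHomFraction (f g : A) : Prop := f ∈ A⁰ ∧ g ∈ A⁰ ∧ ∃ n, f ∈ 𝒜 n ∧ g ∈ 𝒜 n

/-- The divisors `div (f / g)` of the non-zero rational functions. -/
def principalDivisors : Set (WeilDiv 𝒜) :=
  {D | ∃ f g, IsHomFraction 𝒜 f g ∧ ∀ p, D p = (ordAt p.ideal f : ℤ) - ordAt p.ideal g}

/-- `D` is the divisor of a non-zero global section of `L = 𝒪(1)`. -/
def IsHyperplaneDivisor (D : WeilDiv 𝒜) : Prop :=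
  ∃ s ∈ 𝒜 1, s ∈ A⁰ ∧ ∀ p, D p = (ordAt p.ideal s : ℤ)

/-- The function field of `Proj A`, i.e. the fractions `f / g` with `f, g` homogeneous of the
same degree, inside the total ring of fractions of `A`. -/
def functionField : Subalgebra k (FractionRing A) :=
  Algebra.adjoin k {x | ∃ f g, g ∈ A⁰ ∧ (∃ n, f ∈ 𝒜 n ∧ g ∈ 𝒜 n) ∧
    x * algebraMap A (FractionRing A) g = algebraMap A (FractionRing A) f}

/-- The local ring of `Proj A` at the homogeneous prime `p`, inside the function field. -/
def localRing (p : Ideal A) : Subalgebra k (functionField 𝒜) :=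
  Algebra.adjoin k {x | ∃ f g, g ∈ A⁰ ∧ g ∉ p ∧ (∃ n, f ∈ 𝒜 n ∧ g ∈ 𝒜 n) ∧
    (x : FractionRing A) * algebraMap A (FractionRing A) g = algebraMap A (FractionRing A) f}

/-- The `O`-module of those `d`-forms of `F` over `k` which are regular on the subring `O`: the
`O`-span of the forms `da₁ ∧ ⋯ ∧ da_d` with `aᵢ ∈ O`. -/
def regularForms {F : Type} [CommRing F] [Algebra k F] (O : Subalgebra k F) (d : ℕ) :
    Submodule O (⋀[F]^d Ω[F⁄k]) :=
  Submodule.span O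
    {ω | ∃ x : Fin d → F, (∀ i, x i ∈ O) ∧
      ω = exteriorPower.ιMulti F d (fun i => KaehlerDifferential.D k F (x i))}

/-- The form `ω` is `h` times a generator of the module of `d`-forms which are regular on `O`. -/
def IsMulGenerator {F : Type} [CommRing F] [Algebra k F] (O : Subalgebra k F) (d : ℕ)
    (ω : ⋀[F]^d Ω[F⁄k]) (h : F) : Prop :=
  (Submodule.span O {ω} : Set (⋀[F]^d Ω[F⁄k])) = (fun η => h • η) '' (regularForms O d : Set _)

/-- `E` is a canonical divisor of the `d`-dimensional variety `Proj A`: the divisor of some non-zero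
rational `d`-form `ω`, meaning that at every prime divisor `p` there is a rational function `h = f/g`
of order `E p` along `p` such that `ω` is `h` times a generator of the module of `d`-forms regular
at `p`. -/
def IsCanonicalDivisor (d : ℕ) (E : WeilDiv 𝒜) : Prop :=
  ∃ ω : ⋀[functionField 𝒜]^d Ω[functionField 𝒜⁄k], ω ≠ 0 ∧ ∀ p : PrimeDivisor 𝒜,
    ∃ f g, IsHomFraction 𝒜 f g ∧ E p = (ordAt p.ideal f : ℤ) - ordAt p.ideal g ∧
      ∃ h : functionField 𝒜,
        (h : FractionRing A) * algebraMap A (FractionRing A) g = algebraMap A (FractionRing A) f ∧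
        IsMulGenerator (localRing 𝒜 p.ideal) d ω h

/-- A divisor seen as a divisor with real coefficients. -/
def toReal (D : WeilDiv 𝒜) : PrimeDivisor 𝒜 →₀ ℝ := D.mapRange (fun n : ℤ => (n : ℝ)) (by simp)

/-- The class of the real divisor `D` in `Cl(X)_ℝ` lies in the effective cone `Λ_eff(X)`, the cone
generated by the classes of the effective divisors. -/
def IsEffectiveClass (D : PrimeDivisor 𝒜 →₀ ℝ) : Prop :=
  ∃ D' : PrimeDivisor 𝒜 →₀ ℝ, (∀ p, 0 ≤ D' p) ∧
    D - D' ∈ Submodule.span ℝ (toReal 𝒜 '' principalDivisors 𝒜)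

/-- The invariant `a(X, L) = inf {t : t [L] + [K_X] ∈ Λ_eff(X)}`. -/
def aInvariant (d : ℕ) : ℝ :=
  sInf {t : ℝ | ∃ L E, IsHyperplaneDivisor 𝒜 L ∧ IsCanonicalDivisor 𝒜 d E ∧
    IsEffectiveClass 𝒜 (t • toReal 𝒜 L + toReal 𝒜 E)}

/-- The prime divisors whose classes lie on the minimal face of `Λ_eff(X)` containing the adjoint
class `a(X, L) [L] + [K_X]`.  If this class is the class of a rigid effective divisor these are its
components; if it is zero and `X` is projective there are none. -/
def adjointFace (d : ℕ) : Set (PrimeDivisor 𝒜) :=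
  {p | ∃ L E, IsHyperplaneDivisor 𝒜 L ∧ IsCanonicalDivisor 𝒜 d E ∧ ∃ r : ℝ, 0 ≤ r ∧
    IsEffectiveClass 𝒜
      (r • (aInvariant 𝒜 d • toReal 𝒜 L + toReal 𝒜 E) - Finsupp.single p 1)}

/-- Principal divisors together with the prime divisors in `S`. -/
def relSubgroup (S : Set (PrimeDivisor 𝒜)) : AddSubgroup (WeilDiv 𝒜) :=
  AddSubgroup.closure (principalDivisors 𝒜 ∪ {D | ∃ p ∈ S, D = Finsupp.single p 1})

/-- The divisor class group of `X` minus the prime divisors in `S`. -/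
abbrev RelPic (S : Set (PrimeDivisor 𝒜)) : Type := WeilDiv 𝒜 ⧸ relSubgroup 𝒜 S

/-- The group `Pic(X, L)`: the class group of the complement of the adjoint divisor. -/
abbrev AdjointPic (d : ℕ) : Type := RelPic 𝒜 (adjointFace 𝒜 d)

/-- The class of a divisor in `Pic(X, L)`. -/
def divClass (d : ℕ) (D : WeilDiv 𝒜) : AdjointPic 𝒜 d := QuotientAddGroup.mk D

/-- The invariant `b(X, L)`, the rank of `Pic(X, L)`, which is the codimension of the minimal
face of `Λ_eff(X)` containing `a(X, L) [L] + [K_X]`. -/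
def bInvariant (d : ℕ) : ℕ := Module.finrank ℤ (AdjointPic 𝒜 d)

open Classical in
/-- The class `[L]` of `𝒪(1)` in `Pic(X, L)`. -/
def polarization (d : ℕ) : AdjointPic 𝒜 d :=
  if h : ∃ L, IsHyperplaneDivisor 𝒜 L then divClass 𝒜 d h.choose else 0

open Classical in
/-- The invariant `γ(X, L) = ∫_{Λ*} exp(-⟨[L], y⟩) dy`, the characteristic function of the image
`Λ` of the effective cone in `Pic(X, L)_ℝ` at `[L]`.  Here `Λ*` is the dual cone and `dy` is the
Lebesgue measure on the dual of `Pic(X, L)_ℝ` for which the lattice of integral functionals has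
covolume one; the integral is written in the coordinates given by a basis of that lattice. -/
def gammaInvariant (d : ℕ) : ℝ :=
  if h : ∃ r : ℕ, Nonempty (Module.Basis (Fin r) ℤ (AdjointPic 𝒜 d →ₗ[ℤ] ℤ)) then
    let ξ := h.choose_spec.some
    ∫ c in {c : Fin h.choose → ℝ |
        ∀ p : PrimeDivisor 𝒜, 0 ≤ ∑ i, c i * (ξ i (divClass 𝒜 d (Finsupp.single p 1)) : ℝ)},
      Real.exp (-∑ i, c i * (ξ i (polarization 𝒜 d) : ℝ))
  else 0

/-! ### Graded automorphisms act on class groups -/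

section Action

variable {𝒜}

/-- A ring automorphism which preserves the grading. -/
structure IsGraded (𝒜 : ℕ → Submodule k A) (e : A ≃+* A) : Prop where
  map_mem : ∀ n x, x ∈ 𝒜 n → e x ∈ 𝒜 n
  symm_mem : ∀ n x, x ∈ 𝒜 n → e.symm x ∈ 𝒜 n

theorem IsGraded.symm {e : A ≃+* A} (he : IsGraded 𝒜 e) : IsGraded 𝒜 e.symm :=
  ⟨he.symm_mem, fun n x hx => by simpa using he.map_mem n x hx⟩

/-- The image of a prime divisor under a graded automorphism. -/
def PrimeDivisor.map (e : A ≃+* A) (he : IsGraded 𝒜 e) (p : PrimeDivisor 𝒜) :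
    PrimeDivisor 𝒜 where
  ideal := p.ideal.comap e.symm
  isPrime := by
    have := p.isPrime
    exact Ideal.comap_isPrime (e.symm : A →+* A) p.ideal
  homogeneous := by
    apply le_antisymm
    · rw [Ideal.span_le]
      rintro f ⟨hf, -⟩
      exact hf
    · intro f hf
      have h1 : e.symm f ∈ Ideal.span {f | f ∈ p.ideal ∧ ∃ n, f ∈ 𝒜 n} := by
        rw [p.homogeneous]; exact hf
      have h2 := Ideal.mem_map_of_mem (e : A →+* A) h1
      rw [Ideal.map_span] at h2
      have h3 : (e : A →+* A) (e.symm f) = f := by simp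
      rw [h3] at h2
      refine Ideal.span_mono ?_ h2
      rintro _ ⟨g, ⟨hg, n, hn⟩, rfl⟩
      refine ⟨?_, n, he.map_mem n g hn⟩
      simpa [Ideal.mem_comap] using hg
  relevant := by
    obtain ⟨n, hn, f, hf, hfp⟩ := p.relevant
    exact ⟨n, hn, e f, he.map_mem n f hf, by simpa [Ideal.mem_comap] using hfp⟩
  height_one := by
    rw [RingEquiv.height_comap e.symm p.ideal]
    exact p.height_one

theorem ordAt_comap (e : A ≃+* A) (p : Ideal A) (f : A) :
    ordAt (p.comap e.symm) (e f) = ordAt p f := by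
  unfold ordAt
  congr 1
  ext n
  have hpow : (p.comap e.symm) ^ n = (p ^ n).comap e.symm := by
    have h : ∀ I : Ideal A, I.comap e.symm = I.map e := fun I =>
      Ideal.comap_symm e
    rw [h, h, Ideal.map_pow]
  simp only [Set.mem_ofPred_eq, hpow, Ideal.mem_comap]
  constructor
  · rintro ⟨s, hs, hsf⟩
    exact ⟨e.symm s, hs, by simpa using hsf⟩
  · rintro ⟨s, hs, hsf⟩
    exact ⟨e s, by simpa using hs, by simpa using hsf⟩

theorem PrimeDivisor.map_symm_map (e : A ≃+* A) (he : IsGraded 𝒜 e) (p : PrimeDivisor 𝒜) :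
    (p.map e he).map e.symm he.symm = p := by
  apply PrimeDivisor.ext
  ext x
  change e.symm (e.symm.symm x) ∈ p.ideal ↔ _
  simp

theorem PrimeDivisor.map_map_symm (e : A ≃+* A) (he : IsGraded 𝒜 e) (p : PrimeDivisor 𝒜) :
    (p.map e.symm he.symm).map e he = p := by
  apply PrimeDivisor.ext
  ext x
  change e.symm.symm (e.symm x) ∈ p.ideal ↔ _
  simp

/-- The permutation of prime divisors induced by a graded automorphism. -/
def PrimeDivisor.mapEquiv (e : A ≃+* A) (he : IsGraded 𝒜 e) :
    PrimeDivisor 𝒜 ≃ PrimeDivisor 𝒜 where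
  toFun := PrimeDivisor.map e he
  invFun := PrimeDivisor.map e.symm he.symm
  left_inv := PrimeDivisor.map_symm_map e he
  right_inv := PrimeDivisor.map_map_symm e he

/-- The action of a graded automorphism on divisors. -/
def mapDiv (e : A ≃+* A) (he : IsGraded 𝒜 e) : WeilDiv 𝒜 →+ WeilDiv 𝒜 :=
  Finsupp.mapDomain.addMonoidHom (PrimeDivisor.map e he)

theorem mapDiv_apply (e : A ≃+* A) (he : IsGraded 𝒜 e) (D : WeilDiv 𝒜) (p : PrimeDivisor 𝒜) :
    mapDiv e he D (p.map e he) = D p :=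
  Finsupp.mapDomain_apply (PrimeDivisor.mapEquiv e he).injective D p

theorem mapDiv_principal (e : A ≃+* A) (he : IsGraded 𝒜 e) {D : WeilDiv 𝒜}
    (hD : D ∈ principalDivisors 𝒜) : mapDiv e he D ∈ principalDivisors 𝒜 := by
  obtain ⟨f, g, ⟨hf, hg, n, hfn, hgn⟩, h⟩ := hD
  have hreg : ∀ x ∈ A⁰, e x ∈ A⁰ := fun x hx => by
    rw [mem_nonZeroDivisors_iff_right] at hx ⊢
    intro z hz
    have : e.symm z * x = 0 := by
      apply e.injective
      simpa using hz
    simpa using hx _ this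
  refine ⟨e f, e g, ⟨hreg f hf, hreg g hg, n, he.map_mem n f hfn, he.map_mem n g hgn⟩, ?_⟩
  intro p
  obtain ⟨q, rfl⟩ := (PrimeDivisor.mapEquiv e he).surjective p
  change mapDiv e he D (q.map e he) = _
  rw [mapDiv_apply, h q]
  change _ = ((ordAt (q.ideal.comap e.symm) (e f) : ℤ) - ordAt (q.ideal.comap e.symm) (e g))
  rw [ordAt_comap, ordAt_comap]

theorem mapDiv_relSubgroup (e : A ≃+* A) (he : IsGraded 𝒜 e) (S : Set (PrimeDivisor 𝒜))
    (hS : ∀ p ∈ S, p.map e he ∈ S) :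
    relSubgroup 𝒜 S ≤ (relSubgroup 𝒜 S).comap (mapDiv e he) := by
  unfold relSubgroup
  rw [AddSubgroup.closure_le]
  rintro D (hD | ⟨p, hp, rfl⟩)
  · exact AddSubgroup.subset_closure (Or.inl (mapDiv_principal e he hD))
  · refine AddSubgroup.subset_closure (Or.inr ⟨p.map e he, hS p hp, ?_⟩)
    simp [mapDiv, Finsupp.mapDomain_single]

end Action

/-! ### Galois action on the geometric class group -/

variable (k) in
/-- The absolute Galois group of `k`. -/
abbrev AbsGal : Type := AlgebraicClosure k ≃ₐ[k] AlgebraicClosure k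

/-- The coordinate ring of `X` over the algebraic closure of `k`. -/
abbrev GeomRing (k A : Type) [Field k] [CommRing A] [Algebra k A] : Type := AlgebraicClosure k ⊗[k] A

/-- Its graded pieces. -/
def geomPieces : ℕ → Submodule (AlgebraicClosure k) (GeomRing k A) :=
  fun n => (𝒜 n).baseChange (AlgebraicClosure k)

variable (A) in
/-- The Galois action on coefficients. -/
def galRingEquiv (σ : AbsGal k) : GeomRing k A ≃+* GeomRing k A :=
  (Algebra.TensorProduct.congr σ (AlgEquiv.refl : A ≃ₐ[k] A)).toRingEquiv

theorem galRingEquiv_tmul (σ : AbsGal k) (c : AlgebraicClosure k) (x : A) :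
    galRingEquiv A σ (c ⊗ₜ x) = σ c ⊗ₜ x := rfl

theorem galRingEquiv_mem (σ : AbsGal k) (n : ℕ) (x : GeomRing k A) (hx : x ∈ geomPieces 𝒜 n) :
    galRingEquiv A σ x ∈ geomPieces 𝒜 n := by
  unfold geomPieces at hx ⊢
  rw [Submodule.baseChange_eq_span] at hx ⊢
  induction hx using Submodule.span_induction with
  | mem y hy =>
    obtain ⟨z, hz, rfl⟩ := hy
    apply Submodule.subset_span
    refine ⟨z, hz, ?_⟩
    simp [galRingEquiv_tmul]
  | zero => rw [map_zero]; exact Submodule.zero_mem _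
  | add y z _ _ h1 h2 => rw [map_add]; exact Submodule.add_mem _ h1 h2
  | smul c y _ h =>
    have : galRingEquiv A σ (c • y) = σ c • galRingEquiv A σ y := by
      rw [Algebra.smul_def, Algebra.smul_def, map_mul]
      congr 1
    rw [this]
    exact Submodule.smul_mem _ _ h

theorem galRingEquiv_symm (σ : AbsGal k) :
    (galRingEquiv A σ).symm = galRingEquiv A σ⁻¹ := rfl

theorem galRingEquiv_mul (σ τ : AbsGal k) (x : GeomRing k A) :
    galRingEquiv A (σ * τ) x = galRingEquiv A σ (galRingEquiv A τ x) := by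
  induction x using TensorProduct.induction_on with
  | zero => simp
  | tmul c a => simp [galRingEquiv_tmul]
  | add y z h1 h2 => simp [h1, h2]

theorem galRingEquiv_one (x : GeomRing k A) : galRingEquiv A (1 : AbsGal k) x = x := by
  induction x using TensorProduct.induction_on with
  | zero => simp
  | tmul c a => simp [galRingEquiv_tmul]
  | add y z h1 h2 => simp [h1, h2]

theorem galRingEquiv_isGraded (σ : AbsGal k) : IsGraded (geomPieces 𝒜) (galRingEquiv A σ) :=
  ⟨galRingEquiv_mem 𝒜 σ, by rw [galRingEquiv_symm]; exact galRingEquiv_mem 𝒜 σ⁻¹⟩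

/-- The geometric components of the prime divisors on the adjoint face. -/
def geomAdjointFace (d : ℕ) : Set (PrimeDivisor (geomPieces 𝒜)) :=
  {P | ∃ p ∈ adjointFace 𝒜 d,
    p.ideal = P.ideal.comap (Algebra.TensorProduct.includeRight : A →ₐ[k] GeomRing k A)}

theorem geomAdjointFace_map (d : ℕ) (σ : AbsGal k) (P : PrimeDivisor (geomPieces 𝒜))
    (hP : P ∈ geomAdjointFace 𝒜 d) :
    P.map (galRingEquiv A σ) (galRingEquiv_isGraded 𝒜 σ) ∈ geomAdjointFace 𝒜 d := by
  obtain ⟨p, hp, h⟩ := hP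
  refine ⟨p, hp, ?_⟩
  rw [h]
  ext x
  simp only [Ideal.mem_comap, PrimeDivisor.map, galRingEquiv_symm,
    Algebra.TensorProduct.includeRight_apply, galRingEquiv_tmul, map_one]

/-- `Pic(X, L)` over the algebraic closure. -/
def GeomPic (d : ℕ) : Type := RelPic (geomPieces 𝒜) (geomAdjointFace 𝒜 d)

instance (d : ℕ) : AddCommGroup (GeomPic 𝒜 d) :=
  inferInstanceAs (AddCommGroup (RelPic (geomPieces 𝒜) (geomAdjointFace 𝒜 d)))

/-- The Galois action on `Pic(X, L)` over the algebraic closure, induced by the action on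
divisors. -/
def galPic (d : ℕ) (σ : AbsGal k) : GeomPic 𝒜 d →+ GeomPic 𝒜 d :=
  QuotientAddGroup.map _ _ (mapDiv (galRingEquiv A σ) (galRingEquiv_isGraded 𝒜 σ))
    (mapDiv_relSubgroup _ _ _ (geomAdjointFace_map 𝒜 d σ))

/-- Continuous one-cocycles of the absolute Galois group with values in the discrete module
`Pic(X, L)` over the algebraic closure. -/
def oneCocycles (d : ℕ) : AddSubgroup (AbsGal k → GeomPic 𝒜 d) where
  carrier := {c | IsLocallyConstant c ∧ ∀ σ τ, c (σ * τ) = c σ + galPic 𝒜 d σ (c τ)}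
  zero_mem' := ⟨IsLocallyConstant.const 0, fun σ τ => by simp⟩
  add_mem' := by
    rintro a b ⟨ha, ha'⟩ ⟨hb, hb'⟩
    refine ⟨ha.add hb, fun σ τ => ?_⟩
    simp only [Pi.add_apply, ha', hb', map_add]
    abel
  neg_mem' := by
    rintro a ⟨ha, ha'⟩
    refine ⟨ha.neg, fun σ τ => ?_⟩
    simp only [Pi.neg_apply, ha', map_neg]
    abel

/-- One-coboundaries `σ ↦ σ m - m`. -/
def oneCoboundaries (d : ℕ) : AddSubgroup (AbsGal k → GeomPic 𝒜 d) where
  carrier := {c | ∃ m, ∀ σ, c σ = galPic 𝒜 d σ m - m}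
  zero_mem' := ⟨0, fun σ => by simp⟩
  add_mem' := by
    rintro a b ⟨m, hm⟩ ⟨n, hn⟩
    refine ⟨m + n, fun σ => ?_⟩
    simp only [Pi.add_apply, hm, hn, map_add]
    abel
  neg_mem' := by
    rintro a ⟨m, hm⟩
    refine ⟨-m, fun σ => ?_⟩
    simp only [Pi.neg_apply, hm, map_neg]
    abel

/-- The invariant `δ(X, L) = #H¹(Gal(k̄/k), Pic(X_k̄, L))`. -/
def deltaInvariant (d : ℕ) : ℕ :=
  Nat.card (oneCocycles 𝒜 d ⧸ (oneCoboundaries 𝒜 d).addSubgroupOf (oneCocycles 𝒜 d))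

end PolarizedProj

/-! ## Section rings -/

/-- The ring `⊕ₖ 𝒢 k` inside `S[T]`, where the summand `𝒢 k` is placed in degree `k` in `T`. -/
def sectionRing (𝒢 : ℕ → Submodule ℚ (MvPolynomial (Fin 2) ℚ)) :
    Subalgebra ℚ (Polynomial (MvPolynomial (Fin 2) ℚ)) :=
  Algebra.adjoin ℚ {q | ∃ n, ∃ g ∈ 𝒢 n, q = Polynomial.monomial n g}

/-- The piece of degree `n` of the section ring. -/
def sectionPieces (𝒢 : ℕ → Submodule ℚ (MvPolynomial (Fin 2) ℚ)) (n : ℕ) :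
    Submodule ℚ (sectionRing 𝒢) :=
  ((𝒢 n).map ((Polynomial.monomial n :
      MvPolynomial (Fin 2) ℚ →ₗ[MvPolynomial (Fin 2) ℚ] _).restrictScalars ℚ)).comap
    (sectionRing 𝒢).val.toLinearMap

/-- The sections of `𝒪(1)^{(2)}`, to the power `n`, on `Sym² ℙ¹`.  These are the sections of
`𝒪(n, n)` on `ℙ¹ × ℙ¹` which are invariant under the exchange of the factors; in the affine
coordinates of the two factors they are the symmetric polynomials of degree at most `n` in each
variable.  As `Sym² ℙ¹` is the quotient of `ℙ¹ × ℙ¹`, it is `Proj` of the ring they form. -/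
def symSquareSections (n : ℕ) : Submodule ℚ (MvPolynomial (Fin 2) ℚ) :=
  Subalgebra.toSubmodule (MvPolynomial.symmetricSubalgebra (Fin 2) ℚ) ⊓
    MvPolynomial.restrictDegree (Fin 2) ℚ n

/-! ## Lines with their metrics and their symmetric squares -/

/-- A rational line `Λ` in `ℙⁿ⁻¹`, parametrised by
`(τ₀ : τ₁) ↦ (coord 0 0 τ₀ + coord 0 1 τ₁ : coord 1 0 τ₀ + coord 1 1 τ₁ : ⋯)`.
If `complete` holds it is the whole projective line, otherwise it is the affine line `τ₀ ≠ 0`.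
It carries `𝒪(1)` with the adelic metric which defines the usual height on `ℙⁿ⁻¹`. The coordinate
on the affine part is `τ₁ / τ₀`. -/
structure MetrizedLine (n : ℕ) where
  coord : Fin n → Fin 2 → ℚ
  complete : Prop

namespace MetrizedLine

variable {n : ℕ} (Λ : MetrizedLine n)

/-- The inverse `max_i |xᵢ|` of the norm of the section `τ₀` at the point with affine coordinate
`z`, over a normed field `E`. -/
def invNorm {E : Type} [NormedField E] (z : E) : ℝ :=
  ‖(fun i => (Λ.coord i 0 : E) + (Λ.coord i 1 : E) * z : Fin n → E)‖

open Classical in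
/-- Sections of `𝓛^{⊗ m}` over `Sym² Λ`, for the line bundle `𝓛 = 𝒪(1)^{(2)}`, trivialised by
`τ₀ ⊠ τ₀` over the symmetric square of the affine part. -/
def symSections (m : ℕ) : Submodule ℚ (MvPolynomial (Fin 2) ℚ) :=
  if Λ.complete then symSquareSections m
  else Subalgebra.toSubmodule (MvPolynomial.symmetricSubalgebra (Fin 2) ℚ)

/-- The sections of `𝓛^{⊗ m}` over `Sym² Λ` whose norm, which is the product of the norms on the
two factors, is bounded on the complex points.  (It suffices to bound it on a dense open set.) -/
def boundedSections (m : ℕ) : Submodule ℚ (MvPolynomial (Fin 2) ℚ) where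
  carrier := {g | g ∈ Λ.symSections m ∧
    ∃ C : ℝ, ∀ z : Fin 2 → ℂ,
      ‖MvPolynomial.aeval z g‖ ≤ C * (Λ.invNorm (z 0) * Λ.invNorm (z 1)) ^ m}
  zero_mem' := ⟨Submodule.zero_mem _, 0, fun z => by simp⟩
  add_mem' := by
    rintro f g ⟨hf, C, hC⟩ ⟨hg, D, hD⟩
    refine ⟨Submodule.add_mem _ hf hg, C + D, fun z => ?_⟩
    rw [map_add, add_mul]
    exact (norm_add_le _ _).trans (add_le_add (hC z) (hD z))
  smul_mem' := by
    rintro c f ⟨hf, C, hC⟩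
    refine ⟨Submodule.smul_mem _ c hf, ‖(c : ℂ)‖ * C, fun z => ?_⟩
    rw [map_smul, Rat.smul_def, norm_mul, mul_assoc]
    exact mul_le_mul_of_nonneg_left (hC z) (norm_nonneg _)

/-- The graded ring `A(Sym² Λ, 𝓛)` of bounded sections; its `Proj` is the natural compactification
(the `𝓛`-primitive closure) of `Sym² Λ`. -/
abbrev primitiveRing : Subalgebra ℚ (Polynomial (MvPolynomial (Fin 2) ℚ)) :=
  sectionRing Λ.boundedSections

/-- The pieces of `A(Sym² Λ, 𝓛)`. -/
abbrev primitivePieces : ℕ → Submodule ℚ Λ.primitiveRing := sectionPieces Λ.boundedSections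

/-- The Batyrev--Tschinkel invariant `a` of the plane `Sym² Λ`. -/
def a : ℝ := PolarizedProj.aInvariant (k := ℚ) (A := Λ.primitiveRing) Λ.primitivePieces 2

/-- The Batyrev--Tschinkel invariant `b` of the plane `Sym² Λ`. -/
def b : ℕ := PolarizedProj.bInvariant (k := ℚ) (A := Λ.primitiveRing) Λ.primitivePieces 2

/-- The Batyrev--Tschinkel invariant `γ` of the plane `Sym² Λ`. -/
def gamma : ℝ := PolarizedProj.gammaInvariant (k := ℚ) (A := Λ.primitiveRing) Λ.primitivePieces 2

/-- The Batyrev--Tschinkel invariant `δ` of the plane `Sym² Λ`. -/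
def delta : ℕ := PolarizedProj.deltaInvariant (k := ℚ) (A := Λ.primitiveRing) Λ.primitivePieces 2

/-- The divisors on the natural compactification of `Sym² Λ`. -/
abbrev Divisors : Type := PolarizedProj.WeilDiv (k := ℚ) (A := Λ.primitiveRing) Λ.primitivePieces

/-- `D` is the divisor of a non-zero global section of `𝓛` on the natural compactification. -/
def IsHyperplane (D : Λ.Divisors) : Prop :=
  PolarizedProj.IsHyperplaneDivisor (k := ℚ) (A := Λ.primitiveRing) Λ.primitivePieces D

/-- `E` is a canonical divisor on the natural compactification. -/
def IsCanonical (E : Λ.Divisors) : Prop :=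
  PolarizedProj.IsCanonicalDivisor (k := ℚ) (A := Λ.primitiveRing) Λ.primitivePieces 2 E

/-- The geometric class group `Pic(X, 𝓛)` of the natural compactification `X` over the algebraic
closure. -/
abbrev GeomPic : Type := PolarizedProj.GeomPic (k := ℚ) (A := Λ.primitiveRing) Λ.primitivePieces 2

/-- The absolute Galois group acts trivially on the geometric class group. -/
def IsSplit : Prop := ∀ (σ : PolarizedProj.AbsGal ℚ) (c : Λ.GeomPic),
  PolarizedProj.galPic (k := ℚ) (A := Λ.primitiveRing) Λ.primitivePieces 2 σ c = c

open Polynomial in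
/-- The density of the local Tamagawa measure of `Sym² Λ` over the local field `K` in the
coordinates `(t₁, t₂)` of the affine plane for which `T² - t₁ T + t₂` is the polynomial whose
roots are the affine coordinates of the pair of points; the roots are taken in an
algebraic closure `E` of `K` with the extended absolute value.

As the form `dt₁ ∧ dt₂` has divisor `-3 div(τ₀ ⊠ τ₀)`, the isomorphism of `𝓛^{⊗ 3}` with the
anticanonical bundle turns the norm of the dual of this form into `‖τ₀ ⊠ τ₀‖³`. -/
def density (K : Type) {E : Type} [Field K] [NormedField E] [Algebra K E] (t : K × K) : ℝ :=
  (((X ^ 2 - C t.1 * X + C t.2 : K[X]).aroots E).map (fun z : E => (Λ.invNorm z ^ 3)⁻¹)).prod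

/-- The Haar measure on `ℚ_p²` that gives `ℤ_p²` measure one. -/
def padicPlaneMeasure (p : ℕ) [Fact p.Prime] :
    @MeasureTheory.Measure (ℚ_[p] × ℚ_[p]) (borel (ℚ_[p] × ℚ_[p])) :=
  letI : MeasurableSpace (ℚ_[p] × ℚ_[p]) := borel _
  haveI : BorelSpace (ℚ_[p] × ℚ_[p]) := ⟨rfl⟩
  MeasureTheory.Measure.addHaarMeasure
    { carrier := Metric.closedBall 0 1
      isCompact' := isCompact_closedBall 0 1
      interior_nonempty' := ⟨0, mem_interior_iff_mem_nhds.mpr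
        (Metric.closedBall_mem_nhds 0 one_pos)⟩ }

/-- The volume of `(Sym² Λ)(ℚ_p)` for the local Tamagawa measure. (The affine plane
has full measure.) -/
def localVolume (p : ℕ) [Fact p.Prime] : ℝ :=
  @MeasureTheory.integral (ℚ_[p] × ℚ_[p]) ℝ _ _ (borel (ℚ_[p] × ℚ_[p])) (padicPlaneMeasure p)
    (fun t => Λ.density ℚ_[p] (E := PadicAlgCl p) t)

/-- The volume of `(Sym² Λ)(ℝ)` for the local Tamagawa measure. -/
def realVolume : ℝ := ∫ t : ℝ × ℝ, Λ.density ℝ (E := ℂ) t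

/-- The Tamagawa number of a plane `Sym² Λ` for which `IsSplit` holds, i.e. the volume of its adelic
points (in which the rational points of its compactification, a projective plane, are dense).
For trivial Galois action on the geometric class group, of rank `r`, the local `L`-factor
at `p` is `(1 - 1/p)^{-r}`, and its inverse is the convergence factor; the global factor
`lim_{s → 1} (s - 1)^r ζ(s)^r` and the discriminant factor are one. -/
def tamagawa : ℝ :=
  Λ.realVolume * ∏' p : Nat.Primes,
    haveI : Fact (p : ℕ).Prime := ⟨p.2⟩
    (1 - 1 / (p : ℝ)) ^ Module.finrank ℤ Λ.GeomPic * Λ.localVolume p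

/-- The constant `c = γ / (a (b - 1)!) · δ · τ` of Batyrev and Tschinkel for the plane `Sym² Λ`. -/
def btConstant : ℝ :=
  Λ.gamma / (Λ.a * (Nat.factorial (Λ.b - 1) : ℝ)) * Λ.delta * Λ.tamagawa

/-- The main term `c B^a (log B)^(b-1)` predicted for the strongly saturated plane `Sym² Λ`. -/
def btPrediction (B : ℝ) : ℝ := Λ.btConstant * B ^ Λ.a * Real.log B ^ (Λ.b - 1)

end MetrizedLine

/-! ## Rational points and heights on symmetric squares -/

/-- An algebraic closure of the rational numbers. -/
abbrev QBar : Type := AlgebraicClosure ℚ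

/-- The algebraic points of projective space with `n` homogeneous coordinates. -/
abbrev ProjPt (n : ℕ) : Type := Projectivization QBar (Fin n → QBar)

/-- The points of a line over the algebraic closure. -/
def MetrizedLine.points {n : ℕ} (Λ : MetrizedLine n) : Set (ProjPt n) :=
  {x | ∃ τ : Fin 2 → QBar, τ ≠ 0 ∧ (Λ.complete ∨ τ 0 ≠ 0) ∧
    ∃ h : (fun i => (Λ.coord i 0 : QBar) * τ 0 + (Λ.coord i 1 : QBar) * τ 1) ≠ 0,
      x = Projectivization.mk QBar _ h}

section Points

variable {n : ℕ}

/-- The symmetric square of a set of points. -/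
def symSquare (S : Set (ProjPt n)) : Set (Sym2 (ProjPt n)) := {s | ∀ x ∈ s, x ∈ S}

/-- The Galois action on coordinates. -/
def galVec (n : ℕ) (σ : QBar ≃ₐ[ℚ] QBar) :
    (Fin n → QBar) →ₛₗ[(σ : QBar →+* QBar)] (Fin n → QBar) where
  toFun v i := σ (v i)
  map_add' v w := by ext i; simp
  map_smul' c v := by ext i; simp

theorem galVec_injective (σ : QBar ≃ₐ[ℚ] QBar) : Function.Injective (galVec n σ) := by
  intro v w h
  ext i
  exact σ.injective (congrFun h i)

/-- The Galois action on points of projective space. -/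
def galPt (σ : QBar ≃ₐ[ℚ] QBar) : ProjPt n → ProjPt n :=
  Projectivization.map (galVec n σ) (galVec_injective σ)

/-- The rational points of a subset of the symmetric square: the Galois invariant pairs. -/
def rationalPoints (W : Set (Sym2 (ProjPt n))) : Set (Sym2 (ProjPt n)) :=
  {s | s ∈ W ∧ ∀ σ : QBar ≃ₐ[ℚ] QBar, s.map (galPt σ) = s}

/-- Homogeneous coordinates of a point, scaled so that some coordinate is one. -/
def normCoord (x : ProjPt n) (i : Fin n) : QBar :=
  x.rep i / x.rep (Function.ne_iff.mp x.rep_nonzero).choose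

/-- The smallest field containing the coordinates of both points of a pair. -/
def fieldOfDefinition (s : Sym2 (ProjPt n)) : IntermediateField ℚ QBar :=
  IntermediateField.adjoin ℚ (⋃ x ∈ {x | x ∈ s}, Set.range (normCoord x))

instance (s : Sym2 (ProjPt n)) : NumberField (fieldOfDefinition s) where
  to_charZero := inferInstance
  to_finiteDimensional := by
    have hfin : {x | x ∈ s}.Finite := by
      induction s using Sym2.ind with
      | _ x y =>
        have : {z | z ∈ s(x, y)} = {x, y} := by ext z; simp
        rw [this]
        exact Set.toFinite _
    have : Finite (⋃ x ∈ {x | x ∈ s}, Set.range (normCoord x) : Set QBar) :=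
      (hfin.biUnion fun x _ => Set.finite_range _).to_subtype
    have hint : ∀ x : QBar, IsIntegral ℚ x := fun x => by
      have h := ((AlgebraicClosure.isAlgebraic ℚ).isAlgebraic x).isIntegral
      convert h
      · rfl
      · exact Subsingleton.elim _ _
    have h := IntermediateField.finiteDimensional_adjoin
      (S := ⋃ x ∈ {x | x ∈ s}, Set.range (normCoord x)) fun x _ => hint x
    unfold fieldOfDefinition
    convert h

open Classical in
/-- The usual height `H_K` of a point whose coordinates lie in `K` (and one if they do not). -/
def heightOver (K : IntermediateField ℚ QBar) [NumberField K] (x : ProjPt n) : ℝ :=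
  if h : ∀ i, normCoord x i ∈ K then Height.mulHeight (fun i => (⟨normCoord x i, h i⟩ : K)) else 1

/-- The height `(H_K(x₁) H_K(x₂))^{1/[K:ℚ]}` of a pair, for the smallest `K` over which both points
are defined. -/
def symHeight (s : Sym2 (ProjPt n)) : ℝ :=
  (s.map (heightOver (fieldOfDefinition s))).mul ^
    (1 / (Module.finrank ℚ (fieldOfDefinition s) : ℝ))

/-- The number of rational points of height at most `B` on `W`. -/
def countPoints (W : Set (Sym2 (ProjPt n))) (B : ℝ) : ℕ :=
  {s ∈ rationalPoints W | symHeight s ≤ B}.ncard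

/-- Zariski closed subsets of the symmetric square of projective space: those whose preimage
in the product of two projective spaces is cut out by polynomials in two sets of homogeneous
coordinates. -/
def IsZariskiClosed (Z : Set (Sym2 (ProjPt n))) : Prop :=
  ∃ I : Set (MvPolynomial (Fin n ⊕ Fin n) QBar), ∀ s, s ∈ Z ↔
    ∀ (v w : Fin n → QBar) (hv : v ≠ 0) (hw : w ≠ 0),
      s = s(Projectivization.mk QBar v hv, Projectivization.mk QBar w hw) →
        ∀ F ∈ I, MvPolynomial.eval (Sum.elim v w) F = 0

/-- An irreducible subvariety `W` is strongly saturated if no subvariety of smaller dimension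
contains a positive proportion of its rational points, ordered by height. -/
def IsStronglySaturated (W : Set (Sym2 (ProjPt n))) : Prop :=
  ∀ Z, IsZariskiClosed Z → ¬ W ⊆ Z →
    Filter.Tendsto (fun B : ℝ => (countPoints (W ∩ Z) B : ℝ) / countPoints W B)
      Filter.atTop (nhds 0)

end Points

/-! ## The cubic surface -/

/-- The regular locus of the surface `t₀² t₂ = t₁² t₃`, the complement of the line `t₀ = t₁ = 0`. -/
def surfaceV : Set (ProjPt 4) :=
  {x | x.rep 0 ^ 2 * x.rep 2 = x.rep 1 ^ 2 * x.rep 3 ∧ ¬ (x.rep 0 = 0 ∧ x.rep 1 = 0)}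

/-- The fibre over `(y₀ : y₁)` of the map `V → ℙ¹`, `(t₀ : t₁ : t₂ : t₃) ↦ (t₀ : t₁)`. -/
def fibreV (y : Fin 2 → ℚ) : Set (ProjPt 4) :=
  {x | x ∈ surfaceV ∧ x.rep 0 * (y 1 : QBar) = x.rep 1 * (y 0 : QBar)}

/-- The base line `t₂ = t₃ = 0`. -/
def baseV : Set (ProjPt 4) := {x | x ∈ surfaceV ∧ x.rep 2 = 0 ∧ x.rep 3 = 0}

/-- The subvariety of `Sym² V` of pairs of points in the same fibre of `V → ℙ¹`. -/
def diagonalFamily : Set (Sym2 (ProjPt 4)) :=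
  {s | s ∈ symSquare surfaceV ∧ ∀ x ∈ s, ∀ x' ∈ s, x.rep 0 * x'.rep 1 = x.rep 1 * x'.rep 0}

/-- The projective line with the usual metric. -/
def projLine : MetrizedLine 2 := ⟨![![1, 0], ![0, 1]], True⟩

/-- The base line with the metric from `ℙ³`. -/
def baseLine : MetrizedLine 4 := ⟨![![1, 0], ![0, 1], ![0, 0], ![0, 0]], True⟩

/-- The affine line `(τ₀ : τ₁) ↦ (y₀ τ₀ : y₁ τ₀ : y₁² τ₁ : y₀² τ₁)`, `τ₀ ≠ 0`, with the metric
from `ℙ³`. -/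
def fibreLine (y : Fin 2 → ℚ) : MetrizedLine 4 :=
  ⟨![![y 0, 0], ![y 1, 0], ![0, y 1 ^ 2], ![0, y 0 ^ 2]], False⟩

end

/-! ### Homogeneous factors of homogeneous polynomials -/

open scoped TensorProduct nonZeroDivisors

noncomputable section

/-! Geometry. Each plane is the symmetric square of a line whose metric on complex points lies
between two positive multiples of `max 1 |z|`. Boundedness of a section of the `n`-th power
therefore says that a symmetric polynomial has degree at most `n` in each variable, and the theorem
on symmetric functions, with control of degrees, identifies the ring of such sections with `ℚ[e₀,
e₁, e₂]`. On `Proj` of a polynomial ring in three variables the degree identifies the class group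
with `ℤ`, and a chart computation with two-forms gives `K = -3L` (`isCanonicalDivisor_hyperplane`,
`degDiv_canonical`). Hence `a = 3` and `b = γ = 1`. The Galois group preserves degrees, so it acts
trivially on the class group, and `δ = 1` because a profinite group has no non-zero continuous
homomorphism to `ℤ`.

Constants. At every place the metric of the fibre over `y` is `max α (α² |z|)` with `α = max |y₀|
|y₁|`. At a prime the product over the two roots is a Gauss norm in the coefficients of their
polynomial, and summing over boxes gives the volume `α⁻⁹ (1 - p⁻³) / (1 - p⁻¹)` (`localVolume_eq`).
At the real place the superlevel sets of the density are explicit regions and the volume is `12 α⁻⁹`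
(`realVolume_eq`). The product formula turns the `α`'s into `H(y)⁻⁹`, the Euler product gives
`1/ζ(3)`, and `12/3 = 4`.

Counting on one plane. A Galois-invariant pair on a line is the zero set of a primitive integral
binary quadratic form `q`, unique up to sign. In the product of the two heights the finite places
contribute one by Gauss's lemma, and all infinite places contribute the same amount, since the
condition that this contribution is at most `H² T` depends only on the real coefficients of `q`. It
is the condition `SizeLE H T q` (`exists_mulHeight_mul_eq`). There are `8 T³ / H³ + O(T²)` such
integral forms, uniformly in `H ≥ 1`; Möbius inversion over the content divides by `ζ(3)`, the sign
halves, and `T = B / H²` gives `4 B³ / (ζ(3) H⁹)`. A proper closed subset meets the plane in forms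
satisfying a non-trivial equation, of which there are only `O(T²)`.

Counting on `Sym² V`. The rational points of the family are the disjoint union of those of the
planes `V_{y,y}`. The bound `14 B³ / H(y)⁶`, summable over `y`, permits summing the asymptotics by
dominated convergence. The other pairs not on `V_{0,0}` are negligible. Pairs of rational points
number `O(B^{5/2})`. A conjugate pair consists of `(1 : θ : θ² z : z)` and its conjugate; if `M`,
`N` are the sizes of the forms `q`, `Q` of `θ` and `z`, then `M N ≤ B` and, as `z ≠ 0`, also `M² ≤
B`. Both forms split over the same field, so the product of their discriminants is a square. For
fixed `q` this writes `4 Q₀ Q₂` as `Q₁² - d m²`, and a divisor bound leaves `O(N^{8/3})` forms `Q`.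
The sum over `q` is `O(B^{23/8})` (`exists_ncard_isFormPair_le`). -/

theorem MvPolynomial.order_le_totalDegree {σ R : Type*} [CommSemiring R] {f : MvPolynomial σ R}
    (hf : f ≠ 0) : (f : MvPowerSeries σ R).order ≤ f.totalDegree := by
  obtain ⟨d, hd⟩ := MvPolynomial.ne_zero_iff.mp hf
  have h1 : (f : MvPowerSeries σ R).order ≤ d.degree :=
    MvPowerSeries.order_le (by rwa [MvPolynomial.coeff_coe])
  refine h1.trans ?_
  have := MvPolynomial.le_totalDegree (MvPolynomial.mem_support_iff.mpr hd)
  exact_mod_cast this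

/-- The order as a power series is the lowest degree occurring, the total degree the highest. Over a
domain both are additive in products, which is what the statement on factors needs. -/
theorem MvPolynomial.isHomogeneous_iff_le_order {σ R : Type*} [CommSemiring R]
    {f : MvPolynomial σ R} : f.IsHomogeneous f.totalDegree ↔
      (f.totalDegree : ℕ∞) ≤ (f : MvPowerSeries σ R).order := by
  constructor
  · intro h
    refine MvPowerSeries.le_order fun d hd => ?_
    rw [MvPolynomial.coeff_coe]
    refine h.coeff_eq_zero ?_
    intro h'
    rw [h'] at hd
    exact lt_irrefl _ hd
  · intro h
    rw [← MvPolynomial.mem_homogeneousSubmodule, MvPolynomial.mem_homogeneousSubmodule]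
    intro d hd
    have h1 : (f : MvPowerSeries σ R).order ≤ d.degree :=
      MvPowerSeries.order_le (by rwa [MvPolynomial.coeff_coe])
    have h2 : f.totalDegree ≤ d.degree := by exact_mod_cast h.trans h1
    have h3 : d.degree ≤ f.totalDegree :=
      MvPolynomial.le_totalDegree (MvPolynomial.mem_support_iff.mpr hd)
    have h4 : Finsupp.weight (1 : σ → ℕ) d = d.degree := by rw [Finsupp.degree_eq_weight_one]; rfl
    exact h4.trans (le_antisymm h3 h2)

/-- A factor of a non-zero homogeneous polynomial is homogeneous. -/
theorem MvPolynomial.IsHomogeneous.of_mul_left {σ R : Type*} [CommRing R] [IsDomain R]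
    {f g : MvPolynomial σ R} {n : ℕ} (h : (f * g).IsHomogeneous n) (h0 : f * g ≠ 0) :
    f.IsHomogeneous f.totalDegree := by
  have hf : f ≠ 0 := left_ne_zero_of_mul h0
  have hg : g ≠ 0 := right_ne_zero_of_mul h0
  have hn := h.totalDegree h0
  rw [← hn] at h
  rw [MvPolynomial.isHomogeneous_iff_le_order] at h ⊢
  rw [MvPolynomial.totalDegree_mul_of_isDomain hf hg, MvPolynomial.coe_mul,
    MvPowerSeries.order_mul] at h
  have h1 := MvPolynomial.order_le_totalDegree hf
  have h2 := MvPolynomial.order_le_totalDegree hg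
  have h3 : (f : MvPowerSeries σ R).order ≠ ⊤ := fun h => by rw [h] at h1; simp at h1
  have h4 : (g : MvPowerSeries σ R).order ≠ ⊤ := fun h => by rw [h] at h2; simp at h2
  lift (f : MvPowerSeries σ R).order to ℕ using h3 with a
  lift (g : MvPowerSeries σ R).order to ℕ using h4 with b
  -- Order and total degree are additive and the order never exceeds the degree, so equality for the
  -- product forces equality for each factor.
  norm_cast at *
  omega

/-! ### Divisors on `Proj` of a polynomial ring in three variables -/

namespace PolarizedProj

variable {k A : Type} [Field k] [CommRing A] [Algebra k A] {𝒜 : ℕ → Submodule k A}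

/-- A graded isomorphism with the polynomial ring in three variables. -/
structure PolyIso (𝒜 : ℕ → Submodule k A) where
  equiv : A ≃ₐ[k] MvPolynomial (Fin 3) k
  mem_iff : ∀ n x, x ∈ 𝒜 n ↔ (equiv x).IsHomogeneous n

/-- As `π` is prime, a factor `s` outside `(π)` can be cancelled from `πⁿ ∣ s f`. The set of
exponents is then an initial segment bounded by the finite multiplicity, so the supremum in `ℕ` is a
genuine maximum. -/
theorem ordAt_span_singleton [IsDomain A] [UniqueFactorizationMonoid A] {π : A} (hπ : Prime π) {f : A}
    (hf : f ≠ 0) : ordAt (Ideal.span {π}) f = multiplicity π f := by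
  have hfin : FiniteMultiplicity π f := FiniteMultiplicity.of_prime_left hπ hf
  have : {n : ℕ | ∃ s, s ∉ Ideal.span {π} ∧ s * f ∈ Ideal.span {π} ^ n} =
      Set.Iic (multiplicity π f) := by
    ext n
    simp only [Set.mem_ofPred_eq, Ideal.span_singleton_pow, Ideal.mem_span_singleton, Set.mem_Iic]
    rw [← hfin.pow_dvd_iff_le_multiplicity]
    constructor
    · rintro ⟨s, hs, h⟩
      exact hπ.pow_dvd_of_dvd_mul_left n hs h
    · intro h
      exact ⟨1, fun h1 => hπ.not_isUnit (isUnit_of_dvd_one h1), by simpa using h⟩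
  unfold ordAt
  rw [this, csSup_Iic]

namespace PolyIso

variable (P : PolyIso 𝒜)
include P

theorem isDomain : IsDomain A := P.equiv.toMulEquiv.isDomain (MvPolynomial (Fin 3) k)

theorem ufm : haveI := P.isDomain; UniqueFactorizationMonoid A := by
  have := P.isDomain
  exact P.equiv.symm.toMulEquiv.uniqueFactorizationMonoid inferInstance

theorem noetherian : IsNoetherianRing A :=
  isNoetherianRing_of_ringEquiv (MvPolynomial (Fin 3) k) P.equiv.symm.toRingEquiv

/-- The degree of an element. -/
def deg (x : A) : ℕ := (P.equiv x).totalDegree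

theorem deg_eq {n : ℕ} {x : A} (hx : x ∈ 𝒜 n) (h0 : x ≠ 0) : P.deg x = n :=
  ((P.mem_iff n x).mp hx).totalDegree (by simpa using h0)

theorem deg_mul {x y : A} (hx : x ≠ 0) (hy : y ≠ 0) : P.deg (x * y) = P.deg x + P.deg y := by
  unfold deg
  rw [map_mul, MvPolynomial.totalDegree_mul_of_isDomain] <;> simpa

theorem mul_mem {m n : ℕ} {x y : A} (hx : x ∈ 𝒜 m) (hy : y ∈ 𝒜 n) : x * y ∈ 𝒜 (m + n) := by
  rw [P.mem_iff] at *
  rw [map_mul]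
  exact hx.mul hy

theorem one_mem : (1 : A) ∈ 𝒜 0 := by
  rw [P.mem_iff, map_one]
  exact MvPolynomial.isHomogeneous_one _ _

theorem pow_mem {m : ℕ} {x : A} (hx : x ∈ 𝒜 m) (n : ℕ) : x ^ n ∈ 𝒜 (m * n) := by
  rw [P.mem_iff] at *
  rw [map_pow]
  exact hx.pow n

theorem mem_of_mul_left {n : ℕ} {x y : A} (h : x * y ∈ 𝒜 n) (h0 : x * y ≠ 0) : x ∈ 𝒜 (P.deg x) := by
  rw [P.mem_iff] at *
  rw [map_mul] at h
  exact h.of_mul_left (by rw [← map_mul]; exact (map_ne_zero_iff _ P.equiv.injective).mpr h0)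

theorem mem_of_dvd {n : ℕ} {x y : A} (h : y ∈ 𝒜 n) (h0 : y ≠ 0) (hd : x ∣ y) : x ∈ 𝒜 (P.deg x) := by
  obtain ⟨z, rfl⟩ := hd
  exact P.mem_of_mul_left h h0

theorem isUnit_of_deg_eq_zero {x : A} (h0 : x ≠ 0) (h : P.deg x = 0) : IsUnit x := by
  have h1 := (MvPolynomial.totalDegree_eq_zero_iff_eq_C).mp h
  have h2 : IsUnit (P.equiv x) := by
    rw [h1]
    apply IsUnit.map
    rw [isUnit_iff_ne_zero]
    intro h3
    rw [h3, map_zero] at h1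
    exact h0 (by simpa using h1)
  simpa using h2

theorem deg_eq_zero_of_isUnit {x : A} (h : IsUnit x) : P.deg x = 0 := by
  obtain ⟨y, hxy⟩ := h.exists_right_inv
  have := P.isDomain
  have h0 : x * y ≠ 0 := by rw [hxy]; exact one_ne_zero
  have := P.deg_mul (left_ne_zero_of_mul h0) (right_ne_zero_of_mul h0)
  rw [hxy, P.deg_eq P.one_mem one_ne_zero] at this
  omega

/-- The variables. -/
def X (i : Fin 3) : A := P.equiv.symm (MvPolynomial.X i)

theorem X_mem (i : Fin 3) : P.X i ∈ 𝒜 1 := by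
  rw [P.mem_iff, X, AlgEquiv.apply_symm_apply]
  exact MvPolynomial.isHomogeneous_X _ _

theorem X_ne_zero (i : Fin 3) : P.X i ≠ 0 := by
  simp [X]

theorem X_prime (i : Fin 3) : Prime (P.X i) :=
  (MulEquiv.prime_iff P.equiv.symm.toMulEquiv).mpr (MvPolynomial.X_prime)

theorem not_X_dvd_X {i j : Fin 3} (h : i ≠ j) : ¬ P.X i ∣ P.X j := by
  intro hd
  have : (MvPolynomial.X i : MvPolynomial (Fin 3) k) ∣ MvPolynomial.X j := by
    have := map_dvd P.equiv hd
    simpa [X] using this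
  rw [MvPolynomial.X_dvd_X] at this
  simp [h] at this

/-- The prime divisor of a homogeneous prime element. -/
def primeDivisor (π : A) (hπ : Prime π) (hmem : π ∈ 𝒜 (P.deg π)) : PrimeDivisor 𝒜 where
  ideal := Ideal.span {π}
  isPrime := (Ideal.span_singleton_prime hπ.ne_zero).mpr hπ
  homogeneous := by
    apply le_antisymm
    · rw [Ideal.span_le]
      rintro f ⟨hf, -⟩
      exact hf
    · rw [Ideal.span_singleton_le_iff_mem]
      exact Ideal.subset_span ⟨Ideal.mem_span_singleton_self π, _, hmem⟩
  relevant := by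
    -- If all elements of positive degree lay in `(π)`, then `π` would be associated to two
    -- different variables.
    by_contra! h
    have := P.isDomain
    have h' : ∀ i, Associated π (P.X i) := fun i => by
      have := h 1 one_pos (P.X i) (P.X_mem i)
      rw [Ideal.mem_span_singleton] at this
      exact hπ.associated_of_dvd (P.X_prime i) this
    exact P.not_X_dvd_X (i := 0) (j := 1) (by decide) ((h' 0).symm.trans (h' 1)).dvd
  height_one := by
    have := P.isDomain
    have := P.noetherian
    exact Ideal.height_span_singleton_eq_one_of_mem_nonZeroDivisors
      (mem_nonZeroDivisors_of_ne_zero hπ.ne_zero) hπ.not_isUnit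

/-- Primes of height one in a factorial ring are principal. The ideal contains a non-zero
homogeneous element, which the generator divides, so the generator is homogeneous; in degree zero it
would be a unit. -/
theorem exists_generator (p : PrimeDivisor 𝒜) :
    ∃ π : A, Prime π ∧ p.ideal = Ideal.span {π} ∧ π ∈ 𝒜 (P.deg π) ∧ 0 < P.deg π := by
  have := P.isDomain
  have := P.ufm
  have := p.isPrime
  have hne : p.ideal ≠ ⊥ := p.ideal.ne_bot_of_height_eq_one p.height_one
  obtain ⟨f, hf, h0⟩ : ∃ f ∈ {f | f ∈ p.ideal ∧ ∃ n, f ∈ 𝒜 n}, f ≠ 0 := by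
    by_contra! h
    apply hne
    rw [← p.homogeneous, Ideal.span_eq_bot]
    exact h
  obtain ⟨hfp, n, hfn⟩ := hf
  have hprin := (UniqueFactorizationMonoid.isPrincipal_of_height_eq_one p.height_one)
  obtain ⟨π, hπ⟩ := hprin
  change p.ideal = Ideal.span {π} at hπ
  have hπ0 : π ≠ 0 := by
    rintro rfl
    exact hne (by rw [hπ]; simp)
  have hπp : Prime π := by
    rw [← Ideal.span_singleton_prime hπ0, ← hπ]
    exact p.isPrime
  refine ⟨π, hπp, hπ, ?_, ?_⟩
  · rw [hπ, Ideal.mem_span_singleton] at hfp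
    exact P.mem_of_dvd hfn h0 hfp
  · rw [Nat.pos_iff_ne_zero]
    intro h
    exact hπp.not_isUnit (P.isUnit_of_deg_eq_zero hπ0 h)

/-- A homogeneous generator of a prime divisor. -/
def gen (p : PrimeDivisor 𝒜) : A := (P.exists_generator p).choose

theorem gen_prime (p : PrimeDivisor 𝒜) : Prime (P.gen p) := (P.exists_generator p).choose_spec.1

theorem ideal_eq (p : PrimeDivisor 𝒜) : p.ideal = Ideal.span {P.gen p} :=
  (P.exists_generator p).choose_spec.2.1

theorem gen_mem (p : PrimeDivisor 𝒜) : P.gen p ∈ 𝒜 (P.deg (P.gen p)) :=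
  (P.exists_generator p).choose_spec.2.2.1

theorem deg_gen_pos (p : PrimeDivisor 𝒜) : 0 < P.deg (P.gen p) :=
  (P.exists_generator p).choose_spec.2.2.2

theorem ordAt_eq (p : PrimeDivisor 𝒜) {f : A} (hf : f ≠ 0) :
    ordAt p.ideal f = multiplicity (P.gen p) f := by
  have := P.isDomain
  have := P.ufm
  rw [P.ideal_eq p]
  exact ordAt_span_singleton (P.gen_prime p) hf

theorem ordAt_mul (p : PrimeDivisor 𝒜) {f g : A} (hf : f ≠ 0) (hg : g ≠ 0) :
    ordAt p.ideal (f * g) = ordAt p.ideal f + ordAt p.ideal g := by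
  have := P.isDomain
  have := P.ufm
  rw [P.ordAt_eq p hf, P.ordAt_eq p hg, P.ordAt_eq p (mul_ne_zero hf hg)]
  exact multiplicity_mul (P.gen_prime p)
    (FiniteMultiplicity.of_prime_left (P.gen_prime p) (mul_ne_zero hf hg))

theorem ordAt_eq_zero (p : PrimeDivisor 𝒜) {f : A} (hf : f ∉ p.ideal) : ordAt p.ideal f = 0 := by
  have h0 : f ≠ 0 := fun h => hf (h ▸ Ideal.zero_mem _)
  rw [P.ordAt_eq p h0]
  rw [P.ideal_eq, Ideal.mem_span_singleton] at hf
  exact multiplicity_eq_zero.mpr hf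

theorem ordAt_pow (p : PrimeDivisor 𝒜) {f : A} (hf : f ≠ 0) (n : ℕ) :
    ordAt p.ideal (f ^ n) = n * ordAt p.ideal f := by
  have := P.isDomain
  induction n with
  | zero =>
    rw [pow_zero, P.ordAt_eq_zero p, zero_mul]
    exact fun h => p.isPrime.ne_top ((Ideal.eq_top_iff_one _).mpr h)
  | succ n ih => rw [pow_succ, P.ordAt_mul p (pow_ne_zero n hf) hf, ih]; ring

theorem ordAt_gen (p q : PrimeDivisor 𝒜) [Decidable (p = q)] :
    ordAt p.ideal (P.gen q) = if p = q then 1 else 0 := by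
  have := P.isDomain
  have := P.ufm
  split_ifs with h
  · subst h
    rw [P.ordAt_eq p (P.gen_prime p).ne_zero]
    exact multiplicity_self
  · apply P.ordAt_eq_zero
    intro h'
    apply h
    apply PrimeDivisor.ext
    rw [P.ideal_eq p, Ideal.mem_span_singleton] at h'
    rw [P.ideal_eq p, P.ideal_eq q]
    exact Ideal.span_singleton_eq_span_singleton.mpr
      ((P.gen_prime p).associated_of_dvd (P.gen_prime q) h')

/-- The degree of a divisor. -/
def degDiv : WeilDiv 𝒜 →+ ℤ :=
  Finsupp.liftAddHom fun p => (AddMonoidHom.mulRight ((P.deg (P.gen p) : ℤ)))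

theorem degDiv_single (p : PrimeDivisor 𝒜) (n : ℤ) :
    P.degDiv (Finsupp.single p n) = n * P.deg (P.gen p) := by
  simp [degDiv]

/-- Induction on the prime factorisation: prime factors of a homogeneous element are homogeneous,
and each one contributes its own prime divisor with its own degree. This also shows that the orders
of `f` form a finitely supported function. -/
theorem exists_div {n : ℕ} {f : A} (hf : f ∈ 𝒜 n) (h0 : f ≠ 0) :
    ∃ D : WeilDiv 𝒜, (∀ p, D p = ordAt p.ideal f) ∧ P.degDiv D = n := by
  classical
  have := P.isDomain
  have := P.ufm
  induction f using UniqueFactorizationMonoid.induction_on_prime generalizing n with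
  | h₁ => exact absurd rfl h0
  | h₂ x hx =>
    refine ⟨0, fun p => ?_, ?_⟩
    · rw [P.ordAt_eq_zero p]
      · simp
      · exact fun h => p.isPrime.ne_top (Ideal.eq_top_of_isUnit_mem _ h hx)
    · rw [map_zero, ← P.deg_eq hf h0, P.deg_eq_zero_of_isUnit hx]
      rfl
  | h₃ a π ha hπ ih =>
    have h1 : π ∈ 𝒜 (P.deg π) := P.mem_of_dvd hf h0 ⟨a, rfl⟩
    have h2 : a ∈ 𝒜 (P.deg a) := P.mem_of_dvd hf h0 ⟨π, mul_comm _ _⟩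
    obtain ⟨D, hD, hdeg⟩ := ih h2 ha
    let q := P.primeDivisor π hπ h1
    have hass : Associated (P.gen q) π :=
      Ideal.span_singleton_eq_span_singleton.mp ((P.ideal_eq q).symm.trans rfl)
    refine ⟨Finsupp.single q 1 + D, fun p => ?_, ?_⟩
    · rw [P.ordAt_mul p hπ.ne_zero ha, Finsupp.add_apply, hD, Finsupp.single_apply]
      have h3 : ordAt p.ideal π = ordAt p.ideal (P.gen q) := by
        rw [P.ordAt_eq p hπ.ne_zero, P.ordAt_eq p (P.gen_prime q).ne_zero]
        exact multiplicity_eq_of_associated_right hass.symm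
      rw [h3, P.ordAt_gen p q]
      push_cast
      congr 1
      by_cases h : q = p <;> simp [h, eq_comm (a := p)]
    · rw [map_add, hdeg, P.degDiv_single, ← P.deg_eq hf h0, P.deg_mul hπ.ne_zero ha]
      obtain ⟨u, hu⟩ := hass
      have : P.deg π = P.deg (P.gen q) := by
        rw [← hu, P.deg_mul (P.gen_prime q).ne_zero u.ne_zero, P.deg_eq_zero_of_isUnit u.isUnit,
          add_zero]
      rw [this]
      push_cast
      ring

/-- Every divisor is a difference of divisors of homogeneous elements. -/
theorem exists_fraction (D : WeilDiv 𝒜) : ∃ f g, ∃ m n, f ∈ 𝒜 m ∧ g ∈ 𝒜 n ∧ f ≠ 0 ∧ g ≠ 0 ∧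
    (∀ p, D p = (ordAt p.ideal f : ℤ) - ordAt p.ideal g) ∧ P.degDiv D = m - n := by
  classical
  have := P.isDomain
  suffices ∃ f g, ∃ m n, f ∈ 𝒜 m ∧ g ∈ 𝒜 n ∧ f ≠ 0 ∧ g ≠ 0 ∧
      (∀ p, D p = (ordAt p.ideal f : ℤ) - ordAt p.ideal g) by
    obtain ⟨f, g, m, n, hf, hg, hf0, hg0, h⟩ := this
    refine ⟨f, g, m, n, hf, hg, hf0, hg0, h, ?_⟩
    obtain ⟨F, hF, hF'⟩ := P.exists_div hf hf0
    obtain ⟨G, hG, hG'⟩ := P.exists_div hg hg0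
    have : D = F - G := by
      ext p
      rw [h, Finsupp.sub_apply, hF, hG]
    rw [this, map_sub, hF', hG']
  have hneg : ∀ D : WeilDiv 𝒜, (∃ f g, ∃ m n, f ∈ 𝒜 m ∧ g ∈ 𝒜 n ∧ f ≠ 0 ∧ g ≠ 0 ∧
      (∀ p, D p = (ordAt p.ideal f : ℤ) - ordAt p.ideal g)) → ∀ r : ℕ,
      (∃ f g, ∃ m n, f ∈ 𝒜 m ∧ g ∈ 𝒜 n ∧ f ≠ 0 ∧ g ≠ 0 ∧
      (∀ p, (r • D) p = (ordAt p.ideal f : ℤ) - ordAt p.ideal g)) := by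
    rintro D ⟨f, g, m, n, hf, hg, hf0, hg0, h⟩ r
    refine ⟨f ^ r, g ^ r, _, _, P.pow_mem hf r, P.pow_mem hg r, pow_ne_zero r hf0,
      pow_ne_zero r hg0, fun p => ?_⟩
    rw [P.ordAt_pow p hf0, P.ordAt_pow p hg0]
    simp only [Finsupp.smul_apply, h p, nsmul_eq_mul]
    push_cast
    ring
  induction D using Finsupp.induction_linear with
  | zero => exact ⟨1, 1, 0, 0, P.one_mem, P.one_mem, one_ne_zero, one_ne_zero, by simp⟩
  | add D E hD hE =>
    obtain ⟨f, g, m, n, hf, hg, hf0, hg0, h⟩ := hD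
    obtain ⟨f', g', m', n', hf', hg', hf0', hg0', h'⟩ := hE
    refine ⟨f * f', g * g', _, _, P.mul_mem hf hf', P.mul_mem hg hg', mul_ne_zero hf0 hf0',
      mul_ne_zero hg0 hg0', fun p => ?_⟩
    rw [P.ordAt_mul p hf0 hf0', P.ordAt_mul p hg0 hg0', Finsupp.add_apply, h, h']
    push_cast
    ring
  | single q n =>
    have hq : ∀ p, (Finsupp.single q 1 : WeilDiv 𝒜) p = ordAt p.ideal (P.gen q) := fun p => by
      rw [P.ordAt_gen p q, Finsupp.single_apply]
      by_cases h : q = p <;> simp [h, eq_comm (a := p)]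
    have hone : ∀ p : PrimeDivisor 𝒜, ordAt p.ideal (1 : A) = 0 := fun p =>
      P.ordAt_eq_zero p fun h => p.isPrime.ne_top ((Ideal.eq_top_iff_one _).mpr h)
    -- A positive multiple of a prime divisor is the divisor of a power of its generator; for a
    -- negative multiple numerator and denominator are exchanged.
    rcases Int.eq_nat_or_neg n with ⟨r, rfl | rfl⟩
    · have := hneg (Finsupp.single q 1) ⟨P.gen q, 1, _, _, P.gen_mem q, P.one_mem,
        (P.gen_prime q).ne_zero, one_ne_zero, fun p => by rw [hq, hone]; simp⟩ r
      simpa using this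
    · have := hneg (Finsupp.single q (-1)) ⟨1, P.gen q, _, _, P.one_mem, P.gen_mem q,
        one_ne_zero, (P.gen_prime q).ne_zero, fun p => by
          rw [Finsupp.single_neg, Finsupp.neg_apply, hq, hone]; simp⟩ r
      simpa using this

/-- A divisor is `div f - div g` for some homogeneous `f`, `g`, of degree `deg f - deg g`. Degree
zero is thus exactly the condition that `f / g` is a rational function. This makes the class group
`ℤ`. -/
theorem mem_principalDivisors_iff (D : WeilDiv 𝒜) : D ∈ principalDivisors 𝒜 ↔ P.degDiv D = 0 := by
  have := P.isDomain
  constructor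
  · rintro ⟨f, g, ⟨hf, hg, n, hfn, hgn⟩, h⟩
    obtain ⟨F, hF, hF'⟩ := P.exists_div hfn (nonZeroDivisors.ne_zero hf)
    obtain ⟨G, hG, hG'⟩ := P.exists_div hgn (nonZeroDivisors.ne_zero hg)
    have : D = F - G := by
      ext p
      rw [h, Finsupp.sub_apply, hF, hG]
    rw [this, map_sub, hF', hG', sub_self]
  · intro hD
    obtain ⟨f, g, m, n, hf, hg, hf0, hg0, h, hdeg⟩ := P.exists_fraction D
    have hmn : m = n := by omega
    subst hmn
    exact ⟨f, g, ⟨mem_nonZeroDivisors_of_ne_zero hf0, mem_nonZeroDivisors_of_ne_zero hg0, m, hf, hg⟩,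
      h⟩

/-- A coordinate hyperplane. -/
def hyp (i : Fin 3) : PrimeDivisor 𝒜 :=
  P.primeDivisor (P.X i) (P.X_prime i) (by
    rw [P.deg_eq (P.X_mem i) (P.X_ne_zero i)]; exact P.X_mem i)

theorem deg_gen_hyp (i : Fin 3) : P.deg (P.gen (P.hyp i)) = 1 := by
  have := P.isDomain
  have hass : Associated (P.gen (P.hyp i)) (P.X i) :=
    Ideal.span_singleton_eq_span_singleton.mp ((P.ideal_eq (P.hyp i)).symm.trans rfl)
  obtain ⟨u, hu⟩ := hass
  have := P.deg_mul (P.gen_prime (P.hyp i)).ne_zero u.ne_zero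
  rw [hu, P.deg_eq (P.X_mem i) (P.X_ne_zero i), P.deg_eq_zero_of_isUnit u.isUnit] at this
  omega

theorem degDiv_hyperplane {L : WeilDiv 𝒜} (hL : IsHyperplaneDivisor 𝒜 L) : P.degDiv L = 1 := by
  obtain ⟨s, hs, hs0, h⟩ := hL
  have := P.isDomain
  obtain ⟨F, hF, hF'⟩ := P.exists_div hs (nonZeroDivisors.ne_zero hs0)
  have : L = F := by ext p; rw [h, hF]
  rw [this, hF']
  rfl

theorem exists_hyperplane : ∃ L : WeilDiv 𝒜, IsHyperplaneDivisor 𝒜 L := by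
  have := P.isDomain
  obtain ⟨F, hF, -⟩ := P.exists_div (P.X_mem 0) (P.X_ne_zero 0)
  exact ⟨F, P.X 0, P.X_mem 0, mem_nonZeroDivisors_of_ne_zero (P.X_ne_zero 0), hF⟩

theorem relSubgroup_empty : relSubgroup 𝒜 ∅ = P.degDiv.ker := by
  unfold relSubgroup
  apply le_antisymm
  · rw [AddSubgroup.closure_le]
    rintro D (hD | ⟨p, hp, -⟩)
    · exact (P.mem_principalDivisors_iff D).mp hD
    · exact absurd hp (by simp)
  · intro D hD
    exact AddSubgroup.subset_closure (Or.inl ((P.mem_principalDivisors_iff D).mpr hD))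

theorem degDiv_surjective : Function.Surjective P.degDiv := fun n =>
  ⟨Finsupp.single (P.hyp 0) n, by rw [P.degDiv_single, P.deg_gen_hyp]; simp⟩

/-- The class group is `ℤ`. -/
def relPicEquiv : RelPic 𝒜 (∅ : Set (PrimeDivisor 𝒜)) ≃+ ℤ :=
  (QuotientAddGroup.quotientAddEquivOfEq P.relSubgroup_empty).trans
    (QuotientAddGroup.quotientKerEquivOfSurjective P.degDiv P.degDiv_surjective)

/-- The degree of a real divisor. -/
def degReal : (PrimeDivisor 𝒜 →₀ ℝ) →ₗ[ℝ] ℝ :=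
  Finsupp.lsum ℝ fun p => LinearMap.mulRight ℝ ((P.deg (P.gen p) : ℝ))

theorem degReal_single (p : PrimeDivisor 𝒜) (r : ℝ) :
    P.degReal (Finsupp.single p r) = r * P.deg (P.gen p) := by
  simp [degReal]

theorem degReal_toReal (D : WeilDiv 𝒜) : P.degReal (toReal 𝒜 D) = P.degDiv D := by
  induction D using Finsupp.induction_linear with
  | zero => simp [toReal]
  | add D E hD hE =>
    have : toReal 𝒜 (D + E) = toReal 𝒜 D + toReal 𝒜 E := by
      ext p; simp [toReal]
    rw [this, map_add, hD, hE, map_add]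
    push_cast
    rfl
  | single p n =>
    have : toReal 𝒜 (Finsupp.single p n) = Finsupp.single p (n : ℝ) := by
      simp [toReal]
    rw [this, P.degReal_single, P.degDiv_single]
    push_cast
    rfl

/-- Modulo real combinations of principal divisors every divisor is its degree times a coordinate
line, so the effective cone is a half-line. -/
theorem isEffectiveClass_iff (D : PrimeDivisor 𝒜 →₀ ℝ) :
    IsEffectiveClass 𝒜 D ↔ 0 ≤ P.degReal D := by
  constructor
  · rintro ⟨D', hD', h⟩
    have h1 : ∀ F ∈ Submodule.span ℝ (toReal 𝒜 '' principalDivisors 𝒜), P.degReal F = 0 := by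
      intro F hF
      have : Submodule.span ℝ (toReal 𝒜 '' principalDivisors 𝒜) ≤ LinearMap.ker P.degReal := by
        rw [Submodule.span_le]
        rintro _ ⟨E, hE, rfl⟩
        rw [SetLike.mem_coe, LinearMap.mem_ker, P.degReal_toReal,
          (P.mem_principalDivisors_iff E).mp hE, Int.cast_zero]
      exact this hF
    have h2 := h1 _ h
    rw [map_sub, sub_eq_zero] at h2
    rw [h2]
    have : P.degReal D' = ∑ p ∈ D'.support, D' p * P.deg (P.gen p) := by
      simp [degReal, Finsupp.sum]
    rw [this]
    exact Finset.sum_nonneg fun p _ => mul_nonneg (hD' p) (Nat.cast_nonneg _)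
  · intro h
    refine ⟨Finsupp.single (P.hyp 0) (P.degReal D), fun p => ?_, ?_⟩
    · classical
      rw [Finsupp.single_apply]
      split_ifs
      exacts [h, le_rfl]
    · clear h
      induction D using Finsupp.induction_linear with
      | zero => simp
      | add D E hD hE =>
        rw [map_add, Finsupp.single_add, add_sub_add_comm]
        exact Submodule.add_mem _ hD hE
      | single p r =>
        have : Finsupp.single p r - Finsupp.single (P.hyp 0) (P.degReal (Finsupp.single p r)) =
            r • toReal 𝒜 (Finsupp.single p 1 - Finsupp.single (P.hyp 0) (P.deg (P.gen p) : ℤ)) := by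
          classical
          rw [P.degReal_single]
          ext q
          simp only [toReal, Finsupp.sub_apply, Finsupp.smul_apply, Finsupp.mapRange_apply,
            Finsupp.single_apply, smul_eq_mul]
          split_ifs <;> simp [mul_sub]
        rw [this]
        refine Submodule.smul_mem _ _ (Submodule.subset_span ⟨_, ?_, rfl⟩)
        rw [P.mem_principalDivisors_iff, map_sub, P.degDiv_single, P.degDiv_single, P.deg_gen_hyp]
        simp

end PolyIso

end PolarizedProj

/-! ### The invariants `a`, `b`, `γ`, `δ` and the Galois action -/

namespace PolarizedProj

variable {k A : Type} [Field k] [CommRing A] [Algebra k A] {𝒜 : ℕ → Submodule k A}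

namespace PolyIso

variable (P : PolyIso 𝒜)

/-- The class group of the complement of the empty set is `ℤ`. -/
def relPicEquivOfEmpty {S : Set (PrimeDivisor 𝒜)} (hS : S = ∅) : RelPic 𝒜 S ≃ₗ[ℤ] ℤ :=
  AddEquiv.toIntLinearEquiv (by subst hS; exact P.relPicEquiv)

theorem relPicEquivOfEmpty_mk {S : Set (PrimeDivisor 𝒜)} (hS : S = ∅) (D : WeilDiv 𝒜) :
    P.relPicEquivOfEmpty hS (QuotientAddGroup.mk D : RelPic 𝒜 S) = P.degDiv D := by
  subst hS
  rfl

include P in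
theorem finrank_relPic {S : Set (PrimeDivisor 𝒜)} (hS : S = ∅) :
    Module.finrank ℤ (RelPic 𝒜 S) = 1 := by
  rw [(P.relPicEquivOfEmpty hS).finrank_eq, Module.finrank_self]

section Canonical

variable {d : ℕ} (hcan : ∀ E, IsCanonicalDivisor 𝒜 d E → P.degDiv E = -3)
  (hex : ∃ E, IsCanonicalDivisor 𝒜 d E)
include hcan hex

theorem aInvariant_eq : aInvariant 𝒜 d = 3 := by
  have : {t : ℝ | ∃ L E, IsHyperplaneDivisor 𝒜 L ∧ IsCanonicalDivisor 𝒜 d E ∧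
      IsEffectiveClass 𝒜 (t • toReal 𝒜 L + toReal 𝒜 E)} = Set.Ici 3 := by
    ext t
    simp only [Set.mem_ofPred_eq, Set.mem_Ici]
    have key : ∀ L E, IsHyperplaneDivisor 𝒜 L → IsCanonicalDivisor 𝒜 d E →
        (IsEffectiveClass 𝒜 (t • toReal 𝒜 L + toReal 𝒜 E) ↔ 3 ≤ t) := by
      intro L E hL hE
      rw [P.isEffectiveClass_iff, map_add, map_smul, P.degReal_toReal, P.degReal_toReal,
        P.degDiv_hyperplane hL, hcan E hE]
      norm_num
    constructor
    · rintro ⟨L, E, hL, hE, h⟩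
      exact (key L E hL hE).mp h
    · intro h
      obtain ⟨E, hE⟩ := hex
      obtain ⟨L, hL⟩ := P.exists_hyperplane
      exact ⟨L, E, hL, hE, (key L E hL hE).mpr h⟩
  unfold aInvariant
  rw [this, csInf_Ici]

/-- The class `a L + K` has degree zero, and subtracting a prime divisor, whose degree is positive,
leaves the effective cone. -/
theorem adjointFace_eq : adjointFace 𝒜 d = ∅ := by
  rw [Set.eq_empty_iff_forall_notMem]
  rintro p ⟨L, E, hL, hE, r, hr, h⟩
  rw [P.isEffectiveClass_iff, map_sub, map_smul, map_add, map_smul, P.degReal_toReal,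
    P.degReal_toReal, P.degDiv_hyperplane hL, hcan E hE, P.aInvariant_eq hcan hex,
    P.degReal_single] at h
  have := P.deg_gen_pos p
  have h2 : (0 : ℝ) < P.deg (P.gen p) := by exact_mod_cast this
  norm_num at h
  linarith

theorem bInvariant_eq : bInvariant 𝒜 d = 1 := PolyIso.finrank_relPic P (P.adjointFace_eq hcan hex)

/-- A basis of the dual of the class group is the degree up to sign, and `[L]` has degree one, so
the integral is that of `exp (-x)` over `x ≥ 0`. -/
theorem gammaInvariant_eq : gammaInvariant 𝒜 d = 1 := by
  set φ : AdjointPic 𝒜 d ≃ₗ[ℤ] ℤ := P.relPicEquivOfEmpty (P.adjointFace_eq hcan hex) with hφ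
  have hφD : ∀ D, φ (divClass 𝒜 d D) = P.degDiv D := P.relPicEquivOfEmpty_mk _
  have hpol : φ (polarization 𝒜 d) = 1 := by
    have h := P.exists_hyperplane
    unfold polarization
    rw [dif_pos h, hφD, P.degDiv_hyperplane h.choose_spec]
  let ψ : (AdjointPic 𝒜 d →ₗ[ℤ] ℤ) ≃ₗ[ℤ] ℤ :=
    (LinearEquiv.congrLeft ℤ ℤ φ).trans (LinearMap.ringLmapEquivSelf ℤ ℤ ℤ)
  have hb : ∃ r : ℕ, Nonempty (Module.Basis (Fin r) ℤ (AdjointPic 𝒜 d →ₗ[ℤ] ℤ)) :=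
    ⟨1, ⟨(Module.Basis.singleton (Fin 1) ℤ).map ψ.symm⟩⟩
  -- The definition takes a rank and a basis by choice, so the value is computed for all of them.
  have key : ∀ (r : ℕ) (ξ : Module.Basis (Fin r) ℤ (AdjointPic 𝒜 d →ₗ[ℤ] ℤ)),
      ∫ c in {c : Fin r → ℝ |
        ∀ p : PrimeDivisor 𝒜, 0 ≤ ∑ i, c i * (ξ i (divClass 𝒜 d (Finsupp.single p 1)) : ℝ)},
      Real.exp (-∑ i, c i * (ξ i (polarization 𝒜 d) : ℝ)) = 1 := by
    intro r ξ
    have hr : r = 1 := by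
      have h1 := Module.finrank_eq_card_basis ξ
      rw [ψ.finrank_eq, Module.finrank_self, Fintype.card_fin] at h1
      exact h1.symm
    subst hr
    obtain ⟨u, hu⟩ : ∃ u : ℤ, ∀ x, ξ 0 x = φ x * u := by
      refine ⟨ξ 0 (φ.symm 1), fun x => ?_⟩
      have : x = φ x • φ.symm 1 := by
        apply φ.injective
        rw [map_smul, LinearEquiv.apply_symm_apply, smul_eq_mul, mul_one]
      conv_lhs => rw [this]
      rw [map_smul, smul_eq_mul]
    have hunit : IsUnit u := by
      have h1 := ξ.sum_repr φ.toLinearMap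
      rw [Fin.sum_univ_one] at h1
      have h2 := LinearMap.congr_fun h1 (φ.symm 1)
      rw [LinearMap.smul_apply, hu] at h2
      simp only [LinearEquiv.apply_symm_apply, LinearEquiv.coe_coe, one_mul, smul_eq_mul] at h2
      exact IsUnit.of_mul_eq_one_right _ h2
    have hset : {c : Fin 1 → ℝ |
        ∀ p : PrimeDivisor 𝒜, 0 ≤ ∑ i, c i * (ξ i (divClass 𝒜 d (Finsupp.single p 1)) : ℝ)} =
        (MeasurableEquiv.funUnique (Fin 1) ℝ) ⁻¹' {x : ℝ | 0 ≤ x * u} := by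
      ext c
      simp only [Fin.sum_univ_one, hu, hφD, P.degDiv_single, Set.mem_ofPred_eq, Set.mem_preimage,
        MeasurableEquiv.funUnique_apply, Fin.default_eq_zero]
      constructor
      · intro h
        simpa [P.deg_gen_hyp] using h (P.hyp 0)
      · intro h p
        have : (0 : ℝ) ≤ P.deg (P.gen p) := Nat.cast_nonneg _
        have h3 := mul_nonneg h this
        push_cast
        linarith
    rw [hset]
    have hfun : (fun c : Fin 1 → ℝ => Real.exp (-∑ i, c i * (ξ i (polarization 𝒜 d) : ℝ))) =
        fun c => (fun x : ℝ => Real.exp (-(x * u))) (MeasurableEquiv.funUnique (Fin 1) ℝ c) := by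
      ext c
      simp [hu, hpol]
    rw [hfun]
    refine ((MeasureTheory.volume_preserving_funUnique (Fin 1) ℝ).setIntegral_preimage_emb
      (MeasurableEquiv.measurableEmbedding _) (fun x : ℝ => Real.exp (-(x * u))) _).trans ?_
    -- The two possible bases exchange the half-lines; the integral is the same.
    rcases Int.isUnit_iff.mp hunit with rfl | rfl
    · have : {x : ℝ | 0 ≤ x * ((1 : ℤ) : ℝ)} = Set.Ici 0 := by ext; simp
      rw [this, MeasureTheory.integral_Ici_eq_integral_Ioi]
      simpa using integral_exp_neg_Ioi_zero
    · have : {x : ℝ | 0 ≤ x * ((-1 : ℤ) : ℝ)} = Set.Iic 0 := by ext; simp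
      rw [this]
      simpa using integral_exp_Iic_zero
  unfold gammaInvariant
  rw [dif_pos hb]
  exact key _ _

end Canonical

/-! ### Base change to the algebraic closure -/

/-- The coordinate ring over the algebraic closure is again a polynomial ring. -/
def geom : PolyIso (geomPieces 𝒜) where
  equiv := (Algebra.TensorProduct.congr (AlgEquiv.refl : AlgebraicClosure k ≃ₐ[AlgebraicClosure k] _)
    P.equiv).trans (MvPolynomial.algebraTensorAlgEquiv k (AlgebraicClosure k))
  mem_iff := by
    intro n x
    set E := (Algebra.TensorProduct.congr
      (AlgEquiv.refl : AlgebraicClosure k ≃ₐ[AlgebraicClosure k] _)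
      P.equiv).trans (MvPolynomial.algebraTensorAlgEquiv k (AlgebraicClosure k)) with hE
    have hEt : ∀ (c : AlgebraicClosure k) (z : A),
        E (c ⊗ₜ z) = c • MvPolynomial.map (algebraMap k (AlgebraicClosure k)) (P.equiv z) := by
      intro c z
      change MvPolynomial.algebraTensorAlgEquiv k (AlgebraicClosure k) (c ⊗ₜ[k] P.equiv z) = _
      rw [MvPolynomial.algebraTensorAlgEquiv_tmul]
    constructor
    · intro hx
      unfold geomPieces at hx
      rw [Submodule.baseChange_eq_span] at hx
      rw [← MvPolynomial.mem_homogeneousSubmodule]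
      induction hx using Submodule.span_induction with
      | mem y hy =>
        obtain ⟨z, hz, rfl⟩ := hy
        rw [MvPolynomial.mem_homogeneousSubmodule]
        change (E (1 ⊗ₜ z)).IsHomogeneous n
        rw [hEt, one_smul]
        exact ((P.mem_iff n z).mp hz).map _
      | zero => rw [map_zero]; exact Submodule.zero_mem _
      | add y z _ _ h1 h2 => rw [map_add]; exact Submodule.add_mem _ h1 h2
      | smul c y _ h => rw [map_smul]; exact Submodule.smul_mem _ c h
    · intro hx
      -- Expansion of `x` over the images of the monomials; homogeneity of `E x` leaves only those
      -- of degree `n`, each coming from the base field.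
      have h1 : x = ∑ m ∈ (E x).support, MvPolynomial.coeff m (E x) •
          ((1 : AlgebraicClosure k) ⊗ₜ[k] P.equiv.symm (MvPolynomial.monomial m 1)) := by
        apply E.injective
        rw [map_sum]
        conv_lhs => rw [(E x).as_sum]
        refine Finset.sum_congr rfl fun m _ => ?_
        rw [map_smul, hEt, AlgEquiv.apply_symm_apply, MvPolynomial.map_monomial, map_one, one_smul,
          MvPolynomial.smul_monomial, smul_eq_mul, mul_one]
      rw [h1]
      refine Submodule.sum_mem _ fun m hm => Submodule.smul_mem _ _ ?_
      refine Submodule.tmul_mem_baseChange_of_mem _ ?_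
      rw [P.mem_iff, AlgEquiv.apply_symm_apply]
      refine MvPolynomial.isHomogeneous_monomial _ ?_
      by_contra hne
      exact (MvPolynomial.mem_support_iff.mp hm) (hx.coeff_eq_zero hne)

/-- A graded automorphism carries a homogeneous generator of a prime divisor to a homogeneous
generator of its image, of the same degree. -/
theorem degDiv_mapDiv (e : A ≃+* A) (he : IsGraded 𝒜 e) (D : WeilDiv 𝒜) :
    P.degDiv (mapDiv e he D) = P.degDiv D := by
  have := P.isDomain
  induction D using Finsupp.induction_linear with
  | zero => simp
  | add D E hD hE => rw [map_add, map_add, map_add, hD, hE]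
  | single p n =>
    have h1 : mapDiv e he (Finsupp.single p n) = Finsupp.single (p.map e he) n := by
      simp [mapDiv, Finsupp.mapDomain_single]
    rw [h1, P.degDiv_single, P.degDiv_single]
    have h2 : (p.map e he).ideal = Ideal.span {e (P.gen p)} := by
      change p.ideal.comap e.symm = _
      rw [P.ideal_eq p]
      ext x
      rw [Ideal.mem_comap, Ideal.mem_span_singleton, Ideal.mem_span_singleton]
      constructor
      · intro h
        simpa using map_dvd e h
      · intro h
        simpa using map_dvd e.symm h
    have hass : Associated (P.gen (p.map e he)) (e (P.gen p)) :=
      Ideal.span_singleton_eq_span_singleton.mp ((P.ideal_eq _).symm.trans h2)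
    obtain ⟨u, hu⟩ := hass
    have h3 := P.deg_mul (P.gen_prime (p.map e he)).ne_zero u.ne_zero
    rw [hu, P.deg_eq (he.map_mem _ _ (P.gen_mem p)) (by
      simpa using (P.gen_prime p).ne_zero), P.deg_eq_zero_of_isUnit u.isUnit] at h3
    rw [h3, add_zero]

variable {d : ℕ} (hface : adjointFace 𝒜 d = ∅)
include hface

omit P in
theorem geomAdjointFace_eq : geomAdjointFace 𝒜 d = ∅ := by
  rw [Set.eq_empty_iff_forall_notMem]
  rintro p ⟨q, hq, -⟩
  rw [hface] at hq
  exact hq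

include P in
theorem finrank_geomPic : Module.finrank ℤ (GeomPic 𝒜 d) = 1 :=
  PolyIso.finrank_relPic P.geom (geomAdjointFace_eq hface)

include P in
-- The degree determines a geometric class and is unchanged by the Galois action.
theorem galPic_eq (σ : AbsGal k) (c : GeomPic 𝒜 d) : galPic 𝒜 d σ c = c := by
  obtain ⟨D, rfl⟩ := QuotientAddGroup.mk_surjective (s := relSubgroup (geomPieces 𝒜)
    (geomAdjointFace 𝒜 d)) c
  apply (P.geom.relPicEquivOfEmpty (geomAdjointFace_eq hface)).injective
  change P.geom.relPicEquivOfEmpty (geomAdjointFace_eq hface) (QuotientAddGroup.mk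
    (mapDiv (galRingEquiv A σ) (galRingEquiv_isGraded 𝒜 σ) D)) = _
  rw [relPicEquivOfEmpty_mk, degDiv_mapDiv]
  exact (relPicEquivOfEmpty_mk _ _ _).symm

include P in
-- For the trivial action a cocycle is a homomorphism. It is locally constant on a compact group, so
-- its image is a finite subgroup of `ℤ` and vanishes.
theorem deltaInvariant_eq [CharZero k] : deltaInvariant 𝒜 d = 1 := by
  have hle : oneCocycles 𝒜 d ≤ oneCoboundaries 𝒜 d := by
    rintro c ⟨hc, hmul⟩
    have hfin : (Set.range c).Finite := hc.range_finite
    have hadd : ∀ σ τ, c (σ * τ) = c σ + c τ := fun σ τ => by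
      rw [hmul, P.galPic_eq hface]
    have hone : c 1 = 0 := by
      have := hadd 1 1
      rw [mul_one] at this
      exact left_eq_add.mp this
    have hpow : ∀ σ (n : ℕ), c (σ ^ n) = n • c σ := by
      intro σ n
      induction n with
      | zero => rw [pow_zero, hone, zero_smul]
      | succ n ih => rw [pow_succ, hadd, ih, succ_nsmul]
    let φ : GeomPic 𝒜 d ≃ₗ[ℤ] ℤ := P.geom.relPicEquivOfEmpty (geomAdjointFace_eq hface)
    have hzero : ∀ σ, c σ = 0 := by
      intro σ
      by_contra hne
      -- A non-zero value at `σ` would give infinitely many values at the powers of `σ`.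
      have hinj : Function.Injective fun n : ℕ => c (σ ^ n) := by
        intro m n h
        simp only [hpow] at h
        have h2 := congrArg φ h
        rw [map_nsmul, map_nsmul, nsmul_eq_mul, nsmul_eq_mul] at h2
        have h3 : φ (c σ) ≠ 0 := by simpa using hne
        exact_mod_cast mul_right_cancel₀ h3 h2
      exact Set.infinite_range_of_injective hinj
        (hfin.subset (by rintro _ ⟨n, rfl⟩; exact ⟨_, rfl⟩))
    refine ⟨0, fun σ => ?_⟩
    rw [hzero, map_zero, sub_zero]
  have htop : (oneCoboundaries 𝒜 d).addSubgroupOf (oneCocycles 𝒜 d) = ⊤ := by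
    rw [AddSubgroup.addSubgroupOf_eq_top]
    exact hle
  unfold deltaInvariant
  rw [htop]
  have := QuotientAddGroup.subsingleton_quotient_top (G := oneCocycles 𝒜 d)
  exact Nat.card_unique

end PolyIso

end PolarizedProj

/-- Expansion of an alternating form in two variables. -/
theorem AlternatingMap.map_pair_combination {R M N : Type*} [CommRing R] [AddCommGroup M] [Module R M]
    [AddCommGroup N] [Module R N] (f : M [⋀^Fin 2]→ₗ[R] N) (a b c d : R) (u v : M) :
    f ![a • u + b • v, c • u + d • v] = (a * d - b * c) • f ![u, v] := by
  have hswap : ∀ x y, f ![x, y] = -f ![y, x] := by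
    intro x y
    have := f.map_swap ![y, x] (i := 0) (j := 1) (by decide)
    rw [← this]
    congr 1
    ext i
    fin_cases i <;> simp
  have hzero : ∀ x, f ![x, x] = 0 := fun x =>
    f.map_eq_zero_of_eq ![x, x] (i := 0) (j := 1) (by simp) (by decide)
  have hadd : ∀ x y z, f ![x + y, z] = f ![x, z] + f ![y, z] := fun x y z => by
    have := f.map_vecCons_add ![z] x y
    exact this
  have hsmul : ∀ (r : R) x z, f ![r • x, z] = r • f ![x, z] := fun r x z =>
    f.map_vecCons_smul ![z] r x
  have hadd' : ∀ x y z, f ![z, x + y] = f ![z, x] + f ![z, y] := fun x y z => by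
    rw [hswap z, hadd, hswap x, hswap y]; abel
  have hsmul' : ∀ (r : R) x z, f ![z, r • x] = r • f ![z, x] := fun r x z => by
    rw [hswap, hsmul, hswap x, smul_neg, neg_neg]
  simp only [hadd, hadd', hsmul, hsmul', hzero]
  rw [hswap v u]
  module

/-! ### Two-forms on the function field and the canonical divisor -/

namespace PolarizedProj

section Forms

variable {k K : Type} [CommRing K] [Field k] [Algebra k K]

/-- The two-form `da ∧ db`. -/
def wedge (k : Type) {K : Type} [CommRing K] [Field k] [Algebra k K] (a b : K) : ⋀[K]^2 Ω[K⁄k] :=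
  exteriorPower.ιMulti K 2 ![KaehlerDifferential.D k K a, KaehlerDifferential.D k K b]

theorem wedge_swap (a b : K) : wedge k b a = -wedge k a b := by
  have := (exteriorPower.ιMulti K 2 (M := Ω[K⁄k])).map_pair_combination
    0 1 1 0 (KaehlerDifferential.D k K a) (KaehlerDifferential.D k K b)
  simp only [zero_smul, one_smul, zero_add, add_zero, mul_zero, mul_one, zero_sub, neg_smul] at this
  exact this

/-- The change of chart on the projective plane. The cube of `s` is the reason why the canonical
class has degree `-3`. -/
theorem wedge_change {s t : K} (w : K) (h : s * t = 1) :
    wedge k s (s * w) = (-(s ^ 3)) • wedge k t w := by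
  set D := KaehlerDifferential.D k K
  have h1 : D s = (-(s ^ 2)) • D t + (0 : K) • D w := by
    have h := congrArg D h
    rw [Derivation.leibniz, Derivation.map_one_eq_zero] at h
    have h2 : s • (s • D t + t • D s) = 0 := by rw [h, smul_zero]
    rw [smul_add, smul_smul, smul_smul, ‹s * t = 1›, one_smul] at h2
    rw [zero_smul, add_zero, neg_smul, pow_two]
    exact eq_neg_of_add_eq_zero_right h2
  have h2 : D (s * w) = (-(s ^ 2 * w)) • D t + s • D w := by
    rw [Derivation.leibniz, h1]
    module
  unfold wedge
  rw [h1, h2, AlternatingMap.map_pair_combination]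
  congr 1
  ring

/-- The differential of a polynomial in the affine coordinates is a combination of the two
non-constant ones, since the coordinate `u i = 1` has differential zero. -/
theorem D_aeval_mem (u : Fin 3 → K) (i j l : Fin 3) (hi : u i = 1)
    (hcov : ∀ a, a = i ∨ a = j ∨ a = l) (O : Subalgebra k K)
    (hu : ∀ a, u a ∈ O) (φ : MvPolynomial (Fin 3) k) :
    MvPolynomial.aeval u φ ∈ O ∧ KaehlerDifferential.D k K (MvPolynomial.aeval u φ) ∈
      Submodule.span O {KaehlerDifferential.D k K (u j), KaehlerDifferential.D k K (u l)} := by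
  induction φ using MvPolynomial.induction_on with
  | C a =>
    rw [MvPolynomial.aeval_C, Derivation.map_algebraMap]
    exact ⟨O.algebraMap_mem a, Submodule.zero_mem _⟩
  | add p q hp hq =>
    rw [map_add, map_add]
    exact ⟨O.add_mem hp.1 hq.1, Submodule.add_mem _ hp.2 hq.2⟩
  | mul_X p a hp =>
    rw [map_mul, MvPolynomial.aeval_X, Derivation.leibniz]
    refine ⟨O.mul_mem hp.1 (hu a), Submodule.add_mem _ ?_ ?_⟩
    · refine Submodule.smul_mem _ (⟨_, hp.1⟩ : O) ?_
      rcases hcov a with rfl | rfl | rfl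
      · rw [hi, Derivation.map_one_eq_zero]
        exact Submodule.zero_mem _
      · exact Submodule.subset_span (by simp)
      · exact Submodule.subset_span (by simp)
    · exact Submodule.smul_mem _ (⟨_, hu a⟩ : O) hp.2

/-- The quotient rule; `y` is the inverse of the denominator, assumed to lie in `O`. -/
theorem D_fraction_mem (u : Fin 3 → K) (i j l : Fin 3) (hi : u i = 1)
    (hcov : ∀ a, a = i ∨ a = j ∨ a = l) (O : Subalgebra k K)
    (hu : ∀ a, u a ∈ O) (φ ψ : MvPolynomial (Fin 3) k) {x y : K} (hxO : x ∈ O) (hyO : y ∈ O)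
    (h3 : x * MvPolynomial.aeval u ψ = MvPolynomial.aeval u φ)
    (h4 : y * MvPolynomial.aeval u ψ = 1) :
    KaehlerDifferential.D k K x ∈
      Submodule.span O {KaehlerDifferential.D k K (u j), KaehlerDifferential.D k K (u l)} := by
  have h1 := D_aeval_mem u i j l hi hcov O hu φ
  have h2 := D_aeval_mem u i j l hi hcov O hu ψ
  have h5 : KaehlerDifferential.D k K x = y • (KaehlerDifferential.D k K (MvPolynomial.aeval u φ) -
      x • KaehlerDifferential.D k K (MvPolynomial.aeval u ψ)) := by
    rw [← h3, Derivation.leibniz, add_sub_cancel_left, smul_smul, h4, one_smul]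
  rw [h5]
  have h6 : x • KaehlerDifferential.D k K (MvPolynomial.aeval u ψ) ∈ Submodule.span O
      {KaehlerDifferential.D k K (u j), KaehlerDifferential.D k K (u l)} :=
    Submodule.smul_mem _ (⟨x, hxO⟩ : O) h2.2
  exact Submodule.smul_mem _ (⟨y, hyO⟩ : O) (Submodule.sub_mem _ h1.2 h6)

theorem regularForms_two (O : Subalgebra k K) {a b : K} (ha : a ∈ O) (hb : b ∈ O)
    (h : ∀ x ∈ O, KaehlerDifferential.D k K x ∈
      Submodule.span O {KaehlerDifferential.D k K a, KaehlerDifferential.D k K b}) :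
    regularForms O 2 = Submodule.span O {wedge k a b} := by
  unfold regularForms
  apply le_antisymm
  · rw [Submodule.span_le]
    rintro ω ⟨x, hx, rfl⟩
    obtain ⟨c, d, hcd⟩ := Submodule.mem_span_pair.mp (h _ (hx 0))
    obtain ⟨c', d', hcd'⟩ := Submodule.mem_span_pair.mp (h _ (hx 1))
    have h : (fun i => KaehlerDifferential.D k K (x i)) =
        ![(c : K) • KaehlerDifferential.D k K a + (d : K) • KaehlerDifferential.D k K b,
        (c' : K) • KaehlerDifferential.D k K a + (d' : K) • KaehlerDifferential.D k K b] := by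
      ext i
      fin_cases i
      · exact hcd.symm
      · exact hcd'.symm
    rw [h, AlternatingMap.map_pair_combination]
    exact Submodule.mem_span_singleton.mpr ⟨c * d' - d * c', rfl⟩
  · rw [Submodule.span_singleton_le_iff_mem]
    refine Submodule.subset_span ⟨![a, b], ?_, ?_⟩
    · intro i
      fin_cases i
      exacts [ha, hb]
    · unfold wedge
      congr 1
      ext i
      fin_cases i <;> rfl

/-- The two-form `r da ∧ db`. -/
def form (k : Type) {K : Type} [CommRing K] [Field k] [Algebra k K] (r a b : K) : ⋀[K]^2 Ω[K⁄k] :=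
  r • wedge k a b

theorem form_swap (r a b : K) : form k r b a = form k (-r) a b := by
  unfold form
  rw [wedge_swap]
  exact (smul_neg r _).trans (neg_smul r _).symm

theorem form_change {s t : K} (r w : K) (h : s * t = 1) :
    form k r s (s * w) = form k (-(r * s ^ 3)) t w := by
  unfold form
  rw [wedge_change w h, smul_smul, mul_neg]

theorem isMulGenerator_form (O : Subalgebra k K) {a b h c c' : K} (hc : c ∈ O) (hc' : c' ∈ O)
    (hcc : c * c' = 1) (hreg : regularForms O 2 = Submodule.span O {wedge k a b}) :
    IsMulGenerator O 2 (form k (h * c) a b) h := by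
  unfold IsMulGenerator
  rw [hreg]
  ext ω
  simp only [SetLike.mem_coe, Submodule.mem_span_singleton, Set.mem_image]
  constructor
  · rintro ⟨o, rfl⟩
    refine ⟨(o * ⟨c, hc⟩ : O) • wedge k a b, ⟨_, rfl⟩, ?_⟩
    change h • ((o : K) * c) • wedge k a b = (o : K) • (h * c) • wedge k a b
    rw [smul_smul, smul_smul]
    congr 1
    ring
  · rintro ⟨_, ⟨o, rfl⟩, rfl⟩
    refine ⟨o * ⟨c', hc'⟩, ?_⟩
    change ((o : K) * c') • (h * c) • wedge k a b = h • (o : K) • wedge k a b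
    rw [smul_smul, smul_smul]
    congr 1
    linear_combination (o : K) * h * hcc

/-- Two generators of the same cyclic module differ by a unit of `O`. Torsion freeness of `da ∧ db`
allows the coefficients to be compared. -/
theorem exists_unit_of_isMulGenerator [IsDomain K] (O : Subalgebra k K) {a b h r : K} (hr : r ≠ 0)
    (hreg : regularForms O 2 = Submodule.span O {wedge k a b})
    (htf : ∀ r, form k r a b = 0 → r = 0) (hgen : IsMulGenerator O 2 (form k r a b) h) :
    ∃ c ∈ O, ∃ c' ∈ O, c * c' = 1 ∧ r = c * h := by
  unfold IsMulGenerator at hgen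
  rw [hreg] at hgen
  have hinj : ∀ x y, form k x a b = form k y a b → x = y := fun x y hxy => by
    have : form k (x - y) a b = 0 := by
      unfold form at *
      exact (sub_smul x y (wedge k a b)).trans (by rw [hxy, sub_self])
    exact sub_eq_zero.mp (htf _ this)
  have h1 : form k r a b ∈ (fun η => h • η) '' (Submodule.span O {wedge k a b} : Set _) := by
    rw [← hgen]
    exact Submodule.mem_span_singleton_self _
  obtain ⟨_, hη, h1⟩ := h1
  obtain ⟨o, rfl⟩ := Submodule.mem_span_singleton.mp hη
  have h2 : form k h a b ∈ (Submodule.span O {form k r a b} : Set (⋀[K]^2 Ω[K⁄k])) := by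
    rw [hgen]
    exact ⟨_, Submodule.mem_span_singleton_self _, rfl⟩
  obtain ⟨o', h2⟩ := Submodule.mem_span_singleton.mp h2
  have e1 : h * o = r := hinj _ _ (by
    rw [← h1]
    change (h * (o : K)) • wedge k a b = h • (o : K) • wedge k a b
    rw [smul_smul])
  have e2 : o' * r = h := hinj _ _ (by
    rw [← h2]
    change ((o' : K) * r) • wedge k a b = (o' : K) • r • wedge k a b
    rw [smul_smul])
  refine ⟨o, o.2, o', o'.2, ?_, by rw [← e1]; ring⟩
  apply mul_left_cancel₀ hr
  linear_combination (o : K) * e2 + e1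

theorem mem_span_wedge {a b : K} (h : ∀ x : K, KaehlerDifferential.D k K x ∈
      Submodule.span K {KaehlerDifferential.D k K a, KaehlerDifferential.D k K b})
    (ω : ⋀[K]^2 Ω[K⁄k]) : ∃ r : K, ω = form k r a b := by
  unfold form
  have htop : Submodule.span K {KaehlerDifferential.D k K a, KaehlerDifferential.D k K b} = ⊤ := by
    rw [eq_top_iff, ← KaehlerDifferential.span_range_derivation, Submodule.span_le]
    rintro _ ⟨x, rfl⟩
    exact h x
  have hω : ω ∈ Submodule.span K (Set.range (exteriorPower.ιMulti K 2 (M := Ω[K⁄k]))) := by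
    rw [exteriorPower.ιMulti_span]
    trivial
  induction hω using Submodule.span_induction with
  | mem x hx =>
    obtain ⟨v, rfl⟩ := hx
    have hv : ∀ i, v i ∈ Submodule.span K
        {KaehlerDifferential.D k K a, KaehlerDifferential.D k K b} := fun i => by
      rw [htop]; trivial
    obtain ⟨c, d, hcd⟩ := Submodule.mem_span_pair.mp (hv 0)
    obtain ⟨c', d', hcd'⟩ := Submodule.mem_span_pair.mp (hv 1)
    have h : v = ![c • KaehlerDifferential.D k K a + d • KaehlerDifferential.D k K b,
        c' • KaehlerDifferential.D k K a + d' • KaehlerDifferential.D k K b] := by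
      ext i
      fin_cases i
      · exact hcd.symm
      · exact hcd'.symm
    rw [h, AlternatingMap.map_pair_combination]
    exact ⟨_, rfl⟩
  | zero => exact ⟨0, by rw [zero_smul]⟩
  | add x y _ _ hx hy =>
    obtain ⟨r, rfl⟩ := hx
    obtain ⟨s, rfl⟩ := hy
    exact ⟨r + s, by rw [add_smul]⟩
  | smul c x _ hx =>
    obtain ⟨r, rfl⟩ := hx
    exact ⟨c * r, by rw [mul_smul]⟩

/-- If two derivations into a field separate `a` and `b`, the form `da ∧ db` is torsion free. -/
theorem smul_wedge_eq_zero {F : Type} [Field F] [Algebra K F] [Algebra k F] [IsScalarTower k K F]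
    (hinj : Function.Injective (algebraMap K F)) (D₁ D₂ : Derivation k K F) {a b : K}
    (hdet : D₁ a * D₂ b - D₁ b * D₂ a ≠ 0) {r : K} (hr : form k r a b = 0) : r = 0 := by
  unfold form at hr
  -- The determinant formed from the two derivations is an alternating form on the differentials, so
  -- it factors through the exterior square; its value at `da ∧ db` is the given non-zero
  -- determinant.
  let φ : Ω[K⁄k] →ₗ[K] (Fin 2 → F) :=
    LinearMap.pi ![D₁.liftKaehlerDifferential, D₂.liftKaehlerDifferential]
  let M : MultilinearMap K (fun _ : Fin 2 => Ω[K⁄k]) F :=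
    ((Matrix.detRowAlternating (n := Fin 2) (R := F)).toMultilinearMap.restrictScalars K).compLinearMap
      fun _ => φ
  let G : Ω[K⁄k] [⋀^Fin 2]→ₗ[K] F :=
    { M with
      map_eq_zero_of_eq' := fun v i j hij hne => by
        change Matrix.detRowAlternating (fun a => φ (v a)) = 0
        exact (Matrix.detRowAlternating (n := Fin 2) (R := F)).map_eq_zero_of_eq _
          (congrArg φ hij) hne }
  have h1 := congrArg (exteriorPower.alternatingMapLinearEquiv G) hr
  rw [map_zero, map_smul, wedge, exteriorPower.alternatingMapLinearEquiv_apply_ιMulti] at h1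
  have h2 : G ![KaehlerDifferential.D k K a, KaehlerDifferential.D k K b] =
      D₁ a * D₂ b - D₁ b * D₂ a := by
    refine (Matrix.det_fin_two (Matrix.of fun i =>
      φ (![KaehlerDifferential.D k K a, KaehlerDifferential.D k K b] i))).trans ?_
    simp [φ]
    ring
  rw [h2, Algebra.smul_def, mul_eq_zero] at h1
  rcases h1 with h1 | h1
  · exact hinj (by rw [h1, map_zero])
  · exact absurd h1 hdet

/-- A derivation of a domain extends to its field of fractions. -/
theorem exists_derivation_extension {A F : Type} [CommRing A] [IsDomain A] [Algebra k A] [Field F] [Algebra A F]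
    [IsFractionRing A F] [Algebra k F] [IsScalarTower k A F] (D : Derivation k A F) :
    ∃ D' : Derivation k F F, ∀ a, D' (algebraMap A F a) = D a := by
  have hloc := KaehlerDifferential.isLocalizedModule_map k A F A⁰
  have hu : ∀ x : A⁰, IsUnit ((algebraMap A (Module.End A F)) (x : A)) := by
    intro x
    rw [Module.End.isUnit_iff]
    have hx : algebraMap A F x ≠ 0 :=
      IsLocalization.to_map_ne_zero_of_mem_nonZeroDivisors F le_rfl x.2
    constructor
    · intro y z h
      change (x : A) • y = (x : A) • z at h
      rw [Algebra.smul_def, Algebra.smul_def] at h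
      exact mul_left_cancel₀ hx h
    · intro y
      refine ⟨(algebraMap A F x)⁻¹ * y, ?_⟩
      rw [Module.algebraMap_end_apply, Algebra.smul_def, mul_inv_cancel_left₀ hx]
  -- The differentials of `F` are a localisation of those of `A`, and non-zero elements of `A` act
  -- invertibly on `F`.
  let ℓ : Ω[F⁄k] →ₗ[A] F := IsLocalizedModule.lift A⁰ (KaehlerDifferential.map k k A F)
    D.liftKaehlerDifferential hu
  let ℓ' : Ω[F⁄k] →ₗ[F] F := LinearMap.extendScalarsOfIsLocalization A⁰ F ℓ
  refine ⟨ℓ'.compDer (KaehlerDifferential.D k F), fun a => ?_⟩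
  change ℓ (KaehlerDifferential.D k F (algebraMap A F a)) = _
  have h := IsLocalizedModule.lift_apply A⁰ (KaehlerDifferential.map k k A F)
    D.liftKaehlerDifferential hu (KaehlerDifferential.D k A a)
  rw [KaehlerDifferential.map_D, Derivation.liftKaehlerDifferential_comp_D] at h
  exact h

end Forms

variable {k A : Type} [Field k] [CommRing A] [Algebra k A] {𝒜 : ℕ → Submodule k A}

/-- The function `x` is the fraction `f / g`. -/
def IsFrac (x : functionField 𝒜) (f g : A) : Prop :=
  (x : FractionRing A) * algebraMap A (FractionRing A) g = algebraMap A (FractionRing A) f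

theorem IsFrac.mul {x y : functionField 𝒜} {f g f' g' : A} (h : IsFrac x f g) (h' : IsFrac y f' g') :
    IsFrac (x * y) (f * f') (g * g') := by
  unfold IsFrac at *
  rw [map_mul, map_mul, ← h, ← h']
  push_cast
  ring

theorem IsFrac.pow {x : functionField 𝒜} {f g : A} (h : IsFrac x f g) (n : ℕ) :
    IsFrac (x ^ n) (f ^ n) (g ^ n) := by
  unfold IsFrac at *
  rw [map_pow, map_pow, ← h]
  push_cast
  ring

theorem IsFrac.neg {x : functionField 𝒜} {f g : A} (h : IsFrac x f g) :
    IsFrac (-x) (-f) g := by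
  unfold IsFrac at *
  rw [map_neg, ← h]
  push_cast
  ring

theorem IsFrac.one {f : A} : IsFrac (1 : functionField 𝒜) f f := by
  unfold IsFrac
  simp

namespace PolyIso

variable (P : PolyIso 𝒜)
include P

theorem isDomain_functionField : IsDomain (functionField 𝒜) := by
  have := P.isDomain
  infer_instance

theorem algebraMap_ne_zero {f : A} (hf : f ≠ 0) : algebraMap A (FractionRing A) f ≠ 0 := by
  have := P.isDomain
  rwa [Ne, IsFractionRing.to_map_eq_zero_iff]

theorem frac_cross {x : functionField 𝒜} {f g f' g' : A} (h : IsFrac x f g) (h' : IsFrac x f' g') :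
    f * g' = f' * g := by
  have := P.isDomain
  apply IsFractionRing.injective A (FractionRing A)
  unfold IsFrac at *
  rw [map_mul, map_mul, ← h, ← h']
  ring

theorem frac_eq {x y : functionField 𝒜} {f g f' g' : A} (h : IsFrac x f g) (h' : IsFrac y f' g')
    (hg : g ≠ 0) (hg' : g' ≠ 0) (he : f * g' = f' * g) : x = y := by
  have := P.isDomain
  apply Subtype.ext
  apply mul_right_cancel₀ (P.algebraMap_ne_zero (mul_ne_zero hg hg'))
  unfold IsFrac at *
  have he' := congrArg (algebraMap A (FractionRing A)) he
  rw [map_mul, map_mul, ← h, ← h'] at he'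
  rw [map_mul]
  linear_combination he'

theorem exists_frac {n : ℕ} {f g : A} (hf : f ∈ 𝒜 n) (hg : g ∈ 𝒜 n) (hg0 : g ≠ 0) :
    ∃ x : functionField 𝒜, IsFrac x f g := by
  have := P.isDomain
  have hm : g ∈ A⁰ := mem_nonZeroDivisors_of_ne_zero hg0
  have hs : IsLocalization.mk' (FractionRing A) f ⟨g, hm⟩ * algebraMap A (FractionRing A) g =
    algebraMap A (FractionRing A) f := IsLocalization.mk'_spec _ f ⟨g, hm⟩
  exact ⟨⟨_, Algebra.subset_adjoin ⟨f, g, hm, ⟨n, hf, hg⟩, hs⟩⟩, hs⟩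

theorem algebraMap_mem (r : k) : algebraMap k A r ∈ 𝒜 0 := by
  rw [P.mem_iff, AlgEquiv.commutes]
  exact MvPolynomial.isHomogeneous_C _ _

/-- Homogeneous fractions of degree zero already form a ring, so passing to the generated subalgebra
adds nothing. The same holds for the local rings below. -/
theorem mem_functionField (x : functionField 𝒜) :
    ∃ f g n, f ∈ 𝒜 n ∧ g ∈ 𝒜 n ∧ g ≠ 0 ∧ IsFrac x f g := by
  have := P.isDomain
  obtain ⟨x, hx⟩ := x
  have hx' := hx
  unfold functionField at hx'
  induction hx' using Algebra.adjoin_induction with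
  | mem x h =>
    obtain ⟨f, g, hg, ⟨n, hf, hg'⟩, h⟩ := h
    exact ⟨f, g, n, hf, hg', nonZeroDivisors.ne_zero hg, h⟩
  | algebraMap r =>
    refine ⟨algebraMap k A r, 1, 0, P.algebraMap_mem r, P.one_mem, one_ne_zero, ?_⟩
    unfold IsFrac
    rw [map_one, mul_one]
    rfl
  | add x y hx1 hy1 ihx ihy =>
    obtain ⟨f, g, n, hf, hg, hg0, h⟩ := ihx hx1
    obtain ⟨f', g', n', hf', hg', hg0', h'⟩ := ihy hy1
    refine ⟨f * g' + f' * g, g * g', n + n', Submodule.add_mem _ (P.mul_mem hf hg') ?_,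
      P.mul_mem hg hg', mul_ne_zero hg0 hg0', ?_⟩
    · rw [add_comm n]
      exact P.mul_mem hf' hg
    · unfold IsFrac at *
      simp only [map_mul, map_add, ← h, ← h']
      ring
  | mul x y hx1 hy1 ihx ihy =>
    obtain ⟨f, g, n, hf, hg, hg0, h⟩ := ihx hx1
    obtain ⟨f', g', n', hf', hg', hg0', h'⟩ := ihy hy1
    exact ⟨_, _, _, P.mul_mem hf hf', P.mul_mem hg hg', mul_ne_zero hg0 hg0', h.mul h'⟩

theorem mem_localRing (p : PrimeDivisor 𝒜) (x : functionField 𝒜) :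
    x ∈ localRing 𝒜 p.ideal ↔ ∃ f g n, f ∈ 𝒜 n ∧ g ∈ 𝒜 n ∧ g ∉ p.ideal ∧ IsFrac x f g := by
  have := P.isDomain
  have hp := p.isPrime
  constructor
  · intro hx
    unfold localRing at hx
    induction hx using Algebra.adjoin_induction with
    | mem x h =>
      obtain ⟨f, g, hg, hgp, ⟨n, hf, hg'⟩, h⟩ := h
      exact ⟨f, g, n, hf, hg', hgp, h⟩
    | algebraMap r =>
      refine ⟨algebraMap k A r, 1, 0, P.algebraMap_mem r, P.one_mem,
        fun h => hp.ne_top ((Ideal.eq_top_iff_one _).mpr h), ?_⟩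
      unfold IsFrac
      rw [map_one, mul_one]
      rfl
    | add x y hx hy ihx ihy =>
      obtain ⟨f, g, n, hf, hg, hg0, h⟩ := ihx
      obtain ⟨f', g', n', hf', hg', hg0', h'⟩ := ihy
      refine ⟨f * g' + f' * g, g * g', n + n', Submodule.add_mem _ (P.mul_mem hf hg') ?_,
        P.mul_mem hg hg', fun hh => (hp.mem_or_mem hh).elim hg0 hg0', ?_⟩
      · rw [add_comm n]
        exact P.mul_mem hf' hg
      · unfold IsFrac at *
        simp only [map_mul, map_add, ← h, ← h']
        push_cast
        ring
    | mul x y hx hy ihx ihy =>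
      obtain ⟨f, g, n, hf, hg, hg0, h⟩ := ihx
      obtain ⟨f', g', n', hf', hg', hg0', h'⟩ := ihy
      exact ⟨_, _, _, P.mul_mem hf hf', P.mul_mem hg hg',
        fun hh => (hp.mem_or_mem hh).elim hg0 hg0', h.mul h'⟩
  · rintro ⟨f, g, n, hf, hg, hgp, h⟩
    refine Algebra.subset_adjoin ⟨f, g, mem_nonZeroDivisors_of_ne_zero ?_, hgp, ⟨n, hf, hg⟩, h⟩
    rintro rfl
    exact hgp (Ideal.zero_mem _)

/-- The function `X j / X i`. -/
def u (i j : Fin 3) : functionField 𝒜 := (P.exists_frac (P.X_mem j) (P.X_mem i) (P.X_ne_zero i)).choose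

theorem u_frac (i j : Fin 3) : IsFrac (P.u i j) (P.X j) (P.X i) :=
  (P.exists_frac (P.X_mem j) (P.X_mem i) (P.X_ne_zero i)).choose_spec

theorem u_mul (i j l : Fin 3) : P.u i j * P.u j l = P.u i l := by
  have := P.isDomain
  refine P.frac_eq ((P.u_frac i j).mul (P.u_frac j l)) (P.u_frac i l)
    (mul_ne_zero (P.X_ne_zero _) (P.X_ne_zero _)) (P.X_ne_zero _) ?_
  ring

theorem u_self (i : Fin 3) : P.u i i = 1 :=
  P.frac_eq (P.u_frac i i) (IsFrac.one (f := 1)) (P.X_ne_zero i) (by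
    have := P.isDomain
    exact one_ne_zero) (by ring)

theorem exists_X_notMem (p : PrimeDivisor 𝒜) : ∃ i, P.X i ∉ p.ideal := by
  have hp := p.isPrime
  by_contra! h
  have := P.isDomain
  have h' : ∀ i, Associated (P.gen p) (P.X i) := fun i => by
    have := h i
    rw [P.ideal_eq p, Ideal.mem_span_singleton] at this
    exact (P.gen_prime p).associated_of_dvd (P.X_prime i) this
  exact P.not_X_dvd_X (i := 0) (j := 1) (by decide) ((h' 0).symm.trans (h' 1)).dvd

/-- Dehomogenisation at `X i`. -/
def dehom (i : Fin 3) (f : A) : functionField 𝒜 := MvPolynomial.aeval (P.u i) (P.equiv f)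

theorem dehom_frac (i : Fin 3) {n : ℕ} {f : A} (hf : f ∈ 𝒜 n) : IsFrac (P.dehom i f) f (P.X i ^ n) := by
  rw [P.mem_iff] at hf
  obtain ⟨φ, rfl⟩ := P.equiv.symm.surjective f
  rw [AlgEquiv.apply_symm_apply] at hf
  unfold IsFrac dehom
  rw [AlgEquiv.apply_symm_apply]
  conv_lhs => rw [φ.as_sum]
  conv_rhs => rw [φ.as_sum]
  rw [map_sum, map_sum, map_sum, AddSubmonoidClass.coe_finsetSum, Finset.sum_mul]
  refine Finset.sum_congr rfl fun m hm => ?_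
  have hdeg : m.degree = n := by
    by_contra hne
    exact (MvPolynomial.mem_support_iff.mp hm) (hf.coeff_eq_zero hne)
  have h1 : P.equiv.symm (MvPolynomial.monomial m (MvPolynomial.coeff m φ)) =
      algebraMap k A (MvPolynomial.coeff m φ) * ∏ j, P.X j ^ m j := by
    rw [MvPolynomial.monomial_eq, map_mul, Finsupp.prod_fintype _ _ (by simp), map_prod]
    congr 1
    · exact P.equiv.symm.commutes _
    · refine Finset.prod_congr rfl fun j _ => ?_
      rw [map_pow, X]
  have h2 : MvPolynomial.aeval (P.u i) (MvPolynomial.monomial m (MvPolynomial.coeff m φ)) =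
      algebraMap k (functionField 𝒜) (MvPolynomial.coeff m φ) * ∏ j, P.u i j ^ m j := by
    rw [MvPolynomial.aeval_monomial, Finsupp.prod_fintype _ _ (by simp)]
  rw [h1, h2, map_mul, map_prod, ← hdeg, Finsupp.degree_eq_sum, ← Finset.prod_pow_eq_pow_sum, map_prod]
  push_cast
  rw [mul_assoc, ← Finset.prod_mul_distrib]
  congr 1
  refine Finset.prod_congr rfl fun j _ => ?_
  rw [← mul_pow, P.u_frac i j]

/-! ### Differentials -/

theorem u_mem_localRing {p : PrimeDivisor 𝒜} {i : Fin 3} (hi : P.X i ∉ p.ideal) (a : Fin 3) :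
    P.u i a ∈ localRing 𝒜 p.ideal :=
  (P.mem_localRing p _).mpr ⟨_, _, 1, P.X_mem a, P.X_mem i, hi, P.u_frac i a⟩

theorem dehom_mul {n : ℕ} {f g : A} (i : Fin 3) (hf : f ∈ 𝒜 n) (hg : g ∈ 𝒜 n) (hg0 : g ≠ 0)
    {x y : functionField 𝒜} (hx : IsFrac x f g) (hy : IsFrac y (P.X i ^ n) g) :
    x * P.dehom i g = P.dehom i f ∧ y * P.dehom i g = 1 := by
  have := P.isDomain
  have hX := pow_ne_zero n (P.X_ne_zero i)
  constructor
  · refine P.frac_eq (hx.mul (P.dehom_frac i hg)) (P.dehom_frac i hf) (mul_ne_zero hg0 hX) hX ?_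
    ring
  · exact P.frac_eq (hy.mul (P.dehom_frac i hg)) (IsFrac.one (f := 1)) (mul_ne_zero hg0 hX)
      one_ne_zero (by ring)

theorem regularForms_eq {p : PrimeDivisor 𝒜} {i j l : Fin 3} (hcov : ∀ a, a = i ∨ a = j ∨ a = l)
    (hi : P.X i ∉ p.ideal) :
    regularForms (k := k) (localRing 𝒜 p.ideal) 2 =
      Submodule.span (localRing 𝒜 p.ideal) {wedge k (P.u i j) (P.u i l)} := by
  refine regularForms_two _ (P.u_mem_localRing hi j) (P.u_mem_localRing hi l) fun x hx => ?_
  obtain ⟨f, g, n, hf, hg, hgp, h⟩ := (P.mem_localRing p x).mp hx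
  have hX : P.X i ^ n ∈ 𝒜 n := by simpa using P.pow_mem (P.X_mem i) n
  have hg0 : g ≠ 0 := by rintro rfl; exact hgp (Ideal.zero_mem _)
  obtain ⟨y, hy⟩ := P.exists_frac hX hg hg0
  obtain ⟨h1, h2⟩ := P.dehom_mul i hf hg hg0 h hy
  exact D_fraction_mem (P.u i) i j l (P.u_self i) hcov _ (P.u_mem_localRing hi) _ _ hx
    ((P.mem_localRing p y).mpr ⟨_, _, n, hX, hg, hgp, hy⟩) h1 h2

theorem exists_smul_wedge (ω : ⋀[functionField 𝒜]^2 Ω[functionField 𝒜⁄k]) :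
    ∃ r : functionField 𝒜, ω = form k r (P.u 0 1) (P.u 0 2) := by
  refine mem_span_wedge (fun x => ?_) ω
  obtain ⟨f, g, n, hf, hg, hg0, h⟩ := P.mem_functionField x
  have hX : P.X 0 ^ n ∈ 𝒜 n := by simpa using P.pow_mem (P.X_mem 0) n
  obtain ⟨y, hy⟩ := P.exists_frac hX hg hg0
  obtain ⟨h1, h2⟩ := P.dehom_mul 0 hf hg hg0 h hy
  have h3 := D_fraction_mem (P.u 0) 0 1 2 (P.u_self 0) (by decide) (⊤ : Subalgebra k _)
    (fun _ => trivial) _ _ (x := x) (y := y) trivial trivial h1 h2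
  obtain ⟨a, b, hab⟩ := Submodule.mem_span_pair.mp h3
  exact Submodule.mem_span_pair.mpr ⟨a, b, hab⟩

/-- The derivation of the function field induced by a partial derivative. -/
theorem exists_derivation (a : Fin 3) : ∃ D : Derivation k (functionField 𝒜) (FractionRing A),
    ∀ i j, D (P.u i j) * algebraMap A _ (P.X i) + (P.u i j : FractionRing A) * (if a = i then 1 else 0) =
      if a = j then 1 else 0 := by
  have := P.isDomain
  let D₀ : Derivation k A (FractionRing A) :=
    { toFun := fun x => algebraMap A (FractionRing A)
        (P.equiv.symm (MvPolynomial.pderiv a (P.equiv x)))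
      map_add' := fun x y => by simp
      map_smul' := fun c x => by
        rw [map_smul, Derivation.map_smul, map_smul, RingHom.id_apply]
        exact map_smul (IsScalarTower.toAlgHom k A (FractionRing A)) c _
      map_one_eq_zero' := by simp
      leibniz' := fun x y => by
        change algebraMap A (FractionRing A) (P.equiv.symm (MvPolynomial.pderiv a (P.equiv (x * y)))) =
          x • algebraMap A (FractionRing A) (P.equiv.symm (MvPolynomial.pderiv a (P.equiv y))) +
          y • algebraMap A (FractionRing A) (P.equiv.symm (MvPolynomial.pderiv a (P.equiv x)))
        rw [map_mul, Derivation.leibniz]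
        simp [Algebra.smul_def] }
  obtain ⟨D', hD'⟩ := exists_derivation_extension D₀
  refine ⟨D'.compAlgebraMap (functionField 𝒜), fun i j => ?_⟩
  have hX : ∀ b, D' (algebraMap A (FractionRing A) (P.X b)) = if a = b then 1 else 0 := by
    intro b
    rw [hD']
    change algebraMap A (FractionRing A) (P.equiv.symm (MvPolynomial.pderiv a (P.equiv (P.X b)))) = _
    rw [X, AlgEquiv.apply_symm_apply, MvPolynomial.pderiv_X]
    by_cases h : a = b <;> simp [h, eq_comm (a := b)]
  -- The Leibniz rule applied to `(X j / X i) * X i = X j`.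
  have h := congrArg D' (P.u_frac i j)
  rw [Derivation.leibniz, hX, hX, smul_eq_mul, smul_eq_mul] at h
  rw [← h]
  change D' (P.u i j : FractionRing A) * _ + _ = _
  ring

/-- The derivations `∂/∂X₁` and `∂/∂X₂` have determinant `X₀⁻²` on the coordinates `X₁/X₀`, `X₂/X₀`.
-/
theorem smul_wedge_u_eq_zero {r : functionField 𝒜} (hr : form k r (P.u 0 1) (P.u 0 2) = 0) :
    r = 0 := by
  have := P.isDomain
  obtain ⟨D₁, h₁⟩ := P.exists_derivation 1
  obtain ⟨D₂, h₂⟩ := P.exists_derivation 2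
  have hX := P.algebraMap_ne_zero (P.X_ne_zero 0)
  refine smul_wedge_eq_zero (F := FractionRing A) Subtype.val_injective D₁ D₂ (fun h => ?_) hr
  have e1 := h₁ 0 1
  have e2 := h₁ 0 2
  have e3 := h₂ 0 1
  have e4 := h₂ 0 2
  simp only [Fin.reduceEq, if_true, if_false, mul_zero, add_zero] at e1 e2 e3 e4
  have e2' := (mul_eq_zero.mp e2).resolve_right hX
  rw [e2', zero_mul, sub_zero] at h
  rcases mul_eq_zero.mp h with h | h
  · rw [h, zero_mul] at e1
    exact zero_ne_one e1
  · rw [h, zero_mul] at e4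
    exact zero_ne_one e4

/-- The transition from the chart `X₀ ≠ 0` to the chart `X i ≠ 0`; the sign `ε` records the order of
the two remaining coordinates. -/
theorem form_chart (i : Fin 3) : ∃ j l : Fin 3, ∃ ε : ℤ, (∀ a, a = i ∨ a = j ∨ a = l) ∧ ε * ε = 1 ∧
    ∀ r, form k r (P.u 0 1) (P.u 0 2) = form k (ε * (r * P.u 0 i ^ 3)) (P.u i j) (P.u i l) := by
  fin_cases i
  · refine ⟨1, 2, 1, by decide, by norm_num, fun r => ?_⟩
    change _ = form k ((1 : ℤ) * (r * P.u 0 0 ^ 3)) (P.u 0 1) (P.u 0 2)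
    rw [P.u_self]
    simp
  · refine ⟨0, 2, -1, by decide, by norm_num, fun r => ?_⟩
    change _ = form k ((-1 : ℤ) * (r * P.u 0 1 ^ 3)) (P.u 1 0) (P.u 1 2)
    have h := form_change (k := k) (s := P.u 0 1) (t := P.u 1 0) r (P.u 1 2) (by rw [P.u_mul, P.u_self])
    rw [P.u_mul] at h
    rw [h]
    congr 1
    push_cast
    ring
  · refine ⟨0, 1, 1, by decide, by norm_num, fun r => ?_⟩
    change _ = form k ((1 : ℤ) * (r * P.u 0 2 ^ 3)) (P.u 2 0) (P.u 2 1)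
    have h := form_change (k := k) (s := P.u 0 2) (t := P.u 2 0) (-r) (P.u 2 1)
      (by rw [P.u_mul, P.u_self])
    rw [P.u_mul] at h
    rw [form_swap, h]
    congr 1
    push_cast
    ring

theorem form_chart_eq_zero {i j l : Fin 3} {ε : ℤ} (hε : ε * ε = 1)
    (h : ∀ r, form k r (P.u 0 1) (P.u 0 2) = form k (ε * (r * P.u 0 i ^ 3)) (P.u i j) (P.u i l))
    {r : functionField 𝒜} (hr : form k r (P.u i j) (P.u i l) = 0) : r = 0 := by
  have hε' : (ε : functionField 𝒜) * ε = 1 := by rw [← Int.cast_mul, hε, Int.cast_one]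
  have h1 : P.u 0 i ^ 3 * P.u i 0 ^ 3 = 1 := by
    rw [← mul_pow, P.u_mul, P.u_self, one_pow]
  have h2 := h (ε * (r * P.u i 0 ^ 3))
  have h3 : (ε : functionField 𝒜) * (ε * (r * P.u i 0 ^ 3) * P.u 0 i ^ 3) = r := by
    linear_combination r * (P.u i 0 ^ 3 * P.u 0 i ^ 3) * hε' + r * h1
  rw [h3, hr] at h2
  have h4 := P.smul_wedge_u_eq_zero h2
  linear_combination (-r) * h1 - r * P.u i 0 ^ 3 * P.u 0 i ^ 3 * hε' + ε * P.u 0 i ^ 3 * h4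

theorem intCast_mem_localRing (p : PrimeDivisor 𝒜) (ε : ℤ) :
    (ε : functionField 𝒜) ∈ localRing 𝒜 p.ideal := intCast_mem _ ε

/-- The form `(X₀/s)³ d(X₁/X₀) ∧ d(X₂/X₀)` is, up to sign, `(X i/s)³` times the standard form of the
chart `X i ≠ 0`. At a prime divisor not containing `X i` its order is that of `s⁻³`. -/
theorem isCanonicalDivisor_hyperplane {L : WeilDiv 𝒜} (hL : IsHyperplaneDivisor 𝒜 L) :
    IsCanonicalDivisor 𝒜 2 (-(3 : ℤ) • L) := by
  have := P.isDomain
  obtain ⟨s, hs, hs0, hsL⟩ := hL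
  have hs0' := nonZeroDivisors.ne_zero hs0
  have hs3 : s ^ 3 ∈ 𝒜 3 := by simpa using P.pow_mem hs 3
  have hX3 : ∀ i, P.X i ^ 3 ∈ 𝒜 3 := fun i => by simpa using P.pow_mem (P.X_mem i) 3
  have hs30 : s ^ 3 ≠ 0 := pow_ne_zero 3 hs0'
  obtain ⟨r, hr⟩ := P.exists_frac (hX3 0) hs3 hs30
  refine ⟨form k r (P.u 0 1) (P.u 0 2), fun h0 => ?_, fun p => ?_⟩
  · have h1 := P.smul_wedge_u_eq_zero h0
    unfold IsFrac at hr
    rw [h1] at hr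
    have h2 : (0 : FractionRing A) * algebraMap A (FractionRing A) (s ^ 3) =
      algebraMap A (FractionRing A) (P.X 0 ^ 3) := hr
    rw [zero_mul] at h2
    exact P.algebraMap_ne_zero (pow_ne_zero 3 (P.X_ne_zero 0)) h2.symm
  · obtain ⟨i, hi⟩ := P.exists_X_notMem p
    obtain ⟨h, hh⟩ := P.exists_frac (hX3 i) hs3 hs30
    obtain ⟨j, l, ε, hcov, hε, hform⟩ := P.form_chart i
    have hε' : (ε : functionField 𝒜) * ε = 1 := by rw [← Int.cast_mul, hε, Int.cast_one]
    refine ⟨P.X i ^ 3, s ^ 3, ⟨mem_nonZeroDivisors_of_ne_zero (pow_ne_zero 3 (P.X_ne_zero i)),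
      mem_nonZeroDivisors_of_ne_zero hs30, 3, hX3 i, hs3⟩, ?_, h, hh, ?_⟩
    · rw [P.ordAt_pow p hs0', P.ordAt_pow p (P.X_ne_zero i), P.ordAt_eq_zero p hi]
      simp [hsL p]
    · have h1 : r * P.u 0 i ^ 3 = h := by
        refine P.frac_eq (hr.mul ((P.u_frac 0 i).pow 3)) hh
          (mul_ne_zero hs30 (pow_ne_zero 3 (P.X_ne_zero 0))) hs30 ?_
        ring
      rw [hform, h1, mul_comm]
      exact isMulGenerator_form _ (P.intCast_mem_localRing p ε) (P.intCast_mem_localRing p ε) hε'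
        (P.regularForms_eq hcov hi)

theorem ordAt_frac_congr (p : PrimeDivisor 𝒜) {x : functionField 𝒜} {f g f' g' : A} (h : IsFrac x f g)
    (h' : IsFrac x f' g') (hf : f ≠ 0) (hg : g ≠ 0) (hf' : f' ≠ 0) (hg' : g' ≠ 0) :
    (ordAt p.ideal f : ℤ) - ordAt p.ideal g = ordAt p.ideal f' - ordAt p.ideal g' := by
  have h1 := congrArg (ordAt p.ideal) (P.frac_cross h h')
  rw [P.ordAt_mul p hf hg', P.ordAt_mul p hf' hg] at h1
  omega

/-- Every rational form is `r d(X₁/X₀) ∧ d(X₂/X₀)`, and comparing generators in a chart around each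
prime divisor shows that its divisor is `div r - 3 div X₀`. The first term has degree zero. -/
theorem degDiv_canonical {E : WeilDiv 𝒜} (hE : IsCanonicalDivisor 𝒜 2 E) : P.degDiv E = -3 := by
  have := P.isDomain
  have := P.isDomain_functionField
  obtain ⟨ω, hω, hE⟩ := hE
  obtain ⟨r, rfl⟩ := P.exists_smul_wedge ω
  have hr0 : r ≠ 0 := by
    rintro rfl
    exact hω (zero_smul _ _)
  obtain ⟨f₀, g₀, n, hf₀, hg₀, hg₀0, hr⟩ := P.mem_functionField r
  have hf₀0 : f₀ ≠ 0 := by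
    rintro rfl
    apply hr0
    unfold IsFrac at hr
    rw [map_zero] at hr
    exact Subtype.ext ((mul_eq_zero.mp hr).resolve_right (P.algebraMap_ne_zero hg₀0))
  obtain ⟨F, hF, hF'⟩ := P.exists_div hf₀ hf₀0
  obtain ⟨G, hG, hG'⟩ := P.exists_div hg₀ hg₀0
  obtain ⟨H, hH, hH'⟩ := P.exists_div (P.X_mem 0) (P.X_ne_zero 0)
  have hkey : E = F - G - 3 • H := by
    ext p
    obtain ⟨f, g, ⟨hf, hg, -⟩, hEp, h, hh, hgen⟩ := hE p
    have hf0 := nonZeroDivisors.ne_zero hf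
    have hg0 := nonZeroDivisors.ne_zero hg
    obtain ⟨i, hi⟩ := P.exists_X_notMem p
    obtain ⟨j, l, ε, hcov, hε, hform⟩ := P.form_chart i
    have hε' : (ε : functionField 𝒜) * ε = 1 := by rw [← Int.cast_mul, hε, Int.cast_one]
    have h1 : P.u 0 i ^ 3 * P.u i 0 ^ 3 = 1 := by
      rw [← mul_pow, P.u_mul, P.u_self, one_pow]
    have hne : (ε : functionField 𝒜) * (r * P.u 0 i ^ 3) ≠ 0 :=
      mul_ne_zero (left_ne_zero_of_mul_eq_one hε')
        (mul_ne_zero hr0 (left_ne_zero_of_mul_eq_one h1))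
    rw [hform] at hgen
    obtain ⟨c, hc, c', hc', hcc, heq⟩ := exists_unit_of_isMulGenerator _ hne
      (P.regularForms_eq hcov hi) (fun r hr => P.form_chart_eq_zero hε hform hr) hgen
    obtain ⟨a, b, -, -, -, hbp, hab⟩ := (P.mem_localRing p c).mp hc
    obtain ⟨a', b', -, -, -, hbp', hab'⟩ := (P.mem_localRing p c').mp hc'
    have hunit := P.frac_cross (hab.mul hab') (hcc ▸ IsFrac.one (f := 1))
    have hap : a ∉ p.ideal := by
      intro hap
      have h2 : b * b' ∈ p.ideal := by
        have : b * b' = a * a' := by linear_combination -hunit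
        rw [this]
        exact Ideal.mul_mem_right _ _ hap
      exact (p.isPrime.mem_or_mem h2).elim hbp hbp'
    have ha0 : a ≠ 0 := by rintro rfl; exact hap (Ideal.zero_mem _)
    have hb0 : b ≠ 0 := by rintro rfl; exact hbp (Ideal.zero_mem _)
    have hεc : ∃ a₁ : A, a₁ ∉ p.ideal ∧ IsFrac ((ε : functionField 𝒜) * c) a₁ b := by
      rcases Int.isUnit_iff.mp (IsUnit.of_mul_eq_one _ hε) with rfl | rfl
      · exact ⟨a, hap, by simpa using hab⟩
      · exact ⟨-a, fun h => hap (by simpa using h), by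
          have e : ((-1 : ℤ) : functionField 𝒜) * c = -c := by push_cast; ring
          rw [e]
          exact hab.neg⟩
    obtain ⟨a₁, ha₁, hab₁⟩ := hεc
    have ha₁0 : a₁ ≠ 0 := by rintro rfl; exact ha₁ (Ideal.zero_mem _)
    have hreq : r = ε * c * h * P.u i 0 ^ 3 := by
      linear_combination (-r * P.u 0 i ^ 3 * P.u i 0 ^ 3) * hε' - r * h1 +
        ε * P.u i 0 ^ 3 * heq
    have hfr := (hab₁.mul hh).mul ((P.u_frac i 0).pow 3)
    rw [← hreq] at hfr
    have hX0 := fun a => pow_ne_zero 3 (P.X_ne_zero a)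
    have h5 := P.ordAt_frac_congr p hr hfr hf₀0 hg₀0 (mul_ne_zero (mul_ne_zero ha₁0 hf0) (hX0 0))
      (mul_ne_zero (mul_ne_zero hb0 hg0) (hX0 i))
    rw [P.ordAt_mul p (mul_ne_zero ha₁0 hf0) (hX0 0), P.ordAt_mul p ha₁0 hf0,
      P.ordAt_mul p (mul_ne_zero hb0 hg0) (hX0 i), P.ordAt_mul p hb0 hg0,
      P.ordAt_pow p (P.X_ne_zero 0), P.ordAt_pow p (P.X_ne_zero i), P.ordAt_eq_zero p ha₁,
      P.ordAt_eq_zero p hbp, P.ordAt_eq_zero p hi] at h5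
    rw [hEp, Finsupp.sub_apply, Finsupp.sub_apply, Finsupp.smul_apply, hF, hG, hH]
    push_cast at h5 ⊢
    simp only [nsmul_eq_mul]
    push_cast
    linarith
  rw [hkey, map_sub, map_sub, map_nsmul, hF', hG', hH']
  simp

theorem exists_canonical : ∃ E, IsCanonicalDivisor 𝒜 2 E := by
  obtain ⟨L, hL⟩ := P.exists_hyperplane
  exact ⟨_, P.isCanonicalDivisor_hyperplane hL⟩

end PolyIso
end PolarizedProj

/-! ### Dehomogenisation and degrees of symmetric polynomials -/

namespace MvPolynomial

theorem aeval_const_mul_of_isHomogeneous {σ R S : Type*} [Fintype σ] [CommRing R] [CommRing S] [Algebra R S]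
    {F : MvPolynomial σ R} {n : ℕ} (hF : F.IsHomogeneous n) (c : S) (g : σ → S) :
    aeval (fun i => c * g i) F = c ^ n * aeval g F := by
  rw [F.as_sum, map_sum, map_sum, Finset.mul_sum]
  refine Finset.sum_congr rfl fun m hm => ?_
  have hdeg : m.degree = n := by
    by_contra hne
    exact (mem_support_iff.mp hm) (hF.coeff_eq_zero hne)
  rw [aeval_monomial, aeval_monomial, Finsupp.prod_fintype _ _ (by simp),
    Finsupp.prod_fintype _ _ (by simp), ← hdeg, Finsupp.degree_eq_sum, ← Finset.prod_pow_eq_pow_sum]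
  simp only [mul_pow, Finset.prod_mul_distrib]
  ring

/-- A homogeneous polynomial is determined by its dehomogenisation. -/
theorem eq_zero_of_dehomogenize {R : Type*} [Field R] {d n : ℕ}
    {F : MvPolynomial (Fin (d + 1)) R} (hF : F.IsHomogeneous n)
    (h : aeval (Fin.cons 1 X : Fin (d + 1) → MvPolynomial (Fin d) R) F = 0) : F = 0 := by
  let K := FractionRing (MvPolynomial (Fin (d + 1)) R)
  have hX : algebraMap (MvPolynomial (Fin (d + 1)) R) K (X 0) ≠ 0 := by
    rw [Ne, FaithfulSMul.algebraMap_eq_zero_iff]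
    exact X_ne_zero 0
  -- Substituting `X (i + 1) / X 0` for the affine variables and multiplying by `X 0 ^ n` recovers
  -- `F`.
  let ψ : MvPolynomial (Fin d) R →ₐ[R] K := aeval fun i =>
    algebraMap (MvPolynomial (Fin (d + 1)) R) K (X i.succ) / algebraMap (MvPolynomial (Fin (d + 1)) R) K (X 0)
  have h1 := congrArg ψ h
  rw [← AlgHom.comp_apply, comp_aeval, map_zero] at h1
  have h2 := aeval_const_mul_of_isHomogeneous hF (algebraMap (MvPolynomial (Fin (d + 1)) R) K (X 0))
    (fun i => ψ ((Fin.cons 1 X : Fin (d + 1) → MvPolynomial (Fin d) R) i))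
  have h3 : (fun i => algebraMap (MvPolynomial (Fin (d + 1)) R) K (X 0) *
      ψ ((Fin.cons 1 X : Fin (d + 1) → MvPolynomial (Fin d) R) i)) =
      fun i => (IsScalarTower.toAlgHom R (MvPolynomial (Fin (d + 1)) R) K) (X i) := by
    ext i
    refine Fin.cases ?_ (fun j => ?_) i
    · simp
    · simp only [Fin.cons_succ, ψ, aeval_X]
      rw [mul_div_cancel₀ _ hX]
      rfl
  rw [h3, h1, mul_zero, ← comp_aeval_apply, aeval_X_left_apply] at h2
  exact (FaithfulSMul.algebraMap_eq_zero_iff _ K).mp h2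

theorem esymm_fin_two_two {R : Type*} [CommRing R] : esymm (Fin 2) R 2 = X 0 * X 1 := by
  change ∑ t ∈ Finset.powersetCard (Finset.univ : Finset (Fin 2)).card Finset.univ, ∏ i ∈ t, X i = _
  rw [Finset.powersetCard_self, Finset.sum_singleton, Fin.prod_univ_two]

/-- The degree in one variable of a polynomial in the elementary symmetric polynomials. -/
theorem totalDegree_le_of_esymm {R : Type*} [Field R] {m : ℕ} (Q : MvPolynomial (Fin 2) R)
    (h : aeval (fun i : Fin 2 => esymm (Fin 2) R (i + 1)) Q ∈ restrictDegree (Fin 2) R m) :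
    Q.totalDegree ≤ m := by
  by_contra! hlt
  set D := Q.totalDegree
  let S := MvPolynomial (Fin 1) R
  -- Polynomials in two variables are read as polynomials in the first with coefficients in the
  -- second.
  let ψ : MvPolynomial (Fin 2) R →ₐ[R] Polynomial S := aeval ![Polynomial.X, Polynomial.C (X 0)]
  have hlow : ∀ g ∈ restrictDegree (Fin 2) R m, (ψ g).natDegree ≤ m := by
    intro g hg
    rw [mem_restrictDegree] at hg
    rw [g.as_sum, map_sum]
    refine Polynomial.natDegree_sum_le_of_forall_le _ _ fun s hs => ?_
    simp only [ψ, aeval_monomial]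
    rw [Finsupp.prod_fintype _ _ (by simp), Fin.prod_univ_two]
    simp only [Matrix.cons_val_zero, Matrix.cons_val_one]
    rw [← Polynomial.C_pow, IsScalarTower.algebraMap_apply R S (Polynomial S),
      Polynomial.algebraMap_apply]
    refine (Polynomial.natDegree_C_mul_le _ _).trans ((Polynomial.natDegree_mul_C_le _ _).trans ?_)
    rw [Polynomial.natDegree_X_pow]
    exact hg s hs 0
  -- As polynomials in the first variable `T`, with `z` the second, `e₁ = T + z` and `e₂ = z T` have
  -- leading coefficients `1` and `z`. The coefficient of `T ^ D` is thus the top homogeneous part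
  -- of `Q` at `(1, z)`, which cannot vanish.
  have hcoeff : (ψ (aeval (fun i : Fin 2 => esymm (Fin 2) R (i + 1)) Q)).coeff D =
      aeval (Fin.cons 1 X : Fin 2 → S) (homogeneousComponent D Q) := by
    have hgen : (fun i : Fin 2 => ψ (esymm (Fin 2) R (i + 1))) =
        ![Polynomial.X + Polynomial.C (X 0), Polynomial.C (X 0) * Polynomial.X] := by
      ext1 i
      fin_cases i
      · simp [esymm_one, ψ]
      · change ψ (esymm (Fin 2) R 2) = _
        rw [esymm_fin_two_two, map_mul, mul_comm]
        simp [ψ]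
    rw [comp_aeval_apply, hgen, homogeneousComponent_apply, map_sum, Finset.sum_filter]
    conv_lhs => rw [Q.as_sum, map_sum, Polynomial.finsetSum_coeff]
    refine Finset.sum_congr rfl fun s hs => ?_
    have hsD : s 0 + s 1 ≤ D := by
      have := le_totalDegree hs
      rwa [Finsupp.sum_fintype _ _ (by simp), Fin.sum_univ_two] at this
    have hdeg : s.degree = s 0 + s 1 := by
      rw [Finsupp.degree_eq_sum, Fin.sum_univ_two]
    rw [aeval_monomial, Finsupp.prod_fintype _ _ (by simp), Fin.prod_univ_two,
      IsScalarTower.algebraMap_apply R S (Polynomial S), Polynomial.algebraMap_apply,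
      Polynomial.coeff_C_mul]
    simp only [Matrix.cons_val_zero, Matrix.cons_val_one]
    rw [mul_pow, ← Polynomial.C_pow, mul_left_comm, Polynomial.coeff_C_mul]
    have hmonic : ((Polynomial.X + Polynomial.C (X 0 : S)) ^ s 0 * Polynomial.X ^ s 1).Monic :=
      ((Polynomial.monic_X_add_C _).pow _).mul (Polynomial.monic_X_pow _)
    have hnat : ((Polynomial.X + Polynomial.C (X 0 : S)) ^ s 0 * Polynomial.X ^ s 1).natDegree =
        s 0 + s 1 := by
      rw [((Polynomial.monic_X_add_C _).pow _).natDegree_mul (Polynomial.monic_X_pow _),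
        (Polynomial.monic_X_add_C _).natDegree_pow, Polynomial.natDegree_X_add_C,
        Polynomial.natDegree_X_pow, mul_one]
    split_ifs with hsd
    · rw [hdeg] at hsd
      have : ((Polynomial.X + Polynomial.C (X 0 : S)) ^ s 0 * Polynomial.X ^ s 1).coeff D = 1 := by
        rw [← hsd, ← hnat]
        exact hmonic
      rw [this, aeval_monomial, Finsupp.prod_fintype _ _ (by simp), Fin.prod_univ_two]
      change _ = _ * ((1 : S) ^ _ * (X 0) ^ _)
      rw [one_pow, one_mul, mul_one]
      rfl
    · rw [hdeg] at hsd
      rw [Polynomial.coeff_eq_zero_of_natDegree_lt (by omega), mul_zero, mul_zero]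
  have h0 : (ψ (aeval (fun i : Fin 2 => esymm (Fin 2) R (i + 1)) Q)).coeff D = 0 :=
    Polynomial.coeff_eq_zero_of_natDegree_lt ((hlow _ h).trans_lt hlt)
  rw [hcoeff] at h0
  have h1 := eq_zero_of_dehomogenize (homogeneousComponent_isHomogeneous D Q) h0
  have hQ : Q ≠ 0 := by
    rintro rfl
    simp [D] at hlt
  obtain ⟨s, hs, hsD⟩ := Finset.exists_mem_eq_sup Q.support (support_nonempty.mpr hQ)
    (fun s => s.sum fun _ e => e)
  have h2 : coeff s (homogeneousComponent D Q) = 0 := by rw [h1, coeff_zero]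
  rw [coeff_homogeneousComponent, if_pos] at h2
  · exact mem_support_iff.mp hs h2
  · exact hsD.symm

/-- Homogenisation of a polynomial in two variables to the degree `m`. -/
def homogenizeTwo {R : Type*} [CommRing R] (m : ℕ) (Q : MvPolynomial (Fin 2) R) : MvPolynomial (Fin 3) R :=
  ∑ s ∈ Q.support, C (coeff s Q) * (X 0 ^ (m - (s 0 + s 1)) * X 1 ^ s 0 * X 2 ^ s 1)

theorem le_of_mem_support_of_totalDegree_le {R : Type*} [CommRing R] {m : ℕ} {Q : MvPolynomial (Fin 2) R}
    (hQ : Q.totalDegree ≤ m) {s : Fin 2 →₀ ℕ} (hs : s ∈ Q.support) : s 0 + s 1 ≤ m := by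
  have := (le_totalDegree hs).trans hQ
  rwa [Finsupp.sum_fintype _ _ (by simp), Fin.sum_univ_two] at this

theorem homogenizeTwo_isHomogeneous {R : Type*} [CommRing R] {m : ℕ} {Q : MvPolynomial (Fin 2) R}
    (hQ : Q.totalDegree ≤ m) : (homogenizeTwo m Q).IsHomogeneous m := by
  refine IsHomogeneous.sum _ _ _ fun s hs => ?_
  have h := le_of_mem_support_of_totalDegree_le hQ hs
  have h1 := (isHomogeneous_C (Fin 3) (coeff s Q)).mul
    ((((isHomogeneous_X R (0 : Fin 3)).pow (m - (s 0 + s 1))).mul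
      ((isHomogeneous_X R (1 : Fin 3)).pow (s 0))).mul ((isHomogeneous_X R (2 : Fin 3)).pow (s 1)))
  convert h1 using 1
  omega

end MvPolynomial

/-! ### The section ring of `Sym² ℙ¹` -/

section SectionRing

open MvPolynomial

/-- The map `ℚ[x₀, x₁, x₂] → ℚ[z₁, z₂][T]` whose image is the section ring of `Sym² ℙ¹`. -/
def symSquareHom : MvPolynomial (Fin 3) ℚ →ₐ[ℚ] Polynomial (MvPolynomial (Fin 2) ℚ) :=
  aeval fun i => Polynomial.monomial 1 (esymm (Fin 2) ℚ i)

theorem symSquareHom_of_isHomogeneous {m : ℕ} {F : MvPolynomial (Fin 3) ℚ} (hF : F.IsHomogeneous m) :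
    symSquareHom F = Polynomial.monomial m (aeval (fun i : Fin 3 => esymm (Fin 2) ℚ i) F) := by
  have h := aeval_const_mul_of_isHomogeneous hF (Polynomial.X : Polynomial (MvPolynomial (Fin 2) ℚ))
    (fun i : Fin 3 => Polynomial.CAlgHom (R := ℚ) (esymm (Fin 2) ℚ i))
  rw [← comp_aeval_apply] at h
  rw [← Polynomial.C_mul_X_pow_eq_monomial, mul_comm]
  refine Eq.trans ?_ h
  unfold symSquareHom
  congr 2
  ext1 i
  rw [← Polynomial.C_mul_X_eq_monomial, mul_comm]
  rfl

/-- The powers of the extra variable separate the homogeneous components. As `e₀ = 1`, each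
component is mapped to its dehomogenisation evaluated at the algebraically independent `e₁`, `e₂`.
-/
theorem symSquareHom_injective : Function.Injective symSquareHom := by
  rw [injective_iff_map_eq_zero]
  intro F hF
  have hcomp : ∀ m, aeval (fun i : Fin 3 => esymm (Fin 2) ℚ i) (homogeneousComponent m F) = 0 := by
    intro m
    have h1 : symSquareHom F = ∑ i ∈ Finset.range (F.totalDegree + 1),
        Polynomial.monomial i (aeval (fun i : Fin 3 => esymm (Fin 2) ℚ i) (homogeneousComponent i F)) := by
      conv_lhs => rw [← sum_homogeneousComponent F, map_sum]
      exact Finset.sum_congr rfl fun i _ =>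
        symSquareHom_of_isHomogeneous (homogeneousComponent_isHomogeneous i F)
    have h2 := congrArg (fun q => Polynomial.coeff q m) (h1.symm.trans hF)
    simp only [Polynomial.finsetSum_coeff, Polynomial.coeff_monomial, Polynomial.coeff_zero,
      Finset.sum_ite_eq', Finset.mem_range] at h2
    split_ifs at h2 with h3
    · exact h2
    · rw [homogeneousComponent_eq_zero _ _ (by omega), map_zero]
  rw [← sum_homogeneousComponent F]
  refine Finset.sum_eq_zero fun m _ =>
    eq_zero_of_dehomogenize (homogeneousComponent_isHomogeneous m F) ?_
  apply (esymmAlgHom_fin_bijective ℚ 2).injective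
  rw [map_zero]
  apply Subtype.ext
  rw [esymmAlgHom_apply, comp_aeval_apply, ZeroMemClass.coe_zero, ← hcomp m]
  congr 2
  ext1 i
  refine Fin.cases ?_ (fun j => ?_) i
  · simp [esymm_zero]
  · simp

theorem esymm_degreeOf_le (i : Fin 2) (j : Fin 3) : degreeOf i (esymm (Fin 2) ℚ j) ≤ 1 := by
  have hX : ∀ a : Fin 2, degreeOf i (X a : MvPolynomial (Fin 2) ℚ) = if i = a then 1 else 0 :=
    fun a => degreeOf_X _ _
  fin_cases j
  · simp [esymm_zero]
  · simp only [esymm_one, Fin.sum_univ_two]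
    refine (degreeOf_add_le _ _ _).trans ?_
    rw [hX, hX]
    split_ifs <;> simp
  · change degreeOf i (esymm (Fin 2) ℚ 2) ≤ 1
    rw [esymm_fin_two_two]
    refine (degreeOf_mul_le _ _ _).trans ?_
    rw [hX, hX]
    fin_cases i <;> simp

/-- Each of `e₀`, `e₁`, `e₂` is symmetric of degree at most one in each variable. -/
theorem aeval_esymm_mem {m : ℕ} {F : MvPolynomial (Fin 3) ℚ} (hF : F.IsHomogeneous m) :
    aeval (fun i : Fin 3 => esymm (Fin 2) ℚ i) F ∈ symSquareSections m := by
  refine ⟨?_, ?_⟩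
  · have h := Subalgebra.mvPolynomial_aeval_coe (symmetricSubalgebra (Fin 2) ℚ)
      (fun i : Fin 3 => (⟨esymm (Fin 2) ℚ i, esymm_isSymmetric _ _ _⟩ :
        symmetricSubalgebra (Fin 2) ℚ)) F
    change _ ∈ symmetricSubalgebra (Fin 2) ℚ
    have h' := Subtype.prop (aeval (fun i : Fin 3 => (⟨esymm (Fin 2) ℚ i, esymm_isSymmetric _ _ _⟩ :
        symmetricSubalgebra (Fin 2) ℚ)) F)
    rw [← h] at h'
    exact h'
  · rw [F.as_sum, map_sum]
    refine Submodule.sum_mem _ fun s hs => ?_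
    have hdeg : s.degree = m := by
      by_contra hne
      exact (mem_support_iff.mp hs) (hF.coeff_eq_zero hne)
    rw [mem_restrictDegree]
    intro t ht i
    refine degreeOf_le_iff.mp ?_ t ht
    rw [aeval_monomial, Finsupp.prod_fintype _ _ (by simp), Fin.prod_univ_three]
    have hb : ∀ j : Fin 3, degreeOf i (esymm (Fin 2) ℚ j ^ s j) ≤ s j := fun j =>
      (degreeOf_pow_le _ _ _).trans (by have := esymm_degreeOf_le i j; nlinarith)
    rw [Finsupp.degree_eq_sum, Fin.sum_univ_three] at hdeg
    refine (degreeOf_mul_le _ _ _).trans ?_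
    have h0 : degreeOf i (algebraMap ℚ (MvPolynomial (Fin 2) ℚ) (coeff s F)) = 0 := degreeOf_C _ _
    rw [h0, zero_add, ← hdeg]
    exact (degreeOf_mul_le _ _ _).trans (add_le_add ((degreeOf_mul_le _ _ _).trans
      (add_le_add (hb 0) (hb 1))) (hb 2))

/-- A symmetric polynomial is a polynomial `Q` in `e₁`, `e₂`. Its degree in one variable is the
total degree of `Q`, so `Q` can be homogenised to degree `m` by means of `e₀ = 1`. -/
theorem exists_of_mem_symSquareSections {m : ℕ} {g : MvPolynomial (Fin 2) ℚ}
    (hg : g ∈ symSquareSections m) :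
    ∃ F : MvPolynomial (Fin 3) ℚ, F.IsHomogeneous m ∧ symSquareHom F = Polynomial.monomial m g := by
  obtain ⟨Q, hQ⟩ := (esymmAlgHom_fin_bijective ℚ 2).surjective ⟨g, hg.1⟩
  have hQ' : aeval (fun i : Fin 2 => esymm (Fin 2) ℚ (i + 1)) Q = g := by
    rw [← esymmAlgHom_apply, hQ]
  have hdeg : Q.totalDegree ≤ m := totalDegree_le_of_esymm Q (by rw [hQ']; exact hg.2)
  refine ⟨homogenizeTwo m Q, homogenizeTwo_isHomogeneous hdeg, ?_⟩
  rw [symSquareHom_of_isHomogeneous (homogenizeTwo_isHomogeneous hdeg), ← hQ']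
  congr 1
  unfold homogenizeTwo
  conv_rhs => rw [Q.as_sum]
  rw [map_sum, map_sum]
  refine Finset.sum_congr rfl fun s hs => ?_
  rw [aeval_monomial, Finsupp.prod_fintype _ _ (by simp), Fin.prod_univ_two]
  simp [esymm_zero]

theorem symSquareHom_range : symSquareHom.range = sectionRing symSquareSections := by
  apply le_antisymm
  · unfold symSquareHom
    rw [aeval_range, sectionRing, Algebra.adjoin_le_iff]
    rintro _ ⟨i, rfl⟩
    refine Algebra.subset_adjoin ⟨1, _, ?_, rfl⟩
    have := aeval_esymm_mem (isHomogeneous_X ℚ i)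
    rwa [aeval_X] at this
  · rw [sectionRing, Algebra.adjoin_le_iff]
    rintro _ ⟨m, g, hg, rfl⟩
    obtain ⟨F, -, hF⟩ := exists_of_mem_symSquareSections hg
    exact ⟨F, hF⟩

/-- The section ring of `Sym² ℙ¹` is a polynomial ring. -/
def symSquareEquiv : sectionRing symSquareSections ≃ₐ[ℚ] MvPolynomial (Fin 3) ℚ :=
  ((AlgEquiv.ofInjective symSquareHom symSquareHom_injective).trans
    (Subalgebra.equivOfEq _ _ symSquareHom_range)).symm

theorem symSquareHom_equiv (x : sectionRing symSquareSections) :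
    symSquareHom (symSquareEquiv x) = x := by
  obtain ⟨F, rfl⟩ := symSquareEquiv.symm.surjective x
  rw [AlgEquiv.apply_symm_apply]
  rfl

theorem mem_sectionPieces_iff (m : ℕ) (x : sectionRing symSquareSections) :
    x ∈ sectionPieces symSquareSections m ↔ (symSquareEquiv x).IsHomogeneous m := by
  have hmem : x ∈ sectionPieces symSquareSections m ↔ ∃ g ∈ symSquareSections m,
      Polynomial.monomial m g = (x : Polynomial (MvPolynomial (Fin 2) ℚ)) := Iff.rfl
  rw [hmem]
  constructor
  · rintro ⟨g, hg, hx⟩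
    obtain ⟨F, hF, hF'⟩ := exists_of_mem_symSquareSections hg
    have : symSquareEquiv x = F := by
      apply symSquareHom_injective
      rw [symSquareHom_equiv, ← hx, hF']
    rwa [this]
  · intro h
    exact ⟨_, aeval_esymm_mem h, by rw [← symSquareHom_of_isHomogeneous h, symSquareHom_equiv]⟩

theorem symSquareEquiv_eq_X (i : Fin 3) (x : sectionRing symSquareSections)
    (hx : (x : Polynomial (MvPolynomial (Fin 2) ℚ)) = Polynomial.monomial 1 (esymm (Fin 2) ℚ i)) :
    symSquareEquiv x = X i := by
  apply symSquareHom_injective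
  rw [symSquareHom_equiv, hx, symSquareHom, aeval_X]

/-- The section ring of `Sym² ℙ¹` as a graded polynomial ring. -/
def symSquarePolyIso : PolarizedProj.PolyIso (k := ℚ) (A := sectionRing symSquareSections)
    (sectionPieces symSquareSections) where
  equiv := symSquareEquiv
  mem_iff := mem_sectionPieces_iff

end SectionRing

/-! ### Bounded sections are sections of bounded degree -/

/-- A real polynomial of growth `O(x^m)` has degree at most `m`. -/
theorem Polynomial.natDegree_le_of_abs_eval_le {p : Polynomial ℝ} {m : ℕ} {C : ℝ}
    (h : ∀ x : ℝ, 1 ≤ x → |p.eval x| ≤ C * x ^ m) : p.natDegree ≤ m := by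
  by_contra! hlt
  have h1 := p.abs_div_tendsto_atTop_atTop_of_degree_gt (X ^ m)
    (by rw [degree_X_pow]; exact (lt_of_lt_of_le (by exact_mod_cast hlt)
      (degree_eq_natDegree (by rintro rfl; simp at hlt)).ge))
    (pow_ne_zero m X_ne_zero)
  obtain ⟨x, hx1, hx2⟩ := ((Filter.eventually_ge_atTop 1).and
    (h1.eventually (Filter.eventually_gt_atTop C))).exists
  rw [eval_pow, eval_X, abs_div, lt_div_iff₀ (by positivity), abs_of_pos (by positivity : 0 < x ^ m)] at hx2
  exact absurd (h x hx1) (not_le.mpr hx2)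

/-- The second variable is specialised to a rational number at which the leading coefficient does
not vanish; the growth of the remaining polynomial along the real axis then bounds its degree. -/
theorem MvPolynomial.degreeOf_zero_le_of_norm_le {g : MvPolynomial (Fin 2) ℚ} {m : ℕ} {C : ℝ}
    (h : ∀ z : Fin 2 → ℂ, ‖aeval z g‖ ≤ C * (max 1 ‖z 0‖ * max 1 ‖z 1‖) ^ m) : degreeOf 0 g ≤ m := by
  rw [← natDegree_finSuccEquiv]
  by_cases h0 : g = 0
  · simp [h0]
  have hl : (finSuccEquiv ℚ 1 g).leadingCoeff ≠ 0 := by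
    rw [Polynomial.leadingCoeff_ne_zero]
    simpa using h0
  obtain ⟨s, hs⟩ : ∃ s, eval s (finSuccEquiv ℚ 1 g).leadingCoeff ≠ 0 := by
    by_contra! hall
    exact hl (MvPolynomial.funext fun x => by rw [hall x, map_zero])
  set p : Polynomial ℝ := ((finSuccEquiv ℚ 1 g).map (eval s)).map (algebraMap ℚ ℝ) with hp
  have hdeg : p.natDegree = (finSuccEquiv ℚ 1 g).natDegree := by
    rw [hp, Polynomial.natDegree_map, Polynomial.natDegree_map_of_leadingCoeff_ne_zero _ hs]
  rw [← hdeg]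
  have key : ∀ x : ℝ, ((p.eval x : ℝ) : ℂ) = aeval (Fin.cons (x : ℂ) fun i => (s i : ℂ)) g := by
    intro x
    let Φ : MvPolynomial (Fin 2) ℚ →+* ℂ := Complex.ofRealHom.comp ((Polynomial.evalRingHom x).comp
      ((Polynomial.mapRingHom (algebraMap ℚ ℝ)).comp ((Polynomial.mapRingHom (eval s)).comp
        (finSuccEquiv ℚ 1 : MvPolynomial (Fin 2) ℚ →+* _))))
    have hΦ : Φ = (aeval (Fin.cons (x : ℂ) fun i => (s i : ℂ)) : MvPolynomial (Fin 2) ℚ →ₐ[ℚ] ℂ) := by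
      apply MvPolynomial.ringHom_ext
      · intro r
        have e : finSuccEquiv ℚ 1 (MvPolynomial.C r) = Polynomial.C (MvPolynomial.C r) := (finSuccEquiv ℚ 1).commutes r
        change (((((finSuccEquiv ℚ 1 (MvPolynomial.C r)).map (eval s)).map (algebraMap ℚ ℝ)).eval x : ℝ) : ℂ) = _
        rw [e]
        simp
      · intro i
        change (((((finSuccEquiv ℚ 1 (X i)).map (eval s)).map (algebraMap ℚ ℝ)).eval x : ℝ) : ℂ) = _
        refine Fin.cases ?_ (fun j => ?_) i
        · rw [finSuccEquiv_X_zero]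
          simp
        · rw [finSuccEquiv_X_succ]
          simp
    exact congrArg (fun f : MvPolynomial (Fin 2) ℚ →+* ℂ => f g) hΦ
  refine Polynomial.natDegree_le_of_abs_eval_le (C := C * max 1 ‖(s 0 : ℂ)‖ ^ m) fun x hx => ?_
  have h1 := h (Fin.cons (x : ℂ) fun i => (s i : ℂ))
  rw [← key, Complex.norm_real, Real.norm_eq_abs] at h1
  refine h1.trans (le_of_eq ?_)
  rw [Fin.cons_zero, Fin.cons_one, Complex.norm_real, Real.norm_eq_abs, abs_of_nonneg (by linarith),
    max_eq_right hx, mul_pow]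
  ring

/-- By symmetry the degree bound in the first variable carries over to the second. -/
theorem mem_symSquareSections_of_norm_le {g : MvPolynomial (Fin 2) ℚ} {m : ℕ} {C : ℝ}
    (hg : g ∈ MvPolynomial.symmetricSubalgebra (Fin 2) ℚ)
    (h : ∀ z : Fin 2 → ℂ, ‖MvPolynomial.aeval z g‖ ≤ C * (max 1 ‖z 0‖ * max 1 ‖z 1‖) ^ m) :
    g ∈ symSquareSections m := by
  have h0 := MvPolynomial.degreeOf_zero_le_of_norm_le h
  have h1 : MvPolynomial.degreeOf 1 g ≤ m := by
    have := MvPolynomial.degreeOf_rename_of_injective (p := g) (Equiv.swap (0 : Fin 2) 1).injective 0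
    rw [(MvPolynomial.mem_symmetricSubalgebra g).mp hg] at this
    rw [Equiv.swap_apply_left] at this
    rwa [this]
  refine ⟨hg, (MvPolynomial.mem_restrictDegree _ _ _).mpr ?_⟩
  intro s hs i
  fin_cases i
  · exact MvPolynomial.degreeOf_le_iff.mp h0 s hs
  · exact MvPolynomial.degreeOf_le_iff.mp h1 s hs

theorem norm_aeval_le_of_mem_restrictDegree {g : MvPolynomial (Fin 2) ℚ} {m : ℕ}
    (hg : g ∈ MvPolynomial.restrictDegree (Fin 2) ℚ m) : ∃ C : ℝ, 0 ≤ C ∧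
      ∀ z : Fin 2 → ℂ, ‖MvPolynomial.aeval z g‖ ≤ C * (max 1 ‖z 0‖ * max 1 ‖z 1‖) ^ m := by
  rw [MvPolynomial.mem_restrictDegree] at hg
  refine ⟨∑ s ∈ g.support, ‖((g.coeff s : ℚ) : ℂ)‖, by positivity, fun z => ?_⟩
  rw [MvPolynomial.aeval_def, MvPolynomial.eval₂_eq', Finset.sum_mul]
  refine (norm_sum_le _ _).trans (Finset.sum_le_sum fun s hs => ?_)
  rw [norm_mul, Fin.prod_univ_two, norm_mul, norm_pow, norm_pow, mul_pow]
  have hb : ∀ i, ‖z i‖ ^ s i ≤ max 1 ‖z i‖ ^ m := fun i =>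
    (pow_le_pow_left₀ (norm_nonneg _) (le_max_right _ _) _).trans
      (pow_le_pow_right₀ (le_max_left _ _) (hg s hs i))
  have := hb 0
  have := hb 1
  gcongr
  simp

namespace MetrizedLine

variable {n : ℕ} (Λ : MetrizedLine n)

/-- Boundedness depends on the metric only up to positive constants. On an affine line all symmetric
polynomials are admitted as sections, but the growth condition imposes the same degree bound as
completeness. -/
theorem boundedSections_eq {d D : ℝ} (hd : 0 < d)
    (hlow : ∀ z : ℂ, d * max 1 ‖z‖ ≤ Λ.invNorm z) (hup : ∀ z : ℂ, Λ.invNorm z ≤ D * max 1 ‖z‖) :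
    Λ.boundedSections = symSquareSections := by
  have hpos : ∀ z : ℂ, 0 ≤ Λ.invNorm z := fun z => norm_nonneg _
  ext m g
  have hsym : g ∈ Λ.symSections m → g ∈ MvPolynomial.symmetricSubalgebra (Fin 2) ℚ := by
    unfold symSections
    split_ifs
    · exact fun h => h.1
    · exact fun h => h
  constructor
  · rintro ⟨h1, C, hC⟩
    refine mem_symSquareSections_of_norm_le (C := |C| * (D * D) ^ m) (hsym h1) fun z => ?_
    refine (hC z).trans ?_
    have h2 : (Λ.invNorm (z 0) * Λ.invNorm (z 1)) ^ m ≤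
        ((D * max 1 ‖z 0‖) * (D * max 1 ‖z 1‖)) ^ m :=
      pow_le_pow_left₀ (mul_nonneg (hpos _) (hpos _))
        (mul_le_mul (hup _) (hup _) (hpos _) ((hpos _).trans (hup _))) m
    calc C * (Λ.invNorm (z 0) * Λ.invNorm (z 1)) ^ m
        ≤ |C| * (Λ.invNorm (z 0) * Λ.invNorm (z 1)) ^ m :=
          mul_le_mul_of_nonneg_right (le_abs_self C) (pow_nonneg (mul_nonneg (hpos _) (hpos _)) m)
      _ ≤ |C| * ((D * max 1 ‖z 0‖) * (D * max 1 ‖z 1‖)) ^ m :=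
          mul_le_mul_of_nonneg_left h2 (abs_nonneg C)
      _ = _ := by rw [mul_assoc |C|, ← mul_pow]; congr 2; ring
  · intro hg
    refine ⟨?_, ?_⟩
    · unfold symSections
      split_ifs
      · exact hg
      · exact hg.1
    · obtain ⟨C, hC0, hC⟩ := norm_aeval_le_of_mem_restrictDegree hg.2
      refine ⟨C * ((d * d)⁻¹) ^ m, fun z => (hC z).trans ?_⟩
      rw [mul_assoc, ← mul_pow]
      refine mul_le_mul_of_nonneg_left (pow_le_pow_left₀ (by positivity) ?_ m) hC0
      rw [le_inv_mul_iff₀ (by positivity)]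
      calc d * d * (max 1 ‖z 0‖ * max 1 ‖z 1‖) = (d * max 1 ‖z 0‖) * (d * max 1 ‖z 1‖) := by ring
        _ ≤ _ := mul_le_mul (hlow _) (hlow _) (by positivity) (hpos _)

end MetrizedLine

theorem projLine_invNorm {E : Type} [NormedField E] (z : E) : projLine.invNorm z = max 1 ‖z‖ := by
  unfold MetrizedLine.invNorm projLine
  rw [Pi.norm_def]
  simp [Fin.univ_succ]

theorem baseLine_invNorm {E : Type} [NormedField E] (z : E) : baseLine.invNorm z = max 1 ‖z‖ := by
  unfold MetrizedLine.invNorm baseLine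
  rw [Pi.norm_def]
  simp [Fin.univ_succ]

/-- The maximum of the squares is the square of the maximum, at every kind of place. The resulting
shape `max α (α² |z|)` governs all volumes and heights on the fibres. -/
theorem fibreLine_invNorm {E : Type} [NormedField E] (y : Fin 2 → ℚ) (z : E) :
    (fibreLine y).invNorm z =
      max (max ‖(y 0 : E)‖ ‖(y 1 : E)‖) (max ‖(y 0 : E)‖ ‖(y 1 : E)‖ ^ 2 * ‖z‖) := by
  unfold MetrizedLine.invNorm fibreLine
  rw [Pi.norm_def]
  have hsq : max ‖(y 0 : E)‖ ‖(y 1 : E)‖ ^ 2 = max (‖(y 0 : E)‖ ^ 2) (‖(y 1 : E)‖ ^ 2) := by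
    rcases le_total ‖(y 0 : E)‖ ‖(y 1 : E)‖ with h | h
    · rw [max_eq_right h, max_eq_right (pow_le_pow_left₀ (norm_nonneg _) h 2)]
    · rw [max_eq_left h, max_eq_left (pow_le_pow_left₀ (norm_nonneg _) h 2)]
  rw [hsq, max_mul_of_nonneg _ _ (norm_nonneg z)]
  simp only [Fin.univ_succ]
  simp [max_comm, max_left_comm]

theorem projLine_boundedSections : projLine.boundedSections = symSquareSections :=
  projLine.boundedSections_eq (d := 1) (D := 1) one_pos (fun z => by rw [projLine_invNorm, one_mul])
    (fun z => by rw [projLine_invNorm, one_mul])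

theorem baseLine_boundedSections : baseLine.boundedSections = symSquareSections :=
  baseLine.boundedSections_eq (d := 1) (D := 1) one_pos (fun z => by rw [baseLine_invNorm, one_mul])
    (fun z => by rw [baseLine_invNorm, one_mul])

theorem max_norm_pos {E : Type} [NormedField E] [CharZero E] {y : Fin 2 → ℚ} (hy : y ≠ 0) :
    0 < max ‖(y 0 : E)‖ ‖(y 1 : E)‖ := by
  obtain ⟨i, hi⟩ := Function.ne_iff.mp hy
  have : 0 < ‖(y i : E)‖ := by
    rw [norm_pos_iff]
    exact_mod_cast hi
  fin_cases i
  · exact lt_max_of_lt_left this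
  · exact lt_max_of_lt_right this

theorem fibreLine_boundedSections {y : Fin 2 → ℚ} (hy : y ≠ 0) :
    (fibreLine y).boundedSections = symSquareSections := by
  have hα := max_norm_pos (E := ℂ) hy
  set α := max ‖(y 0 : ℂ)‖ ‖(y 1 : ℂ)‖
  refine (fibreLine y).boundedSections_eq (d := min α (α ^ 2)) (D := max α (α ^ 2))
    (lt_min hα (by positivity)) (fun z => ?_) (fun z => ?_)
  · rw [fibreLine_invNorm, mul_max_of_nonneg _ _ (lt_min hα (by positivity)).le, mul_one]
    refine max_le_max (min_le_left _ _) ?_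
    exact mul_le_mul_of_nonneg_right (min_le_right _ _) (norm_nonneg _)
  · rw [fibreLine_invNorm, mul_max_of_nonneg _ _ (lt_max_of_lt_left hα).le, mul_one]
    refine max_le_max (le_max_left _ _) ?_
    exact mul_le_mul_of_nonneg_right (le_max_right _ _) (norm_nonneg _)

/-! ### The invariants of the compactified planes -/

namespace MetrizedLine

variable {n : ℕ} {Λ : MetrizedLine n}

theorem invariants_of_polyIso {𝒢 : ℕ → Submodule ℚ (MvPolynomial (Fin 2) ℚ)} (h : 𝒢 = symSquareSections) :
    Nonempty (PolarizedProj.PolyIso (k := ℚ) (A := sectionRing 𝒢) (sectionPieces 𝒢)) := by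
  subst h
  exact ⟨symSquarePolyIso⟩

theorem a_eq (h : Λ.boundedSections = symSquareSections) : Λ.a = 3 := by
  obtain ⟨P⟩ := invariants_of_polyIso h
  exact P.aInvariant_eq (fun _ => P.degDiv_canonical) P.exists_canonical

theorem b_eq (h : Λ.boundedSections = symSquareSections) : Λ.b = 1 := by
  obtain ⟨P⟩ := invariants_of_polyIso h
  exact P.bInvariant_eq (fun _ => P.degDiv_canonical) P.exists_canonical

theorem gamma_eq (h : Λ.boundedSections = symSquareSections) : Λ.gamma = 1 := by
  obtain ⟨P⟩ := invariants_of_polyIso h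
  exact P.gammaInvariant_eq (fun _ => P.degDiv_canonical) P.exists_canonical

theorem delta_eq (h : Λ.boundedSections = symSquareSections) : Λ.delta = 1 := by
  obtain ⟨P⟩ := invariants_of_polyIso h
  exact P.deltaInvariant_eq (P.adjointFace_eq (fun _ => P.degDiv_canonical) P.exists_canonical)

theorem finrank_geomPic (h : Λ.boundedSections = symSquareSections) :
    Module.finrank ℤ Λ.GeomPic = 1 := by
  obtain ⟨P⟩ := invariants_of_polyIso h
  exact P.finrank_geomPic (P.adjointFace_eq (fun _ => P.degDiv_canonical) P.exists_canonical)

theorem isSplit (h : Λ.boundedSections = symSquareSections) : Λ.IsSplit := by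
  obtain ⟨P⟩ := invariants_of_polyIso h
  exact fun σ c =>
    P.galPic_eq (P.adjointFace_eq (fun _ => P.degDiv_canonical) P.exists_canonical) σ c

theorem isCanonical (h : Λ.boundedSections = symSquareSections) (L : Λ.Divisors)
    (hL : Λ.IsHyperplane L) : Λ.IsCanonical (-(3 : ℤ) • L) := by
  obtain ⟨P⟩ := invariants_of_polyIso h
  exact P.isCanonicalDivisor_hyperplane hL

end MetrizedLine

/-! ### Boxes in `ℚ_p²` and a `p`-adic integral -/

open MeasureTheory

namespace Padic

variable {p : ℕ} [Fact p.Prime]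

theorem exists_sub_natCast_norm_le {u : ℚ_[p]} (hu : ‖u‖ ≤ 1) : ∃ i < p, ‖u - i‖ ≤ (p : ℝ) ^ (-1 : ℤ) := by
  obtain ⟨x, rfl⟩ : ∃ x : ℤ_[p], (x : ℚ_[p]) = u := ⟨⟨u, hu⟩, rfl⟩
  obtain ⟨i, hi, h⟩ := PadicInt.exists_mem_range x
  refine ⟨i, hi, ?_⟩
  have h' : ‖x - (i : ℤ_[p])‖ < 1 := PadicInt.mem_nonunits.mp h
  rw [Padic.norm_le_pow_iff_norm_lt_pow_add_one]
  rw [PadicInt.norm_def] at h'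
  simpa using h'

theorem norm_zpow_prime (m : ℤ) : ‖(p : ℚ_[p]) ^ (-m)‖ = (p : ℝ) ^ m := by
  rw [Padic.norm_p_zpow, neg_neg]

/-- A ball of radius `p ^ (m + 1)` is covered by `p` translates of the ball of radius `p ^ m`;
disjointness is the next lemma. Translation invariance then yields the measure of every box from
that of the unit ball. -/
theorem exists_sub_mul_norm_le {x : ℚ_[p]} {m : ℤ} (hx : ‖x‖ ≤ (p : ℝ) ^ (m + 1)) :
    ∃ i < p, ‖x - i * (p : ℚ_[p]) ^ (-(m + 1))‖ ≤ (p : ℝ) ^ m := by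
  have hp : (0 : ℝ) < p := by exact_mod_cast (Fact.out : p.Prime).pos
  set c : ℚ_[p] := (p : ℚ_[p]) ^ (-(m + 1)) with hc
  have hcn : ‖c‖ = (p : ℝ) ^ (m + 1) := norm_zpow_prime (m + 1)
  have hc0 : c ≠ 0 := by
    rw [← norm_pos_iff, hcn]
    positivity
  obtain ⟨i, hi, h⟩ := exists_sub_natCast_norm_le (u := x / c) (by
    rw [norm_div, hcn]
    exact div_le_one_of_le₀ hx (by positivity))
  refine ⟨i, hi, ?_⟩
  have : x - i * c = (x / c - i) * c := by
    rw [sub_mul, div_mul_cancel₀ _ hc0]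
  rw [this, norm_mul, hcn]
  calc _ ≤ (p : ℝ) ^ (-1 : ℤ) * (p : ℝ) ^ (m + 1) := by gcongr
    _ = _ := by rw [← zpow_add₀ hp.ne']; congr 1; ring

theorem eq_of_sub_mul_norm_le {x : ℚ_[p]} {m : ℤ} {i j : ℕ} (hi : i < p) (hj : j < p)
    (hxi : ‖x - i * (p : ℚ_[p]) ^ (-(m + 1))‖ ≤ (p : ℝ) ^ m)
    (hxj : ‖x - j * (p : ℚ_[p]) ^ (-(m + 1))‖ ≤ (p : ℝ) ^ m) : i = j := by
  have hp : (0 : ℝ) < p := by exact_mod_cast (Fact.out : p.Prime).pos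
  have hp1 : (1 : ℝ) < p := by exact_mod_cast (Fact.out : p.Prime).one_lt
  set c : ℚ_[p] := (p : ℚ_[p]) ^ (-(m + 1)) with hc
  have hcn : ‖c‖ = (p : ℝ) ^ (m + 1) := norm_zpow_prime (m + 1)
  have h1 : ‖(((j : ℤ) - i : ℤ) : ℚ_[p]) * c‖ ≤ (p : ℝ) ^ m := by
    have : (((j : ℤ) - i : ℤ) : ℚ_[p]) * c = (x - i * c) - (x - j * c) := by push_cast; ring
    rw [this]
    rw [sub_eq_add_neg]
    exact (IsUltrametricDist.norm_add_le_max _ _).trans (max_le hxi (by rwa [norm_neg]))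
  rw [norm_mul, hcn, zpow_add_one₀ hp.ne'] at h1
  have h2 : ‖(((j : ℤ) - i : ℤ) : ℚ_[p])‖ < 1 := by
    by_contra! h3
    have h4 : (0 : ℝ) < (p : ℝ) ^ m := by positivity
    nlinarith [mul_le_mul_of_nonneg_right h3 (mul_pos h4 hp).le, mul_pos h4 (sub_pos.mpr hp1)]
  rw [Padic.norm_intCast_lt_one_iff] at h2
  have h3 := Int.eq_zero_of_abs_lt_dvd h2 (by rw [abs_lt]; constructor <;> omega)
  omega

variable (p) in
/-- A product of two balls in `ℚ_p²`. -/
def box (m n : ℤ) : Set (ℚ_[p] × ℚ_[p]) := {t | ‖t.1‖ ≤ (p : ℝ) ^ m ∧ ‖t.2‖ ≤ (p : ℝ) ^ n}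

theorem isClosed_box (m n : ℤ) : IsClosed (box p m n) :=
  (isClosed_le (continuous_norm.comp continuous_fst) continuous_const).inter
    (isClosed_le (continuous_norm.comp continuous_snd) continuous_const)

section Measure

variable [MeasurableSpace (ℚ_[p] × ℚ_[p])] [BorelSpace (ℚ_[p] × ℚ_[p])]
  (μ : Measure (ℚ_[p] × ℚ_[p])) [μ.IsAddLeftInvariant]

theorem measure_eq_mul_of_translates {S T : Set (ℚ_[p] × ℚ_[p])} (hT : MeasurableSet T)
    (v : ℕ → ℚ_[p] × ℚ_[p]) (hS : ∀ t, t ∈ S ↔ ∃ i < p, -v i + t ∈ T)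
    (hv : ∀ t i j, i < p → j < p → -v i + t ∈ T → -v j + t ∈ T → i = j) : μ S = p * μ T := by
  have h : S = ⋃ i ∈ Finset.range p, (fun t => -v i + t) ⁻¹' T := by
    ext t
    rw [hS]
    simp
  rw [h, measure_biUnion_finset]
  · simp [measure_preimage_add]
  · intro i hi j hj hij
    rw [Function.onFun, Set.disjoint_left]
    intro t hti htj
    exact hij (hv t i j (by simpa using hi) (by simpa using hj) hti htj)
  · intro i _
    exact (continuous_const.add continuous_id).measurable hT

theorem measure_box_add_one_left (m n : ℤ) : μ (box p (m + 1) n) = p * μ (box p m n) := by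
  have hp1 : (1 : ℝ) < p := by exact_mod_cast (Fact.out : p.Prime).one_lt
  refine measure_eq_mul_of_translates μ (isClosed_box m n).measurableSet
    (fun i => (i * (p : ℚ_[p]) ^ (-(m + 1)), 0)) (fun t => ?_) (fun t i j hi hj h1 h2 => ?_)
  · constructor
    · rintro ⟨h1, h2⟩
      obtain ⟨i, hi, h⟩ := exists_sub_mul_norm_le h1
      refine ⟨i, hi, ?_, by simpa using h2⟩
      rw [sub_eq_neg_add] at h
      exact h
    · rintro ⟨i, hi, h1, h2⟩
      refine ⟨?_, by simpa using h2⟩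
      have h3 : t.1 = (i * (p : ℚ_[p]) ^ (-(m + 1))) + (-(i * (p : ℚ_[p]) ^ (-(m + 1))) + t.1) := by ring
      rw [h3]
      refine (IsUltrametricDist.norm_add_le_max _ _).trans (max_le ?_ ?_)
      · rw [norm_mul, norm_zpow_prime]
        have := Padic.norm_int_le_one (p := p) i
        rw [Int.cast_natCast] at this
        exact mul_le_of_le_one_left (by positivity) this
      · exact le_trans h1 (zpow_le_zpow_right₀ hp1.le (by omega))
  · refine eq_of_sub_mul_norm_le (x := t.1) (m := m) hi hj ?_ ?_
    · rw [sub_eq_neg_add]; exact h1.1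
    · rw [sub_eq_neg_add]; exact h2.1

theorem measure_box_add_one_right (m n : ℤ) : μ (box p m (n + 1)) = p * μ (box p m n) := by
  have hp1 : (1 : ℝ) < p := by exact_mod_cast (Fact.out : p.Prime).one_lt
  refine measure_eq_mul_of_translates μ (isClosed_box m n).measurableSet
    (fun i => (0, i * (p : ℚ_[p]) ^ (-(n + 1)))) (fun t => ?_) (fun t i j hi hj h1 h2 => ?_)
  · constructor
    · rintro ⟨h1, h2⟩
      obtain ⟨i, hi, h⟩ := exists_sub_mul_norm_le h2
      refine ⟨i, hi, by simpa using h1, ?_⟩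
      rw [sub_eq_neg_add] at h
      exact h
    · rintro ⟨i, hi, h1, h2⟩
      refine ⟨by simpa using h1, ?_⟩
      have h3 : t.2 = (i * (p : ℚ_[p]) ^ (-(n + 1))) + (-(i * (p : ℚ_[p]) ^ (-(n + 1))) + t.2) := by ring
      rw [h3]
      refine (IsUltrametricDist.norm_add_le_max _ _).trans (max_le ?_ ?_)
      · rw [norm_mul, norm_zpow_prime]
        have := Padic.norm_int_le_one (p := p) i
        rw [Int.cast_natCast] at this
        exact mul_le_of_le_one_left (by positivity) this
      · exact le_trans h2 (zpow_le_zpow_right₀ hp1.le (by omega))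
  · refine eq_of_sub_mul_norm_le (x := t.2) (m := n) hi hj ?_ ?_
    · rw [sub_eq_neg_add]; exact h1.2
    · rw [sub_eq_neg_add]; exact h2.2

theorem toReal_natCast_zpow (p : ℕ) (n : ℤ) : ((p : ENNReal) ^ n).toReal = (p : ℝ) ^ n := by
  cases n with
  | ofNat n => simp
  | negSucc n => simp [zpow_negSucc]

theorem eq_zpow_mul_of_step {f : ℤ → ENNReal} {p : ℕ} (hp : p ≠ 0) (h : ∀ n, f (n + 1) = p * f n) (n : ℤ) :
    f n = (p : ENNReal) ^ n * f 0 := by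
  have hp0 : (p : ENNReal) ≠ 0 := by exact_mod_cast hp
  have hpt : (p : ENNReal) ≠ ⊤ := ENNReal.natCast_ne_top p
  induction n using Int.induction_on with
  | zero => simp
  | succ n ih => rw [h, ih, ENNReal.zpow_add hp0 hpt, zpow_one]; ring
  | pred n ih =>
    have h1 := h (-n - 1)
    rw [sub_add_cancel, ih] at h1
    rw [sub_eq_add_neg, ENNReal.zpow_add hp0 hpt, zpow_neg_one, mul_right_comm, h1, mul_comm,
      ← sub_eq_add_neg, ← mul_assoc, ENNReal.inv_mul_cancel hp0 hpt, one_mul]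

theorem measure_box (hμ : μ (Metric.closedBall 0 1) = 1) (m n : ℤ) :
    μ (box p m n) = (p : ENNReal) ^ (m + n) := by
  have hp := (Fact.out : p.Prime).ne_zero
  have hp0 : (p : ENNReal) ≠ 0 := by exact_mod_cast hp
  have hpt : (p : ENNReal) ≠ ⊤ := ENNReal.natCast_ne_top p
  have h0 : box p 0 0 = Metric.closedBall 0 1 := by
    ext t
    simp [box, Prod.norm_def]
  rw [eq_zpow_mul_of_step hp (f := fun m => μ (box p m n)) (fun m => measure_box_add_one_left μ m n) m,
    eq_zpow_mul_of_step hp (f := fun n => μ (box p 0 n)) (fun n => measure_box_add_one_right μ 0 n) n,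
    h0, hμ, mul_one, ENNReal.zpow_add hp0 hpt]

/-- The tail of a geometric series, used to expand a power `q ^ k` over the nested boxes that
contain a given point. -/
theorem hasSum_indicator_geometric {q : ℝ} (h0 : 0 ≤ q) (h1 : q < 1) (k : ℕ) :
    HasSum (fun j : ℕ => if k ≤ j then (1 - q) * q ^ j else 0) (q ^ k) := by
  have h := (hasSum_geometric_of_lt_one h0 h1).mul_left (q ^ k * (1 - q))
  rw [mul_assoc, mul_inv_cancel₀ (by linarith), mul_one] at h
  have hinj : Function.Injective (fun j : ℕ => j + k) := add_left_injective k
  refine (hinj.hasSum_iff (fun j hj => ?_)).mp ?_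
  · rw [if_neg]
    intro hkj
    exact hj ⟨j - k, Nat.sub_add_cancel hkj⟩
  · have e : (fun j : ℕ => if k ≤ j then (1 - q) * q ^ j else 0) ∘ (fun j => j + k) =
        fun j => q ^ k * (1 - q) * q ^ j := by
      ext j
      simp only [Function.comp_apply, Nat.le_add_left, if_true, pow_add]
      ring
    rw [e]
    exact h

/-- The maximum is always a power `p ^ k` with `k ≥ 0`, and a point lies in `box (j - a) (j - 2a)`
exactly when `j ≥ k`. With `q = p⁻³` the integrand `q ^ k` is the sum of `(1 - q) q ^ j` over these
boxes. Their measures are `p ^ (2j - 3a)`, so the integral is a geometric series in `p⁻¹`. -/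
theorem integral_max_pow (hμ : μ (Metric.closedBall 0 1) = 1) (a : ℤ) :
    ∫ t, ((max 1 (max ((p : ℝ) ^ a * ‖t.1‖) ((p : ℝ) ^ (2 * a) * ‖t.2‖))) ^ 3)⁻¹ ∂μ =
      (1 - ((p : ℝ) ^ 3)⁻¹) * (1 - (p : ℝ)⁻¹)⁻¹ * (p : ℝ) ^ (-(3 * a)) := by
  have hp1 : (1 : ℝ) < p := by exact_mod_cast (Fact.out : p.Prime).one_lt
  have hp : (0 : ℝ) < p := by linarith
  set q : ℝ := ((p : ℝ) ^ 3)⁻¹ with hq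
  have hq0 : 0 ≤ q := by positivity
  have hq1 : q < 1 := inv_lt_one_of_one_lt₀ (one_lt_pow₀ hp1 (by norm_num))
  let F : ℕ → ℚ_[p] × ℚ_[p] → ℝ := fun j =>
    (box p (j - a) (j - 2 * a)).indicator fun _ => (1 - q) * q ^ j
  have hmeas : ∀ j : ℕ, μ.real (box p (j - a) (j - 2 * a)) = (p : ℝ) ^ (2 * j) * (p : ℝ) ^ (-(3 * a)) := by
    intro j
    rw [measureReal_def, measure_box μ hμ, toReal_natCast_zpow, 
      ← zpow_natCast, ← zpow_add₀ hp.ne']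
    congr 1
    push_cast
    ring
  have hfin : ∀ j : ℕ, μ (box p (j - a) (j - 2 * a)) ≠ ⊤ := by
    intro j
    rw [measure_box μ hμ]
    exact ENNReal.zpow_ne_top (by exact_mod_cast hp.ne') (ENNReal.natCast_ne_top p) _
  have hint : ∀ j, Integrable (F j) μ := fun j =>
    (integrable_indicator_iff (isClosed_box _ _).measurableSet).mpr
      (integrableOn_const (hs := hfin j))
  have hval : ∀ j, ∫ t, F j t ∂μ = (1 - q) * (p : ℝ) ^ (-(3 * a)) * ((p : ℝ)⁻¹) ^ j := by
    intro j
    rw [integral_indicator_const _ (isClosed_box _ _).measurableSet, hmeas, smul_eq_mul]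
    have : (p : ℝ) ^ (2 * j) * q ^ j = ((p : ℝ)⁻¹) ^ j := by
      rw [pow_mul, ← mul_pow]
      congr 1
      rw [hq]
      field_simp
    rw [← this]
    ring
  have hnorm : ∀ j, ∫ t, ‖F j t‖ ∂μ = (1 - q) * (p : ℝ) ^ (-(3 * a)) * ((p : ℝ)⁻¹) ^ j := by
    intro j
    rw [← hval j]
    congr 1
    ext t
    rw [Real.norm_of_nonneg]
    exact Set.indicator_nonneg (fun _ _ => mul_nonneg (by linarith) (pow_nonneg hq0 j)) t
  have hgeom := (hasSum_geometric_of_lt_one (inv_nonneg.mpr hp.le) (inv_lt_one_of_one_lt₀ hp1)).mul_left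
    ((1 - q) * (p : ℝ) ^ (-(3 * a)))
  have hmain := integral_tsum_of_summable_integral_norm hint (by
    simp_rw [hnorm]
    exact hgeom.summable)
  simp_rw [hval] at hmain
  rw [hgeom.tsum_eq] at hmain
  rw [mul_right_comm, hmain]
  refine integral_congr_ae (Filter.Eventually.of_forall fun t => ?_)
  have hk : ∃ k : ℕ, max 1 (max ((p : ℝ) ^ a * ‖t.1‖) ((p : ℝ) ^ (2 * a) * ‖t.2‖)) = (p : ℝ) ^ k := by
    have hx : ∀ (b : ℤ) (x : ℚ_[p]), (∃ k : ℕ, max 1 ((p : ℝ) ^ b * ‖x‖) = (p : ℝ) ^ k) := by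
      intro b x
      rcases eq_or_ne x 0 with rfl | hx
      · exact ⟨0, by simp⟩
      · rw [Padic.norm_eq_zpow_neg_valuation hx, ← zpow_add₀ hp.ne']
        rcases le_total 0 (b + -x.valuation) with h | h
        · refine ⟨(b + -x.valuation).toNat, ?_⟩
          rw [max_eq_right (one_le_zpow₀ hp1.le h), ← zpow_natCast, Int.toNat_of_nonneg h]
        · exact ⟨0, by rw [max_eq_left (zpow_le_one_of_nonpos₀ hp1.le h), pow_zero]⟩
    obtain ⟨k, hk⟩ := hx a t.1
    obtain ⟨l, hl⟩ := hx (2 * a) t.2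
    refine ⟨max k l, ?_⟩
    have : max 1 (max ((p : ℝ) ^ a * ‖t.1‖) ((p : ℝ) ^ (2 * a) * ‖t.2‖)) =
        max (max 1 ((p : ℝ) ^ a * ‖t.1‖)) (max 1 ((p : ℝ) ^ (2 * a) * ‖t.2‖)) := by
      rw [max_max_max_comm, max_self]
    rw [this, hk, hl]
    exact ((pow_right_mono₀ hp1.le).map_max).symm
  obtain ⟨k, hk⟩ := hk
  have hmem : ∀ j : ℕ, t ∈ box p (j - a) (j - 2 * a) ↔ k ≤ j := by
    intro j
    rw [← pow_le_pow_iff_right₀ hp1, ← hk, max_le_iff, max_le_iff]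
    have h1 : ∀ (b : ℤ) (r : ℝ), (p : ℝ) ^ b * r ≤ (p : ℝ) ^ j ↔ r ≤ (p : ℝ) ^ ((j : ℤ) - b) := by
      intro b r
      rw [zpow_sub₀ hp.ne', zpow_natCast, le_div_iff₀ (by positivity), mul_comm]
    rw [h1, h1]
    simp only [box, Set.mem_ofPred_eq]
    have := one_le_pow₀ hp1.le (n := j)
    tauto
  simp only
  rw [hk, ← pow_mul, mul_comm k 3, pow_mul, ← inv_pow, ← hq,
    ← (hasSum_indicator_geometric hq0 hq1 k).tsum_eq]
  refine tsum_congr fun j => ?_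
  simp only [F, Set.indicator, hmem]

end Measure

end Padic

/-! ### Gauss norms and the local volumes at primes -/

/-- Multiplicativity of the Gauss norm for two linear factors. -/
theorem IsUltrametricDist.max_mul_max_eq {E : Type*} [NormedField E] [IsUltrametricDist E] {α β : ℝ}
    (hα : 0 < α) (hβ : 0 < β) (z w : E) :
    max α (β * ‖z‖) * max α (β * ‖w‖) =
      max (α ^ 2) (max (α * β * ‖z + w‖) (β ^ 2 * ‖z * w‖)) := by
  wlog h : ‖w‖ ≤ ‖z‖ generalizing z w
  · rw [mul_comm, this w z (le_of_not_ge h), add_comm, mul_comm w z]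
  have hz := norm_nonneg z
  have hw := norm_nonneg w
  have hadd : ‖z + w‖ ≤ ‖z‖ := (IsUltrametricDist.norm_add_le_max z w).trans (max_le le_rfl h)
  rw [norm_mul]
  have hαβ := mul_pos hα hβ
  -- With `|w| ≤ |z|` the dominating term on the right is the first if `β|z| ≤ α`, the middle one if
  -- `β|w| ≤ α < β|z|`, and the last if `α < β|w|`.
  rcases le_or_gt (β * ‖z‖) α with h1 | h1
  · have h2 : β * ‖w‖ ≤ α := (mul_le_mul_of_nonneg_left h hβ.le).trans h1
    rw [max_eq_left h1, max_eq_left h2, max_eq_left, pow_two]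
    refine max_le ?_ ?_
    · calc α * β * ‖z + w‖ ≤ α * β * ‖z‖ := by gcongr
        _ = α * (β * ‖z‖) := by ring
        _ ≤ α * α := by gcongr
        _ = _ := by ring
    · calc β ^ 2 * (‖z‖ * ‖w‖) = (β * ‖z‖) * (β * ‖w‖) := by ring
        _ ≤ α * α := by gcongr
        _ = _ := by ring
  · rw [max_eq_right h1.le]
    rcases le_or_gt (β * ‖w‖) α with h2 | h2
    · have hlt : ‖w‖ < ‖z‖ := by
        by_contra! h3
        exact absurd (mul_le_mul_of_nonneg_left h3 hβ.le) (not_le.mpr (h2.trans_lt h1))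
      rw [max_eq_left h2, IsUltrametricDist.norm_add_eq_max_of_norm_ne_norm hlt.ne', max_eq_left h,
        max_eq_left (a := α * β * ‖z‖), max_eq_right]
      · ring
      · nlinarith
      · nlinarith [mul_le_mul_of_nonneg_left h2 (mul_nonneg hβ.le hz)]
    · rw [max_eq_right h2.le, max_eq_right (a := α * β * ‖z + w‖), max_eq_right]
      · ring
      · nlinarith
      · calc α * β * ‖z + w‖ ≤ α * β * ‖z‖ := by gcongr
          _ = α * (β * ‖z‖) := by ring
          _ ≤ (β * ‖w‖) * (β * ‖z‖) := by gcongr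
          _ = _ := by ring

open Polynomial in
theorem exists_aroots_quadratic {K E : Type} [Field K] [Field E] [IsAlgClosed E] [Algebra K E] (t : K × K) :
    ∃ z w : E, (X ^ 2 - C t.1 * X + C t.2 : K[X]).aroots E = {z, w} ∧ z + w = algebraMap K E t.1 ∧
      z * w = algebraMap K E t.2 := by
  have hmon : (X ^ 2 - C t.1 * X + C t.2 : K[X]).Monic := by monicity!
  have hnat : (X ^ 2 - C t.1 * X + C t.2 : K[X]).natDegree = 2 := by compute_degree!
  set P := (X ^ 2 - C t.1 * X + C t.2 : K[X]).map (algebraMap K E) with hP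
  have hcard : P.roots.card = 2 := by
    rw [IsAlgClosed.card_roots_eq_natDegree, hP, hmon.natDegree_map, hnat]
  obtain ⟨z, w, h⟩ := Multiset.card_eq_two.mp hcard
  have hprod := (IsAlgClosed.splits P).eq_prod_roots_of_monic (hmon.map _)
  rw [h] at hprod
  have hexp : P = X ^ 2 - C (algebraMap K E t.1) * X + C (algebraMap K E t.2) := by simp [hP]
  have hprod' : P = (X - C z) * (X - C w) := by simpa using hprod
  rw [hexp] at hprod'
  have hc : (X - C z) * (X - C w) = X ^ 2 - C (z + w) * X + C (z * w) := by
    rw [C_add, C_mul]; ring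
  rw [hc] at hprod'
  refine ⟨z, w, h, ?_, ?_⟩
  · have := congrArg (fun q => q.coeff 1) hprod'
    have h1 : -w + -z = -(algebraMap K E) t.1 := by
      simpa [coeff_X, coeff_C, coeff_X_pow] using this.symm
    linear_combination -h1
  · have := congrArg (fun q => q.coeff 0) hprod'
    simpa [coeff_X, coeff_C, coeff_X_pow] using this.symm

namespace MetrizedLine

variable {n : ℕ} {Λ : MetrizedLine n}

theorem density_eq {K E : Type} [Field K] [NormedField E] [IsAlgClosed E] [Algebra K E] (t : K × K) :
    ∃ z w : E, z + w = algebraMap K E t.1 ∧ z * w = algebraMap K E t.2 ∧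
      Λ.density K (E := E) t = ((Λ.invNorm z * Λ.invNorm w) ^ 3)⁻¹ := by
  obtain ⟨z, w, h, h1, h2⟩ := exists_aroots_quadratic (E := E) t
  refine ⟨z, w, h1, h2, ?_⟩
  unfold density
  rw [h]
  simp [mul_pow, mul_comm]

/-- The local volume of the symmetric square of a line with the metric `max (α, α² |z|)`. -/
theorem localVolume_eq (p : ℕ) [Fact p.Prime] {a : ℤ}
    (hΛ : ∀ z : PadicAlgCl p, Λ.invNorm z = max ((p : ℝ) ^ a) (((p : ℝ) ^ a) ^ 2 * ‖z‖)) :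
    (1 - 1 / (p : ℝ)) * Λ.localVolume p = (((p : ℝ) ^ a) ^ 9)⁻¹ * (1 - ((p : ℝ) ^ 3)⁻¹) := by
  have hp1 : (1 : ℝ) < p := by exact_mod_cast (Fact.out : p.Prime).one_lt
  have hp : (0 : ℝ) < p := by linarith
  set α : ℝ := (p : ℝ) ^ a with hα
  have hα0 : 0 < α := by positivity
  let _ : MeasurableSpace (ℚ_[p] × ℚ_[p]) := borel _
  have : BorelSpace (ℚ_[p] × ℚ_[p]) := ⟨rfl⟩
  -- The Gauss norm expresses the product over the two roots through `t`, so the algebraic closure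
  -- disappears; the factor `α²` is then taken out of the maximum.
  have hdens : ∀ t : ℚ_[p] × ℚ_[p], Λ.density ℚ_[p] (E := PadicAlgCl p) t =
      (α ^ 6)⁻¹ * ((max 1 (max ((p : ℝ) ^ a * ‖t.1‖) ((p : ℝ) ^ (2 * a) * ‖t.2‖))) ^ 3)⁻¹ := by
    intro t
    obtain ⟨z, w, h1, h2, h3⟩ := Λ.density_eq (E := PadicAlgCl p) t
    rw [h3, hΛ, hΛ, IsUltrametricDist.max_mul_max_eq hα0 (by positivity), h1, h2, norm_algebraMap',
      norm_algebraMap', ← mul_inv]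
    congr 1
    have : max (α ^ 2) (max (α * α ^ 2 * ‖t.1‖) ((α ^ 2) ^ 2 * ‖t.2‖)) =
        α ^ 2 * max 1 (max (α * ‖t.1‖) ((p : ℝ) ^ (2 * a) * ‖t.2‖)) := by
      rw [mul_max_of_nonneg _ _ (by positivity), mul_max_of_nonneg _ _ (by positivity), mul_one,
        mul_comm 2 a, zpow_mul, ← hα]
      congr 2
      · ring
      · change _ = α ^ 2 * (α ^ (2 : ℕ) * ‖t.2‖)
        ring
    rw [this, ← hα]
    ring
  have hvol : Λ.localVolume p = ∫ t, Λ.density ℚ_[p] (E := PadicAlgCl p) t ∂(padicPlaneMeasure p) := rfl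
  have : (padicPlaneMeasure p).IsAddLeftInvariant := by
    unfold padicPlaneMeasure
    infer_instance
  have hone : padicPlaneMeasure p (Metric.closedBall 0 1) = 1 :=
    Measure.addHaarMeasure_self (K₀ := { carrier := Metric.closedBall (0 : ℚ_[p] × ℚ_[p]) 1
                                         isCompact' := isCompact_closedBall 0 1
                                         interior_nonempty' := ⟨0, mem_interior_iff_mem_nhds.mpr
                                          (Metric.closedBall_mem_nhds 0 one_pos)⟩ })
  rw [hvol]
  simp_rw [hdens]
  rw [integral_const_mul, Padic.integral_max_pow _ hone]
  have h4 : (p : ℝ) ^ (-(3 * a)) = (α ^ 3)⁻¹ := by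
    rw [zpow_neg, mul_comm, zpow_mul]
    rfl
  have h5 : 1 - (p : ℝ)⁻¹ ≠ 0 := (sub_pos.mpr (inv_lt_one_of_one_lt₀ hp1)).ne'
  rw [h4, one_div]
  calc _ = ((1 - (p : ℝ)⁻¹) * (1 - (p : ℝ)⁻¹)⁻¹) * (((α ^ 6)⁻¹ * (α ^ 3)⁻¹) * (1 - ((p : ℝ) ^ 3)⁻¹)) := by ring
    _ = _ := by rw [mul_inv_cancel₀ h5, one_mul, ← mul_inv, ← pow_add]

end MetrizedLine

/-! ### The size of a pair of complex points and the real volume -/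

open MeasureTheory

theorem Complex.real_or_conj_of_add_mul_real {u v : ℂ} (h1 : (u + v).im = 0) (h2 : (u * v).im = 0) :
    (u.im = 0 ∧ v.im = 0) ∨ v = (starRingEnd ℂ) u := by
  rw [Complex.add_im] at h1
  rw [Complex.mul_im] at h2
  have hv : v.im = -u.im := by linarith
  rw [hv] at h2
  have h3 : u.im * (v.re - u.re) = 0 := by linarith
  rcases mul_eq_zero.mp h3 with h | h
  · exact Or.inl ⟨h, by rw [hv, h, neg_zero]⟩
  · right
    apply Complex.ext
    · rw [Complex.conj_re]; linarith
    · rw [Complex.conj_im, hv]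

/-- The right-hand side says that `(T - u)(T - v)` and `(T + u)(T + v)` are non-negative. When `|uv|
≤ T²`, this excludes that both numbers exceed `T` or both lie below `-T`, so all four factors are
non-negative. -/
theorem Real.max_abs_le_iff_of_mul_le {u v T : ℝ} (hT : 0 < T) (h : |u * v| ≤ T ^ 2) :
    (|u| ≤ T ∧ |v| ≤ T) ↔ |u + v| ≤ T + u * v / T := by
  have hmul : |u + v| ≤ T + u * v / T ↔ |u + v| * T ≤ T ^ 2 + u * v := by
    rw [← mul_le_mul_iff_left₀ hT, add_mul, div_mul_cancel₀ _ hT.ne', pow_two]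
  rw [hmul]
  obtain ⟨h1, h2⟩ := abs_le.mp h
  constructor
  · rintro ⟨hu, hv⟩
    obtain ⟨hu1, hu2⟩ := abs_le.mp hu
    obtain ⟨hv1, hv2⟩ := abs_le.mp hv
    rcases abs_cases (u + v) with ⟨e, -⟩ | ⟨e, -⟩ <;> rw [e] <;> nlinarith
  · intro h3
    have h4 : 0 ≤ (T - u) * (T - v) := by nlinarith [le_abs_self (u + v)]
    have h5 : 0 ≤ (T + u) * (T + v) := by nlinarith [neg_abs_le (u + v)]
    have aux : ∀ a b : ℝ, a * b ≤ T ^ 2 → 0 ≤ (T - a) * (T - b) → a ≤ T := by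
      intro a b hab h
      by_contra! ha
      have hb : T ≤ b := by
        by_contra! hb
        nlinarith [mul_pos (sub_pos.mpr ha) (sub_pos.mpr hb)]
      nlinarith [mul_le_mul_of_nonneg_left hb hT.le, mul_pos (sub_pos.mpr ha) (hT.trans_le hb)]
    refine ⟨abs_le.mpr ⟨?_, aux u v h2 h4⟩, abs_le.mpr ⟨?_, aux v u (by rwa [mul_comm]) (by rwa [mul_comm])⟩⟩
    · have := aux (-u) (-v) (by linarith) (by linarith)
      linarith
    · have := aux (-v) (-u) (by linarith) (by linarith)
      linarith

/-- Numbers with real sum and product are real or conjugate. For conjugate ones both sides hold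
automatically: `|u|² = d ≤ T²`, and `(T - |u|)² ≥ 0` bounds the sum. -/
theorem Complex.max_norm_le_iff_of_mul_le {u v : ℂ} {b d T : ℝ} (hT : 0 < T) (h1 : u + v = b)
    (h2 : u * v = d) (h : |d| ≤ T ^ 2) : (‖u‖ ≤ T ∧ ‖v‖ ≤ T) ↔ |b| ≤ T + d / T := by
  rcases Complex.real_or_conj_of_add_mul_real (u := u) (v := v) (by rw [h1]; simp) (by rw [h2]; simp)
    with ⟨hu, hv⟩ | hv
  · have hu' : u = (u.re : ℂ) := Complex.ext rfl (by simpa using hu)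
    have hv' : v = (v.re : ℂ) := Complex.ext rfl (by simpa using hv)
    rw [hu', hv'] at h1 h2
    have hb : u.re + v.re = b := by exact_mod_cast h1
    have hd : u.re * v.re = d := by exact_mod_cast h2
    rw [hu', hv', Complex.norm_real, Complex.norm_real, Real.norm_eq_abs, Real.norm_eq_abs, ← hb, ← hd]
    exact Real.max_abs_le_iff_of_mul_le hT (by rwa [hd])
  · have hd : ‖u‖ ^ 2 = d := by
      rw [hv, Complex.mul_conj, Complex.normSq_eq_norm_sq] at h2
      exact_mod_cast h2
    have hb : |b| ≤ 2 * ‖u‖ := by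
      have : |b| = ‖u + v‖ := by rw [h1, Complex.norm_real, Real.norm_eq_abs]
      rw [this]
      refine (norm_add_le _ _).trans ?_
      rw [hv, Complex.norm_conj]
      linarith
    have hu : ‖u‖ ≤ T := by
      rw [← abs_of_nonneg (norm_nonneg u)]
      apply abs_le_of_sq_le_sq _ hT.le
      rw [hd]
      exact (le_abs_self d).trans h
    have hvn : ‖v‖ = ‖u‖ := by rw [hv, Complex.norm_conj]
    refine ⟨fun _ => hb.trans ?_, fun _ => ⟨hu, by rwa [hvn]⟩⟩
    rw [← hd, ← mul_le_mul_iff_left₀ hT, add_mul, div_mul_cancel₀ _ hT.ne']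
    nlinarith [sq_nonneg (T - ‖u‖)]

/-- The criterion for `max |τᵢ| · max |ωⱼ| ≤ T` in terms of the real symmetric functions of `τ` and
`ω`. -/
theorem Complex.max_mul_max_le_iff {τ₀ τ₁ ω₀ ω₁ : ℂ} {a b c T : ℝ} (hT : 0 < T) (ha : τ₀ * ω₀ = a)
    (hb : τ₀ * ω₁ + τ₁ * ω₀ = b) (hc : τ₁ * ω₁ = c) :
    max ‖τ₀‖ ‖τ₁‖ * max ‖ω₀‖ ‖ω₁‖ ≤ T ↔ |a| ≤ T ∧ |c| ≤ T ∧ |b| ≤ T + a * c / T := by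
  have ha' : ‖τ₀‖ * ‖ω₀‖ = |a| := by rw [← norm_mul, ha, Complex.norm_real, Real.norm_eq_abs]
  have hc' : ‖τ₁‖ * ‖ω₁‖ = |c| := by rw [← norm_mul, hc, Complex.norm_real, Real.norm_eq_abs]
  -- The product of maxima is the largest of four products. Two of them are `a` and `c` in absolute
  -- value; the other two have sum `b` and product `a c`.
  have hd : (τ₀ * ω₁) * (τ₁ * ω₀) = ((a * c : ℝ) : ℂ) := by
    push_cast
    rw [← ha, ← hc]
    ring
  have hmax : max ‖τ₀‖ ‖τ₁‖ * max ‖ω₀‖ ‖ω₁‖ ≤ T ↔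
      (|a| ≤ T ∧ |c| ≤ T) ∧ ‖τ₀ * ω₁‖ ≤ T ∧ ‖τ₁ * ω₀‖ ≤ T := by
    rw [max_mul_of_nonneg _ _ (le_max_of_le_left (norm_nonneg _)), mul_max_of_nonneg _ _ (norm_nonneg _),
      mul_max_of_nonneg _ _ (norm_nonneg _), max_le_iff, max_le_iff, max_le_iff, ha', hc', norm_mul, norm_mul]
    tauto
  rw [hmax, and_assoc]
  refine and_congr_right fun h1 => and_congr_right fun h2 => ?_
  refine Complex.max_norm_le_iff_of_mul_le hT hb hd ?_
  rw [abs_mul, pow_two]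
  exact mul_le_mul h1 h2 (abs_nonneg _) hT.le

theorem measurableSet_symmetric_region (A B C T : ℝ) :
    MeasurableSet {t : ℝ × ℝ | |C * t.2| ≤ T ∧ |B * t.1| ≤ T + A * (C * t.2) / T} := by
  have h1 : IsClosed {t : ℝ × ℝ | |C * t.2| ≤ T} := isClosed_le (by fun_prop) (by fun_prop)
  have h2 : IsClosed {t : ℝ × ℝ | |B * t.1| ≤ T + A * (C * t.2) / T} :=
    isClosed_le (by fun_prop) (by fun_prop)
  exact (h1.inter h2).measurableSet

/-- The area of the region where the symmetric product of the norms `max (α, β |z|)` is at most `T`. -/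
theorem volume_symmetric_region {A B C T : ℝ} (hB : 0 < B) (hC : 0 < C) (hAT : A ≤ T) (hT : 0 < T) (hA : 0 ≤ A) :
    volume {t : ℝ × ℝ | |C * t.2| ≤ T ∧ |B * t.1| ≤ T + A * (C * t.2) / T} =
      ENNReal.ofReal (4 * T ^ 2 / (B * C)) := by
  have hmeas := measurableSet_symmetric_region A B C T
  rw [Measure.volume_eq_prod, Measure.prod_apply_symm hmeas]
  -- The horizontal slices are intervals whose length is affine in `s`; the linear part is odd and
  -- contributes nothing.
  have hslice : ∀ s : ℝ, volume ((fun x : ℝ => (x, s)) ⁻¹'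
      {t : ℝ × ℝ | |C * t.2| ≤ T ∧ |B * t.1| ≤ T + A * (C * t.2) / T}) =
      (Set.Icc (-(T / C)) (T / C)).indicator (fun s => ENNReal.ofReal (2 * (T + A * (C * s) / T) / B)) s := by
    intro s
    have hs : |C * s| ≤ T ↔ s ∈ Set.Icc (-(T / C)) (T / C) := by
      rw [abs_mul, abs_of_pos hC, mul_comm, ← le_div_iff₀ hC, abs_le]
      rfl
    by_cases h : s ∈ Set.Icc (-(T / C)) (T / C)
    · rw [Set.indicator_of_mem h]
      have : ((fun x : ℝ => (x, s)) ⁻¹' {t : ℝ × ℝ | |C * t.2| ≤ T ∧ |B * t.1| ≤ T + A * (C * t.2) / T}) =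
          Set.Icc (-((T + A * (C * s) / T) / B)) ((T + A * (C * s) / T) / B) := by
        ext x
        simp only [Set.mem_preimage, Set.mem_ofPred_eq, hs.mpr h, true_and]
        rw [abs_mul, abs_of_pos hB, mul_comm, ← le_div_iff₀ hB, abs_le]
        rfl
      rw [this, Real.volume_Icc]
      congr 1
      ring
    · rw [Set.indicator_of_notMem h]
      have : ((fun x : ℝ => (x, s)) ⁻¹' {t : ℝ × ℝ | |C * t.2| ≤ T ∧ |B * t.1| ≤ T + A * (C * t.2) / T}) = ∅ := by
        ext x
        simp only [Set.mem_preimage, Set.mem_ofPred_eq, Set.mem_empty_iff_false, iff_false]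
        exact fun h' => h (hs.mp h'.1)
      rw [this, measure_empty]
  simp_rw [hslice]
  have hTC : -(T / C) ≤ T / C := by
    have : 0 < T / C := by positivity
    linarith
  rw [lintegral_indicator measurableSet_Icc, ← ofReal_integral_eq_lintegral_ofReal]
  · congr 1
    rw [integral_Icc_eq_integral_Ioc, ← intervalIntegral.integral_of_le hTC]
    have : (fun s => 2 * (T + A * (C * s) / T) / B) = fun s => 2 * T / B + (2 * A * C / (T * B)) * s := by
      ext s
      field_simp
    rw [this, intervalIntegral.integral_add (Continuous.intervalIntegrable (by fun_prop) _ _)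
        (Continuous.intervalIntegrable (by fun_prop) _ _), intervalIntegral.integral_const,
      intervalIntegral.integral_const_mul, integral_id]
    simp only [smul_eq_mul]
    field_simp
    ring
  · exact (Continuous.integrableOn_Icc (by fun_prop))
  · refine (ae_restrict_iff' measurableSet_Icc).mpr (Filter.Eventually.of_forall fun s hs => ?_)
    have h1 : -T ≤ C * s := by
      have := (mul_le_mul_of_nonneg_left hs.1 hC.le)
      rwa [mul_neg, mul_div_cancel₀ _ hC.ne'] at this
    -- The hypothesis `A ≤ T` keeps the length of the slice non-negative.
    have h2 : 0 ≤ T + A * (C * s) / T := by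
      have : -A ≤ A * (C * s) / T := by
        rw [le_div_iff₀ hT]
        nlinarith
      linarith
    have : 0 ≤ 2 * (T + A * (C * s) / T) / B := by positivity
    exact this

namespace MetrizedLine

variable {n : ℕ} {Λ : MetrizedLine n}

/-- The real volume of the symmetric square of a line with the metric `max (α, α² |z|)`. -/
theorem realVolume_eq {α : ℝ} (hα : 0 < α) (hΛ : ∀ z : ℂ, Λ.invNorm z = max α (α ^ 2 * ‖z‖)) :
    Λ.realVolume = 12 * (α ^ 9)⁻¹ := by
  set f : ℝ × ℝ → ℝ := fun t => Λ.density ℝ (E := ℂ) t with hf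
  have hf0 : ∀ t, 0 < f t := by
    intro t
    obtain ⟨z, w, -, -, h3⟩ := Λ.density_eq (E := ℂ) t
    have hpos : ∀ z : ℂ, 0 < Λ.invNorm z := fun z => by
      rw [hΛ]
      exact lt_max_of_lt_left hα
    have := hpos z
    have := hpos w
    rw [hf]
    simp only
    rw [h3]
    positivity
  -- The superlevel set at `T⁻³` consists of the pairs of size at most `T`; it is empty for `T <
  -- α²`, the least possible size.
  have hset : ∀ T : ℝ, 0 < T → {t | (T ^ 3)⁻¹ ≤ f t} = if α ^ 2 ≤ T then
      {t : ℝ × ℝ | |α ^ 4 * t.2| ≤ T ∧ |α ^ 3 * t.1| ≤ T + α ^ 2 * (α ^ 4 * t.2) / T} else ∅ := by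
    intro T hT
    have hiff : ∀ t, (T ^ 3)⁻¹ ≤ f t ↔ |α ^ 2| ≤ T ∧ |α ^ 4 * t.2| ≤ T ∧
        |α ^ 3 * t.1| ≤ T + α ^ 2 * (α ^ 4 * t.2) / T := by
      intro t
      obtain ⟨z, w, h1, h2, h3⟩ := Λ.density_eq (E := ℂ) t
      have hM : 0 < Λ.invNorm z * Λ.invNorm w := by
        rw [hΛ, hΛ]
        exact mul_pos (lt_max_of_lt_left hα) (lt_max_of_lt_left hα)
      change _ ≤ Λ.density ℝ t ↔ _
      rw [h3, inv_le_inv₀ (by positivity) (by positivity), pow_le_pow_iff_left₀ hM.le hT.le (by norm_num)]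
      have key := Complex.max_mul_max_le_iff (τ₀ := α) (τ₁ := (α : ℂ) ^ 2 * z) (ω₀ := α)
        (ω₁ := (α : ℂ) ^ 2 * w) (a := α ^ 2) (b := α ^ 3 * t.1) (c := α ^ 4 * t.2) hT (by push_cast; ring)
        (by
          push_cast
          rw [show ((t.1 : ℝ) : ℂ) = z + w from h1.symm]
          ring)
        (by
          push_cast
          rw [show ((t.2 : ℝ) : ℂ) = z * w from h2.symm]
          ring)
      rw [← key, hΛ, hΛ, norm_mul, norm_mul, norm_pow, Complex.norm_real, Real.norm_eq_abs, abs_of_pos hα]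
    ext t
    rw [Set.mem_ofPred_eq, hiff, abs_of_pos (by positivity : 0 < α ^ 2)]
    split_ifs with h
    · simp [h]
    · simp [h]
  have hlevel : ∀ s : ℝ, 0 < s → {t | s ≤ f t} = {t | (((s ^ (-(1 / 3) : ℝ)) ^ 3)⁻¹ : ℝ) ≤ f t} := by
    intro s hs
    rw [← Real.rpow_natCast, ← Real.rpow_mul hs.le]
    norm_num
    rw [Real.rpow_neg_one, inv_inv]
  -- The density is defined through roots; its measurability is read off the superlevel sets.
  have hmeas : Measurable f := by
    refine measurable_of_Ici fun s => ?_
    change MeasurableSet {t | s ≤ f t}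
    rcases le_or_gt s 0 with hs | hs
    · have : {t | s ≤ f t} = Set.univ := by
        ext t
        simp [hs.trans (hf0 t).le]
      rw [this]
      exact MeasurableSet.univ
    · rw [hlevel s hs, hset _ (by positivity)]
      split_ifs
      · exact measurableSet_symmetric_region _ _ _ _
      · exact MeasurableSet.empty
  have hα6 : 0 < (α ^ 6)⁻¹ := by positivity
  -- Layer-cake formula: at level `s` the parameter is `T = s ^ (-1/3)` and the area is `4 T² / α⁷`.
  -- Integrating `4 α⁻⁷ s ^ (-2/3)` up to `α⁻⁶` gives `12 α⁻⁹`.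
  have hmain : ∫⁻ t, ENNReal.ofReal (f t) = ENNReal.ofReal (12 * (α ^ 9)⁻¹) := by
    rw [lintegral_eq_lintegral_meas_le _ (Filter.Eventually.of_forall fun t => (hf0 t).le) hmeas.aemeasurable]
    have h1 : ∀ s ∈ Set.Ioi (0 : ℝ), volume {t | s ≤ f t} =
        (Set.Ioc 0 (α ^ 6)⁻¹).indicator
          (fun s => ENNReal.ofReal (4 * (α ^ 7)⁻¹ * s ^ (-(2 / 3) : ℝ))) s := by
      intro s hs
      have hs : 0 < s := hs
      rw [hlevel s hs, hset _ (by positivity)]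
      have hcond : α ^ 2 ≤ s ^ (-(1 / 3) : ℝ) ↔ s ≤ (α ^ 6)⁻¹ := by
        rw [← pow_le_pow_iff_left₀ (by positivity) (by positivity) (by norm_num : (3 : ℕ) ≠ 0),
          ← Real.rpow_natCast (s ^ _), ← Real.rpow_mul hs.le, le_inv_comm₀ hs (by positivity), ← pow_mul]
        norm_num
        rw [Real.rpow_neg_one]
      split_ifs with h' <;> have h := h' <;> rw [hcond] at h
      · rw [Set.indicator_of_mem (show s ∈ Set.Ioc 0 (α ^ 6)⁻¹ from ⟨hs, h⟩),
          volume_symmetric_region (by positivity) (by positivity) h' (by positivity) (by positivity)]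
        congr 1
        rw [← Real.rpow_natCast (s ^ _), ← Real.rpow_mul hs.le]
        norm_num
        field_simp
      · rw [Set.indicator_of_notMem (fun h' => h h'.2), measure_empty]
    rw [setLIntegral_congr_fun measurableSet_Ioi h1, setLIntegral_indicator measurableSet_Ioc,
      Set.inter_eq_left.mpr (fun s hs => hs.1)]
    have hint : IntervalIntegrable (fun s : ℝ => 4 * (α ^ 7)⁻¹ * s ^ (-(2 / 3) : ℝ)) volume 0 (α ^ 6)⁻¹ :=
      (intervalIntegral.intervalIntegrable_rpow' (by norm_num)).const_mul _
    rw [← ofReal_integral_eq_lintegral_ofReal]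
    · rw [← intervalIntegral.integral_of_le hα6.le, intervalIntegral.integral_const_mul,
        integral_rpow (Or.inl (by norm_num))]
      congr 1
      have h2 : ((α ^ 6)⁻¹ : ℝ) ^ ((-(2 / 3) + 1 : ℝ)) = (α ^ 2)⁻¹ := by
        rw [Real.inv_rpow (by positivity), ← Real.rpow_natCast, ← Real.rpow_mul hα.le]
        norm_num
      rw [h2, Real.zero_rpow (by norm_num)]
      norm_num
      field_simp
      norm_num
    · exact (intervalIntegrable_iff_integrableOn_Ioc_of_le hα6.le).mp hint
    · refine (ae_restrict_iff' measurableSet_Ioc).mpr (Filter.Eventually.of_forall fun s hs => ?_)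
      have : 0 < s := hs.1
      change 0 ≤ 4 * (α ^ 7)⁻¹ * s ^ (-(2 / 3) : ℝ)
      positivity
  unfold realVolume
  rw [integral_eq_lintegral_of_nonneg_ae (Filter.Eventually.of_forall fun t => (hf0 t).le)
    hmeas.aestronglyMeasurable, hmain, ENNReal.toReal_ofReal (by positivity)]

end MetrizedLine

/-! ### Primitive vectors, the product formula and the Batyrev–Tschinkel constants -/

open MeasureTheory

section Primitive

variable {n : ℕ}

theorem exists_primitive_smul {y : Fin n → ℚ} (hy : y ≠ 0) :
    ∃ x : Fin n → ℤ, Finset.univ.gcd x = 1 ∧ ∃ c : ℚ, c ≠ 0 ∧ y = c • (fun i => (x i : ℚ)) := by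
  obtain ⟨i₀, hi₀⟩ := Function.ne_iff.mp hy
  obtain ⟨N, hN⟩ := IsLocalization.exist_integer_multiples_of_finset (nonZeroDivisors ℤ)
    (Finset.univ.image y)
  have hN' : ∀ i, ∃ z : ℤ, (z : ℚ) = (N : ℤ) * y i := fun i => by
    obtain ⟨z, hz⟩ := hN (y i) (Finset.mem_image_of_mem y (Finset.mem_univ i))
    refine ⟨z, ?_⟩
    simpa [Algebra.smul_def] using hz
  choose z hz using hN'
  have hN0 : ((N : ℤ) : ℚ) ≠ 0 := by
    exact_mod_cast nonZeroDivisors.coe_ne_zero N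
  obtain ⟨x, hx, hx1⟩ := Finset.extract_gcd z ⟨i₀, Finset.mem_univ _⟩
  have hy' : ∀ i, y i = ((Finset.univ.gcd z : ℤ) : ℚ) / (N : ℤ) * x i := fun i => by
    have h1 := hz i
    rw [hx i (Finset.mem_univ i)] at h1
    push_cast at h1
    rw [div_mul_eq_mul_div, h1, mul_div_cancel_left₀ _ hN0]
  refine ⟨x, hx1, _, ?_, funext hy'⟩
  intro h0
  apply hi₀
  rw [hy', h0, zero_mul]
  rfl

theorem ne_zero_of_primitive {x : Fin n → ℤ} (hx : Finset.univ.gcd x = 1) : x ≠ 0 := by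
  rintro rfl
  have : Finset.univ.gcd (0 : Fin n → ℤ) = 0 := Finset.gcd_eq_zero_iff.mpr (by simp)
  rw [this] at hx
  exact zero_ne_one hx

theorem nonempty_of_primitive {x : Fin n → ℤ} (hx : Finset.univ.gcd x = 1) : Nonempty (Fin n) := by
  obtain ⟨i, -⟩ := Function.ne_iff.mp (ne_zero_of_primitive hx)
  exact ⟨i⟩

theorem norm_int_vec_eq [Nonempty (Fin n)] (x : Fin n → ℤ) : ‖x‖ = ((⨆ i, |x i| : ℤ) : ℝ) := by
  apply le_antisymm
  · refine (pi_norm_le_iff_of_nonneg ?_).mpr fun i => ?_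
    · have : 0 ≤ ⨆ i, |x i| := (abs_nonneg (x (Classical.arbitrary _))).trans
        (le_ciSup (f := fun i => |x i|) (Finite.bddAbove_range _) _)
      exact_mod_cast this
    · rw [Int.norm_eq_abs]
      exact_mod_cast le_ciSup (f := fun i => |x i|) (Finite.bddAbove_range _) i
  · obtain ⟨i, hi⟩ := exists_eq_ciSup_of_finite (f := fun i => |x i|)
    rw [← hi]
    have := norm_le_pi_norm x i
    rw [Int.norm_eq_abs] at this
    exact_mod_cast this

theorem mulHeight_of_primitive {x : Fin n → ℤ} (hx : Finset.univ.gcd x = 1) {c : ℚ} (hc : c ≠ 0) :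
    Height.mulHeight (c • fun i => (x i : ℚ)) = ‖x‖ := by
  have := nonempty_of_primitive hx
  rw [Height.mulHeight_smul_eq_mulHeight _ hc, norm_int_vec_eq]
  exact Rat.mulHeight_eq_max_abs_of_gcd_eq_one hx

theorem one_le_norm_of_ne_zero {x : Fin n → ℤ} (hx : x ≠ 0) : 1 ≤ ‖x‖ := by
  obtain ⟨i, hi⟩ := Function.ne_iff.mp hx
  refine le_trans ?_ (norm_le_pi_norm x i)
  rw [Int.norm_eq_abs]
  exact_mod_cast Int.one_le_abs hi

/-- A primitive integral representative of a rational point. -/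
def primRep (y : Projectivization ℚ (Fin n → ℚ)) : Fin n → ℤ :=
  (exists_primitive_smul y.rep_nonzero).choose

theorem primRep_primitive (y : Projectivization ℚ (Fin n → ℚ)) : Finset.univ.gcd (primRep y) = 1 :=
  (exists_primitive_smul y.rep_nonzero).choose_spec.1

theorem exists_rep_eq (y : Projectivization ℚ (Fin n → ℚ)) :
    ∃ c : ℚ, c ≠ 0 ∧ y.rep = c • fun i => (primRep y i : ℚ) :=
  (exists_primitive_smul y.rep_nonzero).choose_spec.2

theorem primRep_injective : Function.Injective (primRep (n := n)) := by
  intro y z h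
  obtain ⟨c, hc, hy⟩ := exists_rep_eq y
  obtain ⟨d, hd, hz⟩ := exists_rep_eq z
  rw [← y.mk_rep, ← z.mk_rep, Projectivization.mk_eq_mk_iff']
  refine ⟨c / d, ?_⟩
  rw [hy, hz, h, smul_smul, div_mul_cancel₀ _ hd]

theorem mulHeight_rep (y : Projectivization ℚ (Fin n → ℚ)) : Height.mulHeight y.rep = ‖primRep y‖ := by
  obtain ⟨c, hc, hy⟩ := exists_rep_eq y
  rw [hy]
  exact mulHeight_of_primitive (primRep_primitive y) hc

/-- Primitive representatives embed the projective line into the non-zero vectors of `ℤ²`, and the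
height is the norm of the representative, so the sum is dominated by an Eisenstein series. -/
theorem summable_mulHeight_rep_pow {k : ℕ} (hk : 2 < k) :
    Summable fun y : Projectivization ℚ (Fin 2 → ℚ) => (Height.mulHeight y.rep ^ k)⁻¹ := by
  have h := (EisensteinSeries.summable_one_div_norm_rpow (k := k) (by exact_mod_cast hk)).comp_injective
    (primRep_injective (n := 2))
  refine h.congr fun y => ?_
  rw [Function.comp_apply, mulHeight_rep, Real.rpow_neg (norm_nonneg _), Real.rpow_natCast]

end Primitive

section Adelic

theorem hasProd_padicNorm_nat {m : ℕ} (hm : m ≠ 0) :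
    HasProd (fun p : Nat.Primes => ((padicNorm p m : ℚ) : ℝ)) ((m : ℝ)⁻¹) := by
  induction m using Nat.recOnMul with
  | zero => exact absurd rfl hm
  | one =>
    simp only [Nat.cast_one, padicNorm.one, Rat.cast_one, inv_one]
    exact hasProd_one
  | prime q hq =>
    have : Fact q.Prime := ⟨hq⟩
    have h := hasProd_single (f := fun p : Nat.Primes => ((padicNorm p q : ℚ) : ℝ)) ⟨q, hq⟩ (fun p hp => by
      have : Fact (p : ℕ).Prime := ⟨p.2⟩
      rw [padicNorm.padicNorm_of_prime_of_ne, Rat.cast_one]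
      rintro h
      exact hp (Subtype.ext h))
    simpa [padicNorm.padicNorm_p hq.one_lt] using h
  | mul a b iha ihb =>
    obtain ⟨ha, hb⟩ := mul_ne_zero_iff.mp hm
    have h := (iha ha).mul (ihb hb)
    push_cast
    rw [mul_inv]
    refine h.congr_fun fun p => ?_
    have : Fact (p : ℕ).Prime := ⟨p.2⟩
    rw [padicNorm.mul, Rat.cast_mul]

/-- The product formula, from multiplicativity and the case of a prime. -/
theorem hasProd_padicNorm {c : ℚ} (hc : c ≠ 0) :
    HasProd (fun p : Nat.Primes => ((padicNorm p c : ℚ) : ℝ)) (|(c : ℝ)|⁻¹) := by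
  have h1 := hasProd_padicNorm_nat (Int.natAbs_ne_zero.mpr (Rat.num_ne_zero.mpr hc))
  have h2 := (hasProd_padicNorm_nat c.den_ne_zero).inv₀
    (inv_ne_zero (Nat.cast_ne_zero.mpr c.den_ne_zero))
  have h3 : (((c.num.natAbs : ℕ) : ℝ)⁻¹ * ((c.den : ℝ)⁻¹)⁻¹) = |(c : ℝ)|⁻¹ := by
    rw [Rat.cast_def c, abs_div, Nat.cast_natAbs, Int.cast_abs, Nat.abs_cast, inv_div, inv_inv]
    field_simp
  rw [← h3]
  refine (h1.mul h2).congr_fun fun p => ?_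
  have : Fact (p : ℕ).Prime := ⟨p.2⟩
  have h4 : padicNorm p (c.num.natAbs : ℕ) = padicNorm p c.num := by
    rcases Int.natAbs_eq c.num with h | h
    · conv_rhs => rw [h]
      simp
    · conv_rhs => rw [h]
      simp
  conv_lhs => rw [← Rat.num_div_den c]
  rw [padicNorm.div, Rat.cast_div, div_eq_mul_inv, h4]

theorem hasProd_euler_three : HasProd (fun p : Nat.Primes => 1 - (((p : ℕ) : ℝ) ^ 3)⁻¹)
    (∑' m : ℕ, 1 / ((m : ℝ) + 1) ^ 3)⁻¹ := by
  let f : ℕ →*₀ ℝ :=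
    { toFun := fun n => ((n : ℝ) ^ 3)⁻¹
      map_zero' := by simp
      map_one' := by simp
      map_mul' := fun a b => by push_cast; rw [mul_pow, mul_inv] }
  have hs : Summable fun n : ℕ => ((n : ℝ) ^ 3)⁻¹ := Real.summable_nat_pow_inv.mpr (by norm_num)
  have h := EulerProduct.eulerProduct_completely_multiplicative_hasProd (f := f) (by
    refine hs.congr fun n => ?_
    rw [Real.norm_of_nonneg]
    · rfl
    · exact inv_nonneg.mpr (by positivity))
  have hsum : ∑' n, f n = ∑' m : ℕ, 1 / ((m : ℝ) + 1) ^ 3 := by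
    change ∑' n : ℕ, ((n : ℝ) ^ 3)⁻¹ = _
    rw [hs.tsum_eq_zero_add]
    simp
  have hpos : ∑' n, f n ≠ 0 := by
    have h1 := hs.le_tsum 1 (fun j _ => by positivity)
    change ∑' n : ℕ, ((n : ℝ) ^ 3)⁻¹ ≠ 0
    have : (1 : ℝ) ≤ ∑' n : ℕ, ((n : ℝ) ^ 3)⁻¹ := by simpa using h1
    linarith
  have h' := h.inv₀ hpos
  rw [hsum] at h'
  refine h'.congr_fun fun p => ?_
  rw [inv_inv]
  rfl

end Adelic

namespace MetrizedLine

variable {n : ℕ} {Λ : MetrizedLine n}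

/-- The volumes carry the factors `α⁻⁹` with `α = |c|_p` at the primes and `α = |c| H` at the real
place; by the product formula they multiply to `H⁻⁹`. The convergence factors leave the Euler
product of `1/ζ(3)`, and `γ δ / a = 1/3` turns the real `12` into `4`. -/
theorem btConstant_eq (hΛ : Λ.boundedSections = symSquareSections) {c : ℚ} (hc : c ≠ 0) {H : ℝ} (hH : 0 < H)
    (hp : ∀ (p : ℕ) [Fact p.Prime] (z : PadicAlgCl p),
      Λ.invNorm z = max ((padicNorm p c : ℚ) : ℝ) (((padicNorm p c : ℚ) : ℝ) ^ 2 * ‖z‖))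
    (hr : ∀ z : ℂ, Λ.invNorm z = max (|(c : ℝ)| * H) ((|(c : ℝ)| * H) ^ 2 * ‖z‖)) :
    Λ.btConstant = 4 / (∑' m : ℕ, 1 / ((m : ℝ) + 1) ^ 3) / H ^ 9 := by
  have hc' : 0 < |(c : ℝ)| := abs_pos.mpr (Rat.cast_ne_zero.mpr hc)
  have hprod : HasProd (fun p : Nat.Primes =>
      haveI : Fact (p : ℕ).Prime := ⟨p.2⟩
      (1 - 1 / (p : ℝ)) ^ Module.finrank ℤ Λ.GeomPic * Λ.localVolume p)
      (|(c : ℝ)| ^ 9 * (∑' m : ℕ, 1 / ((m : ℝ) + 1) ^ 3)⁻¹) := by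
    have h1 := ((hasProd_padicNorm hc).pow 9).inv₀ (pow_ne_zero 9 (inv_ne_zero hc'.ne'))
    rw [inv_pow, inv_inv] at h1
    refine (h1.mul hasProd_euler_three).congr_fun fun p => ?_
    have : Fact (p : ℕ).Prime := ⟨p.2⟩
    rw [finrank_geomPic hΛ, pow_one]
    have h2 : ((padicNorm p c : ℚ) : ℝ) = ((p : ℕ) : ℝ) ^ (-padicValRat p c) := by
      rw [padicNorm.eq_zpow_of_nonzero hc]
      push_cast
      rfl
    rw [localVolume_eq p (a := -padicValRat p c) (fun z => by rw [hp, h2]), h2]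
  unfold btConstant tamagawa
  rw [hprod.tprod_eq, a_eq hΛ, b_eq hΛ, gamma_eq hΛ, delta_eq hΛ,
    realVolume_eq (α := |(c : ℝ)| * H) (by positivity) hr]
  have : (∑' m : ℕ, 1 / ((m : ℝ) + 1) ^ 3)⁻¹ = 1 / (∑' m : ℕ, 1 / ((m : ℝ) + 1) ^ 3) := (one_div _).symm
  rw [this]
  set Z := (∑' m : ℕ, 1 / ((m : ℝ) + 1) ^ 3)
  rw [mul_pow]
  norm_num
  field_simp
  norm_num

end MetrizedLine

theorem projLine_btConstant : projLine.btConstant = 4 / ∑' m : ℕ, 1 / ((m : ℝ) + 1) ^ 3 := by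
  rw [MetrizedLine.btConstant_eq projLine_boundedSections (c := 1) one_ne_zero (H := 1) one_pos]
  · simp
  · intro p _ z
    rw [projLine_invNorm]
    simp
  · intro z
    rw [projLine_invNorm]
    simp

theorem baseLine_btConstant : baseLine.btConstant = projLine.btConstant := by
  rw [projLine_btConstant, MetrizedLine.btConstant_eq baseLine_boundedSections (c := 1) one_ne_zero (H := 1) one_pos]
  · simp
  · intro p _ z
    rw [baseLine_invNorm]
    simp
  · intro z
    rw [baseLine_invNorm]
    simp

theorem max_padicNorm_of_primitive (p : ℕ) [Fact p.Prime] {x : Fin 2 → ℤ} (hx : Finset.univ.gcd x = 1) :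
    max (padicNorm p (x 0)) (padicNorm p (x 1)) = 1 := by
  apply le_antisymm (max_le (padicNorm.of_int _) (padicNorm.of_int _))
  by_contra! h
  obtain ⟨h0, h1⟩ := max_lt_iff.mp h
  rw [padicNorm.int_lt_one_iff] at h0 h1
  have : (p : ℤ) ∣ Finset.univ.gcd x := Finset.dvd_gcd fun i _ => by
    fin_cases i
    · exact h0
    · exact h1
  rw [hx] at this
  have h2 := Int.isUnit_iff_natAbs_eq.mp (isUnit_of_dvd_one this)
  exact (Fact.out : p.Prime).one_lt.ne' (by simpa using h2)

theorem norm_pair_eq_max (x : Fin 2 → ℤ) : ‖x‖ = max |(x 0 : ℝ)| |(x 1 : ℝ)| := by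
  rw [Pi.norm_def]
  simp [Fin.univ_succ, Int.norm_eq_abs]

/-- For `y = c x` with `x` primitive, the maximum of the `|y i|` is `|c|` at every prime and `|c|`
times the height at the real place. -/
theorem fibreLine_btConstant {y : Fin 2 → ℚ} (hy : y ≠ 0) :
    (fibreLine y).btConstant = projLine.btConstant / Height.mulHeight y ^ 9 := by
  obtain ⟨x, hx, c, hc, hxy⟩ := exists_primitive_smul hy
  have hH : 0 < ‖x‖ := norm_pos_iff.mpr (ne_zero_of_primitive hx)
  rw [projLine_btConstant, MetrizedLine.btConstant_eq (fibreLine_boundedSections hy) hc hH, hxy,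
    mulHeight_of_primitive hx hc]
  · intro p _ z
    rw [fibreLine_invNorm]
    have hn : ∀ q : ℚ, ‖(q : PadicAlgCl p)‖ = ((padicNorm p q : ℚ) : ℝ) := fun q => by
      rw [← Padic.eq_padicNorm, ← norm_algebraMap' (PadicAlgCl p) (q : ℚ_[p])]
      congr 1
    have hmax : max ‖(y 0 : PadicAlgCl p)‖ ‖(y 1 : PadicAlgCl p)‖ = ((padicNorm p c : ℚ) : ℝ) := by
      rw [hn, hn, hxy]
      simp only [Pi.smul_apply, smul_eq_mul]
      rw [padicNorm.mul, padicNorm.mul, Rat.cast_mul, Rat.cast_mul,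
        ← mul_max_of_nonneg _ _ (by exact_mod_cast padicNorm.nonneg _), ← Rat.cast_max,
        max_padicNorm_of_primitive p hx, Rat.cast_one, mul_one]
    rw [hmax]
  · intro z
    rw [fibreLine_invNorm]
    have hmax : max ‖(y 0 : ℂ)‖ ‖(y 1 : ℂ)‖ = |(c : ℝ)| * ‖x‖ := by
      rw [hxy, norm_pair_eq_max, mul_max_of_nonneg _ _ (abs_nonneg _), ← abs_mul, ← abs_mul]
      simp only [Pi.smul_apply, smul_eq_mul, ← Complex.ofReal_ratCast, Complex.norm_real, Real.norm_eq_abs]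
      push_cast
      rfl
    rw [hmax]

/-! ### Heights of pairs on lines with a standard metric -/

open NumberField

section Instances

/-- The `ℚ`-algebra structure on a ring is unique, which identifies the two structures on `QBar`. -/
instance : IsAlgClosure ℚ QBar := by
  have h : @IsAlgClosure ℚ QBar _ _ (AlgebraicClosure.instAlgebra ℚ) _ := inferInstance
  convert h
  exact Subsingleton.elim _ _

instance : IsGalois ℚ QBar := IsAlgClosure.isGalois ℚ QBar

theorem QBar.exists_rat_of_fixed {x : QBar} (h : ∀ σ : QBar ≃ₐ[ℚ] QBar, σ x = x) :
    ∃ r : ℚ, (r : QBar) = x := by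
  obtain ⟨r, hr⟩ := IntermediateField.mem_bot.mp
    ((InfiniteGalois.mem_bot_iff_fixed (k := ℚ) x).mpr h)
  exact ⟨r, by simpa using hr⟩

end Instances

section Heights

theorem ciSup_fin_two {α : Type*} [ConditionallyCompleteLattice α] (f : Fin 2 → α) :
    ⨆ i, f i = f 0 ⊔ f 1 := by
  apply le_antisymm
  · exact ciSup_le (Fin.forall_fin_two.mpr ⟨le_sup_left, le_sup_right⟩)
  · exact sup_le (le_ciSup (Finite.bddAbove_range f) 0) (le_ciSup (Finite.bddAbove_range f) 1)

variable {K : Type} [Field K] [NumberField K]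

/-- Gauss's lemma for two linear forms: the inhomogeneous version applies after division by the
leading coefficients, and a vanishing leading coefficient is treated directly. -/
theorem NumberField.FinitePlace.max_mul_max_eq (v : FinitePlace K) (τ ω : Fin 2 → K) :
    max (v (τ 0)) (v (τ 1)) * max (v (ω 0)) (v (ω 1)) =
      max (v (τ 0 * ω 0)) (max (v (τ 0 * ω 1 + τ 1 * ω 0)) (v (τ 1 * ω 1))) := by
  have key : ∀ z w : K, max 1 (v z) * max 1 (v w) = max 1 (max (v (z + w)) (v (z * w))) := by
    intro z w
    let _ : NormedField (WithAbs v.val) := inferInstance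
    have : IsUltrametricDist (WithAbs v.val) :=
      IsUltrametricDist.isUltrametricDist_of_forall_norm_add_le_max_norm fun x y =>
        FinitePlace.add_le v x.ofAbs y.ofAbs
    have := IsUltrametricDist.max_mul_max_eq one_pos one_pos (WithAbs.toAbs v.val z) (WithAbs.toAbs v.val w)
    simp only [one_mul, one_pow] at this
    exact this
  have hadd := FinitePlace.add_le v
  by_cases hτ : τ 0 = 0
  · rw [hτ, map_zero, max_eq_right (apply_nonneg v _), zero_mul, map_zero, zero_mul, zero_add,
      mul_max_of_nonneg _ _ (apply_nonneg v _), ← map_mul, ← map_mul,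
      max_eq_right (le_max_of_le_left (apply_nonneg v _))]
  by_cases hω : ω 0 = 0
  · rw [hω, map_zero, max_eq_right (apply_nonneg v (ω 1)), mul_zero, map_zero, mul_zero, add_zero,
      max_mul_of_nonneg _ _ (apply_nonneg v _), ← map_mul, ← map_mul,
      max_eq_right (a := (0 : ℝ)) (le_max_of_le_left (apply_nonneg v _))]
  have h := key (τ 1 / τ 0) (ω 1 / ω 0)
  have h0 : 0 < v (τ 0) := FinitePlace.pos_iff.mpr hτ
  have h1 : 0 < v (ω 0) := FinitePlace.pos_iff.mpr hω
  have h2 := congrArg (fun t => v (τ 0) * v (ω 0) * t) h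
  beta_reduce at h2
  rw [← map_mul v (τ 0) (ω 0), mul_max_of_nonneg 1 (max (v _) (v _)) (apply_nonneg v _),
    mul_max_of_nonneg (v _) (v _) (apply_nonneg v _), mul_one, ← map_mul v (τ 0 * ω 0) (_ + _),
    ← map_mul v (τ 0 * ω 0) (_ * _)] at h2
  rw [show τ 0 * ω 0 * (τ 1 / τ 0 + ω 1 / ω 0) = τ 0 * ω 1 + τ 1 * ω 0 by field_simp; ring,
    show τ 0 * ω 0 * (τ 1 / τ 0 * (ω 1 / ω 0)) = τ 1 * ω 1 by field_simp] at h2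
  rw [← h2, map_mul, mul_mul_mul_comm, mul_max_of_nonneg _ _ h0.le, mul_max_of_nonneg _ _ h1.le,
    mul_one, mul_one, ← map_mul, ← map_mul, mul_div_cancel₀ _ hτ, mul_div_cancel₀ _ hω]

/-- By Bézout, one is an integral combination of the entries, so at a non-archimedean place some
entry has absolute value at least one. -/
theorem NumberField.FinitePlace.iSup_intCast_eq_one {n : ℕ} (v : FinitePlace K) {x : Fin n → ℤ}
    (hx : Finset.univ.gcd x = 1) : ⨆ i, v (x i : K) = 1 := by
  have := nonempty_of_primitive hx
  have hv : IsNonarchimedean (v ·) := FinitePlace.add_le v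
  have H (n : ℤ) : v n ≤ 1 := IsNonarchimedean.apply_intCast_le_one hv
  obtain ⟨f, hf⟩ := Finset.gcd_eq_sum_mul .univ x
  replace hf := congrArg (fun z : ℤ => v (z : K)) hf
  simp_rw [hx, Int.cast_one, map_one, Int.cast_sum, Int.cast_mul] at hf
  replace hf := hf.trans_le hv.apply_sum_univ_le
  obtain ⟨i, hi⟩ := exists_eq_ciSup_of_finite (f := fun i ↦ v (x i * f i : K))
  rw [← hi, map_mul] at hf
  replace hf : 1 ≤ v (x i : K) := hf.trans <| mul_le_of_le_one_right (apply_nonneg v _) (H _)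
  exact le_antisymm (ciSup_le (H <| x ·)) <| Finite.le_ciSup_of_le i hf

theorem NumberField.InfinitePlace.intCast_apply (v : InfinitePlace K) (m : ℤ) : v (m : K) = |(m : ℝ)| := by
  rw [← InfinitePlace.norm_embedding_eq, map_intCast, Complex.norm_intCast]

end Heights

section Forms

/-- The coefficients of the product of two linear forms. -/
def prodForm {R : Type*} [CommRing R] (τ ω : Fin 2 → R) : Fin 3 → R :=
  ![τ 0 * ω 0, τ 0 * ω 1 + τ 1 * ω 0, τ 1 * ω 1]

/-- The point of the metrized line with given homogeneous coordinates. -/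
def MetrizedLine.vec {n : ℕ} (Λ : MetrizedLine n) {K : Type*} [Field K] (τ : Fin 2 → K) :
    Fin n → K := fun i => (Λ.coord i 0 : K) * τ 0 + (Λ.coord i 1 : K) * τ 1

/-- The pairs of complex numbers with real symmetric functions `q` which have size at most `T`. -/
def SizeLE (H T : ℝ) (q : Fin 3 → ℝ) : Prop :=
  |q 0| ≤ T ∧ H ^ 2 * |q 2| ≤ T ∧ H * |q 1| ≤ T + H ^ 2 * (q 0 * q 2) / T

/-- A line whose metric is given by `max (H |τ₀|) (H² |τ₁|)` at the infinite places and by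
`max |τ₀| |τ₁|` at the finite places. -/
structure MetrizedLine.IsStandard {n : ℕ} (Λ : MetrizedLine n) (H : ℝ) : Prop where
  one_le : 1 ≤ H
  infinite : ∀ (K : Type) [Field K] [NumberField K] (v : InfinitePlace K) (τ : Fin 2 → K),
    ⨆ i, v (Λ.vec τ i) = max (H * v (τ 0)) (H ^ 2 * v (τ 1))
  finite : ∀ (K : Type) [Field K] [NumberField K] (v : FinitePlace K) (τ : Fin 2 → K),
    ⨆ i, v (Λ.vec τ i) = max (v (τ 0)) (v (τ 1))
  leftInv : ∃ M : Fin 2 → Fin n → ℚ, ∀ (K : Type) [Field K] [CharZero K] (τ : Fin 2 → K) (j : Fin 2),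
    ∑ i, (M j i : K) * Λ.vec τ i = τ j

namespace MetrizedLine

variable {n : ℕ} {Λ : MetrizedLine n} {H : ℝ}

theorem IsStandard.vec_injective (h : Λ.IsStandard H) {K : Type} [Field K] [CharZero K] :
    Function.Injective (Λ.vec (K := K)) := by
  obtain ⟨M, hM⟩ := h.leftInv
  intro τ ω hτ
  ext j
  rw [← hM K τ j, ← hM K ω j, hτ]

theorem vec_smul {K : Type*} [Field K] (c : K) (τ : Fin 2 → K) : Λ.vec (c • τ) = c • Λ.vec τ := by
  ext i
  simp only [vec, Pi.smul_apply, smul_eq_mul]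
  ring

theorem vec_zero {K : Type*} [Field K] : Λ.vec (0 : Fin 2 → K) = 0 := by
  ext i
  simp [vec]

theorem IsStandard.vec_ne_zero (h : Λ.IsStandard H) {K : Type} [Field K] [CharZero K]
    {τ : Fin 2 → K} (hτ : τ ≠ 0) : Λ.vec τ ≠ 0 := by
  rw [← vec_zero (Λ := Λ)]
  exact h.vec_injective.ne hτ

variable {K : Type} [Field K] [NumberField K]

/-- The product of heights is a product over places of products of two maxima. At finite places
these are Gauss norms of the primitive form `q`, hence one. At an infinite place the factor is at
most `H² T` exactly when `SizeLE H T` holds, a condition that does not involve the place; so all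
infinite factors equal one number `N`, and the total is `N ^ [K : ℚ]`. -/
theorem IsStandard.exists_mulHeight_mul_eq (h : Λ.IsStandard H) {τ ω : Fin 2 → K} (hτ : τ ≠ 0) (hω : ω ≠ 0)
    {q : Fin 3 → ℤ} (hq : Finset.univ.gcd q = 1) (hf : prodForm τ ω = fun i => (q i : K)) :
    ∃ N : ℝ, 0 < N ∧ Height.mulHeight (Λ.vec τ) * Height.mulHeight (Λ.vec ω) = N ^ Module.finrank ℚ K ∧
      ∀ T : ℝ, 0 < T → (N ≤ H ^ 2 * T ↔ SizeLE H T fun i => (q i : ℝ)) := by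
  have hH0 : 0 < H := one_pos.trans_le h.one_le
  let P : InfinitePlace K → ℝ := fun v =>
    max (H * v (τ 0)) (H ^ 2 * v (τ 1)) * max (H * v (ω 0)) (H ^ 2 * v (ω 1))
  have f0 : τ 0 * ω 0 = (q 0 : K) := congrFun hf 0
  have f1 : τ 0 * ω 1 + τ 1 * ω 0 = (q 1 : K) := congrFun hf 1
  have f2 : τ 1 * ω 1 = (q 2 : K) := congrFun hf 2
  -- A factor `H` is taken out of each maximum; what remains is the criterion for the forms with
  -- coordinates `(τ₀, H τ₁)` and `(ω₀, H ω₁)`.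
  have crit : ∀ v T, 0 < T → (P v ≤ H ^ 2 * T ↔ SizeLE H T fun i => (q i : ℝ)) := by
    intro v T hT
    have key := Complex.max_mul_max_le_iff (τ₀ := v.embedding (τ 0)) (τ₁ := H * v.embedding (τ 1))
      (ω₀ := v.embedding (ω 0)) (ω₁ := H * v.embedding (ω 1)) (a := q 0) (b := H * q 1) (c := H ^ 2 * q 2) hT
      (by rw [← map_mul, f0, map_intCast, Complex.ofReal_intCast])
      (by
        push_cast
        rw [← map_intCast v.embedding, ← f1, map_add, map_mul, map_mul]
        ring)
      (by
        push_cast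
        rw [← map_intCast v.embedding, ← f2, map_mul]
        ring)
    simp only [norm_mul, InfinitePlace.norm_embedding_eq, Complex.norm_real, Real.norm_eq_abs,
      abs_of_pos hH0] at key
    have hP : P v = H ^ 2 * (max (v (τ 0)) (H * v (τ 1)) * max (v (ω 0)) (H * v (ω 1))) := by
      simp only [P]
      rw [pow_two, mul_mul_mul_comm, mul_max_of_nonneg _ _ hH0.le, mul_max_of_nonneg _ _ hH0.le,
        mul_assoc, mul_assoc]
    rw [hP, mul_le_mul_iff_right₀ (by positivity), key, SizeLE, abs_mul, abs_mul, abs_of_pos hH0,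
      abs_of_pos (a := H ^ 2) (by positivity)]
    refine and_congr_right fun _ => and_congr_right fun _ => ?_
    rw [show (q 0 : ℝ) * (H ^ 2 * q 2) / T = H ^ 2 * (q 0 * q 2) / T by ring]
  have hpos1 : ∀ (v : InfinitePlace K) (σ : Fin 2 → K), σ ≠ 0 → 0 < max (H * v (σ 0)) (H ^ 2 * v (σ 1)) := by
    intro v σ hσ
    by_cases h0 : σ 0 = 0
    · have h1 : σ 1 ≠ 0 := fun h1 => hσ (by ext i; fin_cases i <;> assumption)
      exact lt_max_of_lt_right (mul_pos (by positivity) (InfinitePlace.pos_iff.mpr h1))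
    · exact lt_max_of_lt_left (mul_pos hH0 (InfinitePlace.pos_iff.mpr h0))
  have hpos : ∀ v, 0 < P v := fun v => mul_pos (hpos1 v τ hτ) (hpos1 v ω hω)
  -- The criterion holds at `w` for `T = P w / H²`, hence at `v` for the same `T`.
  have hle : ∀ v w, P v ≤ P w := fun v w => by
    have h1 : H ^ 2 * (P w / H ^ 2) = P w := mul_div_cancel₀ _ (by positivity)
    have h2 : 0 < P w / H ^ 2 := div_pos (hpos w) (by positivity)
    have := (crit v _ h2).mpr ((crit w _ h2).mp h1.ge)
    rwa [h1] at this
  have v₀ : InfinitePlace K := Classical.arbitrary _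
  refine ⟨P v₀, hpos v₀, ?_, fun T hT => crit v₀ T hT⟩
  have hx := h.vec_ne_zero hτ
  have hy := h.vec_ne_zero hω
  have hxy : (fun a : Fin n × Fin n => Λ.vec τ a.1 * Λ.vec ω a.2) ≠ 0 := by
    obtain ⟨i, hi⟩ := Function.ne_iff.mp hx
    obtain ⟨j, hj⟩ := Function.ne_iff.mp hy
    exact Function.ne_iff.mpr ⟨(i, j), mul_ne_zero hi hj⟩
  have : Nonempty (Fin n) := ⟨(Function.ne_iff.mp hx).choose⟩
  rw [← Height.mulHeight_fun_mul_eq hx hy, NumberField.mulHeight_eq hxy,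
    finprod_eq_one_of_forall_eq_one, mul_one]
  · rw [← InfinitePlace.sum_mult_eq, ← Finset.prod_pow_eq_pow_sum]
    refine Finset.prod_congr rfl fun v _ => ?_
    rw [Real.iSup_fun_mul_eq_iSup_mul_iSup_of_nonneg, h.infinite, h.infinite]
    exact congrArg (· ^ v.mult) (le_antisymm (hle _ _) (hle _ _))
  · intro v
    rw [Real.iSup_fun_mul_eq_iSup_mul_iSup_of_nonneg, h.finite, h.finite,
      v.max_mul_max_eq, f0, f1, f2, ← v.iSup_intCast_eq_one hq]
    apply le_antisymm
    · have hb := Finite.bddAbove_range (fun i => v (q i : K))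
      exact max_le (le_ciSup hb 0) (max_le (le_ciSup hb 1) (le_ciSup hb 2))
    · refine ciSup_le fun i => ?_
      fin_cases i
      · exact le_max_left _ _
      · exact le_max_of_le_right (le_max_left _ _)
      · exact le_max_of_le_right (le_max_right _ _)

theorem IsStandard.mulHeight_intCast (h : Λ.IsStandard H) {t : Fin 2 → ℤ} (ht : Finset.univ.gcd t = 1) :
    Height.mulHeight (Λ.vec fun i => (t i : K)) = max (H * |(t 0 : ℝ)|) (H ^ 2 * |(t 1 : ℝ)|) ^ Module.finrank ℚ K := by
  have ht0 : (fun i => (t i : K)) ≠ 0 := by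
    obtain ⟨i, hi⟩ := Function.ne_iff.mp (ne_zero_of_primitive ht)
    exact Function.ne_iff.mpr ⟨i, by simpa using hi⟩
  rw [NumberField.mulHeight_eq (h.vec_ne_zero ht0), finprod_eq_one_of_forall_eq_one, mul_one]
  · rw [← InfinitePlace.sum_mult_eq, ← Finset.prod_pow_eq_pow_sum]
    refine Finset.prod_congr rfl fun v _ => ?_
    rw [h.infinite, v.intCast_apply, v.intCast_apply]
  · intro v
    rw [h.finite, ← v.iSup_intCast_eq_one ht, ciSup_fin_two]

theorem projLine_isStandard : projLine.IsStandard 1 where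
  one_le := le_rfl
  infinite K _ _ v τ := by
    rw [ciSup_fin_two]
    simp [vec, projLine]
  finite K _ _ v τ := by
    rw [ciSup_fin_two]
    simp [vec, projLine]
  leftInv := ⟨![![1, 0], ![0, 1]], fun K _ _ τ j => by
    fin_cases j <;> simp [vec, projLine, Fin.sum_univ_two]⟩

theorem ciSup_fin_four (f : Fin 4 → ℝ) : ⨆ i, f i = max (max (f 0) (f 1)) (max (f 2) (f 3)) := by
  have hb := Finite.bddAbove_range f
  apply le_antisymm
  · refine ciSup_le fun i => ?_
    fin_cases i <;> simp
  · exact max_le (max_le (le_ciSup hb 0) (le_ciSup hb 1)) (max_le (le_ciSup hb 2) (le_ciSup hb 3))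

theorem baseLine_isStandard : baseLine.IsStandard 1 where
  one_le := le_rfl
  infinite K _ _ v τ := by
    rw [ciSup_fin_four]
    simp [vec, baseLine]
  finite K _ _ v τ := by
    rw [ciSup_fin_four]
    simp [vec, baseLine]
  leftInv := ⟨![![1, 0, 0, 0], ![0, 1, 0, 0]], fun K _ _ τ j => by
    fin_cases j <;> simp [vec, baseLine, Fin.sum_univ_four]⟩

theorem fibreLine_vec {K : Type*} [Field K] (y : Fin 2 → ℚ) (τ : Fin 2 → K) :
    (fibreLine y).vec τ = ![y 0 * τ 0, y 1 * τ 0, (y 1 : K) ^ 2 * τ 1, (y 0 : K) ^ 2 * τ 1] := by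
  ext i
  fin_cases i <;> simp [vec, fibreLine]

theorem fibreLine_isStandard {y : Fin 2 → ℤ} (hy : Finset.univ.gcd y = 1) :
    (fibreLine fun i => (y i : ℚ)).IsStandard ‖y‖ where
  one_le := one_le_norm_of_ne_zero (ne_zero_of_primitive hy)
  infinite K _ _ v τ := by
    rw [ciSup_fin_four, fibreLine_vec, norm_pair_eq_max]
    simp only [Rat.cast_intCast, Matrix.cons_val_zero, Matrix.cons_val_one, Matrix.cons_val, map_mul,
      map_pow, v.intCast_apply]
    rw [max_mul_of_nonneg _ _ (apply_nonneg v _), max_comm (|(y 1 : ℝ)| ^ 2 * _),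
      ← max_mul_of_nonneg _ _ (apply_nonneg v (τ 1))]
    congr 2
    exact ((pow_left_monotoneOn (n := 2)).map_sup (Set.mem_Ici.mpr (abs_nonneg (y 0 : ℝ)))
      (Set.mem_Ici.mpr (abs_nonneg (y 1 : ℝ)))).symm
  finite K _ _ v τ := by
    have h := v.iSup_intCast_eq_one hy
    rw [ciSup_fin_two] at h
    rw [ciSup_fin_four, fibreLine_vec]
    simp only [Rat.cast_intCast, Matrix.cons_val_zero, Matrix.cons_val_one, Matrix.cons_val, map_mul, map_pow]
    rw [← max_mul_of_nonneg _ _ (apply_nonneg v _), max_comm (v (y 1 : K) ^ 2 * _),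
      ← max_mul_of_nonneg _ _ (apply_nonneg v (τ 1)), h, one_mul]
    congr 1
    rw [← ((pow_left_monotoneOn (n := 2)).map_sup (Set.mem_Ici.mpr (apply_nonneg v (y 0 : K)))
      (Set.mem_Ici.mpr (apply_nonneg v (y 1 : K)))), h, one_pow, one_mul]
  leftInv := by
    have h0 : (y 0 : ℚ) ≠ 0 ∨ (y 1 : ℚ) ≠ 0 := by
      by_contra! hc
      apply ne_zero_of_primitive hy
      ext i
      fin_cases i
      · exact_mod_cast hc.1
      · exact_mod_cast hc.2
    have h2 : (y 0 : ℚ) ^ 2 + (y 1 : ℚ) ^ 2 ≠ 0 := by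
      rcases h0 with h | h <;> positivity
    have h4 : (y 0 : ℚ) ^ 4 + (y 1 : ℚ) ^ 4 ≠ 0 := by
      rcases h0 with h | h <;> positivity
    -- Rational left inverses from the projections to the vectors `(y₀, y₁)` and `(y₁², y₀²)`.
    refine ⟨![![y 0 / (y 0 ^ 2 + y 1 ^ 2), y 1 / (y 0 ^ 2 + y 1 ^ 2), 0, 0],
      ![0, 0, y 1 ^ 2 / (y 0 ^ 4 + y 1 ^ 4), y 0 ^ 2 / (y 0 ^ 4 + y 1 ^ 4)]], fun K _ _ τ j => ?_⟩
    have h2' : (y 0 : K) ^ 2 + (y 1 : K) ^ 2 ≠ 0 := by exact_mod_cast h2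
    have h4' : (y 0 : K) ^ 4 + (y 1 : K) ^ 4 ≠ 0 := by exact_mod_cast h4
    rw [fibreLine_vec]
    fin_cases j
    · simp [Fin.sum_univ_four]
      field_simp
    · simp [Fin.sum_univ_four]
      field_simp
      ring

end MetrizedLine

end Forms

/-! ### Points of projective space and the lines on the surface -/

section ProjPoints

variable {n : ℕ}

theorem exists_smul_eq_rep (v : Fin n → QBar) (hv : v ≠ 0) :
    ∃ a : QBar, a ≠ 0 ∧ (Projectivization.mk QBar v hv).rep = a • v := by
  obtain ⟨a, ha⟩ := Projectivization.exists_smul_eq_mk_rep QBar v hv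
  exact ⟨a, a.ne_zero, ha.symm⟩

theorem mk_eq_mk_of_smul {v w : Fin n → QBar} (hv : v ≠ 0) (hw : w ≠ 0) {a : QBar} (h : v = a • w) :
    Projectivization.mk QBar v hv = Projectivization.mk QBar w hw :=
  (Projectivization.mk_eq_mk_iff' QBar v w hv hw).mpr ⟨a, h.symm⟩

theorem mk_mem_surfaceV {v : Fin 4 → QBar} (hv : v ≠ 0) : Projectivization.mk QBar v hv ∈ surfaceV ↔
    v 0 ^ 2 * v 2 = v 1 ^ 2 * v 3 ∧ ¬ (v 0 = 0 ∧ v 1 = 0) := by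
  obtain ⟨a, ha, h⟩ := exists_smul_eq_rep v hv
  simp only [surfaceV, Set.mem_ofPred_eq, h, Pi.smul_apply, smul_eq_mul, mul_eq_zero, ha, false_or]
  refine and_congr_left fun _ => ?_
  rw [show (a * v 0) ^ 2 * (a * v 2) = a ^ 3 * (v 0 ^ 2 * v 2) by ring,
    show (a * v 1) ^ 2 * (a * v 3) = a ^ 3 * (v 1 ^ 2 * v 3) by ring]
  exact mul_right_inj' (pow_ne_zero 3 ha)

theorem mk_mem_fibreV {v : Fin 4 → QBar} (hv : v ≠ 0) {y : Fin 2 → ℚ} :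
    Projectivization.mk QBar v hv ∈ fibreV y ↔
      Projectivization.mk QBar v hv ∈ surfaceV ∧ v 0 * (y 1 : QBar) = v 1 * (y 0 : QBar) := by
  obtain ⟨a, ha, h⟩ := exists_smul_eq_rep v hv
  simp only [fibreV, Set.mem_ofPred_eq, h, Pi.smul_apply, smul_eq_mul, mul_assoc]
  exact and_congr_right fun _ => mul_right_inj' ha

theorem mk_mem_baseV {v : Fin 4 → QBar} (hv : v ≠ 0) :
    Projectivization.mk QBar v hv ∈ baseV ↔
      Projectivization.mk QBar v hv ∈ surfaceV ∧ v 2 = 0 ∧ v 3 = 0 := by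
  obtain ⟨a, ha, h⟩ := exists_smul_eq_rep v hv
  simp only [baseV, Set.mem_ofPred_eq, h, Pi.smul_apply, smul_eq_mul, mul_eq_zero, ha, false_or]

theorem mk_mem_diagonalFamily {v w : Fin 4 → QBar} (hv : v ≠ 0) (hw : w ≠ 0) :
    s(Projectivization.mk QBar v hv, Projectivization.mk QBar w hw) ∈ diagonalFamily ↔
      (Projectivization.mk QBar v hv ∈ surfaceV ∧ Projectivization.mk QBar w hw ∈ surfaceV) ∧
        v 0 * w 1 = v 1 * w 0 := by
  obtain ⟨a, ha, h⟩ := exists_smul_eq_rep v hv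
  obtain ⟨b, hb, h'⟩ := exists_smul_eq_rep w hw
  simp only [diagonalFamily, symSquare, Set.mem_ofPred_eq, Sym2.mem_iff, forall_eq_or_imp, forall_eq, h, h',
    Pi.smul_apply, smul_eq_mul]
  refine and_congr_right fun _ => ?_
  have hab := mul_ne_zero ha hb
  constructor
  · rintro ⟨⟨-, h1⟩, -⟩
    apply mul_left_cancel₀ hab
    linear_combination h1
  · intro h1
    refine ⟨⟨by ring, ?_⟩, ?_, by ring⟩
    · linear_combination a * b * h1
    · linear_combination - a * b * h1

theorem galPt_mk (σ : QBar ≃ₐ[ℚ] QBar) {v : Fin n → QBar} (hv : v ≠ 0) :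
    galPt σ (Projectivization.mk QBar v hv) =
      Projectivization.mk QBar (galVec n σ v) ((map_ne_zero_iff _ (galVec_injective σ)).mpr hv) := rfl

theorem exists_coord_fieldOfDefinition {s : Sym2 (ProjPt n)} {x : ProjPt n} (hx : x ∈ s) :
    ∃ (w : Fin n → fieldOfDefinition s) (hw : (fun i => (w i : QBar)) ≠ 0),
      x = Projectivization.mk QBar (fun i => (w i : QBar)) hw := by
  have hmem : ∀ i, normCoord x i ∈ fieldOfDefinition s := fun i =>
    IntermediateField.subset_adjoin _ _ (Set.mem_biUnion (x := x) hx ⟨i, rfl⟩)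
  have h0 := (Function.ne_iff.mp x.rep_nonzero).choose_spec
  set i₀ := (Function.ne_iff.mp x.rep_nonzero).choose with hi₀
  refine ⟨fun i => ⟨normCoord x i, hmem i⟩, Function.ne_iff.mpr ⟨i₀, ?_⟩, ?_⟩
  · simp only [normCoord, ← hi₀]
    rw [div_self h0]
    exact one_ne_zero
  · conv_lhs => rw [← x.mk_rep]
    refine mk_eq_mk_of_smul _ _ (a := x.rep i₀) ?_
    ext i
    simp only [normCoord, ← hi₀, Pi.smul_apply, smul_eq_mul]
    rw [mul_div_cancel₀ _ h0]

theorem heightOver_mk (K : IntermediateField ℚ QBar) [NumberField K] (w : Fin n → K)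
    (hw : (fun i => (w i : QBar)) ≠ 0) :
    heightOver K (Projectivization.mk QBar _ hw) = Height.mulHeight w := by
  obtain ⟨a, ha, h⟩ := exists_smul_eq_rep _ hw
  set x := Projectivization.mk QBar _ hw
  have h0 := (Function.ne_iff.mp x.rep_nonzero).choose_spec
  set i₀ := (Function.ne_iff.mp x.rep_nonzero).choose with hi₀
  have hw0 : w i₀ ≠ 0 := fun h1 => h0 (by rw [h]; simp [h1])
  have hn : ∀ i, normCoord x i = ((w i₀)⁻¹ * w i : K) := fun i => by
    simp only [normCoord, ← hi₀]
    rw [h]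
    simp only [Pi.smul_apply, smul_eq_mul]
    rw [mul_div_mul_left _ _ ha, div_eq_inv_mul]
    push_cast
    rfl
  have hmem : ∀ i, normCoord x i ∈ K := fun i => by
    rw [hn]
    exact SetLike.coe_mem _
  rw [heightOver, dif_pos hmem, ← Height.mulHeight_smul_eq_mulHeight w (inv_ne_zero hw0)]
  congr 1
  ext i
  exact hn i

theorem fibreV_eq_points {y : Fin 2 → ℚ} (hy : y ≠ 0) : fibreV y = (fibreLine y).points := by
  have hy' : (y 0 : QBar) ≠ 0 ∨ (y 1 : QBar) ≠ 0 := by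
    by_contra! hc
    apply hy
    ext i
    fin_cases i
    · exact_mod_cast hc.1
    · exact_mod_cast hc.2
  ext x
  constructor
  · intro hx
    rw [← x.mk_rep] at hx
    rw [mk_mem_fibreV, mk_mem_surfaceV] at hx
    obtain ⟨⟨h1, h2⟩, h3⟩ := hx
    set v := x.rep with hv
    have hτ : ∃ t : QBar, v 0 = y 0 * t ∧ v 1 = y 1 * t := by
      rcases hy' with h | h
      · exact ⟨v 0 / y 0, by field_simp, by field_simp; linear_combination -h3⟩
      · exact ⟨v 1 / y 1, by field_simp; linear_combination h3, by field_simp⟩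
    obtain ⟨t, ht0, ht1⟩ := hτ
    have ht : t ≠ 0 := by
      rintro rfl
      exact h2 ⟨by rw [ht0, mul_zero], by rw [ht1, mul_zero]⟩
    -- On a fibre the cubic equation is divisible by `t²` and becomes linear, so `(v 2, v 3)` is
    -- proportional to `(y₁², y₀²)`.
    have h4 : (y 0 : QBar) ^ 2 * v 2 = (y 1 : QBar) ^ 2 * v 3 := by
      apply mul_left_cancel₀ (pow_ne_zero 2 ht)
      rw [ht0, ht1] at h1
      linear_combination h1
    have hu : ∃ u : QBar, v 2 = (y 1 : QBar) ^ 2 * u ∧ v 3 = (y 0 : QBar) ^ 2 * u := by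
      rcases hy' with h | h
      · exact ⟨v 3 / y 0 ^ 2, by field_simp; linear_combination h4, by field_simp⟩
      · exact ⟨v 2 / y 1 ^ 2, by field_simp, by field_simp; linear_combination -h4⟩
    obtain ⟨u, hu2, hu3⟩ := hu
    have hvec : (fibreLine y).vec ![t, u] = v := by
      rw [MetrizedLine.fibreLine_vec]
      ext i
      fin_cases i
      · simpa using ht0.symm
      · simpa using ht1.symm
      · simpa using hu2.symm
      · simpa using hu3.symm
    refine ⟨![t, u], fun h => ht (congrFun h 0), Or.inr ht, ?_⟩
    refine ⟨hvec.trans_ne x.rep_nonzero, ?_⟩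
    conv_lhs => rw [← x.mk_rep]
    refine mk_eq_mk_of_smul _ _ (a := 1) ?_
    rw [one_smul]
    exact hvec.symm
  · rintro ⟨τ, -, hτ, h, rfl⟩
    replace hτ := hτ.resolve_left id
    rw [mk_mem_fibreV, mk_mem_surfaceV]
    simp only [fibreLine, Matrix.cons_val_zero, Matrix.cons_val_one, Matrix.cons_val, Rat.cast_zero,
      zero_mul, add_zero, zero_add, mul_eq_zero, hτ, or_false, Rat.cast_pow]
    refine ⟨⟨by ring, ?_⟩, by ring⟩
    rintro ⟨h0, h1⟩
    exact hy'.elim (fun h => h h0) (fun h => h h1)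

theorem baseV_eq_points : baseV = baseLine.points := by
  ext x
  constructor
  · intro hx
    rw [← x.mk_rep] at hx
    rw [mk_mem_baseV, mk_mem_surfaceV] at hx
    obtain ⟨⟨h1, h2⟩, h3, h4⟩ := hx
    set v := x.rep with hv
    have hvec : baseLine.vec ![v 0, v 1] = v := by
      ext i
      fin_cases i <;> simp [MetrizedLine.vec, baseLine, h3, h4]
    refine ⟨![v 0, v 1], fun h => h2 ⟨congrFun h 0, congrFun h 1⟩, Or.inl trivial, ?_⟩
    refine ⟨hvec.trans_ne x.rep_nonzero, ?_⟩
    conv_lhs => rw [← x.mk_rep]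
    refine mk_eq_mk_of_smul _ _ (a := 1) ?_
    rw [one_smul]
    exact hvec.symm
  · rintro ⟨τ, hτ0, -, h, rfl⟩
    rw [mk_mem_baseV, mk_mem_surfaceV]
    simp [baseLine]
    intro h0 h1
    exact hτ0 (by ext i; fin_cases i <;> assumption)

theorem projLine_points : projLine.points = Set.univ := by
  ext x
  refine ⟨fun _ => trivial, fun _ => ?_⟩
  have hvec : projLine.vec x.rep = x.rep := by
    ext i
    fin_cases i <;> simp [MetrizedLine.vec, projLine]
  refine ⟨x.rep, x.rep_nonzero, Or.inl trivial, hvec.trans_ne x.rep_nonzero, ?_⟩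
  conv_lhs => rw [← x.mk_rep]
  refine mk_eq_mk_of_smul _ _ (a := 1) ?_
  rw [one_smul]
  exact hvec.symm

end ProjPoints

/-! ### Binary quadratic forms as products of linear forms -/

section ProdForm

variable {F : Type*} [Field F]

theorem prodForm_comm (τ ω : Fin 2 → F) : prodForm τ ω = prodForm ω τ := by
  ext i
  fin_cases i <;> simp [prodForm] <;> ring

theorem prodForm_smul_left (c : F) (τ ω : Fin 2 → F) : prodForm (c • τ) ω = c • prodForm τ ω := by
  ext i
  fin_cases i <;> simp [prodForm] <;> ring

theorem prodForm_smul_right (c : F) (τ ω : Fin 2 → F) : prodForm τ (c • ω) = c • prodForm τ ω := by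
  rw [prodForm_comm, prodForm_smul_left, prodForm_comm]

theorem prodForm_left_cancel {τ : Fin 2 → F} (hτ : τ ≠ 0) {ω ω' : Fin 2 → F}
    (h : prodForm τ ω = prodForm τ ω') : ω = ω' := by
  have h0 : τ 0 * ω 0 = τ 0 * ω' 0 := congrFun h 0
  have h1 : τ 0 * ω 1 + τ 1 * ω 0 = τ 0 * ω' 1 + τ 1 * ω' 0 := congrFun h 1
  have h2 : τ 1 * ω 1 = τ 1 * ω' 1 := congrFun h 2
  by_cases h3 : τ 0 = 0
  · have h4 : τ 1 ≠ 0 := fun h4 => hτ (by ext i; fin_cases i <;> assumption)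
    rw [h3, zero_mul, zero_mul, zero_add, zero_add] at h1
    ext i
    fin_cases i
    · exact mul_left_cancel₀ h4 h1
    · exact mul_left_cancel₀ h4 h2
  · have h5 := mul_left_cancel₀ h3 h0
    rw [h5, add_left_inj] at h1
    ext i
    fin_cases i
    · exact h5
    · exact mul_left_cancel₀ h3 h1

theorem prodForm_ne_zero {τ ω : Fin 2 → F} (hτ : τ ≠ 0) (hω : ω ≠ 0) : prodForm τ ω ≠ 0 := by
  intro h
  apply hω
  apply prodForm_left_cancel hτ
  rw [h]
  ext i
  fin_cases i <;> simp [prodForm]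

theorem exists_smul_of_det_eq_zero {τ τ' : Fin 2 → F} (hτ' : τ' ≠ 0) (h : τ' 0 * τ 1 = τ' 1 * τ 0) :
    ∃ a : F, τ = a • τ' := by
  by_cases h0 : τ' 0 = 0
  · have h1 : τ' 1 ≠ 0 := fun h1 => hτ' (by ext i; fin_cases i <;> assumption)
    refine ⟨τ 1 / τ' 1, ?_⟩
    ext i
    fin_cases i
    · have : τ 0 = 0 := by
        rw [h0, zero_mul] at h
        exact (mul_eq_zero.mp h.symm).resolve_left h1
      simp [h0, this]
    · simp [h1]
  · refine ⟨τ 0 / τ' 0, ?_⟩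
    ext i
    fin_cases i
    · simp [h0]
    · simp only [Pi.smul_apply, smul_eq_mul, Fin.mk_one]
      field_simp
      linear_combination h

/-- Unique factorisation: evaluating both products at the zero of `τ` shows that `τ` is proportional
to `τ'` or `ω'`, and the other factor follows by cancellation. -/
theorem eq_smul_of_prodForm_eq_smul {τ ω τ' ω' : Fin 2 → F} (hτ : τ ≠ 0) (hτ' : τ' ≠ 0) (hω' : ω' ≠ 0)
    {c : F} (hc : c ≠ 0) (h : prodForm τ ω = c • prodForm τ' ω') :
    (∃ a b : F, τ = a • τ' ∧ ω = b • ω') ∨ (∃ a b : F, τ = a • ω' ∧ ω = b • τ') := by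
  have key : ∀ σ' ρ' : Fin 2 → F, σ' ≠ 0 → prodForm τ ω = c • prodForm σ' ρ' →
      σ' 0 * τ 1 = σ' 1 * τ 0 → ∃ a b : F, τ = a • σ' ∧ ω = b • ρ' := by
    intro σ' ρ' hσ' hf hd
    obtain ⟨a, rfl⟩ := exists_smul_of_det_eq_zero hσ' hd
    have ha : a ≠ 0 := by
      rintro rfl
      exact hτ (zero_smul _ _)
    refine ⟨a, c / a, rfl, ?_⟩
    apply prodForm_left_cancel hτ
    rw [hf, prodForm_smul_right, prodForm_smul_left, smul_smul, div_mul_cancel₀ _ ha]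
  have h0 : τ 0 * ω 0 = c * (τ' 0 * ω' 0) := congrFun h 0
  have h1 : τ 0 * ω 1 + τ 1 * ω 0 = c * (τ' 0 * ω' 1 + τ' 1 * ω' 0) := congrFun h 1
  have h2 : τ 1 * ω 1 = c * (τ' 1 * ω' 1) := congrFun h 2
  have hd : (τ' 0 * τ 1 - τ' 1 * τ 0) * (ω' 0 * τ 1 - ω' 1 * τ 0) = 0 := by
    apply mul_left_cancel₀ hc
    linear_combination (-τ 1 ^ 2) * h0 + τ 0 * τ 1 * h1 - τ 0 ^ 2 * h2
  rcases mul_eq_zero.mp hd with h3 | h3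
  · exact Or.inl (key τ' ω' hτ' h (sub_eq_zero.mp h3))
  · right
    rw [prodForm_comm τ'] at h
    exact key ω' τ' hω' h (sub_eq_zero.mp h3)

theorem exists_prodForm_eq [IsAlgClosed F] [CharZero F] (q : Fin 3 → F) (hq : q ≠ 0) :
    ∃ τ ω : Fin 2 → F, τ ≠ 0 ∧ ω ≠ 0 ∧ prodForm τ ω = q := by
  by_cases h0 : q 0 = 0
  · refine ⟨![0, 1], ![q 1, q 2], fun h => one_ne_zero (congrFun h 1), fun h => hq ?_, ?_⟩
    · ext i
      fin_cases i
      · exact h0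
      · exact congrFun h 0
      · exact congrFun h 1
    · ext i
      fin_cases i <;> simp [prodForm, h0]
  · obtain ⟨z, hz⟩ := IsAlgClosed.exists_pow_nat_eq (q 1 ^ 2 - 4 * q 0 * q 2) two_pos
    refine ⟨![1, (q 1 + z) / (2 * q 0)], ![q 0, (q 1 - z) / 2], fun h => one_ne_zero (congrFun h 0),
      fun h => h0 (congrFun h 0), ?_⟩
    ext i
    fin_cases i
    · simp [prodForm]
    · simp [prodForm]
      field_simp
      ring
    · simp [prodForm]
      field_simp
      linear_combination (-1) * hz

end ProdForm

/-! ### Rational pairs on a line and primitive integral forms -/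

theorem symHeight_eq_of_eq {n : ℕ} {s : Sym2 (ProjPt n)} {x y : ProjPt n} (h : s = s(x, y)) :
    symHeight s = (heightOver (fieldOfDefinition s) x * heightOver (fieldOfDefinition s) y) ^
      (1 / (Module.finrank ℚ (fieldOfDefinition s) : ℝ)) := by
  subst h
  rfl

namespace MetrizedLine

variable {n : ℕ} {Λ : MetrizedLine n} {H : ℝ}

/-- The pair `s` of points of the line is given by the zeros of the binary quadratic form `q`. -/
def IsPair (Λ : MetrizedLine n) (q : Fin 3 → QBar) (s : Sym2 (ProjPt n)) : Prop :=
  ∃ (τ ω : Fin 2 → QBar) (hτ : Λ.vec τ ≠ 0) (hω : Λ.vec ω ≠ 0), prodForm τ ω = q ∧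
    s = s(Projectivization.mk QBar _ hτ, Projectivization.mk QBar _ hω)

theorem ne_zero_of_vec_ne_zero {K : Type*} [Field K] {τ : Fin 2 → K} (h : Λ.vec τ ≠ 0) : τ ≠ 0 := by
  rintro rfl
  exact h vec_zero

theorem mk_mem_points (h : Λ.IsStandard H) {τ : Fin 2 → QBar} (hτ : Λ.vec τ ≠ 0) :
    Projectivization.mk QBar _ hτ ∈ Λ.points ↔ (Λ.complete ∨ τ 0 ≠ 0) := by
  constructor
  · rintro ⟨τ', -, hc, h', hx⟩
    refine hc.imp_right fun h0 => ?_
    obtain ⟨a, ha⟩ := (Projectivization.mk_eq_mk_iff' QBar _ _ hτ h').mp hx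
    have h2 : a • τ' = τ := h.vec_injective (by rw [vec_smul]; exact ha)
    rw [← h2]
    refine mul_ne_zero ?_ h0
    rintro rfl
    exact ne_zero_of_vec_ne_zero hτ (by rw [← h2, zero_smul])
  · intro hc
    exact ⟨τ, ne_zero_of_vec_ne_zero hτ, hc, hτ, rfl⟩

theorem IsPair.ne_zero {q : Fin 3 → QBar} {s : Sym2 (ProjPt n)} (h : Λ.IsPair q s) : q ≠ 0 := by
  obtain ⟨τ, ω, hτ, hω, rfl, -⟩ := h
  exact prodForm_ne_zero (ne_zero_of_vec_ne_zero hτ) (ne_zero_of_vec_ne_zero hω)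

theorem IsPair.smul {q : Fin 3 → QBar} {s : Sym2 (ProjPt n)} (h : Λ.IsPair q s) {c : QBar} (hc : c ≠ 0) :
    Λ.IsPair (c • q) s := by
  obtain ⟨τ, ω, hτ, hω, rfl, rfl⟩ := h
  refine ⟨c • τ, ω, ?_, hω, prodForm_smul_left _ _ _, ?_⟩
  · rw [vec_smul]
    exact smul_ne_zero hc hτ
  · rw [mk_eq_mk_of_smul (v := Λ.vec (c • τ)) _ hτ (vec_smul _ _)]

theorem IsPair.unique {q : Fin 3 → QBar} {s s' : Sym2 (ProjPt n)} (h : Λ.IsPair q s) {c : QBar} (hc : c ≠ 0)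
    (h' : Λ.IsPair (c • q) s') : s = s' := by
  obtain ⟨τ, ω, hτ, hω, rfl, rfl⟩ := h
  obtain ⟨τ', ω', hτ', hω', hq, rfl⟩ := h'
  have hmk : ∀ {σ σ' : Fin 2 → QBar} (hσ : Λ.vec σ ≠ 0) (hσ' : Λ.vec σ' ≠ 0) {a : QBar}, σ' = a • σ →
      Projectivization.mk QBar _ hσ = Projectivization.mk QBar _ hσ' := by
    rintro σ _ hσ hσ' a rfl
    exact (mk_eq_mk_of_smul hσ' hσ (vec_smul _ _)).symm
  rcases eq_smul_of_prodForm_eq_smul (ne_zero_of_vec_ne_zero hτ') (ne_zero_of_vec_ne_zero hτ)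
    (ne_zero_of_vec_ne_zero hω) hc hq with ⟨a, b, ha, hb⟩ | ⟨a, b, ha, hb⟩
  · rw [hmk hτ hτ' ha, hmk hω hω' hb]
  · rw [hmk hω hτ' ha, hmk hτ hω' hb, Sym2.eq_swap]

/-- Together with the preceding lemma: pairs of points of the line correspond to non-zero binary
quadratic forms up to scalars. -/
theorem IsPair.exists_smul (h : Λ.IsStandard H) {q q' : Fin 3 → QBar} {s : Sym2 (ProjPt n)}
    (hs : Λ.IsPair q s) (hs' : Λ.IsPair q' s) : ∃ c : QBar, c ≠ 0 ∧ q' = c • q := by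
  have hq' := hs'.ne_zero
  obtain ⟨τ, ω, hτ, hω, rfl, rfl⟩ := hs
  obtain ⟨τ', ω', hτ', hω', rfl, hs⟩ := hs'
  have hmk : ∀ {σ σ' : Fin 2 → QBar} (hσ : Λ.vec σ ≠ 0) (hσ' : Λ.vec σ' ≠ 0),
      Projectivization.mk QBar _ hσ = Projectivization.mk QBar _ hσ' → ∃ a : QBar, σ' = a • σ := by
    intro σ σ' hσ hσ' he
    obtain ⟨a, ha⟩ := (Projectivization.mk_eq_mk_iff' QBar _ _ hσ' hσ).mp he.symm
    exact ⟨a, h.vec_injective (by rw [vec_smul]; exact ha.symm)⟩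
  have key : ∀ c : QBar, prodForm τ' ω' = c • prodForm τ ω → ∃ c : QBar, c ≠ 0 ∧ prodForm τ' ω' = c • prodForm τ ω := by
    intro c hc
    refine ⟨c, ?_, hc⟩
    rintro rfl
    exact hq' (by rw [hc, zero_smul])
  rcases Sym2.eq_iff.mp hs with ⟨h1, h2⟩ | ⟨h1, h2⟩
  · obtain ⟨a, rfl⟩ := hmk hτ hτ' h1
    obtain ⟨b, rfl⟩ := hmk hω hω' h2
    exact key _ (by rw [prodForm_smul_left, prodForm_smul_right, smul_smul])
  · obtain ⟨a, rfl⟩ := hmk hτ hω' h1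
    obtain ⟨b, rfl⟩ := hmk hω hτ' h2
    exact key _ (by rw [prodForm_smul_left, prodForm_smul_right, smul_smul, prodForm_comm])

theorem exists_isPair (h : Λ.IsStandard H) {q : Fin 3 → QBar} (hq : q ≠ 0) : ∃ s, Λ.IsPair q s := by
  obtain ⟨τ, ω, hτ, hω, hf⟩ := exists_prodForm_eq q hq
  exact ⟨_, τ, ω, h.vec_ne_zero hτ, h.vec_ne_zero hω, hf, rfl⟩

theorem IsPair.mem_symSquare_iff (h : Λ.IsStandard H) {q : Fin 3 → QBar} {s : Sym2 (ProjPt n)}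
    (hs : Λ.IsPair q s) : s ∈ symSquare Λ.points ↔ (Λ.complete ∨ q 0 ≠ 0) := by
  obtain ⟨τ, ω, hτ, hω, rfl, rfl⟩ := hs
  simp only [symSquare, Set.mem_ofPred_eq, Sym2.mem_iff, forall_eq_or_imp, forall_eq, mk_mem_points h,
    prodForm, Matrix.cons_val_zero, mul_ne_zero_iff]
  tauto

theorem exists_isPair_of_mem {s : Sym2 (ProjPt n)} (hs : s ∈ symSquare Λ.points) :
    ∃ q, Λ.IsPair q s := by
  induction s using Sym2.ind with
  | _ x y =>
    obtain ⟨τ, -, -, hτ, rfl⟩ := hs x (Sym2.mem_mk_left x y)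
    obtain ⟨ω, -, -, hω, rfl⟩ := hs y (Sym2.mem_mk_right _ y)
    exact ⟨_, τ, ω, hτ, hω, rfl, rfl⟩

theorem IsPair.map_galPt {q : Fin 3 → QBar} {s : Sym2 (ProjPt n)} (hs : Λ.IsPair q s)
    (σ : QBar ≃ₐ[ℚ] QBar) : Λ.IsPair (fun i => σ (q i)) (s.map (galPt σ)) := by
  obtain ⟨τ, ω, hτ, hω, rfl, rfl⟩ := hs
  have hvec : ∀ ρ : Fin 2 → QBar, galVec n σ (Λ.vec ρ) = Λ.vec (fun i => σ (ρ i)) := by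
    intro ρ
    ext i
    change σ (_ * _ + _ * _) = _ * _ + _ * _
    rw [map_add, map_mul, map_mul, map_ratCast, map_ratCast]
  have hg : ∀ ρ : Fin 2 → QBar, Λ.vec ρ ≠ 0 → Λ.vec (fun i => σ (ρ i)) ≠ 0 := fun ρ hρ => by
    rw [← hvec]
    exact (map_ne_zero_iff _ (galVec_injective σ)).mpr hρ
  refine ⟨fun i => σ (τ i), fun i => σ (ω i), hg τ hτ, hg ω hω, ?_, ?_⟩
  · ext i
    fin_cases i <;> simp [prodForm]
  · rw [Sym2.map_mk, galPt_mk, galPt_mk]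
    simp only [hvec]

theorem IsPair.map_galPt_eq {q : Fin 3 → ℤ} {s : Sym2 (ProjPt n)}
    (hs : Λ.IsPair (fun i => (q i : QBar)) s) (σ : QBar ≃ₐ[ℚ] QBar) : s.map (galPt σ) = s := by
  refine (hs.unique one_ne_zero ?_).symm
  have := hs.map_galPt σ
  simpa using this

/-- A Galois conjugate of the form of an invariant pair has the same zeros, so it is proportional to
the form. The ratios of the coefficients are therefore fixed by the Galois group, hence rational,
and denominators can be cleared. -/
theorem exists_primitive_isPair (h : Λ.IsStandard H) {s : Sym2 (ProjPt n)}
    (hs : s ∈ rationalPoints (symSquare Λ.points)) :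
    ∃ q : Fin 3 → ℤ, Finset.univ.gcd q = 1 ∧ Λ.IsPair (fun i => (q i : QBar)) s := by
  obtain ⟨f, hf⟩ := exists_isPair_of_mem hs.1
  obtain ⟨i₀, hi₀⟩ := Function.ne_iff.mp hf.ne_zero
  have hr : ∀ i, ∃ r : ℚ, (r : QBar) = f i / f i₀ := fun i => by
    refine QBar.exists_rat_of_fixed fun σ => ?_
    have h1 := hf.map_galPt σ
    rw [hs.2 σ] at h1
    obtain ⟨c, hc, h2⟩ := hf.exists_smul h h1
    have h3 := congrFun h2 i
    have h4 := congrFun h2 i₀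
    simp only [Pi.smul_apply, smul_eq_mul] at h3 h4
    rw [map_div₀, h3, h4, mul_div_mul_left _ _ hc]
  choose r hr using hr
  have hr0 : r ≠ 0 := by
    intro h0
    have := hr i₀
    rw [div_self hi₀, h0, Pi.zero_apply, Rat.cast_zero] at this
    exact zero_ne_one this
  obtain ⟨q, hq, c, hc, hrc⟩ := exists_primitive_smul hr0
  refine ⟨q, hq, ?_⟩
  have hc' : (c : QBar) ≠ 0 := by exact_mod_cast hc
  have : (fun i => (q i : QBar)) = ((c : QBar)⁻¹ * (f i₀)⁻¹) • f := by
    ext i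
    have h1 := hr i
    rw [hrc] at h1
    simp only [Pi.smul_apply, smul_eq_mul, Rat.cast_mul, Rat.cast_intCast] at h1 ⊢
    rw [mul_assoc, ← div_eq_inv_mul (f i), ← h1, inv_mul_cancel_left₀ hc']
  rw [this]
  exact hf.smul (mul_ne_zero (inv_ne_zero hc') (inv_ne_zero hi₀))

theorem eq_or_eq_neg_of_primitive {k : ℕ} {q q' : Fin k → ℤ} (hq : Finset.univ.gcd q = 1)
    (hq' : Finset.univ.gcd q' = 1) {c : QBar} (h : (fun i => (q' i : QBar)) = c • fun i => (q i : QBar)) :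
    q' = q ∨ q' = -q := by
  have key : ∀ i j, q' i * q j = q' j * q i := fun i j => by
    have h1 := congrFun h i
    have h2 := congrFun h j
    simp only [Pi.smul_apply, smul_eq_mul] at h1 h2
    have : (q' i : QBar) * q j = q' j * q i := by
      rw [h1, h2]
      ring
    exact_mod_cast this
  have hdvd : ∀ {p p' : Fin k → ℤ}, Finset.univ.gcd p = 1 → (∀ i j, p' i * p j = p' j * p i) →
      ∀ i, p i ∣ p' i := by
    intro p p' hp hk i
    obtain ⟨f, hf⟩ := Finset.gcd_eq_sum_mul .univ p
    rw [hp] at hf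
    refine ⟨∑ j, p' j * f j, ?_⟩
    calc p' i = p' i * ∑ j, p j * f j := by rw [← hf, mul_one]
      _ = _ := by
        rw [Finset.mul_sum, Finset.mul_sum]
        exact Finset.sum_congr rfl fun j _ => by linear_combination f j * hk i j
  have h1 := hdvd hq key
  have h2 := hdvd (p' := q) hq' (fun i j => by linear_combination key j i)
  obtain ⟨i₀, hi₀⟩ := Function.ne_iff.mp (ne_zero_of_primitive hq)
  rcases Int.associated_iff.mp (associated_of_dvd_dvd (h2 i₀) (h1 i₀)) with h3 | h3
  · left
    ext j
    have := key i₀ j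
    rw [h3] at this
    exact (mul_left_cancel₀ hi₀ (by rw [this]; ring)).symm
  · right
    ext j
    have := key i₀ j
    rw [h3] at this
    refine mul_left_cancel₀ hi₀ ?_
    rw [Pi.neg_apply]
    linear_combination -this

/-- Once coordinates of both points are chosen in the field of definition and scaled so that the
product of the linear forms is exactly `q`, the product of the two heights is `N ^ [K : ℚ]`. The
root in the definition of the height undoes this power. -/
theorem IsPair.symHeight_eq (h : Λ.IsStandard H) {q : Fin 3 → ℤ} (hq : Finset.univ.gcd q = 1)
    {s : Sym2 (ProjPt n)} (hs : Λ.IsPair (fun i => (q i : QBar)) s) :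
    0 < symHeight s ∧ ∀ T : ℝ, 0 < T → (symHeight s ≤ H ^ 2 * T ↔ SizeLE H T fun i => (q i : ℝ)) := by
  obtain ⟨τ, ω, hτ, hω, hf, hs'⟩ := hs
  set K := fieldOfDefinition s with hK
  have hcoord : ∀ ρ : Fin 2 → QBar, ∀ hρ : Λ.vec ρ ≠ 0, Projectivization.mk QBar _ hρ ∈ s →
      ∃ (ρ' : Fin 2 → K) (c : QBar), ρ' ≠ 0 ∧ (fun i => (ρ' i : QBar)) = c • ρ ∧
        heightOver K (Projectivization.mk QBar _ hρ) = Height.mulHeight (Λ.vec ρ') := by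
    intro ρ hρ hmem
    obtain ⟨w, hw, hx⟩ := exists_coord_fieldOfDefinition hmem
    obtain ⟨c, hc⟩ := (Projectivization.mk_eq_mk_iff' QBar _ _ hw hρ).mp hx.symm
    -- The parametrisation has a rational left inverse, so a point with coordinates in `K` has
    -- parameters in `K`.
    obtain ⟨M, hM⟩ := h.leftInv
    have h1 : (fun j => ((∑ i, (M j i : K) * w i : K) : QBar)) = c • ρ := by
      ext j
      push_cast
      rw [← hM QBar (c • ρ) j, vec_smul, hc]
    have h2 : (fun i => ((Λ.vec (fun j => ∑ i, (M j i : K) * w i) i : K) : QBar)) = fun i => (w i : QBar) := by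
      rw [← hc, ← vec_smul, ← h1]
      ext i
      simp [vec]
    have h3 : Λ.vec (fun j => ∑ i, (M j i : K) * w i) = w := by
      ext i
      exact congrFun h2 i
    refine ⟨fun j => ∑ i, (M j i : K) * w i, c, ?_, h1, ?_⟩
    · intro h0
      rw [h0, vec_zero] at h3
      apply hw
      rw [← h3]
      ext i
      simp
    · rw [hx, heightOver_mk, h3]
  obtain ⟨τ', c, hτ', hc, hHτ⟩ := hcoord τ hτ (by rw [hs']; exact Sym2.mem_mk_left _ _)
  obtain ⟨ω', d, hω', hd, hHω⟩ := hcoord ω hω (by rw [hs']; exact Sym2.mem_mk_right _ _)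
  have hfe : (fun i => ((prodForm τ' ω' i : K) : QBar)) = (c * d) • fun i => (q i : QBar) := by
    have h1 : (fun i => ((prodForm τ' ω' i : K) : QBar)) = prodForm (fun i => (τ' i : QBar)) (fun i => (ω' i : QBar)) := by
      ext i
      fin_cases i <;> simp [prodForm]
    rw [h1, hc, hd, prodForm_smul_left, prodForm_smul_right, smul_smul, hf]
  obtain ⟨i₀, hi₀⟩ := Function.ne_iff.mp (ne_zero_of_primitive hq)
  have hi₀' : (q i₀ : QBar) ≠ 0 := by exact_mod_cast hi₀
  have hi₁ : (q i₀ : K) ≠ 0 := by exact_mod_cast hi₀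
  -- The scalar relating the product of the chosen linear forms to `q`; it lies in `K`, and dividing
  -- `τ'` by it does not change the height.
  set e : K := prodForm τ' ω' i₀ / q i₀ with he
  have hecd : (e : QBar) = c * d := by
    have := congrFun hfe i₀
    simp only [Pi.smul_apply, smul_eq_mul] at this
    rw [he]
    push_cast
    rw [this, mul_div_cancel_right₀ _ hi₀']
  have hfe' : prodForm τ' ω' = e • fun i => (q i : K) := by
    ext i
    have := congrFun hfe i
    rw [← hecd] at this
    simpa using this
  have he0 : e ≠ 0 := by
    intro h0
    apply prodForm_ne_zero hτ' hω'
    rw [hfe', h0, zero_smul]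
  obtain ⟨N, hN, hN1, hN2⟩ := h.exists_mulHeight_mul_eq (smul_ne_zero (inv_ne_zero he0) hτ') hω' hq
    (by rw [prodForm_smul_left, hfe', inv_smul_smul₀ he0])
  rw [vec_smul, Height.mulHeight_smul_eq_mulHeight _ (inv_ne_zero he0), ← hHτ, ← hHω] at hN1
  have hsym : symHeight s = N := by
    rw [symHeight_eq_of_eq hs', hN1, one_div, Real.pow_rpow_inv_natCast hN.le Module.finrank_pos.ne']
  rw [hsym]
  exact ⟨hN, hN2⟩

end MetrizedLine

/-! ### Counting integral forms of bounded size -/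

section LatticeCount

/-- The integral triples `q` with `SizeLE H T q`. -/
def sizeSet (H T : ℝ) : Set (Fin 3 → ℤ) := {q | SizeLE H T fun i => (q i : ℝ)}

variable {H T : ℝ}

theorem abs_mul_div_le {H T a c : ℝ} (hT : 0 < T) (ha : |a| ≤ T) (hc : H ^ 2 * |c| ≤ T) :
    |H ^ 2 * (a * c) / T| ≤ T := by
  rw [abs_div, abs_of_pos hT, div_le_iff₀ hT, abs_mul, abs_mul, abs_of_nonneg (sq_nonneg H)]
  calc H ^ 2 * (|a| * |c|) = |a| * (H ^ 2 * |c|) := by ring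
    _ ≤ T * T := mul_le_mul ha hc (by positivity) hT.le

theorem SizeLE.mul_abs_one_le {q : Fin 3 → ℝ} (hT : 0 < T) (h : SizeLE H T q) : H * |q 1| ≤ 2 * T := by
  have := (le_abs_self _).trans (abs_mul_div_le hT h.1 h.2.1)
  linarith [h.2.2]

theorem SizeLE.smul_iff {q : Fin 3 → ℝ} {c : ℝ} (hc : 0 < c) :
    SizeLE H T (c • q) ↔ SizeLE H (T / c) q := by
  simp only [SizeLE, Pi.smul_apply, smul_eq_mul, abs_mul, abs_of_pos hc, le_div_iff₀ hc]
  have h3 : H ^ 2 * (q 0 * q 2) / (T / c) = c * (H ^ 2 * (q 0 * q 2)) / T := by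
    rw [div_div_eq_mul_div]
    ring
  rw [h3]
  refine and_congr (by rw [mul_comm]) (and_congr (by rw [← mul_assoc, mul_comm _ c]; ring_nf) ?_)
  rw [← mul_le_mul_iff_right₀ hc, ← mul_le_mul_iff_right₀ (inv_pos.mpr hc)]
  constructor
  all_goals
    intro h
    first
    | (have h4 := mul_le_mul_of_nonneg_left h hc.le
       field_simp at h4 ⊢
       linarith)

theorem sizeSet_eq_empty_of_lt (hH : 1 ≤ H) (hT : T < 1) {q : Fin 3 → ℤ} (hq : q ∈ sizeSet H T) :
    q = 0 := by
  have hlt : ∀ m : ℤ, |(m : ℝ)| < 1 → m = 0 := fun m hm => by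
    have : |m| < 1 := by exact_mod_cast hm
    exact Int.abs_lt_one_iff.mp this
  have hH2 : 1 ≤ H ^ 2 := one_le_pow₀ hH
  have h0 : q 0 = 0 := hlt _ (hq.1.trans_lt hT)
  have h2 : q 2 = 0 := hlt _ (by nlinarith [hq.2.1, abs_nonneg (q 2 : ℝ)])
  have h1 : q 1 = 0 := hlt _ (by
    have := hq.2.2
    simp only [h0, Int.cast_zero, zero_mul, mul_zero, zero_div, add_zero] at this
    nlinarith [abs_nonneg (q 1 : ℝ)])
  ext i
  fin_cases i <;> assumption

theorem abs_intCast_le_iff {m : ℤ} {x : ℝ} : |(m : ℝ)| ≤ x ↔ m ∈ Finset.Icc (-⌊x⌋) ⌊x⌋ := by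
  rw [Finset.mem_Icc, ← abs_le, Int.le_floor, Int.cast_abs]

/-- The bound for the middle coefficient. -/
def midBound (H T : ℝ) (p : ℤ × ℤ) : ℝ := (T + H ^ 2 * ((p.1 : ℝ) * p.2) / T) / H

/-- The pairs of outer coefficients. -/
def outerBox (H T : ℝ) : Finset (ℤ × ℤ) :=
  Finset.Icc (-⌊T⌋) ⌊T⌋ ×ˢ Finset.Icc (-⌊T / H ^ 2⌋) ⌊T / H ^ 2⌋

theorem mem_outerBox (hH : 1 ≤ H) {p : ℤ × ℤ} :
    p ∈ outerBox H T ↔ |(p.1 : ℝ)| ≤ T ∧ H ^ 2 * |(p.2 : ℝ)| ≤ T := by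
  rw [outerBox, Finset.mem_product, ← abs_intCast_le_iff, ← abs_intCast_le_iff,
    le_div_iff₀' (by positivity)]

theorem mem_sizeSet_iff (hH : 1 ≤ H) {q : Fin 3 → ℤ} : q ∈ sizeSet H T ↔
    (q 0, q 2) ∈ outerBox H T ∧ q 1 ∈ Finset.Icc (-⌊midBound H T (q 0, q 2)⌋) ⌊midBound H T (q 0, q 2)⌋ := by
  rw [mem_outerBox hH, ← abs_intCast_le_iff, midBound, le_div_iff₀' (by positivity), and_assoc]
  rfl

/-- The integral triples in `sizeSet H T`, as a finite set. -/
def sizeFinset (H T : ℝ) : Finset (Fin 3 → ℤ) :=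
  ((outerBox H T).sigma fun p => Finset.Icc (-⌊midBound H T p⌋) ⌊midBound H T p⌋).image
    fun x => ![x.1.1, x.2, x.1.2]

theorem coe_sizeFinset (hH : 1 ≤ H) : (sizeFinset H T : Set (Fin 3 → ℤ)) = sizeSet H T := by
  ext q
  rw [Finset.mem_coe, mem_sizeSet_iff hH, sizeFinset, Finset.mem_image]
  constructor
  · rintro ⟨x, hx, rfl⟩
    exact Finset.mem_sigma.mp hx
  · intro h
    refine ⟨⟨(q 0, q 2), q 1⟩, Finset.mem_sigma.mpr h, ?_⟩
    ext i
    fin_cases i <;> rfl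

theorem sizeSet_finite (hH : 1 ≤ H) : (sizeSet H T).Finite := by
  rw [← coe_sizeFinset hH]
  exact Finset.finite_toSet _

theorem ncard_sizeSet (hH : 1 ≤ H) : (sizeSet H T).ncard =
    ∑ p ∈ outerBox H T, (Finset.Icc (-⌊midBound H T p⌋) ⌊midBound H T p⌋).card := by
  rw [← coe_sizeFinset hH, Set.ncard_coe_finset, sizeFinset, Finset.card_image_of_injective,
    Finset.card_sigma]
  rintro ⟨⟨a, c⟩, b⟩ ⟨⟨a', c'⟩, b'⟩ h
  have h0 : a = a' := congrFun h 0
  have h1 : b = b' := congrFun h 1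
  have h2 : c = c' := congrFun h 2
  subst h0 h1 h2
  rfl

theorem card_Icc_floor {x : ℝ} (hx : 0 ≤ x) : ((Finset.Icc (-⌊x⌋) ⌊x⌋).card : ℝ) = 2 * ⌊x⌋ + 1 := by
  have h0 : 0 ≤ ⌊x⌋ := Int.floor_nonneg.mpr hx
  have h1 : ((Finset.Icc (-⌊x⌋) ⌊x⌋).card : ℤ) = 2 * ⌊x⌋ + 1 := by
    rw [Int.card_Icc, Int.toNat_of_nonneg (by omega)]
    ring
  exact_mod_cast h1

theorem abs_card_Icc_floor_sub_le {x : ℝ} (hx : 0 ≤ x) :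
    |((Finset.Icc (-⌊x⌋) ⌊x⌋).card : ℝ) - 2 * x| ≤ 1 := by
  rw [card_Icc_floor hx, abs_le]
  have h1 := Int.floor_le x
  have h2 := Int.lt_floor_add_one x
  constructor <;> linarith

theorem midBound_nonneg (hH : 1 ≤ H) (hT : 0 < T) {p : ℤ × ℤ} (hp : p ∈ outerBox H T) :
    0 ≤ midBound H T p := by
  obtain ⟨h1, h2⟩ := (mem_outerBox hH).mp hp
  have := (abs_le.mp (abs_mul_div_le hT h1 h2)).1
  exact div_nonneg (by linarith) (by linarith)

/-- The bilinear term is odd in the first outer coefficient and cancels, just as in the computation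
of the area. -/
theorem sum_midBound : ∑ p ∈ outerBox H T, midBound H T p = (outerBox H T).card * (T / H) := by
  have hodd : ∑ p ∈ outerBox H T, (p.1 : ℝ) * p.2 = 0 := by
    rw [outerBox, Finset.sum_product]
    simp only
    simp_rw [← Finset.mul_sum]
    rw [← Finset.sum_mul]
    have : ∑ i ∈ Finset.Icc (-⌊T⌋) ⌊T⌋, (i : ℝ) = 0 := by
      have h1 : ∑ i ∈ Finset.Icc (-⌊T⌋) ⌊T⌋, (i : ℝ) = ∑ i ∈ Finset.Icc (-⌊T⌋) ⌊T⌋, (-(i : ℝ)) := by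
        refine Finset.sum_nbij' (fun i => -i) (fun i => -i) ?_ ?_ ?_ ?_ ?_ <;> intro i hi
        · rw [Finset.mem_Icc] at hi ⊢; omega
        · rw [Finset.mem_Icc] at hi ⊢; omega
        · exact neg_neg i
        · exact neg_neg i
        · push_cast; ring
      rw [Finset.sum_neg_distrib] at h1
      linarith
    rw [this, zero_mul]
  have h : ∀ p ∈ outerBox H T, midBound H T p = T / H + (H ^ 2 / T / H) * ((p.1 : ℝ) * p.2) := fun p _ => by
    rw [midBound]
    ring
  rw [Finset.sum_congr rfl h, Finset.sum_add_distrib, ← Finset.mul_sum, hodd, mul_zero, add_zero,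
    Finset.sum_const, nsmul_eq_mul]

theorem abs_card_outerBox_sub_le (hH : 1 ≤ H) (hT : 1 ≤ T) :
    |((outerBox H T).card : ℝ) - 4 * T ^ 2 / H ^ 2| ≤ 5 * T ∧ ((outerBox H T).card : ℝ) ≤ 9 * T ^ 2 := by
  have hH2 : 1 ≤ H ^ 2 := one_le_pow₀ hH
  have h2 : 0 ≤ T / H ^ 2 := by positivity
  have h2' : T / H ^ 2 ≤ T := div_le_self (by linarith) hH2
  have h1 := abs_le.mp (abs_card_Icc_floor_sub_le (x := T) (by linarith))
  have h3 := abs_le.mp (abs_card_Icc_floor_sub_le h2)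
  rw [outerBox, Finset.card_product, Nat.cast_mul]
  set u : ℝ := ((Finset.Icc (-⌊T⌋) ⌊T⌋).card : ℝ)
  set w : ℝ := ((Finset.Icc (-⌊T / H ^ 2⌋) ⌊T / H ^ 2⌋).card : ℝ)
  set t := T / H ^ 2 with ht
  have hu : 0 ≤ u := Nat.cast_nonneg _
  have hw : 0 ≤ w := Nat.cast_nonneg _
  rw [show 4 * T ^ 2 / H ^ 2 = (2 * T) * (2 * t) by rw [ht]; ring]
  constructor
  · rw [abs_le]
    constructor <;> nlinarith
  · nlinarith

/-- Rounding the middle coefficient costs at most one per outer pair, hence `9 T²`; the count of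
outer pairs costs `2T · 5T`. The error is uniform in `H ≥ 1`. -/
theorem abs_ncard_sizeSet_sub_le (hH : 1 ≤ H) (hT : 1 ≤ T) :
    |((sizeSet H T).ncard : ℝ) - 8 * T ^ 3 / H ^ 3| ≤ 19 * T ^ 2 := by
  have hT0 : 0 < T := by linarith
  obtain ⟨h1, h2⟩ := abs_card_outerBox_sub_le hH hT
  have h3 : |((sizeSet H T).ncard : ℝ) - 2 * ((outerBox H T).card * (T / H))| ≤ (outerBox H T).card := by
    rw [ncard_sizeSet hH, ← sum_midBound, Nat.cast_sum, Finset.mul_sum, ← Finset.sum_sub_distrib]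
    refine (Finset.abs_sum_le_sum_abs _ _).trans ?_
    refine (Finset.sum_le_sum fun p hp => abs_card_Icc_floor_sub_le (midBound_nonneg hH hT0 hp)).trans ?_
    simp
  have h4 : |2 * ((outerBox H T).card * (T / H)) - 8 * T ^ 3 / H ^ 3| ≤ 10 * T ^ 2 := by
    have h5 : 2 * ((outerBox H T).card * (T / H)) - 8 * T ^ 3 / H ^ 3 =
        2 * (T / H) * ((outerBox H T).card - 4 * T ^ 2 / H ^ 2) := by
      field_simp
      ring
    rw [h5, abs_mul, abs_of_pos (by positivity)]
    have h6 : T / H ≤ T := div_le_self hT0.le hH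
    calc 2 * (T / H) * _ ≤ 2 * T * (5 * T) := by gcongr
      _ = _ := by ring
  calc _ ≤ _ := abs_sub_le _ (2 * ((outerBox H T).card * (T / H))) _
    _ ≤ 9 * T ^ 2 + 10 * T ^ 2 := add_le_add (h3.trans h2) h4
    _ = _ := by ring

/-- Without the leading coefficient only two bounded coefficients remain. These forms have a zero at
the point missing from an affine line. -/
theorem ncard_sizeSet_zero_le (hH : 1 ≤ H) (hT : 1 ≤ T) :
    ({q ∈ sizeSet H T | q 0 = 0}.ncard : ℝ) ≤ 9 * T ^ 2 := by
  refine le_trans ?_ (abs_card_outerBox_sub_le (H := 1) le_rfl hT).2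
  rw [← Set.ncard_coe_finset]
  have hH2 : 1 ≤ H ^ 2 := one_le_pow₀ hH
  refine Nat.cast_le.mpr (Set.ncard_le_ncard_of_injOn (fun q => (q 1, q 2)) ?_ ?_ (Finset.finite_toSet _))
  · rintro q ⟨hq, h0⟩
    rw [Finset.mem_coe, mem_outerBox le_rfl]
    have := hq.2.2
    simp only [h0, Int.cast_zero, zero_mul, mul_zero, zero_div, add_zero] at this
    exact ⟨by nlinarith [abs_nonneg (q 1 : ℝ)], by nlinarith [hq.2.1, abs_nonneg (q 2 : ℝ)]⟩
  · rintro q ⟨-, h0⟩ q' ⟨-, h0'⟩ h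
    rw [Prod.mk.injEq] at h
    ext i
    fin_cases i
    · exact h0.trans h0'.symm
    · exact h.1
    · exact h.2

theorem ncard_sizeSet_le (hH : 1 ≤ H) (hT : 1 ≤ T) : ((sizeSet H T).ncard : ℝ) ≤ 27 * T ^ 3 := by
  have h := (abs_le.mp (abs_ncard_sizeSet_sub_le hH hT)).2
  have h1 : 8 * T ^ 3 / H ^ 3 ≤ 8 * T ^ 3 := div_le_self (by positivity) (one_le_pow₀ hH)
  nlinarith [pow_pos (one_pos.trans_le hT) 2]

end LatticeCount

/-! ### Möbius inversion over the content of a form -/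

section Primitive

open ArithmeticFunction Filter Topology

theorem sum_moebius_divisors (n : ℕ) :
    ∑ d ∈ n.divisors, (moebius d : ℤ) = if n = 1 then 1 else 0 := by
  rw [← coe_mul_zeta_apply, moebius_mul_coe_zeta, one_apply]

theorem tsum_moebius_div_pow_three :
    ∑' g : ℕ, (moebius g : ℝ) / (g : ℝ) ^ 3 = 1 / ∑' m : ℕ, 1 / ((m : ℝ) + 1) ^ 3 := by
  have h := LSeries_one_mul_Lseries_moebius (s := 3) (by norm_num)
  have h1 : LSeries 1 3 = ((∑' m : ℕ, 1 / ((m : ℝ) + 1) ^ 3 : ℝ) : ℂ) := by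
    rw [LSeries_one_eq_riemannZeta (by norm_num), zeta_eq_tsum_one_div_nat_add_one_cpow (by norm_num)]
    push_cast
    refine tsum_congr fun m => ?_
    norm_cast
  have h2 : LSeries (fun n => ((moebius n : ℤ) : ℂ)) 3 = ((∑' g : ℕ, (moebius g : ℝ) / (g : ℝ) ^ 3 : ℝ) : ℂ) := by
    rw [LSeries]
    push_cast
    refine tsum_congr fun g => ?_
    rw [LSeries.term_def]
    split_ifs with hg
    · simp [hg]
    · norm_cast
  rw [h1, h2, ← Complex.ofReal_mul] at h
  have h3 := Complex.ofReal_eq_one.mp h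
  exact eq_one_div_of_mul_eq_one_right h3

variable {H : ℝ} {G : (Fin 3 → ℤ) → Prop}

/-- The forms of size at most `T` divisible by `g` are `g` times the forms of size at most `T / g`.
Detecting content one by the sum of `μ` over its divisors gives the formula. -/
theorem ncard_primitive_eq_tsum (hH : 1 ≤ H) (h0 : ∀ q, G q → q ≠ 0)
    (hG : ∀ (g : ℕ) q, g ≠ 0 → (G (g • q) ↔ G q)) {T : ℝ} :
    (({q | Finset.univ.gcd q = 1 ∧ G q ∧ q ∈ sizeSet H T}.ncard : ℕ) : ℝ) =
      ∑' g : ℕ, (moebius g : ℝ) * ({q | G q ∧ q ∈ sizeSet H (T / g)}.ncard : ℕ) := by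
  classical
  have hfin : {q | G q ∧ q ∈ sizeSet H T}.Finite := (sizeSet_finite hH).subset fun q hq => hq.2
  set R := hfin.toFinset with hR
  have hRmem : ∀ q, q ∈ R ↔ G q ∧ q ∈ sizeSet H T := fun q => by
    rw [hR, Set.Finite.mem_toFinset]
    rfl
  let c : (Fin 3 → ℤ) → ℕ := fun q => (Finset.univ.gcd q).natAbs
  have hc0 : ∀ q ∈ R, c q ≠ 0 := fun q hq h => by
    refine h0 q ((hRmem q).mp hq).1 ?_
    rw [Int.natAbs_eq_zero, Finset.gcd_eq_zero_iff] at h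
    ext i
    exact h i (Finset.mem_univ i)
  have hc1 : ∀ q, c q = 1 ↔ Finset.univ.gcd q = 1 := fun q => by
    have h1 : (0 : ℤ) ≤ Finset.univ.gcd q := Int.nonneg_of_normalize_eq_self Finset.normalize_gcd
    change (Finset.univ.gcd q).natAbs = 1 ↔ _
    omega
  have hcd : ∀ q (g : ℕ), g ∣ c q ↔ ∀ i, (g : ℤ) ∣ q i := fun q g => by
    rw [← Int.natCast_dvd, Finset.dvd_gcd_iff]
    simp
  -- The contents of the finitely many forms are bounded, so the sum over `g` is finite. The term `g
  -- = 0` vanishes because `μ 0 = 0`.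
  obtain ⟨N, hN⟩ : ∃ N : ℕ, ∀ q ∈ R, c q ≤ N := ⟨R.sup c, fun q hq => Finset.le_sup hq⟩
  obtain ⟨N', hN'⟩ := exists_nat_gt T
  have hgcard : ∀ g : ℕ, g ≠ 0 → ({q | G q ∧ q ∈ sizeSet H (T / g)}.ncard) = {q ∈ R | g ∣ c q}.card := by
    intro g hg
    have hg' : (0 : ℝ) < g := by positivity
    rw [← Set.ncard_coe_finset]
    refine Set.ncard_congr (fun q _ => g • q) ?_ ?_ ?_
    · rintro q ⟨h1, h2⟩
      rw [Finset.mem_coe, Finset.mem_filter, hRmem, hG g q hg, hcd]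
      refine ⟨⟨h1, ?_⟩, fun i => ⟨q i, by simp⟩⟩
      have h3 := (SizeLE.smul_iff (H := H) (T := T) (q := fun i => (q i : ℝ)) hg').mpr h2
      have h4 : SizeLE H T fun i => (((g • q) i : ℤ) : ℝ) := by
        convert h3 using 1
        ext i
        simp
      exact h4
    · intro q q' _ _ h
      ext i
      have := congrFun h i
      simpa [hg] using this
    · intro q hq
      rw [Finset.mem_coe, Finset.mem_filter, hRmem, hcd] at hq
      obtain ⟨⟨h1, h2⟩, h3⟩ := hq
      choose r hr using h3
      have hqr : q = g • r := by
        ext i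
        rw [hr i]
        simp
      subst hqr
      refine ⟨r, ⟨(hG g r hg).mp h1, ?_⟩, rfl⟩
      refine (SizeLE.smul_iff (H := H) (T := T) (q := fun i => (r i : ℝ)) hg').mp ?_
      have h4 : SizeLE H T fun i => (((g • r) i : ℤ) : ℝ) := h2
      convert h4 using 1
      ext i
      simp
  have hzero : ∀ g ∉ Finset.Icc 1 (max N N'),
      (moebius g : ℝ) * ({q | G q ∧ q ∈ sizeSet H (T / g)}.ncard : ℕ) = 0 := by
    intro g hg
    by_cases hg0 : g = 0
    · simp [hg0]
    · rw [hgcard g hg0, Finset.filter_eq_empty_iff.mpr, Finset.card_empty, Nat.cast_zero, mul_zero]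
      intro q hq hd
      apply hg
      rw [Finset.mem_Icc]
      exact ⟨Nat.one_le_iff_ne_zero.mpr hg0,
        (Nat.le_of_dvd (Nat.pos_of_ne_zero (hc0 q hq)) hd).trans ((hN q hq).trans (le_max_left _ _))⟩
  rw [tsum_eq_sum hzero]
  have h1 : {q | Finset.univ.gcd q = 1 ∧ G q ∧ q ∈ sizeSet H T} = ({q ∈ R | c q = 1} : Finset _) := by
    ext q
    rw [Finset.mem_coe, Finset.mem_filter, hRmem, hc1, and_comm]
    rfl
  rw [h1, Set.ncard_coe_finset]
  have h2 : (({q ∈ R | c q = 1}.card : ℕ) : ℤ) =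
      ∑ g ∈ Finset.Icc 1 (max N N'), moebius g * ({q ∈ R | g ∣ c q}.card : ℕ) := by
    simp_rw [Finset.card_filter, Nat.cast_sum, Finset.mul_sum]
    rw [Finset.sum_comm]
    refine Finset.sum_congr rfl fun q hq => ?_
    have h3 := sum_moebius_divisors (c q)
    have h4 : (c q).divisors = {g ∈ Finset.Icc 1 (max N N') | g ∣ c q} := by
      ext g
      rw [Nat.mem_divisors, Finset.mem_filter, Finset.mem_Icc]
      constructor
      · rintro ⟨hd, -⟩
        exact ⟨⟨Nat.pos_of_dvd_of_pos hd (Nat.pos_of_ne_zero (hc0 q hq)),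
          (Nat.le_of_dvd (Nat.pos_of_ne_zero (hc0 q hq)) hd).trans ((hN q hq).trans (le_max_left _ _))⟩, hd⟩
      · rintro ⟨-, hd⟩
        exact ⟨hd, hc0 q hq⟩
    rw [h4, Finset.sum_filter] at h3
    push_cast
    rw [← h3]
    refine Finset.sum_congr rfl fun g _ => ?_
    split_ifs <;> simp
  have h5 := congrArg (fun z : ℤ => (z : ℝ)) h2
  push_cast at h5
  rw [h5]
  refine Finset.sum_congr rfl fun g hg => ?_
  rw [hgcard g (by rw [Finset.mem_Icc] at hg; omega)]

theorem ncard_good_le (hH : 1 ≤ H) (h0 : ∀ q, G q → q ≠ 0) {T : ℝ} (hT : 0 < T) :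
    (({q | G q ∧ q ∈ sizeSet H T}.ncard : ℕ) : ℝ) ≤ 27 * T ^ 3 := by
  rcases lt_or_ge T 1 with h1 | h1
  · have : {q | G q ∧ q ∈ sizeSet H T} = ∅ := by
      rw [Set.eq_empty_iff_forall_notMem]
      rintro q ⟨h2, h3⟩
      exact h0 q h2 (sizeSet_eq_empty_of_lt hH h1 h3)
    rw [this, Set.ncard_empty, Nat.cast_zero]
    positivity
  · exact le_trans (Nat.cast_le.mpr (Set.ncard_le_ncard (fun q hq => hq.2) (sizeSet_finite hH)))
      (ncard_sizeSet_le hH h1)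

/-- The condition `G` excludes at most the forms with `q 0 = 0`, so the error is at most `(19 + 9)
T²`. -/
theorem tendsto_ncard_good_div (hH : 1 ≤ H) (hG : ∀ q : Fin 3 → ℤ, q 0 ≠ 0 → G q) :
    Tendsto (fun T : ℝ => (({q | G q ∧ q ∈ sizeSet H T}.ncard : ℕ) : ℝ) / T ^ 3) atTop (𝓝 (8 / H ^ 3)) := by
  have hbound : ∀ T : ℝ, 1 ≤ T →
      |(({q | G q ∧ q ∈ sizeSet H T}.ncard : ℕ) : ℝ) / T ^ 3 - 8 / H ^ 3| ≤ 28 / T := by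
    intro T hT
    have hT0 : 0 < T := one_pos.trans_le hT
    have h1 := abs_le.mp (abs_ncard_sizeSet_sub_le hH hT)
    have h2 := ncard_sizeSet_zero_le hH hT
    have h3 : ({q | G q ∧ q ∈ sizeSet H T}.ncard : ℝ) ≤ (sizeSet H T).ncard :=
      Nat.cast_le.mpr (Set.ncard_le_ncard (fun q hq => hq.2) (sizeSet_finite hH))
    have h4 : ((sizeSet H T).ncard : ℝ) ≤
        {q | G q ∧ q ∈ sizeSet H T}.ncard + {q ∈ sizeSet H T | q 0 = 0}.ncard := by
      rw [← Nat.cast_add, Nat.cast_le]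
      refine le_trans (Set.ncard_le_ncard ?_ ?_) (Set.ncard_union_le _ _)
      · intro q hq
        by_cases h : q 0 = 0
        · exact Or.inr ⟨hq, h⟩
        · exact Or.inl ⟨hG q h, hq⟩
      · exact ((sizeSet_finite hH).subset fun q hq => hq.2).union ((sizeSet_finite hH).subset fun q hq => hq.1)
    have h5 : (({q | G q ∧ q ∈ sizeSet H T}.ncard : ℕ) : ℝ) / T ^ 3 - 8 / H ^ 3 =
        (({q | G q ∧ q ∈ sizeSet H T}.ncard : ℕ) - 8 * T ^ 3 / H ^ 3) / T ^ 3 := by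
      field_simp
    rw [h5, abs_div, abs_of_pos (a := T ^ 3) (by positivity), div_le_div_iff₀ (by positivity) hT0]
    have h6 : |(({q | G q ∧ q ∈ sizeSet H T}.ncard : ℕ) : ℝ) - 8 * T ^ 3 / H ^ 3| ≤ 28 * T ^ 2 := by
      rw [abs_le]
      constructor <;> linarith [h1.1, h1.2, sq_nonneg T]
    calc _ ≤ 28 * T ^ 2 * T := by gcongr
      _ = _ := by ring
  rw [tendsto_iff_norm_sub_tendsto_zero]
  refine squeeze_zero' (Eventually.of_forall fun T => norm_nonneg _) ?_
    (tendsto_const_nhds.div_atTop tendsto_id (a := (28 : ℝ)))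
  filter_upwards [eventually_ge_atTop 1] with T hT
  exact hbound T hT

/-- Dominated convergence in the Möbius sum: after division by `T³` the term of index `g` is at most
`27 / g³`, uniformly in `T`. -/
theorem tendsto_ncard_primitive_div (hH : 1 ≤ H) (h0 : ∀ q, G q → q ≠ 0)
    (hG : ∀ (g : ℕ) q, g ≠ 0 → (G (g • q) ↔ G q)) (hG' : ∀ q : Fin 3 → ℤ, q 0 ≠ 0 → G q) :
    Tendsto (fun T : ℝ => (({q | Finset.univ.gcd q = 1 ∧ G q ∧ q ∈ sizeSet H T}.ncard : ℕ) : ℝ) / T ^ 3)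
      atTop (𝓝 (8 / H ^ 3 / ∑' m : ℕ, 1 / ((m : ℝ) + 1) ^ 3)) := by
  have hlim : ∑' g : ℕ, (moebius g : ℝ) / (g : ℝ) ^ 3 * (8 / H ^ 3) =
      8 / H ^ 3 / ∑' m : ℕ, 1 / ((m : ℝ) + 1) ^ 3 := by
    rw [tsum_mul_right, tsum_moebius_div_pow_three]
    ring
  rw [← hlim]
  have hmu : ∀ g : ℕ, |(moebius g : ℝ)| ≤ 1 := fun g => by
    have := abs_moebius_le_one (n := g)
    exact_mod_cast this
  have key := tendsto_tsum_of_dominated_convergence (𝓕 := atTop)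
    (f := fun (T : ℝ) (g : ℕ) => (moebius g : ℝ) * ({q | G q ∧ q ∈ sizeSet H (T / g)}.ncard : ℕ) / T ^ 3)
    (g := fun g : ℕ => (moebius g : ℝ) / (g : ℝ) ^ 3 * (8 / H ^ 3))
    (bound := fun g : ℕ => 27 * (1 / (g : ℝ) ^ 3))
    ((Real.summable_one_div_nat_pow.mpr (by norm_num)).mul_left 27) ?_ ?_
  · refine key.congr' ?_
    filter_upwards [eventually_gt_atTop 0] with T hT
    rw [tsum_div_const, ← ncard_primitive_eq_tsum hH h0 hG]
  · intro g
    rcases Nat.eq_zero_or_pos g with rfl | hg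
    · simp
    have hg' : (0 : ℝ) < g := Nat.cast_pos.mpr hg
    have h1 := (tendsto_ncard_good_div hH hG').comp (tendsto_id.atTop_div_const hg')
    refine (h1.const_mul ((moebius g : ℝ) / (g : ℝ) ^ 3)).congr fun T => ?_
    simp only [Function.comp_apply, id_eq, div_pow]
    field_simp
  · filter_upwards [eventually_gt_atTop 0] with T hT g
    rcases Nat.eq_zero_or_pos g with rfl | hg
    · simp
    have hg' : (0 : ℝ) < g := Nat.cast_pos.mpr hg
    have h1 := ncard_good_le hH h0 (div_pos hT hg')
    rw [norm_div, norm_mul, Real.norm_eq_abs, Real.norm_eq_abs, Real.norm_eq_abs, abs_of_pos (pow_pos hT 3),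
      Nat.abs_cast, div_le_iff₀ (by positivity)]
    calc _ ≤ 1 * (27 * (T / g) ^ 3) := mul_le_mul (hmu g) h1 (Nat.cast_nonneg _) zero_le_one
      _ = _ := by rw [div_pow]; ring

end Primitive

/-! ### The number of rational points on a plane -/

open Filter Topology

namespace MetrizedLine

variable {n : ℕ} {Λ : MetrizedLine n} {H : ℝ}

/-- A rational pair belongs to exactly two primitive integral forms, `q` and `-q`; conversely the
zeros of an integral form are a Galois-invariant pair. -/
theorem two_mul_countPoints (h : Λ.IsStandard H) {W : Set (Sym2 (ProjPt n))} (hW : W ⊆ symSquare Λ.points)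
    {B : ℝ} (hB : 0 < B) :
    {s ∈ rationalPoints W | symHeight s ≤ B}.Finite ∧ 2 * countPoints W B =
      {q : Fin 3 → ℤ | Finset.univ.gcd q = 1 ∧ (∃ s ∈ W, Λ.IsPair (fun i => (q i : QBar)) s) ∧
        q ∈ sizeSet H (B / H ^ 2)}.ncard := by
  classical
  have hH : 0 < H := one_pos.trans_le h.one_le
  have hT : 0 < B / H ^ 2 := by positivity
  have hBT : H ^ 2 * (B / H ^ 2) = B := mul_div_cancel₀ _ (by positivity)
  set S := {s ∈ rationalPoints W | symHeight s ≤ B}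
  set Q := {q : Fin 3 → ℤ | Finset.univ.gcd q = 1 ∧ (∃ s ∈ W, Λ.IsPair (fun i => (q i : QBar)) s) ∧
        q ∈ sizeSet H (B / H ^ 2)} with hQ
  have hQfin : Q.Finite := (sizeSet_finite h.one_le).subset fun q hq => hq.2.2
  have hex : ∀ s ∈ S, ∃ q : Fin 3 → ℤ, Finset.univ.gcd q = 1 ∧ Λ.IsPair (fun i => (q i : QBar)) s :=
    fun s hs => exists_primitive_isPair h ⟨hW hs.1.1, hs.1.2⟩
  choose! f hf1 hf2 using hex
  have hneg : ∀ {q : Fin 3 → ℤ} {s}, Λ.IsPair (fun i => (q i : QBar)) s →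
      Λ.IsPair (fun i => ((-q) i : QBar)) s := fun {q s} hq => by
    have := hq.smul (c := -1) (by simp)
    convert this using 1
    ext i
    simp
  have hgneg : ∀ {q : Fin 3 → ℤ}, Finset.univ.gcd q = 1 → Finset.univ.gcd (-q) = 1 := fun {q} hq => by
    have : Finset.univ.gcd (-q) = Finset.univ.gcd q := by
      refine dvd_antisymm_of_normalize_eq Finset.normalize_gcd Finset.normalize_gcd ?_ ?_ <;>
      · rw [Finset.dvd_gcd_iff]
        intro i hi
        have := Finset.gcd_dvd (f := q) hi
        have h2 := Finset.gcd_dvd (f := -q) hi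
        rw [Pi.neg_apply] at *
        first
        | exact (dvd_neg.mp h2)
        | exact (dvd_neg.mpr this)
    rw [this, hq]
  have hcrit : ∀ {q : Fin 3 → ℤ} {s}, Finset.univ.gcd q = 1 → Λ.IsPair (fun i => (q i : QBar)) s →
      (symHeight s ≤ B ↔ q ∈ sizeSet H (B / H ^ 2)) := fun {q s} h1 h2 => by
    have := (h2.symHeight_eq h h1).2 _ hT
    rwa [hBT] at this
  have hfQ : ∀ s ∈ S, f s ∈ Q := fun s hs =>
    ⟨hf1 s hs, ⟨s, hs.1.1, hf2 s hs⟩, (hcrit (hf1 s hs) (hf2 s hs)).mp hs.2⟩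
  have hfQ' : ∀ s ∈ S, -f s ∈ Q := fun s hs =>
    ⟨hgneg (hf1 s hs), ⟨s, hs.1.1, hneg (hf2 s hs)⟩,
      (hcrit (hgneg (hf1 s hs)) (hneg (hf2 s hs))).mp hs.2⟩
  have hinj : Set.InjOn f S := fun s hs s' hs' he => by
    have h1 := hf2 s' hs'
    rw [← he] at h1
    exact (hf2 s hs).unique one_ne_zero (by rwa [one_smul])
  have hSfin : S.Finite := Set.Finite.of_finite_image
    (hQfin.subset (by rintro _ ⟨s, hs, rfl⟩; exact hfQ s hs)) hinj
  refine ⟨hSfin, ?_⟩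
  have hunion : Q = f '' S ∪ (fun s => -f s) '' S := by
    ext q
    constructor
    · rintro ⟨h1, ⟨s, hsW, hs⟩, h3⟩
      have hsS : s ∈ S := ⟨⟨hsW, hs.map_galPt_eq⟩, (hcrit h1 hs).mpr h3⟩
      obtain ⟨c, -, hc⟩ := (hf2 s hsS).exists_smul h hs
      rcases eq_or_eq_neg_of_primitive (hf1 s hsS) h1 hc with h4 | h4
      · exact Or.inl ⟨s, hsS, h4.symm⟩
      · exact Or.inr ⟨s, hsS, h4.symm⟩
    · rintro (⟨s, hs, rfl⟩ | ⟨s, hs, rfl⟩)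
      · exact hfQ s hs
      · exact hfQ' s hs
  have hdisj : Disjoint (f '' S) ((fun s => -f s) '' S) := by
    rw [Set.disjoint_left]
    rintro _ ⟨s, hs, rfl⟩ ⟨s', hs', he⟩
    have he' : -f s' = f s := he
    have h1 := hneg (hf2 s' hs')
    rw [he'] at h1
    have h2 : s = s' := (hf2 s hs).unique one_ne_zero (by rwa [one_smul])
    subst h2
    apply ne_zero_of_primitive (hf1 s hs)
    ext i
    have := congrFun he' i
    rw [Pi.neg_apply] at this
    rw [Pi.zero_apply]
    omega
  rw [hunion, Set.ncard_union_eq hdisj (hSfin.image _) (hSfin.image _), hinj.ncard_image,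
    Set.InjOn.ncard_image, two_mul]
  · rfl
  · intro s hs s' hs' he
    exact hinj hs hs' (neg_injective he)

/-- The forms whose zeros lie on the line. -/
def IsGoodForm (Λ : MetrizedLine n) (q : Fin 3 → ℤ) : Prop := q ≠ 0 ∧ (Λ.complete ∨ q 0 ≠ 0)

theorem exists_mem_symSquare_iff (h : Λ.IsStandard H) {q : Fin 3 → ℤ} :
    (∃ s ∈ symSquare Λ.points, Λ.IsPair (fun i => (q i : QBar)) s) ↔ Λ.IsGoodForm q := by
  constructor
  · rintro ⟨s, hs, hq⟩
    refine ⟨?_, ((hq.mem_symSquare_iff h).mp hs).imp_right fun h0 => by exact_mod_cast h0⟩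
    rintro rfl
    exact hq.ne_zero (by ext i; simp)
  · rintro ⟨h0, h1⟩
    have h2 : (fun i => (q i : QBar)) ≠ 0 := fun h2 => h0 (by
      ext i
      have := congrFun h2 i
      simpa using this)
    obtain ⟨s, hs⟩ := exists_isPair h h2
    exact ⟨s, (hs.mem_symSquare_iff h).mpr (h1.imp_right fun h0 => by exact_mod_cast h0), hs⟩

theorem two_mul_countPoints_symSquare (h : Λ.IsStandard H) {B : ℝ} (hB : 0 < B) :
    2 * countPoints (symSquare Λ.points) B =
      {q : Fin 3 → ℤ | Finset.univ.gcd q = 1 ∧ Λ.IsGoodForm q ∧ q ∈ sizeSet H (B / H ^ 2)}.ncard := by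
  rw [(two_mul_countPoints h subset_rfl hB).2]
  simp only [exists_mem_symSquare_iff h]

/-- A bound valid for every `B > 0`, with `14 ≥ 27/2`. The exponent of `H` exceeds two, which makes
the bounds summable over the fibres. -/
theorem countPoints_symSquare_le (h : Λ.IsStandard H) {B : ℝ} (hB : 0 < B) :
    (countPoints (symSquare Λ.points) B : ℝ) ≤ 14 * (B ^ 3 / H ^ 6) := by
  have hH : 0 < H := one_pos.trans_le h.one_le
  have h1 := two_mul_countPoints_symSquare h hB
  have h2 : ({q : Fin 3 → ℤ | Finset.univ.gcd q = 1 ∧ Λ.IsGoodForm q ∧ q ∈ sizeSet H (B / H ^ 2)}.ncard : ℝ) ≤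
      27 * (B / H ^ 2) ^ 3 := by
    refine le_trans (Nat.cast_le.mpr (Set.ncard_le_ncard ?_ ?_))
      (ncard_good_le (G := Λ.IsGoodForm) h.one_le (fun q hq => hq.1) (T := B / H ^ 2) (by positivity))
    · exact fun q hq => hq.2
    · exact (sizeSet_finite h.one_le).subset fun q hq => hq.2
  rw [← h1, div_pow, ← pow_mul] at h2
  push_cast at h2
  have h3 : 0 ≤ B ^ 3 / H ^ 6 := by positivity
  linarith

theorem tendsto_countPoints_div (h : Λ.IsStandard H) :
    Tendsto (fun B : ℝ => (countPoints (symSquare Λ.points) B : ℝ) / B ^ 3) atTop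
      (𝓝 (4 / (∑' m : ℕ, 1 / ((m : ℝ) + 1) ^ 3) / H ^ 9)) := by
  have hH : 0 < H := one_pos.trans_le h.one_le
  have h1 := tendsto_ncard_primitive_div (G := Λ.IsGoodForm) h.one_le (fun q hq => hq.1) (fun g q hg => by
    rw [IsGoodForm, IsGoodForm, ← natCast_zsmul q g, smul_ne_zero_iff, Pi.smul_apply, smul_ne_zero_iff]
    simp [hg]) (fun q hq => ⟨fun h0 => hq (by rw [h0]; rfl), Or.inr hq⟩)
  have h2 := (h1.comp (tendsto_id.atTop_div_const (r := H ^ 2) (by positivity))).mul_const (1 / (2 * H ^ 6))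
  refine (h2.congr' ?_).trans (le_of_eq ?_)
  · filter_upwards [eventually_gt_atTop 0] with B hB
    have h3 := two_mul_countPoints_symSquare h hB
    have h4 : (countPoints (symSquare Λ.points) B : ℝ) =
        ({q : Fin 3 → ℤ | Finset.univ.gcd q = 1 ∧ Λ.IsGoodForm q ∧ q ∈ sizeSet H (B / H ^ 2)}.ncard : ℝ) / 2 := by
      rw [← h3]
      push_cast
      ring
    rw [h4]
    simp only [Function.comp_apply, id_eq]
    field_simp
  · congr 1
    field_simp
    norm_num

end MetrizedLine

/-! ### Strong saturation of the planes -/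

section Saturation

/-- For `q 0 ≠ 0` let `z = τ₁/τ₀` and `t = q₁/q₀`, the sum of the two affine zeros. The equation
becomes `r t` evaluated at `z`, a polynomial of degree at most `deg P`. Unless it vanishes
identically, `q₀` and `q₁` leave at most `deg P` values of `q₂`; it vanishes identically only for
finitely many `t`, and then `q₀` determines `q₁`. As `P` need not be bihomogeneous, its vanishing is
assumed for all rescalings of the two linear forms. -/
theorem exists_ncard_le_of_mvPolynomial {P : MvPolynomial (Fin 4) QBar} (hP : P ≠ 0) {H : ℝ} (hH : 1 ≤ H) :
    ∃ C : ℝ, ∀ T : ℝ, 1 ≤ T →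
      ({q : Fin 3 → ℤ | q ∈ sizeSet H T ∧ ∃ τ ω : Fin 2 → QBar, prodForm τ ω = (fun i => (q i : QBar)) ∧
        ∀ a b : QBar, a ≠ 0 → b ≠ 0 →
          MvPolynomial.eval ![a * τ 0, a * τ 1, b * ω 0, b * ω 1] P = 0}.ncard : ℝ) ≤ C * T ^ 2 := by
  classical
  -- The extra factors give a point where `P` does not vanish and where the coordinates `l`, `m`
  -- used for dehomogenising are non-zero.
  have hP' : P * MvPolynomial.X 0 * MvPolynomial.X 2 ≠ 0 :=
    mul_ne_zero (mul_ne_zero hP (MvPolynomial.X_ne_zero 0)) (MvPolynomial.X_ne_zero 2)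
  obtain ⟨x, hx⟩ : ∃ x, MvPolynomial.eval x (P * MvPolynomial.X 0 * MvPolynomial.X 2) ≠ 0 := by
    by_contra! hc
    exact hP' (MvPolynomial.funext fun x => by rw [hc, map_zero])
  simp only [map_mul, MvPolynomial.eval_X] at hx
  have hl : x 0 ≠ 0 := fun h => hx (by rw [h]; ring)
  have hm : x 2 ≠ 0 := fun h => hx (by rw [h]; ring)
  have hPx : MvPolynomial.eval x P ≠ 0 := fun h => hx (by rw [h]; ring)
  set l := x 0
  set m := x 2
  set u := x 1 / l with hu
  set v := x 3 / m with hv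
  let r : QBar → Polynomial QBar := fun t => MvPolynomial.aeval
    ![.C l, .C l * .X, .C m, .C m * (.C t - .X)] P
  let R : Polynomial QBar := MvPolynomial.aeval ![.C l, .C (l * u), .C m, .C m * (.X - .C u)] P
  have heval : ∀ (f : Fin 4 → Polynomial QBar) (z : QBar) (p : MvPolynomial (Fin 4) QBar),
      (MvPolynomial.aeval f p).eval z = MvPolynomial.eval (fun i => (f i).eval z) p := by
    intro f z p
    induction p using MvPolynomial.induction_on with
    | C a => simp
    | add p q hp hq => simp [hp, hq]
    | mul_X p i hp => simp [hp]
  have hr : ∀ t z, (r t).eval z = MvPolynomial.eval ![l, l * z, m, m * (t - z)] P := by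
    intro t z
    rw [heval]
    congr 2
    ext i
    fin_cases i <;> simp
  have hR : ∀ t, R.eval t = MvPolynomial.eval ![l, l * u, m, m * (t - u)] P := by
    intro t
    rw [heval]
    congr 2
    ext i
    fin_cases i <;> simp
  -- `R t` is the value of `r t` at `u`, and at `t = u + v` it is the value of `P` at the chosen
  -- point.
  have hR0 : R ≠ 0 := by
    intro h0
    have h1 := hR (u + v)
    rw [h0, Polynomial.eval_zero] at h1
    apply hPx
    rw [h1]
    congr 2
    ext i
    fin_cases i
    · rfl
    · simp [hu, mul_div_cancel₀ _ hl]
    · rfl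
    · simp [hv, mul_div_cancel₀ _ hm]
  have hr0 : ∀ t, R.eval t ≠ 0 → r t ≠ 0 := by
    intro t ht h0
    apply ht
    rw [hR, ← hr, h0, Polynomial.eval_zero]
  have hdeg : ∀ t, (r t).roots.toFinset.card ≤ P.totalDegree := by
    intro t
    refine (Multiset.toFinset_card_le _).trans ((Polynomial.card_roots' _).trans ?_)
    refine (MvPolynomial.aeval_natDegree_le (n := 1) P le_rfl _ ?_).trans (mul_one _).le
    intro i
    fin_cases i
    · simp
    · exact (Polynomial.natDegree_C_mul_le _ _).trans Polynomial.natDegree_X_le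
    · simp
    · refine (Polynomial.natDegree_C_mul_le _ _).trans ?_
      rw [Polynomial.natDegree_sub]
      exact (Polynomial.natDegree_X_sub_C _).le
  -- The three terms count the forms with `q 0 = 0`, those with `t` a root of `R`, and the others.
  -- The last use `|q 0|, |q 1| ≤ 2T`, whence `9 (2T)² = 36 T²` pairs.
  refine ⟨9 + R.roots.toFinset.card * 9 + P.totalDegree * 36, fun T hT => ?_⟩
  have hT0 : 0 < T := one_pos.trans_le hT
  set E := {q : Fin 3 → ℤ | q ∈ sizeSet H T ∧ ∃ τ ω : Fin 2 → QBar, prodForm τ ω = (fun i => (q i : QBar)) ∧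
        ∀ a b : QBar, a ≠ 0 → b ≠ 0 →
          MvPolynomial.eval ![a * τ 0, a * τ 1, b * ω 0, b * ω 1] P = 0} with hE
  have hEfin : E.Finite := (sizeSet_finite hH).subset fun q hq => hq.1
  have hroot : ∀ q ∈ E, q 0 ≠ 0 → ∃ z : QBar, (r (q 1 / q 0)).eval z = 0 ∧
      (q 2 : QBar) = q 0 * (z * (q 1 / q 0 - z)) := by
    rintro q ⟨-, τ, ω, hf, hz⟩ h0
    have h0' : (q 0 : QBar) ≠ 0 := by exact_mod_cast h0
    have f0 : τ 0 * ω 0 = (q 0 : QBar) := congrFun hf 0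
    have f1 : τ 0 * ω 1 + τ 1 * ω 0 = (q 1 : QBar) := congrFun hf 1
    have f2 : τ 1 * ω 1 = (q 2 : QBar) := congrFun hf 2
    have hτ0 : τ 0 ≠ 0 := fun h => h0' (by rw [← f0, h, zero_mul])
    have hω0 : ω 0 ≠ 0 := fun h => h0' (by rw [← f0, h, mul_zero])
    have ht : (q 1 : QBar) / q 0 - τ 1 / τ 0 = ω 1 / ω 0 := by
      rw [← f1, ← f0]
      field_simp
      ring
    refine ⟨τ 1 / τ 0, ?_, ?_⟩
    · rw [hr, ht, ← hz (l / τ 0) (m / ω 0) (div_ne_zero hl hτ0) (div_ne_zero hm hω0)]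
      congr 2
      ext i
      fin_cases i <;> simp <;> field_simp
    · rw [ht, ← f0, ← f2]
      field_simp
  have hbox : ∀ q ∈ E, (q 0, q 1) ∈ outerBox 1 (2 * T) := by
    rintro q ⟨hq, -⟩
    rw [mem_outerBox le_rfl]
    have h1 := SizeLE.mul_abs_one_le (q := fun i => (q i : ℝ)) hT0 hq
    exact ⟨by linarith [hq.1], by nlinarith [abs_nonneg (q 1 : ℝ)]⟩
  have hsub : E ⊆ {q ∈ sizeSet H T | q 0 = 0} ∪ ({q ∈ E | q 0 ≠ 0 ∧ R.eval ((q 1 : QBar) / q 0) = 0} ∪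
      {q ∈ E | q 0 ≠ 0 ∧ R.eval ((q 1 : QBar) / q 0) ≠ 0}) := by
    intro q hq
    by_cases h0 : q 0 = 0
    · exact Or.inl ⟨hq.1, h0⟩
    · by_cases h1 : R.eval ((q 1 : QBar) / q 0) = 0
      · exact Or.inr (Or.inl ⟨hq, h0, h1⟩)
      · exact Or.inr (Or.inr ⟨hq, h0, h1⟩)
  have hA : ({q ∈ E | q 0 ≠ 0 ∧ R.eval ((q 1 : QBar) / q 0) = 0}.ncard : ℝ) ≤
      R.roots.toFinset.card * (9 * T ^ 2) := by
    have h1 : {q ∈ E | q 0 ≠ 0 ∧ R.eval ((q 1 : QBar) / q 0) = 0}.ncard ≤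
        (R.roots.toFinset ×ˢ outerBox H T).card := by
      rw [← Set.ncard_coe_finset]
      refine Set.ncard_le_ncard_of_injOn (fun q => ((q 1 : QBar) / q 0, (q 0, q 2))) ?_ ?_
        (Finset.finite_toSet _)
      · rintro q ⟨hq, h0, h1⟩
        rw [Finset.mem_coe, Finset.mem_product, Multiset.mem_toFinset, Polynomial.mem_roots hR0]
        exact ⟨h1, (mem_outerBox hH).mpr ⟨hq.1.1, hq.1.2.1⟩⟩
      · rintro q ⟨-, h0, -⟩ q' ⟨-, h0', -⟩ he
        simp only [Prod.mk.injEq] at he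
        obtain ⟨h1, h2, h3⟩ := he
        have h0' : (q 0 : QBar) ≠ 0 := by exact_mod_cast h0
        rw [← h2, div_left_inj' h0'] at h1
        ext i
        fin_cases i
        · exact h2
        · exact_mod_cast h1
        · exact h3
    calc _ ≤ (((R.roots.toFinset ×ˢ outerBox H T).card : ℕ) : ℝ) := Nat.cast_le.mpr h1
      _ ≤ _ := by
        rw [Finset.card_product, Nat.cast_mul]
        exact mul_le_mul_of_nonneg_left (abs_card_outerBox_sub_le hH hT).2 (Nat.cast_nonneg _)
  have hBd : ({q ∈ E | q 0 ≠ 0 ∧ R.eval ((q 1 : QBar) / q 0) ≠ 0}.ncard : ℝ) ≤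
      P.totalDegree * (36 * T ^ 2) := by
    have hfin : {q ∈ E | q 0 ≠ 0 ∧ R.eval ((q 1 : QBar) / q 0) ≠ 0}.Finite := hEfin.subset fun q hq => hq.1
    set s := hfin.toFinset with hs
    have hmem : ∀ q, q ∈ s ↔ q ∈ E ∧ q 0 ≠ 0 ∧ R.eval ((q 1 : QBar) / q 0) ≠ 0 := fun q => by
      rw [hs, Set.Finite.mem_toFinset]
      rfl
    rw [Set.ncard_eq_toFinset_card _ hfin, ← hs]
    have h1 : s.card ≤ P.totalDegree * (s.image fun q => (q 0, q 1)).card := by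
      refine Finset.card_le_mul_card_image s _ ?_
      intro p hp
      obtain ⟨q₀, hq₀, rfl⟩ := Finset.mem_image.mp hp
      obtain ⟨-, h0, hR'⟩ := (hmem q₀).mp hq₀
      have hne := hr0 _ hR'
      refine le_trans ?_ (hdeg ((q₀ 1 : QBar) / q₀ 0))
      refine le_trans (Finset.card_le_card_of_injOn (t := (r ((q₀ 1 : QBar) / q₀ 0)).roots.toFinset.image
        fun z => (q₀ 0 : QBar) * (z * (q₀ 1 / q₀ 0 - z))) (fun q => (q 2 : QBar)) ?_ ?_) Finset.card_image_le
      · intro q hq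
        rw [Finset.mem_coe, Finset.mem_filter, Prod.mk.injEq] at hq
        obtain ⟨hq, e0, e1⟩ := hq
        obtain ⟨hqE, hq0, -⟩ := (hmem q).mp hq
        obtain ⟨z, hz, hz2⟩ := hroot q hqE hq0
        rw [e0, e1] at hz hz2
        rw [Finset.mem_coe, Finset.mem_image]
        exact ⟨z, by rwa [Multiset.mem_toFinset, Polynomial.mem_roots hne], hz2.symm⟩
      · intro q hq q' hq' he
        rw [Finset.mem_coe, Finset.mem_filter, Prod.mk.injEq] at hq hq'
        ext i
        fin_cases i
        · exact hq.2.1.trans hq'.2.1.symm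
        · exact hq.2.2.trans hq'.2.2.symm
        · have h3 : (q 2 : QBar) = q' 2 := he
          exact_mod_cast h3
    have h2 : (s.image fun q => (q 0, q 1)).card ≤ (outerBox 1 (2 * T)).card := by
      refine Finset.card_le_card ?_
      intro p hp
      obtain ⟨q, hq, rfl⟩ := Finset.mem_image.mp hp
      exact hbox q ((hmem q).mp hq).1
    have h3 := (abs_card_outerBox_sub_le (H := 1) le_rfl (T := 2 * T) (by linarith)).2
    calc ((s.card : ℕ) : ℝ) ≤ ((P.totalDegree * (outerBox 1 (2 * T)).card : ℕ) : ℝ) :=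
          Nat.cast_le.mpr (h1.trans (Nat.mul_le_mul_left _ h2))
      _ ≤ _ := by
        rw [Nat.cast_mul]
        refine mul_le_mul_of_nonneg_left (h3.trans (le_of_eq (by ring))) (Nat.cast_nonneg _)
  have hle : (E.ncard : ℝ) ≤ {q ∈ sizeSet H T | q 0 = 0}.ncard +
      ({q ∈ E | q 0 ≠ 0 ∧ R.eval ((q 1 : QBar) / q 0) = 0}.ncard +
      {q ∈ E | q 0 ≠ 0 ∧ R.eval ((q 1 : QBar) / q 0) ≠ 0}.ncard) := by
    rw [← Nat.cast_add, ← Nat.cast_add, Nat.cast_le]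
    refine (Set.ncard_le_ncard hsub ?_).trans ((Set.ncard_union_le _ _).trans
      (Nat.add_le_add_left (Set.ncard_union_le _ _) _))
    exact ((sizeSet_finite hH).subset fun q hq => hq.1).union
      ((hEfin.subset fun q hq => hq.1).union (hEfin.subset fun q hq => hq.1))
  have h0 := ncard_sizeSet_zero_le hH hT
  linarith

namespace MetrizedLine

variable {n : ℕ} {Λ : MetrizedLine n} {H : ℝ}

/-- One of the equations of `Z` fails at some pair of the plane; `P` is its restriction to the
parametrisation. -/
theorem exists_mvPolynomial_of_not_subset {Z : Set (Sym2 (ProjPt n))} (hZ : IsZariskiClosed Z)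
    (hW : ¬ symSquare Λ.points ⊆ Z) : ∃ P : MvPolynomial (Fin 4) QBar, P ≠ 0 ∧
      ∀ (τ ω : Fin 2 → QBar) (hτ : Λ.vec τ ≠ 0) (hω : Λ.vec ω ≠ 0),
        s(Projectivization.mk QBar _ hτ, Projectivization.mk QBar _ hω) ∈ Z →
          MvPolynomial.eval ![τ 0, τ 1, ω 0, ω 1] P = 0 := by
  obtain ⟨I, hI⟩ := hZ
  obtain ⟨s, hs, hsZ⟩ := Set.not_subset.mp hW
  rw [hI] at hsZ
  push Not at hsZ
  obtain ⟨v, w, hv, hw, rfl, F, hF, hne⟩ := hsZ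
  let P : MvPolynomial (Fin 4) QBar := MvPolynomial.bind₁ (Sum.elim
    (fun i => MvPolynomial.C (Λ.coord i 0 : QBar) * MvPolynomial.X 0 + MvPolynomial.C (Λ.coord i 1 : QBar) * MvPolynomial.X 1)
    (fun i => MvPolynomial.C (Λ.coord i 0 : QBar) * MvPolynomial.X 2 + MvPolynomial.C (Λ.coord i 1 : QBar) * MvPolynomial.X 3)) F
  have hP : ∀ τ ω : Fin 2 → QBar, MvPolynomial.eval ![τ 0, τ 1, ω 0, ω 1] P =
      MvPolynomial.eval (Sum.elim (Λ.vec τ) (Λ.vec ω)) F := by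
    intro τ ω
    have h1 : MvPolynomial.eval ![τ 0, τ 1, ω 0, ω 1] P = _ := MvPolynomial.eval₂Hom_bind₁ _ _ _ F
    rw [h1]
    change MvPolynomial.eval _ F = _
    congr 2
    ext (i | i) <;> simp [vec]
  have hlift : ∀ (v : Fin n → QBar) (hv : v ≠ 0), Projectivization.mk QBar v hv ∈ Λ.points →
      ∃ τ : Fin 2 → QBar, v = Λ.vec τ := by
    rintro v hv ⟨τ, -, -, hτ, hx⟩
    obtain ⟨a, ha⟩ := (Projectivization.mk_eq_mk_iff' QBar _ _ hv hτ).mp hx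
    exact ⟨a • τ, by rw [vec_smul, ← ha]; rfl⟩
  obtain ⟨τ₀, rfl⟩ := hlift v hv (hs _ (Sym2.mem_mk_left _ _))
  obtain ⟨ω₀, rfl⟩ := hlift w hw (hs _ (Sym2.mem_mk_right _ _))
  refine ⟨P, ?_, ?_⟩
  · intro h0
    apply hne
    rw [← hP, h0, map_zero]
  · intro τ ω hτ hω hZ
    rw [hP]
    exact (hI _).mp hZ _ _ hτ hω rfl F hF

/-- `O(B²)` points on the closed subset are compared with a positive multiple of `B³` on the plane.
-/
theorem isStronglySaturated (h : Λ.IsStandard H) : IsStronglySaturated (symSquare Λ.points) := by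
  intro Z hZ hW
  have hH : 0 < H := one_pos.trans_le h.one_le
  obtain ⟨P, hP, hPZ⟩ := exists_mvPolynomial_of_not_subset hZ hW
  obtain ⟨C, hC⟩ := exists_ncard_le_of_mvPolynomial hP h.one_le
  have hcount : ∀ B : ℝ, H ^ 2 ≤ B → (countPoints (symSquare Λ.points ∩ Z) B : ℝ) ≤ |C| * B ^ 2 := by
    intro B hB
    have hB0 : 0 < B := lt_of_lt_of_le (by positivity) hB
    have hT : 1 ≤ B / H ^ 2 := (one_le_div (by positivity)).mpr hB
    have h1 := (two_mul_countPoints h (Set.inter_subset_left (s := symSquare Λ.points) (t := Z)) hB0).2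
    have h2 := hC _ hT
    have h3 : {q : Fin 3 → ℤ | Finset.univ.gcd q = 1 ∧
        (∃ s ∈ symSquare Λ.points ∩ Z, Λ.IsPair (fun i => (q i : QBar)) s) ∧ q ∈ sizeSet H (B / H ^ 2)}.ncard ≤ _ :=
      Set.ncard_le_ncard (t := {q : Fin 3 → ℤ | q ∈ sizeSet H (B / H ^ 2) ∧
        ∃ τ ω : Fin 2 → QBar, prodForm τ ω = (fun i => (q i : QBar)) ∧ ∀ a b : QBar, a ≠ 0 → b ≠ 0 →
          MvPolynomial.eval ![a * τ 0, a * τ 1, b * ω 0, b * ω 1] P = 0}) (by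
        rintro q ⟨-, ⟨s, ⟨-, hsZ⟩, τ, ω, hτ, hω, hf, rfl⟩, hq⟩
        refine ⟨hq, τ, ω, hf, fun a b ha hb => ?_⟩
        have ha' : Λ.vec (a • τ) ≠ 0 := by
          rw [vec_smul]
          exact smul_ne_zero ha hτ
        have hb' : Λ.vec (b • ω) ≠ 0 := by
          rw [vec_smul]
          exact smul_ne_zero hb hω
        have h4 := hPZ (a • τ) (b • ω) ha' hb' (by
          rwa [mk_eq_mk_of_smul ha' hτ (vec_smul a τ), mk_eq_mk_of_smul hb' hω (vec_smul b ω)])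
        simpa using h4) ((sizeSet_finite h.one_le).subset fun q hq => hq.1)
    rw [← h1] at h3
    have h4 : (2 * countPoints (symSquare Λ.points ∩ Z) B : ℝ) ≤ C * (B / H ^ 2) ^ 2 :=
      le_trans (by exact_mod_cast h3) h2
    have h5 : C * (B / H ^ 2) ^ 2 ≤ |C| * B ^ 2 := by
      have h6 : B / H ^ 2 ≤ B := div_le_self hB0.le (one_le_pow₀ h.one_le)
      have h7 : 0 ≤ B / H ^ 2 := by positivity
      exact mul_le_mul (le_abs_self C) (by gcongr) (by positivity) (abs_nonneg C)
    have h8 : (0 : ℝ) ≤ countPoints (symSquare Λ.points ∩ Z) B := Nat.cast_nonneg _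
    linarith
  have hpos : 0 < 4 / (∑' m : ℕ, 1 / ((m : ℝ) + 1) ^ 3) / H ^ 9 := by
    have h3 : 0 < ∑' m : ℕ, 1 / ((m : ℝ) + 1) ^ 3 := by
      have hs : Summable fun m : ℕ => 1 / ((m : ℝ) + 1) ^ 3 := by
        have := (summable_nat_add_iff 1).mpr (Real.summable_one_div_nat_pow.mpr (by norm_num : 1 < 3))
        simpa using this
      exact hs.tsum_pos (fun m => by positivity) 0 (by simp)
    positivity
  have hlim := tendsto_countPoints_div h
  have hz : Tendsto (fun B : ℝ => (countPoints (symSquare Λ.points ∩ Z) B : ℝ) / B ^ 3) atTop (𝓝 0) := by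
    refine squeeze_zero' ?_ ?_ (tendsto_const_nhds.div_atTop tendsto_id (a := |C|))
    · filter_upwards [eventually_ge_atTop 0] with B hB
      positivity
    · filter_upwards [eventually_ge_atTop (H ^ 2)] with B hB
      have hB0 : 0 < B := lt_of_lt_of_le (by positivity) hB
      rw [id_eq, div_le_div_iff₀ (by positivity) hB0]
      calc _ ≤ |C| * B ^ 2 * B := by gcongr; exact hcount B hB
        _ = _ := by ring
  have := hz.div hlim hpos.ne'
  rw [zero_div] at this
  refine this.congr' ?_
  filter_upwards [eventually_gt_atTop 0] with B hB
  simp only [Pi.div_apply]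
  rw [div_div_div_cancel_right₀ (by positivity)]

end MetrizedLine

end Saturation

/-! ### Tools for upper bounds -/

section Counting

/-- Rankin's trick: elements whose weights are at least `c` are counted by a convergent sum of
weights. -/
theorem ncard_mul_le_tsum {α ι : Type*} {S : Set α} {f : α → ι} (hf : Set.InjOn f S) {w : ι → ℝ}
    (hw : Summable w) (hw0 : ∀ i, 0 ≤ w i) {c : ℝ} (hc : 0 < c) (h : ∀ s ∈ S, c ≤ w (f s)) :
    S.Finite ∧ S.ncard * c ≤ ∑' i, w i := by
  have hfin : {i | c ≤ w i}.Finite := by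
    have := (hw.tendsto_cofinite_zero.eventually (gt_mem_nhds hc))
    rw [Filter.eventually_cofinite] at this
    simpa using this
  have hS : S.Finite := Set.Finite.of_finite_image
    (hfin.subset (by rintro _ ⟨s, hs, rfl⟩; exact h s hs)) hf
  refine ⟨hS, ?_⟩
  classical
  rw [Set.ncard_eq_toFinset_card _ hS]
  calc (hS.toFinset.card : ℝ) * c = ∑ s ∈ hS.toFinset, c := by rw [Finset.sum_const, nsmul_eq_mul]
    _ ≤ ∑ s ∈ hS.toFinset, w (f s) := Finset.sum_le_sum fun s hs => h s (hS.mem_toFinset.mp hs)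
    _ = ∑ i ∈ hS.toFinset.image f, w i := by
      rw [Finset.sum_image]
      intro s hs t ht he
      exact hf (hS.mem_toFinset.mp hs) (hS.mem_toFinset.mp ht) he
    _ ≤ _ := hw.sum_le_tsum _ fun i _ => hw0 i

theorem Nat.succ_pow_three_le (v : ℕ) : (v + 1) ^ 3 ≤ 8 * 2 ^ v := by
  induction v using Nat.strong_induction_on with
  | _ v ih =>
    rcases Nat.lt_or_ge v 5 with h | h
    · interval_cases v <;> norm_num
    · obtain ⟨k, rfl⟩ : ∃ k, v = k + 1 := ⟨v - 1, by omega⟩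
      have h1 := ih k (by omega)
      have h2 : (k + 1 + 1) ^ 3 ≤ 2 * (k + 1) ^ 3 := by
        obtain ⟨j, rfl⟩ := Nat.exists_eq_add_of_le (show 4 ≤ k by omega)
        nlinarith [Nat.zero_le (j ^ 3), Nat.zero_le (j ^ 2)]
      rw [pow_succ 2]
      omega

/-- Compare the factors of the number of divisors prime by prime: `(v + 1)³ ≤ 8 ^ v ≤ p ^ v` for `p
≥ 8`, while each smaller prime costs a factor `8`, and there are fewer than eight of those. -/
theorem Nat.card_divisors_pow_three_le {n : ℕ} (hn : n ≠ 0) : n.divisors.card ^ 3 ≤ 8 ^ 8 * n := by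
  have h1 : n.divisors.card ^ 3 ≤
      ∏ p ∈ n.primeFactors, ((if p < 8 then 8 else 1) * p ^ n.factorization p) := by
    rw [Nat.card_divisors hn, ← Finset.prod_pow]
    refine Finset.prod_le_prod' fun p hp => ?_
    have hp2 := (Nat.prime_of_mem_primeFactors hp).two_le
    split_ifs with h
    · exact (Nat.succ_pow_three_le _).trans (Nat.mul_le_mul_left _ (Nat.pow_le_pow_left hp2 _))
    · calc (n.factorization p + 1) ^ 3 ≤ (2 ^ n.factorization p) ^ 3 :=
          Nat.pow_le_pow_left (Nat.lt_two_pow_self) 3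
        _ = 8 ^ n.factorization p := by rw [← pow_mul, mul_comm, pow_mul]; norm_num
        _ ≤ p ^ n.factorization p := Nat.pow_le_pow_left (by omega) _
        _ = _ := (one_mul _).symm
  refine h1.trans ?_
  rw [Finset.prod_mul_distrib]
  refine Nat.mul_le_mul ?_ (le_of_eq ?_)
  · rw [Finset.prod_ite, Finset.prod_const, Finset.prod_const_one, mul_one]
    refine Nat.pow_le_pow_right (by norm_num) ?_
    refine (Finset.card_le_card (t := Finset.range 8) ?_).trans (by simp)
    intro p hp
    exact Finset.mem_range.mpr (Finset.mem_filter.mp hp).2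
  · exact Nat.prod_factorization_pow_eq_self hn

theorem Int.exists_eq_sq_mul_squarefree (D : ℤ) (hD : D ≠ 0) :
    ∃ d f : ℤ, f ≠ 0 ∧ d ≠ 0 ∧ Squarefree d ∧ D = f ^ 2 * d := by
  obtain ⟨a, b, hab, ha⟩ := Nat.sq_mul_squarefree D.natAbs
  have hDn : D.natAbs ≠ 0 := Int.natAbs_ne_zero.mpr hD
  have hb : b ≠ 0 := by
    rintro rfl
    exact hDn (by rw [← hab]; simp)
  have ha0 : a ≠ 0 := by
    rintro rfl
    exact hDn (by rw [← hab]; simp)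
  rcases Int.natAbs_eq D with h | h
  · refine ⟨a, b, by exact_mod_cast hb, by exact_mod_cast ha0, Int.squarefree_natCast.mpr ha, ?_⟩
    rw [h, ← hab]
    push_cast
    ring
  · refine ⟨-a, b, by exact_mod_cast hb, by simpa using ha0, Int.squarefree_natAbs.mp (by simpa using ha), ?_⟩
    rw [h, ← hab]
    push_cast
    ring

theorem summable_max_one_abs_rpow {a : ℝ} (ha : 1 < a) : Summable fun m : ℤ => (max 1 |(m : ℝ)|) ^ (-a) := by
  refine (Real.summable_abs_int_rpow ha).congr_cofinite ?_
  rw [Filter.EventuallyEq, Filter.eventually_cofinite]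
  refine (Set.finite_singleton (0 : ℤ)).subset fun m hm => ?_
  by_contra h0
  apply hm
  have : (1 : ℝ) ≤ |(m : ℝ)| := by exact_mod_cast Int.one_le_abs h0
  rw [max_eq_right this]

/-- The norm dominates each `max 1 |q i|`, so the sum is bounded by a product of three sums with
exponent `a / 3 > 1`. -/
theorem summable_norm_rpow_fin_three {a : ℝ} (ha : 3 < a) :
    Summable fun q : {q : Fin 3 → ℤ // q ≠ 0} => ‖q.1‖ ^ (-a) := by
  have h1 := summable_max_one_abs_rpow (a := a / 3) (by linarith)
  have h0 : ∀ m : ℤ, 0 ≤ (max 1 |(m : ℝ)|) ^ (-(a / 3)) := fun m => by positivity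
  have h2 := h1.mul_of_nonneg (h1.mul_of_nonneg h1 h0 h0) h0 fun x => mul_nonneg (h0 _) (h0 _)
  have h3 := h2.comp_injective (i := fun q : {q : Fin 3 → ℤ // q ≠ 0} => (q.1 0, q.1 1, q.1 2)) (by
    intro q q' h
    simp only [Prod.mk.injEq] at h
    ext i
    fin_cases i
    · exact h.1
    · exact h.2.1
    · exact h.2.2)
  refine Summable.of_nonneg_of_le (fun q => by positivity) (fun q => ?_) h3
  have hq := one_le_norm_of_ne_zero q.2
  have hle : ∀ i, max 1 |(q.1 i : ℝ)| ≤ ‖q.1‖ := fun i => by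
    refine max_le hq ?_
    rw [← Int.norm_eq_abs]
    exact norm_le_pi_norm q.1 i
  have hmono : ∀ i, ‖q.1‖ ^ (-(a / 3)) ≤ (max 1 |(q.1 i : ℝ)|) ^ (-(a / 3)) := fun i =>
    Real.rpow_le_rpow_of_nonpos (by positivity) (hle i) (by linarith)
  have hpos : 0 ≤ ‖q.1‖ ^ (-(a / 3)) := by positivity
  calc ‖q.1‖ ^ (-a) = ‖q.1‖ ^ (-(a / 3)) * (‖q.1‖ ^ (-(a / 3)) * ‖q.1‖ ^ (-(a / 3))) := by
        rw [← Real.rpow_add (by linarith), ← Real.rpow_add (by linarith)]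
        ring_nf
    _ ≤ _ := mul_le_mul (hmono 0) (mul_le_mul (hmono 1) (hmono 2) hpos (h0 _)) (by positivity) (h0 _)

end Counting

/-! ### Pairs of forms whose discriminants multiply to a square -/

section ConjugatePairs

/-- The discriminant of a binary quadratic form. -/
def formDisc {R : Type*} [CommRing R] (q : Fin 3 → R) : R := q 1 ^ 2 - 4 * (q 0 * q 2)

/-- Two integral forms of sizes `M`, `N` with `M N ≤ B` and `M² ≤ B`, together with a square root of the product
of their discriminants. -/
def IsFormPair (B : ℝ) (t : (Fin 3 → ℤ) × (Fin 3 → ℤ) × ℤ) : Prop :=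
  formDisc t.1 ≠ 0 ∧ t.2.1 0 * t.2.1 2 ≠ 0 ∧ t.2.2 ^ 2 = formDisc t.1 * formDisc t.2.1 ∧
    ∃ M N : ℝ, 0 < M ∧ 0 < N ∧ M * N ≤ B ∧ M ^ 2 ≤ B ∧ SizeLE 1 M (fun i => (t.1 i : ℝ)) ∧
      SizeLE 1 N (fun i => (t.2.1 i : ℝ))

theorem abs_le_two_mul_of_sizeLE {M : ℝ} (hM : 0 < M) {q : Fin 3 → ℤ} (h : SizeLE 1 M fun i => (q i : ℝ)) :
    |(q 0 : ℝ)| ≤ M ∧ |(q 1 : ℝ)| ≤ 2 * M ∧ |(q 2 : ℝ)| ≤ M :=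
  ⟨h.1, by simpa using h.mul_abs_one_le hM, by simpa using h.2.1⟩

theorem norm_le_of_sizeLE {M : ℝ} (hM : 0 < M) {q : Fin 3 → ℤ} (h : SizeLE 1 M fun i => (q i : ℝ)) :
    ‖q‖ ≤ 2 * M := by
  obtain ⟨h0, h1, h2⟩ := abs_le_two_mul_of_sizeLE hM h
  refine (pi_norm_le_iff_of_nonneg (by linarith)).mpr fun i => ?_
  rw [Int.norm_eq_abs]
  fin_cases i
  · exact h0.trans (by linarith)
  · exact h1
  · exact h2.trans (by linarith)

/-- With `d` the squarefree part of the discriminant of `q`, the condition says `disc Q = d m²`,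
that is `4 Q₀ Q₂ = Q₁² - d m²`. For fixed `q` there are `O(X²)` pairs `(Q₁, m)` with `X = 2B/‖q‖`,
and `Q₀` is a divisor of a non-zero number of size `O(X²)`, which leaves `O(X^{2/3})` choices. It
remains to sum `X^{8/3}` over `‖q‖ ≤ 2 B^{1/2}`. -/
theorem exists_ncard_isFormPair_le : ∃ C : ℝ, ∀ B : ℝ, 1 ≤ B →
    {t | IsFormPair B t}.Finite ∧ ({t | IsFormPair B t}.ncard : ℝ) ≤ C * B ^ (23 / 8 : ℝ) := by
  classical
  choose! d f hf hd hdsq hD using Int.exists_eq_sq_mul_squarefree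
  let W : ℝ := ∑' q : {q : Fin 3 → ℤ // q ≠ 0}, ‖q.1‖ ^ (-(37 / 12) : ℝ)
  have hsum := summable_norm_rpow_fin_three (a := 37 / 12) (by norm_num)
  -- Here `50176 = 49 · 1024`: at most `49 X²` pairs `(Q₁, m)`, each with at most `1024 X^{2/3}`
  -- signed divisors. The exponent `37/12` is just above `3`; the surplus `37/12 - 8/3 = 5/12` of
  -- `‖q‖` costs `B^{5/24}`, and `8/3 + 5/24 = 23/8`.
  refine ⟨50176 * (2 ^ (8 / 3 : ℝ) * 2 ^ (5 / 12 : ℝ)) * W, fun B hB => ?_⟩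
  have hB0 : 0 < B := one_pos.trans_le hB
  let n : (Fin 3 → ℤ) → ℤ × ℤ → ℤ := fun q u => u.1 ^ 2 - d (formDisc q) * u.2 ^ 2
  let X : (Fin 3 → ℤ) → ℝ := fun q => 2 * B / ‖q‖
  have hQfin : {q : Fin 3 → ℤ | q ≠ 0 ∧ ‖q‖ ≤ 2 * B ^ (1 / 2 : ℝ)}.Finite := by
    refine (Metric.finite_isBounded_inter_isClosed DiscreteTopology.isDiscrete
      (Metric.isBounded_closedBall (x := (0 : Fin 3 → ℤ)) (r := 2 * B ^ (1 / 2 : ℝ))) isClosed_univ).subset ?_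
    rintro q ⟨-, hq⟩
    exact ⟨by simpa using hq, trivial⟩
  set 𝒬 := hQfin.toFinset with h𝒬
  have hmem𝒬 : ∀ q, q ∈ 𝒬 ↔ q ≠ 0 ∧ ‖q‖ ≤ 2 * B ^ (1 / 2 : ℝ) := fun q => by
    rw [h𝒬, Set.Finite.mem_toFinset]
    rfl
  let U : (Fin 3 → ℤ) → Finset (ℤ × ℤ) := fun q =>
    {u ∈ Finset.Icc (-⌊3 * X q⌋) ⌊3 * X q⌋ ×ˢ Finset.Icc (-⌊3 * X q⌋) ⌊3 * X q⌋ |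
      ((n q u).natAbs : ℝ) ≤ 4 * X q ^ 2}
  let 𝒯 := 𝒬.sigma fun q => (U q).sigma fun u => (n q u).natAbs.divisors ×ˢ ({1, -1} : Finset ℤ)
  -- The code of a triple: `q`, then `Q₁` and `m = k / (f d)`, then the absolute value and sign of
  -- `Q₀`. The discriminant `d m²` recovers `Q₂`, and `k = f d m`.
  let g : (Fin 3 → ℤ) × (Fin 3 → ℤ) × ℤ → (_ : Fin 3 → ℤ) × (_ : ℤ × ℤ) × (ℕ × ℤ) := fun t =>
    ⟨t.1, ⟨(t.2.1 1, t.2.2 / (f (formDisc t.1) * d (formDisc t.1))), ((t.2.1 0).natAbs, (t.2.1 0).sign)⟩⟩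
  have hkey : ∀ t, IsFormPair B t → ∃ m : ℤ, t.2.2 = f (formDisc t.1) * d (formDisc t.1) * m ∧
      t.2.2 / (f (formDisc t.1) * d (formDisc t.1)) = m ∧ d (formDisc t.1) * m ^ 2 = formDisc t.2.1 := by
    rintro ⟨q, Q, k⟩ ⟨h1, -, h3, -⟩
    change formDisc q ≠ 0 at h1
    change k ^ 2 = formDisc q * formDisc Q at h3
    change ∃ m : ℤ, k = f (formDisc q) * d (formDisc q) * m ∧ k / (f (formDisc q) * d (formDisc q)) = m ∧
      d (formDisc q) * m ^ 2 = formDisc Q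
    have e1 := hD _ h1
    have e2 := hf _ h1
    have e3 := hd _ h1
    have e4 := hdsq _ h1
    set F := f (formDisc q)
    set E := d (formDisc q)
    obtain ⟨k', rfl⟩ : F ∣ k := (Int.pow_dvd_pow_iff two_ne_zero).mp ⟨E * formDisc Q, by rw [h3, e1]; ring⟩
    have h4 : k' ^ 2 = E * formDisc Q := by
      apply mul_left_cancel₀ (pow_ne_zero 2 e2)
      rw [← mul_pow, h3]
      conv_lhs => rw [e1]
      ring
    -- As `E` is squarefree and divides `k'²`, it divides `k'`.
    obtain ⟨m, rfl⟩ : E ∣ k' := (e4.dvd_pow_iff_dvd two_ne_zero).mp ⟨formDisc Q, h4⟩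
    refine ⟨m, by ring, ?_, ?_⟩
    · rw [← mul_assoc, Int.mul_ediv_cancel_left _ (mul_ne_zero e2 e3)]
    · apply mul_left_cancel₀ e3
      rw [← h4]
      ring
  have hmaps : Set.MapsTo g {t | IsFormPair B t} (𝒯 : Set _) := by
    intro t ht
    obtain ⟨m, -, hm2, hm3⟩ := hkey t ht
    obtain ⟨q, Q, k⟩ := t
    obtain ⟨h1, h2, -, M, N, hM, hN, hMN, hMB, hq, hQ⟩ := ht
    simp only at h1 h2 hq hQ hm2 hm3
    have hq0 : q ≠ 0 := by
      rintro rfl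
      exact h1 (by simp [formDisc])
    have hqM := norm_le_of_sizeLE hM hq
    have hq1 := one_le_norm_of_ne_zero hq0
    have hNX : N ≤ X q := by
      rw [le_div_iff₀ (by linarith)]
      calc N * ‖q‖ ≤ N * (2 * M) := by gcongr
        _ = 2 * (M * N) := by ring
        _ ≤ _ := by linarith
    obtain ⟨b0, b1, b2⟩ := abs_le_two_mul_of_sizeLE hN hQ
    have hn : n q (Q 1, m) = 4 * (Q 0 * Q 2) := by
      change Q 1 ^ 2 - d (formDisc q) * m ^ 2 = _
      rw [hm3, formDisc]
      ring
    have hX0 : 0 ≤ X q := hN.le.trans hNX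
    have hQQ : |(Q 0 : ℝ) * Q 2| ≤ N ^ 2 := by
      rw [abs_mul, pow_two]
      exact mul_le_mul b0 b2 (abs_nonneg _) hN.le
    -- From `m² ≤ |d| m² = |disc Q| ≤ 4N² + 4N²`.
    have hm : |(m : ℝ)| ≤ 3 * N := by
      have e3 : (1 : ℝ) ≤ |(d (formDisc q) : ℝ)| := by exact_mod_cast Int.one_le_abs (hd _ h1)
      have e5 : (d (formDisc q) : ℝ) * (m : ℝ) ^ 2 = (Q 1 : ℝ) ^ 2 - 4 * (Q 0 * Q 2) := by
        exact_mod_cast hm3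
      have e6 : |(d (formDisc q) : ℝ)| * (m : ℝ) ^ 2 ≤ 8 * N ^ 2 := by
        rw [← abs_of_nonneg (sq_nonneg (m : ℝ)), ← abs_mul, e5]
        refine (abs_sub _ _).trans ?_
        have b3 : |(Q 1 : ℝ)| ^ 2 ≤ (2 * N) ^ 2 := pow_le_pow_left₀ (abs_nonneg _) b1 2
        rw [abs_mul, abs_of_nonneg (sq_nonneg _), ← sq_abs (Q 1 : ℝ), abs_of_pos (by norm_num : (0 : ℝ) < 4)]
        linarith
      refine abs_le_of_sq_le_sq ?_ (by linarith)
      nlinarith [sq_nonneg (m : ℝ)]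
    simp only [𝒯, g, Finset.mem_coe, Finset.mem_sigma, hm2]
    refine ⟨(hmem𝒬 q).mpr ⟨hq0, ?_⟩, ?_, ?_⟩
    · refine hqM.trans (mul_le_mul_of_nonneg_left ?_ zero_le_two)
      rw [← Real.sqrt_eq_rpow]
      exact Real.le_sqrt_of_sq_le hMB
    · simp only [U, Finset.mem_filter, Finset.mem_product, ← abs_intCast_le_iff]
      refine ⟨⟨by linarith, by linarith⟩, ?_⟩
      rw [hn, Nat.cast_natAbs, Int.cast_abs]
      push_cast
      rw [abs_mul, abs_of_pos (by norm_num : (0 : ℝ) < 4)]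
      nlinarith
    · rw [Finset.mem_product, Nat.mem_divisors, hn]
      refine ⟨⟨Int.natAbs_dvd_natAbs.mpr ⟨4 * Q 2, by ring⟩, by simpa using h2⟩, ?_⟩
      have h0 : Q 0 ≠ 0 := fun h => h2 (by rw [h, zero_mul])
      rcases lt_or_gt_of_ne h0 with h | h
      · simp [Int.sign_eq_neg_one_of_neg h]
      · simp [Int.sign_eq_one_of_pos h]
  have hinj : Set.InjOn g {t | IsFormPair B t} := by
    intro t ht t' ht' he
    obtain ⟨m, hm1, hm2, hm3⟩ := hkey t ht
    obtain ⟨m', hm1', hm2', hm3'⟩ := hkey t' ht'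
    obtain ⟨q, Q, k⟩ := t
    obtain ⟨q', Q', k'⟩ := t'
    have h2 := ht.2.1
    simp only [g, Sigma.mk.injEq, heq_eq_eq, Prod.mk.injEq] at he hm1 hm2 hm3 hm1' hm2' hm3' h2
    obtain ⟨rfl, ⟨hQ1, hmm⟩, habs, hsign⟩ := he
    rw [hm2, hm2'] at hmm
    subst hmm
    have hQ0 : Q 0 = Q' 0 := by rw [← Int.sign_mul_natAbs (Q 0), ← Int.sign_mul_natAbs (Q' 0), habs, hsign]
    have hdisc : formDisc Q = formDisc Q' := by rw [← hm3, ← hm3']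
    have h0 : Q 0 ≠ 0 := fun h => h2 (by rw [h, zero_mul])
    have hQ2 : Q 2 = Q' 2 := by
      simp only [formDisc, hQ1, ← hQ0] at hdisc
      apply mul_left_cancel₀ h0
      linarith
    have hQ : Q = Q' := by
      ext i
      fin_cases i <;> assumption
    rw [hQ, hm1, hm1']
  have hfin : {t | IsFormPair B t}.Finite :=
    Set.Finite.of_finite_image ((Finset.finite_toSet 𝒯).subset hmaps.image_subset) hinj
  refine ⟨hfin, ?_⟩
  have hcard : {t | IsFormPair B t}.ncard ≤ 𝒯.card := by
    rw [← Set.ncard_coe_finset]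
    exact Set.ncard_le_ncard_of_injOn g hmaps hinj (Finset.finite_toSet _)
  have hterm : ∀ q ∈ 𝒬, (((U q).sigma fun u => (n q u).natAbs.divisors ×ˢ ({1, -1} : Finset ℤ)).card : ℝ) ≤
      50176 * X q ^ (8 / 3 : ℝ) := by
    intro q hq
    obtain ⟨hq0, hqB⟩ := (hmem𝒬 q).mp hq
    have hq1 := one_le_norm_of_ne_zero hq0
    have hX1 : 1 ≤ X q := by
      rw [one_le_div (by linarith)]
      refine hqB.trans (mul_le_mul_of_nonneg_left ?_ zero_le_two)
      exact (Real.rpow_le_rpow_of_exponent_le hB (by norm_num)).trans (Real.rpow_one B).le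
    have hX0 : 0 ≤ X q := zero_le_one.trans hX1
    have hU : ((U q).card : ℝ) ≤ 49 * X q ^ 2 := by
      have h1 : ((Finset.Icc (-⌊3 * X q⌋) ⌊3 * X q⌋).card : ℝ) ≤ 7 * X q := by
        have := (abs_le.mp (abs_card_Icc_floor_sub_le (x := 3 * X q) (by linarith))).2
        linarith
      calc ((U q).card : ℝ) ≤ ((Finset.Icc (-⌊3 * X q⌋) ⌊3 * X q⌋ ×ˢ
            Finset.Icc (-⌊3 * X q⌋) ⌊3 * X q⌋).card : ℝ) := Nat.cast_le.mpr (Finset.card_filter_le _ _)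
        _ ≤ (7 * X q) * (7 * X q) := by
          rw [Finset.card_product, Nat.cast_mul]
          exact mul_le_mul h1 h1 (Nat.cast_nonneg _) (by linarith)
        _ = _ := by ring
    have hdiv : ∀ u ∈ U q, (((n q u).natAbs.divisors ×ˢ ({1, -1} : Finset ℤ)).card : ℝ) ≤
        1024 * X q ^ (2 / 3 : ℝ) := by
      intro u hu
      have hu2 : ((n q u).natAbs : ℝ) ≤ 4 * X q ^ 2 := (Finset.mem_filter.mp hu).2
      rw [Finset.card_product, Nat.cast_mul]
      have h2 : (({1, -1} : Finset ℤ).card : ℝ) = 2 := by norm_num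
      rw [h2]
      by_cases h0 : (n q u).natAbs = 0
      · rw [h0, Nat.divisors_zero, Finset.card_empty, Nat.cast_zero, zero_mul]
        positivity
      -- The cube is at most `8⁸ · 4 X² = 2²⁶ X²`, below `512³ X² = 2²⁷ X²`.
      have h3 : ((n q u).natAbs.divisors.card : ℝ) ^ 3 ≤ (512 * X q ^ (2 / 3 : ℝ)) ^ 3 := by
        have h4 : ((n q u).natAbs.divisors.card : ℝ) ^ 3 ≤ 8 ^ 8 * (n q u).natAbs := by
          exact_mod_cast Nat.card_divisors_pow_three_le h0
        have h5 : (X q ^ (2 / 3 : ℝ)) ^ 3 = X q ^ 2 := by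
          rw [← Real.rpow_natCast, ← Real.rpow_mul hX0]
          norm_num
        rw [mul_pow, h5]
        nlinarith [sq_nonneg (X q)]
      have := le_of_pow_le_pow_left₀ three_ne_zero (by positivity) h3
      linarith
    rw [Finset.card_sigma, Nat.cast_sum]
    refine (Finset.sum_le_sum hdiv).trans ?_
    rw [Finset.sum_const, nsmul_eq_mul]
    calc ((U q).card : ℝ) * (1024 * X q ^ (2 / 3 : ℝ)) ≤ 49 * X q ^ 2 * (1024 * X q ^ (2 / 3 : ℝ)) := by gcongr
      _ = 50176 * (X q ^ (2 : ℝ) * X q ^ (2 / 3 : ℝ)) := by rw [Real.rpow_two]; ring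
      _ = _ := by
        rw [← Real.rpow_add (by linarith)]
        norm_num
  have hX : ∀ q ∈ 𝒬, X q ^ (8 / 3 : ℝ) ≤
      2 ^ (8 / 3 : ℝ) * 2 ^ (5 / 12 : ℝ) * B ^ (23 / 8 : ℝ) * ‖q‖ ^ (-(37 / 12) : ℝ) := by
    intro q hq
    obtain ⟨hq0, hqB⟩ := (hmem𝒬 q).mp hq
    have hq1 : 0 < ‖q‖ := norm_pos_iff.mpr hq0
    have h1 : ‖q‖ ^ (5 / 12 : ℝ) ≤ 2 ^ (5 / 12 : ℝ) * B ^ (5 / 24 : ℝ) := by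
      refine (Real.rpow_le_rpow hq1.le hqB (by norm_num)).trans ?_
      rw [Real.mul_rpow (by norm_num) (by positivity), ← Real.rpow_mul hB0.le]
      norm_num
    have h2 : X q ^ (8 / 3 : ℝ) = 2 ^ (8 / 3 : ℝ) * B ^ (8 / 3 : ℝ) * (‖q‖ ^ (5 / 12 : ℝ) * ‖q‖ ^ (-(37 / 12) : ℝ)) := by
      rw [Real.div_rpow (by positivity) hq1.le, Real.mul_rpow (by norm_num) hB0.le, div_eq_mul_inv,
        ← Real.rpow_neg hq1.le, ← Real.rpow_add hq1]
      norm_num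
    rw [h2]
    calc _ ≤ 2 ^ (8 / 3 : ℝ) * B ^ (8 / 3 : ℝ) * ((2 ^ (5 / 12 : ℝ) * B ^ (5 / 24 : ℝ)) * ‖q‖ ^ (-(37 / 12) : ℝ)) := by
          gcongr
      _ = 2 ^ (8 / 3 : ℝ) * 2 ^ (5 / 12 : ℝ) * (B ^ (8 / 3 : ℝ) * B ^ (5 / 24 : ℝ)) * ‖q‖ ^ (-(37 / 12) : ℝ) := by ring
      _ = _ := by
        rw [← Real.rpow_add hB0]
        norm_num
  have hsumle : ∑ q ∈ 𝒬, ‖q‖ ^ (-(37 / 12) : ℝ) ≤ W := by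
    have h1 := hsum.sum_le_tsum (𝒬.subtype (· ≠ 0)) (fun q _ => by positivity)
    refine le_trans (le_of_eq ?_) h1
    rw [Finset.sum_subtype_eq_sum_filter (f := fun q : Fin 3 → ℤ => ‖q‖ ^ (-(37 / 12) : ℝ)),
      Finset.filter_true_of_mem]
    intro q hq
    exact ((hmem𝒬 q).mp hq).1
  calc ({t | IsFormPair B t}.ncard : ℝ) ≤ (𝒯.card : ℝ) := Nat.cast_le.mpr hcard
    _ = ∑ q ∈ 𝒬, (((U q).sigma fun u => (n q u).natAbs.divisors ×ˢ ({1, -1} : Finset ℤ)).card : ℝ) := by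
      rw [Finset.card_sigma, Nat.cast_sum]
    _ ≤ ∑ q ∈ 𝒬, 50176 * (2 ^ (8 / 3 : ℝ) * 2 ^ (5 / 12 : ℝ) * B ^ (23 / 8 : ℝ) * ‖q‖ ^ (-(37 / 12) : ℝ)) :=
      Finset.sum_le_sum fun q hq => (hterm q hq).trans (mul_le_mul_of_nonneg_left (hX q hq) (by norm_num))
    _ = 50176 * (2 ^ (8 / 3 : ℝ) * 2 ^ (5 / 12 : ℝ)) * B ^ (23 / 8 : ℝ) * ∑ q ∈ 𝒬, ‖q‖ ^ (-(37 / 12) : ℝ) := by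
      rw [Finset.mul_sum]
      exact Finset.sum_congr rfl fun q _ => by ring
    _ ≤ 50176 * (2 ^ (8 / 3 : ℝ) * 2 ^ (5 / 12 : ℝ)) * B ^ (23 / 8 : ℝ) * W := by gcongr
    _ = _ := by ring

end ConjugatePairs

/-! ### Pairs of rational points -/

open NumberField

section FixedPoints

theorem exists_rat_rep {n : ℕ} {x : ProjPt n} (hx : ∀ σ, galPt σ x = x) :
    ∃ (r : Fin n → ℚ) (hr : (fun i => (r i : QBar)) ≠ 0), x = Projectivization.mk QBar _ hr := by
  obtain ⟨i₀, hi₀⟩ := Function.ne_iff.mp x.rep_nonzero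
  have h1 : ∀ i, ∃ r : ℚ, (r : QBar) = x.rep i / x.rep i₀ := fun i => by
    refine QBar.exists_rat_of_fixed fun σ => ?_
    have h2 := hx σ
    rw [← x.mk_rep, galPt_mk, Projectivization.mk_eq_mk_iff'] at h2
    obtain ⟨c, hc⟩ := h2
    have e1 : c * x.rep i = σ (x.rep i) := congrFun hc i
    have e2 : c * x.rep i₀ = σ (x.rep i₀) := congrFun hc i₀
    have hc0 : c ≠ 0 := by
      rintro rfl
      rw [zero_mul] at e2
      exact hi₀ ((map_eq_zero σ).mp e2.symm)
    rw [map_div₀, ← e1, ← e2, mul_div_mul_left _ _ hc0]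
  choose r hr using h1
  refine ⟨r, Function.ne_iff.mpr ⟨i₀, ?_⟩, ?_⟩
  · rw [hr, div_self hi₀]
    exact one_ne_zero
  · conv_lhs => rw [← x.mk_rep]
    refine mk_eq_mk_of_smul _ _ (a := x.rep i₀) ?_
    ext i
    rw [Pi.smul_apply, smul_eq_mul, hr, mul_div_cancel₀ _ hi₀]

/-- A rational point lies on the fibre over a rational `p`, and the rational left inverse of the
parametrisation makes its parameter on that fibre rational too. Both are then taken primitive. -/
theorem exists_primitive_of_fixed {x : ProjPt 4} (hxV : x ∈ surfaceV) (hx : ∀ σ, galPt σ x = x) :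
    ∃ p t : Fin 2 → ℤ, Finset.univ.gcd p = 1 ∧ Finset.univ.gcd t = 1 ∧
      ∃ h : (fibreLine fun i => (p i : ℚ)).vec (fun i => (t i : QBar)) ≠ 0, x = Projectivization.mk QBar _ h := by
  obtain ⟨r, hr, rfl⟩ := exists_rat_rep hx
  have h0 := ((mk_mem_surfaceV hr).mp hxV).2
  have hr01 : ![r 0, r 1] ≠ 0 := fun h => h0
    ⟨by exact_mod_cast congrFun h 0, by exact_mod_cast congrFun h 1⟩
  obtain ⟨p, hp, c, hc, hcp⟩ := exists_primitive_smul hr01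
  have e0 : r 0 = c * p 0 := congrFun hcp 0
  have e1 : r 1 = c * p 1 := congrFun hcp 1
  have hp0 : (fun i => (p i : ℚ)) ≠ 0 := by
    obtain ⟨i, hi⟩ := Function.ne_iff.mp (ne_zero_of_primitive hp)
    exact Function.ne_iff.mpr ⟨i, by simpa using hi⟩
  have hmem : Projectivization.mk QBar _ hr ∈ fibreV fun i => (p i : ℚ) := by
    rw [mk_mem_fibreV]
    refine ⟨hxV, ?_⟩
    rw [e0, e1]
    push_cast
    ring
  rw [fibreV_eq_points hp0] at hmem
  obtain ⟨τ, -, -, hτ, hx'⟩ := hmem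
  obtain ⟨a, ha⟩ := (Projectivization.mk_eq_mk_iff' QBar _ _ hr hτ).mp hx'
  have ha' : (fibreLine fun i => (p i : ℚ)).vec (a • τ) = fun i => (r i : QBar) := by
    rw [MetrizedLine.vec_smul]
    exact ha
  obtain ⟨m, hm⟩ := (MetrizedLine.fibreLine_isStandard hp).leftInv
  have h1 : a • τ = fun j => ((∑ i, m j i * r i : ℚ) : QBar) := by
    ext j
    rw [← hm QBar (a • τ) j, ha']
    push_cast
    rfl
  have hρ : (fun j => ∑ i, m j i * r i) ≠ 0 := by
    intro h
    apply hr
    rw [← ha', h1]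
    have h2 : (fun j => ((∑ i, m j i * r i : ℚ) : QBar)) = 0 := by
      ext j
      rw [show ∑ i, m j i * r i = 0 from congrFun h j]
      simp
    rw [h2, MetrizedLine.vec_zero]
  obtain ⟨t, ht, d, hd, hdt⟩ := exists_primitive_smul hρ
  have h2 : a • τ = (d : QBar) • fun i => (t i : QBar) := by
    rw [h1]
    ext j
    rw [show ∑ i, m j i * r i = d * t j from congrFun hdt j]
    simp
  rw [h2, MetrizedLine.vec_smul] at ha'
  have h3 : (fibreLine fun i => (p i : ℚ)).vec (fun i => (t i : QBar)) ≠ 0 := by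
    intro h3
    rw [h3, smul_zero] at ha'
    exact hr ha'.symm
  exact ⟨p, t, hp, ht, h3, mk_eq_mk_of_smul _ _ ha'.symm⟩

/-- The height is the power of `max (H |t₀|) (H² |t₁|)` with `H = ‖p‖ ≥ 1`, hence at least that of
`H ‖t‖`. -/
theorem le_heightOver_of_primitive {p t : Fin 2 → ℤ} (hp : Finset.univ.gcd p = 1) (ht : Finset.univ.gcd t = 1)
    (h : (fibreLine fun i => (p i : ℚ)).vec (fun i => (t i : QBar)) ≠ 0) (K : IntermediateField ℚ QBar)
    [NumberField K] : (‖p‖ * ‖t‖) ^ Module.finrank ℚ K ≤ heightOver K (Projectivization.mk QBar _ h) := by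
  have hcast : (fibreLine fun i => (p i : ℚ)).vec (fun i => (t i : QBar)) =
      fun i => (((fibreLine fun i => (p i : ℚ)).vec (fun i => (t i : K)) i : K) : QBar) := by
    ext i
    simp [MetrizedLine.vec]
  have h' := h
  rw [hcast] at h'
  have h1 : Projectivization.mk QBar _ h = Projectivization.mk QBar _ h' := mk_eq_mk_of_smul _ _ (a := 1) (by
    rw [one_smul, hcast])
  rw [h1, heightOver_mk, (MetrizedLine.fibreLine_isStandard hp).mulHeight_intCast ht]
  have hp1 := one_le_norm_of_ne_zero (ne_zero_of_primitive hp)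
  refine pow_le_pow_left₀ (by positivity) ?_ _
  rw [norm_pair_eq_max t, mul_max_of_nonneg _ _ (norm_nonneg p)]
  refine max_le_max le_rfl ?_
  exact mul_le_mul_of_nonneg_right (by nlinarith) (abs_nonneg _)

/-- The pairs of rational points. -/
def splitPairs : Set (Sym2 (ProjPt 4)) := {s | s ∈ symSquare surfaceV ∧ ∀ x ∈ s, ∀ σ, galPt σ x = x}

theorem le_symHeight_of_forall {n : ℕ} {s : Sym2 (ProjPt n)} {x y : ProjPt n} (hs : s = s(x, y)) {N : ℝ} (hN : 0 ≤ N)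
    (h : N ^ Module.finrank ℚ (fieldOfDefinition s) ≤
      heightOver (fieldOfDefinition s) x * heightOver (fieldOfDefinition s) y) : N ≤ symHeight s := by
  rw [symHeight_eq_of_eq hs, one_div]
  refine le_trans (le_of_eq ?_) (Real.rpow_le_rpow (by positivity) h (by positivity))
  rw [Real.pow_rpow_inv_natCast hN Module.finrank_pos.ne']

/-- A pair is encoded by four vectors of `ℤ²` whose norms have product at most `B`. Rankin's trick
applies with any exponent above two; `5/2` also stays below three. -/
theorem exists_ncard_splitPairs_le : ∃ C : ℝ, ∀ B : ℝ, 0 < B →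
    {s ∈ splitPairs | symHeight s ≤ B}.Finite ∧
      ({s ∈ splitPairs | symHeight s ≤ B}.ncard : ℝ) ≤ C * B ^ (5 / 2 : ℝ) := by
  have hex : ∀ x : ProjPt 4, x ∈ surfaceV ∧ (∀ σ, galPt σ x = x) → ∃ p t : Fin 2 → ℤ,
      Finset.univ.gcd p = 1 ∧ Finset.univ.gcd t = 1 ∧
      ∃ h : (fibreLine fun i => (p i : ℚ)).vec (fun i => (t i : QBar)) ≠ 0, x = Projectivization.mk QBar _ h :=
    fun x hx => exists_primitive_of_fixed hx.1 hx.2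
  choose! p t hp ht hv hx using hex
  have hw1 := EisensteinSeries.summable_one_div_norm_rpow (k := 5 / 2) (by norm_num)
  have h0 : ∀ u : Fin 2 → ℤ, 0 ≤ ‖u‖ ^ (-(5 / 2) : ℝ) := fun u => by positivity
  have hw2 := hw1.mul_of_nonneg hw1 h0 h0
  have h02 : ∀ u : (Fin 2 → ℤ) × (Fin 2 → ℤ), 0 ≤ ‖u.1‖ ^ (-(5 / 2) : ℝ) * ‖u.2‖ ^ (-(5 / 2) : ℝ) :=
    fun u => mul_nonneg (h0 _) (h0 _)
  have hw := hw2.mul_of_nonneg hw2 h02 h02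
  refine ⟨∑' x : ((Fin 2 → ℤ) × (Fin 2 → ℤ)) × ((Fin 2 → ℤ) × (Fin 2 → ℤ)),
    ‖x.1.1‖ ^ (-(5 / 2) : ℝ) * ‖x.1.2‖ ^ (-(5 / 2) : ℝ) *
      (‖x.2.1‖ ^ (-(5 / 2) : ℝ) * ‖x.2.2‖ ^ (-(5 / 2) : ℝ)), fun B hB => ?_⟩
  have key := ncard_mul_le_tsum (S := {s ∈ splitPairs | symHeight s ≤ B})
    (f := fun s => ((p (Quot.out s).1, t (Quot.out s).1), (p (Quot.out s).2, t (Quot.out s).2)))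
    ?_ hw (fun u => mul_nonneg (h02 _) (h02 _)) (c := B ^ (-(5 / 2) : ℝ)) (by positivity) ?_
  · refine ⟨key.1, ?_⟩
    have h1 := key.2
    rw [Real.rpow_neg hB.le, ← div_eq_mul_inv, div_le_iff₀ (by positivity)] at h1
    exact h1
  · intro s hs s' hs' he
    have e1 : s(s.out.1, s.out.2) = s := Quot.out_eq s
    have e2 : s(s'.out.1, s'.out.2) = s' := Quot.out_eq s'
    have m1 : s.out.1 ∈ s := s.out_fst_mem
    have m2 : s.out.2 ∈ s := s.out_snd_mem
    have m1' : s'.out.1 ∈ s' := s'.out_fst_mem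
    have m2' : s'.out.2 ∈ s' := s'.out_snd_mem
    simp only [Prod.mk.injEq] at he
    obtain ⟨⟨h1, h2⟩, h3, h4⟩ := he
    have hcode : ∀ x y : ProjPt 4, (x ∈ surfaceV ∧ ∀ σ, galPt σ x = x) → (y ∈ surfaceV ∧ ∀ σ, galPt σ y = y) →
        p x = p y → t x = t y → x = y := by
      intro x y hx' hy' hpe hte
      rw [hx x hx', hx y hy']
      refine mk_eq_mk_of_smul _ _ (a := 1) ?_
      rw [one_smul, hpe, hte]
    rw [← e1, ← e2, hcode _ _ ⟨hs.1.1 _ m1, hs.1.2 _ m1⟩ ⟨hs'.1.1 _ m1', hs'.1.2 _ m1'⟩ h1 h2,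
      hcode _ _ ⟨hs.1.1 _ m2, hs.1.2 _ m2⟩ ⟨hs'.1.1 _ m2', hs'.1.2 _ m2'⟩ h3 h4]
  · rintro s ⟨⟨hsV, hsf⟩, hsB⟩
    have e1 : s(s.out.1, s.out.2) = s := Quot.out_eq s
    have m1 : s.out.1 ∈ s := s.out_fst_mem
    have m2 : s.out.2 ∈ s := s.out_snd_mem
    have c1 : s.out.1 ∈ surfaceV ∧ ∀ σ, galPt σ s.out.1 = s.out.1 := ⟨hsV _ m1, hsf _ m1⟩
    have c2 : s.out.2 ∈ surfaceV ∧ ∀ σ, galPt σ s.out.2 = s.out.2 := ⟨hsV _ m2, hsf _ m2⟩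
    set x := s.out.1
    set y := s.out.2
    have n1 := one_le_norm_of_ne_zero (ne_zero_of_primitive (hp x c1))
    have n2 := one_le_norm_of_ne_zero (ne_zero_of_primitive (ht x c1))
    have n3 := one_le_norm_of_ne_zero (ne_zero_of_primitive (hp y c2))
    have n4 := one_le_norm_of_ne_zero (ne_zero_of_primitive (ht y c2))
    have hle : (‖p x‖ * ‖t x‖) * (‖p y‖ * ‖t y‖) ≤ symHeight s := by
      refine le_symHeight_of_forall e1.symm (by positivity) ?_
      rw [mul_pow]
      have g1 := le_heightOver_of_primitive (hp x c1) (ht x c1) (hv x c1) (fieldOfDefinition s)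
      have g2 := le_heightOver_of_primitive (hp y c2) (ht y c2) (hv y c2) (fieldOfDefinition s)
      rw [← hx x c1] at g1
      rw [← hx y c2] at g2
      exact mul_le_mul g1 g2 (by positivity) (le_trans (by positivity) g1)
    have h1 := Real.rpow_le_rpow_of_nonpos (z := -(5 / 2)) (by positivity) (hle.trans hsB) (by norm_num)
    rw [Real.mul_rpow (by positivity) (by positivity), Real.mul_rpow (by positivity) (by positivity),
      Real.mul_rpow (by positivity) (by positivity)] at h1
    exact h1

end FixedPoints

/-! ### Heights of the points `(1 : θ : θ² z : z)` -/

section AffinePoints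

/-- The point `(1 : θ : θ² z : z)` of the surface. -/
def affPt (θ z : QBar) : ProjPt 4 :=
  Projectivization.mk QBar ![1, θ, θ ^ 2 * z, z] fun h => one_ne_zero (congrFun h 0)

theorem affPt_inj {θ z θ' z' : QBar} (h : affPt θ z = affPt θ' z') : θ = θ' ∧ z = z' := by
  obtain ⟨a, ha⟩ := (Projectivization.mk_eq_mk_iff' QBar _ _ _ _).mp h
  have h0 : a * 1 = 1 := congrFun ha 0
  have h1 : a * θ' = θ := congrFun ha 1
  have h3 : a * z' = z := congrFun ha 3
  rw [mul_one] at h0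
  rw [h0, one_mul] at h1 h3
  exact ⟨h1.symm, h3.symm⟩

theorem galPt_affPt (σ : QBar ≃ₐ[ℚ] QBar) (θ z : QBar) : galPt σ (affPt θ z) = affPt (σ θ) (σ z) := by
  rw [affPt, galPt_mk]
  refine mk_eq_mk_of_smul _ _ (a := 1) ?_
  rw [one_smul]
  ext i
  fin_cases i <;> simp [galVec]

theorem eq_affPt {v : Fin 4 → QBar} (hv : v ≠ 0) (hV : Projectivization.mk QBar v hv ∈ surfaceV) (h0 : v 0 ≠ 0) :
    Projectivization.mk QBar v hv = affPt (v 1 / v 0) (v 3 / v 0) := by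
  have h1 := ((mk_mem_surfaceV hv).mp hV).1
  refine mk_eq_mk_of_smul _ _ (a := v 0) ?_
  ext i
  fin_cases i
  · simp
  · simp [mul_div_cancel₀ _ h0]
  · simp
    field_simp
    linear_combination h1
  · simp [mul_div_cancel₀ _ h0]

theorem affPt_mem_surfaceV (θ z : QBar) : affPt θ z ∈ surfaceV := by
  rw [affPt, mk_mem_surfaceV]
  simp

theorem exists_heightOver_affPt {s : Sym2 (ProjPt 4)} {θ z : QBar} (h : affPt θ z ∈ s) :
    ∃ θ₀ z₀ : fieldOfDefinition s, (θ₀ : QBar) = θ ∧ (z₀ : QBar) = z ∧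
      heightOver (fieldOfDefinition s) (affPt θ z) = Height.mulHeight ![1, θ₀, θ₀ ^ 2 * z₀, z₀] := by
  obtain ⟨w, hw, hx⟩ := exists_coord_fieldOfDefinition h
  obtain ⟨a, ha⟩ := (Projectivization.mk_eq_mk_iff' QBar _ _ _ hw).mp hx
  have h0 : a * w 0 = 1 := congrFun ha 0
  have h1 : a * w 1 = θ := congrFun ha 1
  have h3 : a * w 3 = z := congrFun ha 3
  have hw0 : (w 0 : QBar) ≠ 0 := right_ne_zero_of_mul_eq_one h0
  have ha' : a = (w 0 : QBar)⁻¹ := eq_inv_of_mul_eq_one_left h0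
  have e1 : ((w 1 / w 0 : fieldOfDefinition s) : QBar) = θ := by
    push_cast
    rw [← h1, ha', div_eq_inv_mul]
  have e3 : ((w 3 / w 0 : fieldOfDefinition s) : QBar) = z := by
    push_cast
    rw [← h3, ha', div_eq_inv_mul]
  refine ⟨w 1 / w 0, w 3 / w 0, e1, e3, ?_⟩
  have hcast : ![1, θ, θ ^ 2 * z, z] = fun i => ((![1, w 1 / w 0, (w 1 / w 0) ^ 2 * (w 3 / w 0), w 3 / w 0] i :
      fieldOfDefinition s) : QBar) := by
    ext i
    fin_cases i
    · simp
    · exact e1.symm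
    · change θ ^ 2 * z = (((w 1 / w 0) ^ 2 * (w 3 / w 0) : fieldOfDefinition s) : QBar)
      rw [MulMemClass.coe_mul, SubmonoidClass.coe_pow, e1, e3]
    · exact e3.symm
  have hne : (fun i => ((![1, w 1 / w 0, (w 1 / w 0) ^ 2 * (w 3 / w 0), w 3 / w 0] i :
      fieldOfDefinition s) : QBar)) ≠ 0 := by
    rw [← hcast]
    exact fun h => one_ne_zero (congrFun h 0)
  rw [← heightOver_mk _ _ hne]
  congr 1
  exact mk_eq_mk_of_smul _ _ (a := 1) (by rw [one_smul, hcast])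

theorem mul_le_max_sq_mul {t c : ℝ} (ht : 0 ≤ t) (hc : 0 ≤ c) : t * c ≤ max (t ^ 2 * c) c := by
  rcases le_total t 1 with h | h
  · exact le_max_of_le_right (mul_le_of_le_one_left hc h)
  · exact le_max_of_le_left (mul_le_mul_of_nonneg_right (by nlinarith) hc)

variable {K : Type} [Field K] [NumberField K]

/-- At every place `|θ z|` lies between `|z|` and `|θ² z|`, so adjoining `θ z` does not change the
maximum. -/
theorem mulHeight_affine_eq (θ z : K) : Height.mulHeight ![1, θ, θ ^ 2 * z, z] =
    Height.mulHeight ![1, θ, θ ^ 2 * z, z, θ * z] := by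
  have key : ∀ v : K → ℝ, (∀ x y, v (x * y) = v x * v y) → (∀ x, 0 ≤ v x) →
      ⨆ i, v (![1, θ, θ ^ 2 * z, z] i) = ⨆ i, v (![1, θ, θ ^ 2 * z, z, θ * z] i) := by
    intro v hv h0
    have hb := Finite.bddAbove_range fun i => v (![1, θ, θ ^ 2 * z, z] i)
    apply le_antisymm
    · refine ciSup_le fun i => ?_
      exact le_ciSup (f := fun i => v (![1, θ, θ ^ 2 * z, z, θ * z] i)) (Finite.bddAbove_range _) i.castSucc |>.trans' (by
        fin_cases i <;> rfl)
    · refine ciSup_le fun i => ?_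
      fin_cases i
      · exact le_ciSup hb 0
      · exact le_ciSup hb 1
      · exact le_ciSup hb 2
      · exact le_ciSup hb 3
      · change v (θ * z) ≤ _
        rw [hv]
        refine (mul_le_max_sq_mul (h0 θ) (h0 z)).trans (max_le ?_ (le_ciSup hb 3))
        rw [pow_two, ← hv, ← hv, ← pow_two]
        exact le_ciSup hb 2
  have h4 : ![1, θ, θ ^ 2 * z, z] ≠ 0 := fun h => one_ne_zero (congrFun h 0)
  have h5 : ![1, θ, θ ^ 2 * z, z, θ * z] ≠ 0 := fun h => one_ne_zero (congrFun h 0)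
  rw [NumberField.mulHeight_eq h4, NumberField.mulHeight_eq h5]
  congr 1
  · exact Finset.prod_congr rfl fun v _ => by rw [key v (map_mul v) (apply_nonneg v)]
  · exact finprod_congr fun v => key v (map_mul v) (apply_nonneg v)

/-- The products `1, z, θ, θ z` all occur among the extended coordinates. This yields `M N ≤ B`. -/
theorem mulHeight_mul_le_affine (θ z : K) :
    Height.mulHeight ![1, θ] * Height.mulHeight ![1, z] ≤ Height.mulHeight ![1, θ, θ ^ 2 * z, z] := by
  have h1 : ![1, θ] ≠ 0 := fun h => one_ne_zero (congrFun h 0)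
  have h2 : ![1, z] ≠ 0 := fun h => one_ne_zero (congrFun h 0)
  rw [mulHeight_affine_eq, ← Height.mulHeight_fun_mul_eq h1 h2]
  -- The table gives the position of each product in the vector `(1, θ, θ² z, z, θ z)`.
  refine le_trans (le_of_eq ?_) (Height.mulHeight_comp_le
    (fun a : Fin 2 × Fin 2 => (![![0, 3], ![1, 4]] : Fin 2 → Fin 2 → Fin 5) a.1 a.2) _)
  congr 1
  ext ⟨i, j⟩
  fin_cases i <;> fin_cases j <;> simp

/-- After multiplication by `z`, the products `1, θ, θ, θ²` become extended coordinates. This yields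
`M² ≤ B`, and it fails on the base line, where `z = 0`. -/
theorem mulHeight_sq_le_affine (θ : K) {z : K} (hz : z ≠ 0) :
    Height.mulHeight ![1, θ] * Height.mulHeight ![1, θ] ≤ Height.mulHeight ![1, θ, θ ^ 2 * z, z] := by
  have h1 : ![1, θ] ≠ 0 := fun h => one_ne_zero (congrFun h 0)
  rw [mulHeight_affine_eq, ← Height.mulHeight_fun_mul_eq h1 h1, ← Height.mulHeight_smul_eq_mulHeight _ hz]
  refine le_trans (le_of_eq ?_) (Height.mulHeight_comp_le
    (fun a : Fin 2 × Fin 2 => (![![3, 4], ![4, 2]] : Fin 2 → Fin 2 → Fin 5) a.1 a.2) _)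
  congr 1
  ext ⟨i, j⟩
  fin_cases i <;> fin_cases j <;> simp <;> ring

/-- The height formula for pairs on the projective line with `H = 1`, applied to the linear forms
`(1, θ)` and `q₀ (1, θ')`. -/
theorem exists_mulHeight_pair_eq {θ θ' : K} {q : Fin 3 → ℤ} (hq : Finset.univ.gcd q = 1) (h0 : q 0 ≠ 0)
    (h1 : (q 1 : K) = q 0 * (θ + θ')) (h2 : (q 2 : K) = q 0 * (θ * θ')) :
    ∃ M : ℝ, 0 < M ∧ Height.mulHeight ![1, θ] * Height.mulHeight ![1, θ'] = M ^ Module.finrank ℚ K ∧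
      SizeLE 1 M fun i => (q i : ℝ) := by
  have h0' : (q 0 : K) ≠ 0 := by exact_mod_cast h0
  have hvec : ∀ τ : Fin 2 → K, projLine.vec τ = τ := fun τ => by
    ext i
    fin_cases i <;> simp [MetrizedLine.vec, projLine]
  obtain ⟨M, hM, hM1, hM2⟩ := MetrizedLine.projLine_isStandard.exists_mulHeight_mul_eq (τ := ![1, θ])
    (ω := (q 0 : K) • ![1, θ']) (fun h => one_ne_zero (congrFun h 0))
    (smul_ne_zero h0' fun h => one_ne_zero (congrFun h 0)) hq (by
      ext i
      fin_cases i
      · simp [prodForm]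
      · simp [prodForm, h1]
        ring
      · simp [prodForm, h2]
        ring)
  rw [hvec, hvec, Height.mulHeight_smul_eq_mulHeight _ h0'] at hM1
  exact ⟨M, hM, hM1, (hM2 M hM).mp (by norm_num)⟩

end AffinePoints

/-! ### Conjugate pairs in different fibres -/

section ConjugatePairs

/-- The pair `s` consists of the points `(1 : θ : θ² z : z)` and `(1 : θ' : θ'² z' : z')`, where `θ, θ'` and `z, z'`
are the roots of the binary forms `q` and `Q`, and `k` is the mixed discriminant which tells how the
roots are matched. -/
def IsConjData (s : Sym2 (ProjPt 4)) (t : (Fin 3 → ℤ) × (Fin 3 → ℤ) × ℤ) : Prop :=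
  ∃ θ θ' z z' : QBar, s = s(affPt θ z, affPt θ' z') ∧ t.1 0 ≠ 0 ∧ t.2.1 0 ≠ 0 ∧ θ ≠ θ' ∧
    (t.1 1 : QBar) = t.1 0 * (θ + θ') ∧ (t.1 2 : QBar) = t.1 0 * (θ * θ') ∧
    (t.2.1 1 : QBar) = t.2.1 0 * (z + z') ∧ (t.2.1 2 : QBar) = t.2.1 0 * (z * z') ∧
    (t.2.2 : QBar) = t.1 0 * t.2.1 0 * ((θ - θ') * (z - z'))

theorem eq_or_eq_swap_of_add_mul {F : Type*} [Field F] {a b c d : F} (h1 : a + b = c + d) (h2 : a * b = c * d) :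
    (a = c ∧ b = d) ∨ (a = d ∧ b = c) := by
  have h : (a - c) * (a - d) = 0 := by linear_combination a * h1 - h2
  rcases mul_eq_zero.mp h with h | h
  · exact Or.inl ⟨sub_eq_zero.mp h, by linear_combination h1 - h⟩
  · exact Or.inr ⟨sub_eq_zero.mp h, by linear_combination h1 - h⟩

/-- The forms determine the sets `{θ, θ'}` and `{z, z'}`. Exchanging only one of them changes the
sign of `k`, so the matching is determined unless `z = z'`, when it does not matter. -/
theorem IsConjData.unique {s s' : Sym2 (ProjPt 4)} {t : (Fin 3 → ℤ) × (Fin 3 → ℤ) × ℤ} (h : IsConjData s t)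
    (h' : IsConjData s' t) : s = s' := by
  obtain ⟨θ, θ', z, z', rfl, h0, H0, hne, h1, h2, H1, H2, hk⟩ := h
  obtain ⟨φ, φ', w, w', rfl, -, -, -, g1, g2, G1, G2, gk⟩ := h'
  have h0' : (t.1 0 : QBar) ≠ 0 := by exact_mod_cast h0
  have H0' : (t.2.1 0 : QBar) ≠ 0 := by exact_mod_cast H0
  have e1 := mul_left_cancel₀ h0' (h1.symm.trans g1)
  have e2 := mul_left_cancel₀ h0' (h2.symm.trans g2)
  have e3 := mul_left_cancel₀ H0' (H1.symm.trans G1)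
  have e4 := mul_left_cancel₀ H0' (H2.symm.trans G2)
  have e5 := mul_left_cancel₀ (mul_ne_zero h0' H0') (hk.symm.trans gk)
  rcases eq_or_eq_swap_of_add_mul e1 e2 with ⟨rfl, rfl⟩ | ⟨rfl, rfl⟩ <;>
    rcases eq_or_eq_swap_of_add_mul e3 e4 with ⟨rfl, rfl⟩ | ⟨rfl, rfl⟩
  · rfl
  · have h3 : 2 * ((θ - θ') * (z - z')) = 0 := by linear_combination e5
    have h4 : z = z' := by
      have := (mul_eq_zero.mp ((mul_eq_zero.mp h3).resolve_left two_ne_zero)).resolve_left (sub_ne_zero.mpr hne)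
      exact sub_eq_zero.mp this
    rw [h4]
  · have h3 : 2 * ((θ - θ') * (z - z')) = 0 := by linear_combination e5
    have h4 : z = z' := by
      have := (mul_eq_zero.mp ((mul_eq_zero.mp h3).resolve_left two_ne_zero)).resolve_left (sub_ne_zero.mpr hne)
      exact sub_eq_zero.mp this
    rw [h4, Sym2.eq_swap]
  · rw [Sym2.eq_swap]

/-- Some `σ` exchanges the two points. If the coordinate `t₀` vanished at one of them it would
vanish at both, and they would lie in the same fibre; so both are in the chart `t₀ ≠ 0`, with
distinct `θ` and `θ'`. -/
theorem exists_affPt_conj {s : Sym2 (ProjPt 4)} (hs : s ∈ rationalPoints (symSquare surfaceV))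
    (hd : s ∉ diagonalFamily) (hsp : s ∉ splitPairs) : ∃ θ θ' z z' : QBar, s = s(affPt θ z, affPt θ' z') ∧ θ ≠ θ' ∧
      (∃ σ : QBar ≃ₐ[ℚ] QBar, σ z = z') ∧
      ∀ σ : QBar ≃ₐ[ℚ] QBar, (σ θ = θ ∧ σ z = z ∧ σ θ' = θ' ∧ σ z' = z') ∨ (σ θ = θ' ∧ σ z = z' ∧ σ θ' = θ ∧ σ z' = z) := by
  obtain ⟨hsV, hσ⟩ := hs
  induction s using Sym2.ind with | _ x y =>
  have hxV := hsV x (Sym2.mem_mk_left _ _)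
  have hyV := hsV y (Sym2.mem_mk_right _ _)
  have hor : ∀ σ, (galPt σ x = x ∧ galPt σ y = y) ∨ (galPt σ x = y ∧ galPt σ y = x) := fun σ => by
    simpa using hσ σ
  obtain ⟨σ₀, h1, h2⟩ : ∃ σ, galPt σ x = y ∧ galPt σ y = x := by
    by_contra! hcon
    refine hsp ⟨hsV, fun p hp σ => ?_⟩
    have h3 : galPt σ x = x ∧ galPt σ y = y := (hor σ).resolve_right fun h => hcon σ h.1 h.2
    rcases Sym2.mem_iff.mp hp with rfl | rfl
    exacts [h3.1, h3.2]
  induction x using Projectivization.ind with | _ v hv =>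
  induction y using Projectivization.ind with | _ w hw =>
  have hvw : ∀ {v w : Fin 4 → QBar} (hv : v ≠ 0) (hw : w ≠ 0),
      galPt σ₀ (Projectivization.mk QBar v hv) = Projectivization.mk QBar w hw → v 0 = 0 → w 0 = 0 := by
    intro v w hv hw h h0
    rw [galPt_mk] at h
    obtain ⟨a, ha⟩ := (Projectivization.mk_eq_mk_iff' QBar _ _ _ hw).mp h
    have ha0 : a * w 0 = σ₀ (v 0) := congrFun ha 0
    rw [h0, map_zero] at ha0
    rcases mul_eq_zero.mp ha0 with h' | h'
    · rw [h', zero_smul] at ha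
      exact absurd ((map_eq_zero_iff _ (galVec_injective σ₀)).mp ha.symm) hv
    · exact h'
  have hne0 : ¬ (v 0 = 0 ∧ w 0 = 0) := fun h => hd ((mk_mem_diagonalFamily hv hw).mpr
    ⟨⟨hxV, hyV⟩, by rw [h.1, h.2, zero_mul, mul_zero]⟩)
  have hv0 : v 0 ≠ 0 := fun h => hne0 ⟨h, hvw hv hw h1 h⟩
  have hw0 : w 0 ≠ 0 := fun h => hne0 ⟨hvw hw hv h2 h, h⟩
  have hdet : v 1 / v 0 ≠ w 1 / w 0 := fun h => hd ((mk_mem_diagonalFamily hv hw).mpr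
    ⟨⟨hxV, hyV⟩, by field_simp at h; linear_combination -h⟩)
  rw [eq_affPt hv hxV hv0, eq_affPt hw hyV hw0] at hor h1 ⊢
  simp only [galPt_affPt] at hor h1
  refine ⟨_, _, _, _, rfl, hdet, ⟨σ₀, (affPt_inj h1).2⟩, fun σ => ?_⟩
  rcases hor σ with ⟨g1, g2⟩ | ⟨g1, g2⟩
  · exact Or.inl ⟨(affPt_inj g1).1, (affPt_inj g1).2, (affPt_inj g2).1, (affPt_inj g2).2⟩
  · exact Or.inr ⟨(affPt_inj g1).1, (affPt_inj g1).2, (affPt_inj g2).1, (affPt_inj g2).2⟩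

theorem exists_primitive_monic_quadratic {θ θ' : QBar} (h : ∀ σ : QBar ≃ₐ[ℚ] QBar,
    (σ θ = θ ∧ σ θ' = θ') ∨ (σ θ = θ' ∧ σ θ' = θ)) :
    ∃ q : Fin 3 → ℤ, Finset.univ.gcd q = 1 ∧ q 0 ≠ 0 ∧ (q 1 : QBar) = q 0 * (θ + θ') ∧
      (q 2 : QBar) = q 0 * (θ * θ') := by
  obtain ⟨b, hb⟩ := QBar.exists_rat_of_fixed (x := θ + θ') fun σ => by
    rcases h σ with ⟨h1, h2⟩ | ⟨h1, h2⟩ <;> simp [h1, h2, add_comm]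
  obtain ⟨c, hc⟩ := QBar.exists_rat_of_fixed (x := θ * θ') fun σ => by
    rcases h σ with ⟨h1, h2⟩ | ⟨h1, h2⟩ <;> simp [h1, h2, mul_comm]
  obtain ⟨q, hq, d, hd, hdq⟩ := exists_primitive_smul (y := ![1, b, c]) fun h => one_ne_zero (congrFun h 0)
  have e0 : 1 = d * q 0 := congrFun hdq 0
  have e1 : b = d * q 1 := congrFun hdq 1
  have e2 : c = d * q 2 := congrFun hdq 2
  refine ⟨q, hq, ?_, ?_, ?_⟩
  · intro h0
    rw [h0] at e0
    simp at e0
  · rw [← hb]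
    have : (q 1 : ℚ) = q 0 * b := by
      rw [e1]
      linear_combination (q 1 : ℚ) * e0
    exact_mod_cast congrArg (Rat.cast (K := QBar)) this
  · rw [← hc]
    have : (q 2 : ℚ) = q 0 * c := by
      rw [e2]
      linear_combination (q 2 : ℚ) * e0
    exact_mod_cast congrArg (Rat.cast (K := QBar)) this

theorem exists_int_of_sq_eq {r : ℚ} {n : ℤ} (h : r ^ 2 = n) : ∃ k : ℤ, (k : ℚ) = r := by
  have h1 : IsIntegral ℤ r := by
    refine IsIntegral.of_pow (n := 2) two_pos ?_
    rw [h]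
    exact isIntegral_algebraMap (R := ℤ) (x := n)
  obtain ⟨k, hk⟩ := IsIntegrallyClosed.isIntegral_iff.mp h1
  exact ⟨k, hk⟩

/-- The pairs `θ, θ'` and `z, z'` are Galois-stable and give primitive forms. Every `σ` exchanges
both or neither, so `(θ - θ')(z - z')` is rational. If `z` vanished so would its conjugate, and the
pair would lie on the base line. -/
theorem exists_isConjData {s : Sym2 (ProjPt 4)} (hs : s ∈ rationalPoints (symSquare surfaceV))
    (hd : s ∉ diagonalFamily) (hsp : s ∉ splitPairs) (hbase : s ∉ symSquare baseV) {B : ℝ} (hB : symHeight s ≤ B) :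
    ∃ t, IsConjData s t ∧ IsFormPair B t := by
  obtain ⟨θ, θ', z, z', hs', hne, ⟨σ₀, hσ₀⟩, hσ⟩ := exists_affPt_conj hs hd hsp
  obtain ⟨q, hq, hq0, hq1, hq2⟩ := exists_primitive_monic_quadratic (θ := θ) (θ' := θ') fun σ =>
    (hσ σ).imp (fun h => ⟨h.1, h.2.2.1⟩) fun h => ⟨h.1, h.2.2.1⟩
  obtain ⟨Q, hQ, hQ0, hQ1, hQ2⟩ := exists_primitive_monic_quadratic (θ := z) (θ' := z') fun σ =>
    (hσ σ).imp (fun h => ⟨h.2.1, h.2.2.2⟩) fun h => ⟨h.2.1, h.2.2.2⟩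
  obtain ⟨r, hr⟩ := QBar.exists_rat_of_fixed (x := (θ - θ') * (z - z')) fun σ => by
    rcases hσ σ with ⟨h1, h2, h3, h4⟩ | ⟨h1, h2, h3, h4⟩ <;> simp only [map_mul, map_sub, h1, h2, h3, h4]
    ring
  -- The mixed discriminant is rational with an integral square, hence an integer.
  have hsq : (q 0 * Q 0 * r) ^ 2 = ((formDisc q * formDisc Q : ℤ) : ℚ) := by
    apply Rat.cast_injective (α := QBar)
    simp only [formDisc]
    push_cast
    rw [hr, hq1, hq2, hQ1, hQ2]
    ring
  obtain ⟨k, hk⟩ := exists_int_of_sq_eq hsq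
  have hq0' : (q 0 : QBar) ≠ 0 := by exact_mod_cast hq0
  have hQ0' : (Q 0 : QBar) ≠ 0 := by exact_mod_cast hQ0
  have hzz : z ≠ 0 ∧ z' ≠ 0 := by
    have hz : z ≠ 0 := by
      intro hz
      have hz' : z' = 0 := by rw [← hσ₀, hz, map_zero]
      refine hbase fun p hp => ?_
      rw [hs'] at hp
      rcases Sym2.mem_iff.mp hp with rfl | rfl
      · rw [affPt, mk_mem_baseV]
        exact ⟨affPt_mem_surfaceV _ _, by simp [hz], by simp [hz]⟩
      · rw [affPt, mk_mem_baseV]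
        exact ⟨affPt_mem_surfaceV _ _, by simp [hz'], by simp [hz']⟩
    refine ⟨hz, ?_⟩
    rw [← hσ₀]
    exact (map_ne_zero σ₀).mpr hz
  refine ⟨(q, Q, k), ⟨θ, θ', z, z', hs', hq0, hQ0, hne, hq1, hq2, hQ1, hQ2, ?_⟩, ?_, ?_, ?_, ?_⟩
  · change (k : QBar) = q 0 * Q 0 * _
    rw [← hr]
    exact_mod_cast congrArg (Rat.cast (K := QBar)) hk
  · change formDisc q ≠ 0
    intro h0
    have h1 : ((formDisc q : ℤ) : QBar) = 0 := by rw [h0, Int.cast_zero]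
    simp only [formDisc] at h1
    push_cast at h1
    rw [hq1, hq2] at h1
    have h2 : (q 0 : QBar) ^ 2 * (θ - θ') ^ 2 = 0 := by linear_combination h1
    exact mul_ne_zero (pow_ne_zero 2 hq0') (pow_ne_zero 2 (sub_ne_zero.mpr hne)) h2
  · change Q 0 * Q 2 ≠ 0
    refine mul_ne_zero hQ0 fun h0 => ?_
    rw [h0, Int.cast_zero] at hQ2
    exact mul_ne_zero hQ0' (mul_ne_zero hzz.1 hzz.2) hQ2.symm
  · change k ^ 2 = formDisc q * formDisc Q
    rw [← hk] at hsq
    exact_mod_cast hsq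
  · have m1 : affPt θ z ∈ s := hs' ▸ Sym2.mem_mk_left _ _
    have m2 : affPt θ' z' ∈ s := hs' ▸ Sym2.mem_mk_right _ _
    obtain ⟨a, b, ha, hb, hab⟩ := exists_heightOver_affPt m1
    obtain ⟨a', b', ha', hb', hab'⟩ := exists_heightOver_affPt m2
    have hinj : Function.Injective (fun u : fieldOfDefinition s => (u : QBar)) := Subtype.val_injective
    obtain ⟨M, hM, hM1, hM2⟩ := exists_mulHeight_pair_eq (θ := a) (θ' := a') hq hq0
      (hinj (by simpa [ha, ha'] using hq1)) (hinj (by simpa [ha, ha'] using hq2))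
    obtain ⟨N, hN, hN1, hN2⟩ := exists_mulHeight_pair_eq (θ := b) (θ' := b') hQ hQ0
      (hinj (by simpa [hb, hb'] using hQ1)) (hinj (by simpa [hb, hb'] using hQ2))
    have hb0 : b ≠ 0 := fun h => hzz.1 (by rw [← hb, h]; rfl)
    have hb0' : b' ≠ 0 := fun h => hzz.2 (by rw [← hb', h]; rfl)
    have hpos : ∀ u : fieldOfDefinition s, 0 < Height.mulHeight ![1, u] := fun u => Height.mulHeight_pos _
    refine ⟨M, N, hM, hN, (le_symHeight_of_forall hs' (by positivity) ?_).trans hB,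
      (le_symHeight_of_forall hs' (by positivity) ?_).trans hB, hM2, hN2⟩
    · rw [mul_pow, ← hM1, ← hN1, hab, hab']
      calc _ = (Height.mulHeight ![1, a] * Height.mulHeight ![1, b]) *
            (Height.mulHeight ![1, a'] * Height.mulHeight ![1, b']) := by ring
        _ ≤ _ := mul_le_mul (mulHeight_mul_le_affine a b) (mulHeight_mul_le_affine a' b')
          (mul_nonneg (hpos _).le (hpos _).le) (Height.mulHeight_pos _).le
    · rw [← pow_mul, mul_comm, pow_mul, ← hM1, hab, hab']
      calc _ = (Height.mulHeight ![1, a] * Height.mulHeight ![1, a]) *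
            (Height.mulHeight ![1, a'] * Height.mulHeight ![1, a']) := by ring
        _ ≤ _ := mul_le_mul (mulHeight_sq_le_affine a hb0) (mulHeight_sq_le_affine a' hb0')
          (mul_nonneg (hpos _).le (hpos _).le) (Height.mulHeight_pos _).le

/-- The pairs of points in different fibres which are not both on the base line contribute little. -/
theorem exists_ncard_offDiagonal_le : ∃ C : ℝ, ∀ B : ℝ, 1 ≤ B →
    {s ∈ rationalPoints (symSquare surfaceV \ (diagonalFamily ∪ symSquare baseV)) | symHeight s ≤ B}.Finite ∧
      (countPoints (symSquare surfaceV \ (diagonalFamily ∪ symSquare baseV)) B : ℝ) ≤ C * B ^ (23 / 8 : ℝ) := by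
  obtain ⟨C, hC⟩ := exists_ncard_splitPairs_le
  obtain ⟨D, hD⟩ := exists_ncard_isFormPair_le
  refine ⟨|C| + D, fun B hB => ?_⟩
  have hB0 := one_pos.trans_le hB
  obtain ⟨hC1, hC2⟩ := hC B hB0
  obtain ⟨hD1, hD2⟩ := hD B hB
  let T := {s | s ∈ rationalPoints (symSquare surfaceV) ∧ s ∉ diagonalFamily ∧ s ∉ splitPairs ∧
    s ∉ symSquare baseV ∧ symHeight s ≤ B}
  have hex : ∀ s, s ∈ T → ∃ t, IsConjData s t ∧ IsFormPair B t := fun s hs =>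
    exists_isConjData hs.1 hs.2.1 hs.2.2.1 hs.2.2.2.1 hs.2.2.2.2
  choose! f hf1 hf2 using hex
  have hinj : Set.InjOn f T := fun s hs s' hs' h => (hf1 s hs).unique (h ▸ hf1 s' hs')
  have hmaps : Set.MapsTo f T {t | IsFormPair B t} := fun s hs => hf2 s hs
  have hTfin : T.Finite := Set.Finite.of_injOn hmaps hinj hD1
  have hTcard : T.ncard ≤ {t | IsFormPair B t}.ncard := Set.ncard_le_ncard_of_injOn f hmaps hinj hD1
  have hsub : {s ∈ rationalPoints (symSquare surfaceV \ (diagonalFamily ∪ symSquare baseV)) | symHeight s ≤ B} ⊆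
      {s ∈ splitPairs | symHeight s ≤ B} ∪ T := by
    rintro s ⟨⟨⟨hs1, hs2⟩, hs3⟩, hs4⟩
    by_cases hsp : s ∈ splitPairs
    · exact Or.inl ⟨hsp, hs4⟩
    · exact Or.inr ⟨⟨hs1, hs3⟩, fun h => hs2 (Or.inl h), hsp, fun h => hs2 (Or.inr h), hs4⟩
  refine ⟨(hC1.union hTfin).subset hsub, ?_⟩
  have h1 : countPoints (symSquare surfaceV \ (diagonalFamily ∪ symSquare baseV)) B ≤
      {s ∈ splitPairs | symHeight s ≤ B}.ncard + {t | IsFormPair B t}.ncard :=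
    (Set.ncard_le_ncard hsub (hC1.union hTfin)).trans ((Set.ncard_union_le _ _).trans (by gcongr))
  calc (countPoints (symSquare surfaceV \ (diagonalFamily ∪ symSquare baseV)) B : ℝ)
      ≤ {s ∈ splitPairs | symHeight s ≤ B}.ncard + {t | IsFormPair B t}.ncard := by exact_mod_cast h1
    _ ≤ C * B ^ (5 / 2 : ℝ) + D * B ^ (23 / 8 : ℝ) := add_le_add hC2 hD2
    _ ≤ |C| * B ^ (23 / 8 : ℝ) + D * B ^ (23 / 8 : ℝ) := by
        exact add_le_add (mul_le_mul (le_abs_self C) (Real.rpow_le_rpow_of_exponent_le hB (by norm_num))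
          (by positivity) (abs_nonneg _)) le_rfl
    _ = (|C| + D) * B ^ (23 / 8 : ℝ) := by ring

end ConjugatePairs

/-! ### Summation over the fibres -/

open Filter Topology

section Family

theorem fibreV_smul {c : ℚ} (hc : c ≠ 0) (y : Fin 2 → ℚ) : fibreV (c • y) = fibreV y := by
  have hc' : (c : QBar) ≠ 0 := by exact_mod_cast hc
  ext x
  refine and_congr_right fun _ => ?_
  simp only [Pi.smul_apply, smul_eq_mul, Rat.cast_mul]
  rw [mul_left_comm, mul_left_comm (x.rep 1), mul_right_inj' hc']

theorem fibreV_intCast_eq_points {p : Fin 2 → ℤ} (hp : Finset.univ.gcd p = 1) :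
    fibreV (fun i => (p i : ℚ)) = (fibreLine fun i => (p i : ℚ)).points := by
  refine fibreV_eq_points fun h => ne_zero_of_primitive hp ?_
  ext i
  simpa using congrFun h i

theorem fibreV_rep (y : Projectivization ℚ (Fin 2 → ℚ)) :
    fibreV y.rep = (fibreLine fun i => (primRep y i : ℚ)).points := by
  obtain ⟨c, hc, hy⟩ := exists_rep_eq y
  rw [hy, fibreV_smul hc, fibreV_intCast_eq_points (primRep_primitive y)]

theorem symSquare_fibreV_subset {y : Fin 2 → ℚ} (hy : y ≠ 0) : symSquare (fibreV y) ⊆ diagonalFamily := by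
  intro s hs
  refine ⟨fun x hx => (hs x hx).1, fun x hx x' hx' => ?_⟩
  have h1 := (hs x hx).2
  have h2 := (hs x' hx').2
  by_cases h0 : y 0 = 0
  · have h3 : (y 1 : QBar) ≠ 0 := by
      have : y 1 ≠ 0 := fun h3 => hy (by ext i; fin_cases i <;> assumption)
      exact_mod_cast this
    rw [h0, Rat.cast_zero, mul_zero] at h1 h2
    rw [(mul_eq_zero.mp h1).resolve_right h3, (mul_eq_zero.mp h2).resolve_right h3]
    ring
  · have h3 : (y 0 : QBar) ≠ 0 := by exact_mod_cast h0
    refine mul_right_cancel₀ h3 ?_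
    linear_combination x'.rep 0 * h1 - x.rep 0 * h2

theorem eq_of_mem_fibreV_rep {y y' : Projectivization ℚ (Fin 2 → ℚ)} {x : ProjPt 4} (h : x ∈ fibreV y.rep)
    (h' : x ∈ fibreV y'.rep) : y = y' := by
  have h1 := h.2
  have h2 := h'.2
  have hx : ¬ (x.rep 0 = 0 ∧ x.rep 1 = 0) := h.1.2
  have key : y'.rep 0 * y.rep 1 = y'.rep 1 * y.rep 0 := by
    apply Rat.cast_injective (α := QBar)
    push_cast
    by_cases h0 : x.rep 0 = 0
    · refine mul_left_cancel₀ (fun h3 => hx ⟨h0, h3⟩ : x.rep 1 ≠ 0) ?_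
      linear_combination (y'.rep 1 : QBar) * h1 - (y.rep 1 : QBar) * h2
    · refine mul_left_cancel₀ h0 ?_
      linear_combination (y'.rep 0 : QBar) * h1 - (y.rep 0 : QBar) * h2
  obtain ⟨a, ha⟩ := exists_smul_of_det_eq_zero y'.rep_nonzero key
  rw [← y.mk_rep, ← y'.mk_rep, Projectivization.mk_eq_mk_iff']
  exact ⟨a, ha.symm⟩

/-- Both points have the same ratio `t₁/t₀`, and a Galois automorphism maps each to one of the two.
The ratio is therefore invariant, hence rational. -/
theorem exists_mem_symSquare_fibreV {s : Sym2 (ProjPt 4)} (hs : s ∈ rationalPoints diagonalFamily) :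
    ∃ y : Projectivization ℚ (Fin 2 → ℚ), s ∈ symSquare (fibreV y.rep) := by
  obtain ⟨hd, hσ⟩ := hs
  suffices h : ∃ r : Fin 2 → ℚ, r ≠ 0 ∧ s ∈ symSquare (fibreV r) by
    obtain ⟨r, hr, hs⟩ := h
    obtain ⟨c, hc⟩ := Projectivization.exists_smul_eq_mk_rep ℚ r hr
    refine ⟨Projectivization.mk ℚ r hr, ?_⟩
    rw [← hc, Units.smul_def, fibreV_smul c.ne_zero]
    exact hs
  induction s using Sym2.ind with | _ x y =>
  have hor : ∀ σ, galPt σ x = x ∨ galPt σ x = y := fun σ => by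
    have h := hσ σ
    rw [Sym2.map_mk, Sym2.eq_iff] at h
    exact h.imp And.left And.left
  induction x using Projectivization.ind with | _ v hv =>
  induction y using Projectivization.ind with | _ w hw =>
  obtain ⟨⟨hvV, hwV⟩, hvw⟩ := (mk_mem_diagonalFamily hv hw).mp hd
  have hv01 := ((mk_mem_surfaceV hv).mp hvV).2
  have hw01 := ((mk_mem_surfaceV hw).mp hwV).2
  have hmem : ∀ r : Fin 2 → ℚ, v 0 * (r 1 : QBar) = v 1 * (r 0 : QBar) → w 0 * (r 1 : QBar) = w 1 * (r 0 : QBar) →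
      s(Projectivization.mk QBar v hv, Projectivization.mk QBar w hw) ∈ symSquare (fibreV r) := by
    intro r h1 h2 p hp
    rcases Sym2.mem_iff.mp hp with rfl | rfl
    · exact (mk_mem_fibreV hv).mpr ⟨hvV, h1⟩
    · exact (mk_mem_fibreV hw).mpr ⟨hwV, h2⟩
  by_cases h0 : v 0 = 0
  · have hw0 : w 0 = 0 := by
      rw [h0, zero_mul] at hvw
      exact (mul_eq_zero.mp hvw.symm).resolve_left fun h1 => hv01 ⟨h0, h1⟩
    exact ⟨![0, 1], fun h => one_ne_zero (congrFun h 1), hmem _ (by simp [h0]) (by simp [hw0])⟩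
  · have hw0 : w 0 ≠ 0 := fun h => by
      rw [h, mul_zero] at hvw
      exact hw01 ⟨h, (mul_eq_zero.mp hvw).resolve_left h0⟩
    have hvw' : w 1 / w 0 = v 1 / v 0 := by
      field_simp
      linear_combination hvw
    obtain ⟨r, hr⟩ := QBar.exists_rat_of_fixed (x := v 1 / v 0) fun σ => by
      have aux : ∀ (u : Fin 4 → QBar) (hu : u ≠ 0), u 1 / u 0 = v 1 / v 0 →
          galPt σ (Projectivization.mk QBar v hv) = Projectivization.mk QBar u hu → σ (v 1 / v 0) = v 1 / v 0 := by
        intro u hu he h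
        rw [galPt_mk] at h
        obtain ⟨a, ha⟩ := (Projectivization.mk_eq_mk_iff' QBar _ _ _ hu).mp h
        have ha0 : a * u 0 = σ (v 0) := congrFun ha 0
        have ha1 : a * u 1 = σ (v 1) := congrFun ha 1
        have ha' : a ≠ 0 := by
          rintro rfl
          rw [zero_mul] at ha0
          exact h0 ((map_eq_zero σ).mp ha0.symm)
        rw [map_div₀, ← ha0, ← ha1, mul_div_mul_left _ _ ha', he]
      rcases hor σ with h | h
      exacts [aux v hv rfl h, aux w hw hvw' h]
    refine ⟨![1, r], fun h => one_ne_zero (congrFun h 0), hmem _ ?_ ?_⟩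
    · simp [hr, mul_div_cancel₀ _ h0]
    · simp [hr, ← hvw', mul_div_cancel₀ _ hw0]

theorem countPoints_fibreV_rep_le (y : Projectivization ℚ (Fin 2 → ℚ)) {B : ℝ} (hB : 0 < B) :
    (countPoints (symSquare (fibreV y.rep)) B : ℝ) ≤ 14 * B ^ 3 * (Height.mulHeight y.rep ^ 6)⁻¹ := by
  rw [fibreV_rep, mulHeight_rep, mul_assoc, ← div_eq_mul_inv]
  exact MetrizedLine.countPoints_symSquare_le (MetrizedLine.fibreLine_isStandard (primRep_primitive y)) hB

theorem finite_rationalPoints_fibreV_rep (y : Projectivization ℚ (Fin 2 → ℚ)) {B : ℝ} (hB : 0 < B) :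
    {s ∈ rationalPoints (symSquare (fibreV y.rep)) | symHeight s ≤ B}.Finite := by
  rw [fibreV_rep]
  exact (MetrizedLine.two_mul_countPoints (MetrizedLine.fibreLine_isStandard (primRep_primitive y)) subset_rfl hB).1

/-- For fixed `B` the summable bound drops below one for all but finitely many `y`, and a count
below one is zero. The remaining planes are disjoint because a point lies on one fibre only. -/
theorem countPoints_diagonalFamily {B : ℝ} (hB : 0 < B) :
    {s ∈ rationalPoints diagonalFamily | symHeight s ≤ B}.Finite ∧
      (countPoints diagonalFamily B : ℝ) =
        ∑' y : Projectivization ℚ (Fin 2 → ℚ), (countPoints (symSquare (fibreV y.rep)) B : ℝ) := by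
  have hsum := (summable_mulHeight_rep_pow (k := 6) (by norm_num)).mul_left (14 * B ^ 3)
  have hev : {y : Projectivization ℚ (Fin 2 → ℚ) | ¬ (14 * B ^ 3 * (Height.mulHeight y.rep ^ 6)⁻¹ < 1)}.Finite :=
    hsum.tendsto_cofinite_zero.eventually_lt_const one_pos
  have hzero : ∀ y ∉ hev.toFinset, countPoints (symSquare (fibreV y.rep)) B = 0 := by
    intro y hy
    have h1 : 14 * B ^ 3 * (Height.mulHeight y.rep ^ 6)⁻¹ < 1 := by simpa using hy
    have h2 := (countPoints_fibreV_rep_le y hB).trans_lt h1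
    exact Nat.lt_one_iff.mp (by exact_mod_cast h2)
  have hU : {s ∈ rationalPoints diagonalFamily | symHeight s ≤ B} =
      ⋃ y ∈ hev.toFinset, {s ∈ rationalPoints (symSquare (fibreV y.rep)) | symHeight s ≤ B} := by
    ext s
    simp only [Set.mem_iUnion, exists_prop]
    constructor
    · rintro ⟨hs, hsB⟩
      obtain ⟨y, hy⟩ := exists_mem_symSquare_fibreV hs
      have hsy : s ∈ {s ∈ rationalPoints (symSquare (fibreV y.rep)) | symHeight s ≤ B} := ⟨⟨hy, hs.2⟩, hsB⟩
      refine ⟨y, by_contra fun h => ?_, hsy⟩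
      exact ((Set.ncard_eq_zero (finite_rationalPoints_fibreV_rep y hB)).mp (hzero y h)).le hsy
    · rintro ⟨y, -, hs, hsB⟩
      exact ⟨⟨symSquare_fibreV_subset y.rep_nonzero hs.1, hs.2⟩, hsB⟩
  refine ⟨hU ▸ hev.toFinset.finite_toSet.biUnion fun y _ => finite_rationalPoints_fibreV_rep y hB, ?_⟩
  rw [tsum_eq_sum (s := hev.toFinset) fun y hy => by rw [hzero y hy, Nat.cast_zero], ← Nat.cast_sum]
  have h1 := Set.Finite.ncard_biUnion hev.toFinset.finite_toSet
    (s := fun y : Projectivization ℚ (Fin 2 → ℚ) =>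
      {s ∈ rationalPoints (symSquare (fibreV y.rep)) | symHeight s ≤ B})
    (fun y _ => finite_rationalPoints_fibreV_rep y hB) (by
      intro y _ y' _ hne
      refine Set.disjoint_left.mpr fun s hs hs' => hne ?_
      exact eq_of_mem_fibreV_rep (hs.1.1 _ s.out_fst_mem) (hs'.1.1 _ s.out_fst_mem))
  rw [finsum_mem_coe_finset] at h1
  simp only [Finset.mem_coe] at h1
  rw [countPoints, hU, h1]
  rfl

/-- Dominated convergence: each plane has its own asymptotic, and `14 / H(y)⁶` dominates the
normalised counts for all `B > 0`. -/
theorem tendsto_countPoints_diagonalFamily_div :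
    Tendsto (fun B : ℝ => (countPoints diagonalFamily B : ℝ) / B ^ 3) atTop
      (𝓝 (∑' y : Projectivization ℚ (Fin 2 → ℚ), (fibreLine y.rep).btConstant)) := by
  have h := tendsto_tsum_of_dominated_convergence (𝓕 := atTop)
    (f := fun (B : ℝ) (y : Projectivization ℚ (Fin 2 → ℚ)) => (countPoints (symSquare (fibreV y.rep)) B : ℝ) / B ^ 3)
    (g := fun y => (fibreLine y.rep).btConstant)
    (bound := fun y => 14 * (Height.mulHeight y.rep ^ 6)⁻¹)
    ((summable_mulHeight_rep_pow (k := 6) (by norm_num)).mul_left 14) (fun y => ?_) ?_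
  · refine h.congr' ?_
    filter_upwards [eventually_gt_atTop 0] with B hB
    rw [(countPoints_diagonalFamily hB).2, tsum_div_const]
  · rw [fibreLine_btConstant y.rep_nonzero, projLine_btConstant, mulHeight_rep, fibreV_rep]
    exact MetrizedLine.tendsto_countPoints_div (MetrizedLine.fibreLine_isStandard (primRep_primitive y))
  · filter_upwards [eventually_gt_atTop 0] with B hB y
    rw [Real.norm_of_nonneg (by positivity), div_le_iff₀ (by positivity)]
    refine (countPoints_fibreV_rep_le y hB).trans (le_of_eq (by ring))

end Family

/-! ### The count on `Sym² V` -/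

section Total

theorem baseV_subset : baseV ⊆ surfaceV := fun _ hx => hx.1

/-- A fibre meets the base line in one point, so the two points of the pair coincide and are fixed
by the Galois group. The overlap of the family with `V_{0,0}` is thereby negligible. -/
theorem mem_splitPairs_of_mem_diagonalFamily {s : Sym2 (ProjPt 4)} (hs : s ∈ rationalPoints diagonalFamily)
    (hb : s ∈ symSquare baseV) : s ∈ splitPairs := by
  obtain ⟨hd, hσ⟩ := hs
  refine ⟨hd.1, ?_⟩
  induction s using Sym2.ind with | _ x y =>
  have hx := hb x (Sym2.mem_mk_left _ _)
  have hy := hb y (Sym2.mem_mk_right _ _)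
  have hxy : x = y := by
    induction x using Projectivization.ind with | _ v hv =>
    induction y using Projectivization.ind with | _ w hw =>
    have hvw := ((mk_mem_diagonalFamily hv hw).mp hd).2
    obtain ⟨-, hv2, hv3⟩ := (mk_mem_baseV hv).mp hx
    obtain ⟨-, hw2, hw3⟩ := (mk_mem_baseV hw).mp hy
    have hw' : ![w 0, w 1] ≠ 0 := fun h => hw (by
      have h0 : w 0 = 0 := congrFun h 0
      have h1 : w 1 = 0 := congrFun h 1
      ext i
      fin_cases i <;> assumption)
    obtain ⟨a, ha⟩ := exists_smul_of_det_eq_zero (τ := ![v 0, v 1]) hw' (by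
      change w 0 * v 1 = w 1 * v 0
      linear_combination -hvw)
    have h0 : v 0 = a * w 0 := congrFun ha 0
    have h1 : v 1 = a * w 1 := congrFun ha 1
    refine mk_eq_mk_of_smul hv hw (a := a) ?_
    ext i
    fin_cases i
    · exact h0
    · exact h1
    · simp [hv2, hw2]
    · simp [hv3, hw3]
  subst hxy
  intro p hp σ
  have hpx : p = x := by simpa using hp
  have h := hσ σ
  rw [Sym2.map_mk, Sym2.eq_iff, or_self] at h
  rw [hpx]
  exact h.1

theorem tendsto_div_of_le_rpow {f : ℝ → ℝ} {C a : ℝ} (ha : a < 3) (h0 : ∀ B, 0 ≤ f B)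
    (h : ∀ B, 1 ≤ B → f B ≤ C * B ^ a) : Tendsto (fun B => f B / B ^ 3) atTop (𝓝 0) := by
  have h1 := (tendsto_rpow_neg_atTop (sub_pos.mpr ha)).const_mul C
  rw [mul_zero] at h1
  refine squeeze_zero' ?_ ?_ h1
  · filter_upwards [eventually_ge_atTop 0] with B hB
    exact div_nonneg (h0 B) (by positivity)
  · filter_upwards [eventually_ge_atTop 1] with B hB
    have hB0 := one_pos.trans_le hB
    rw [div_le_iff₀ (by positivity), neg_sub, Real.rpow_sub hB0, mul_assoc]
    refine (h B hB).trans (le_of_eq ?_)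
    rw [show B ^ (3 : ℝ) = B ^ 3 by exact_mod_cast Real.rpow_natCast B 3, div_mul_cancel₀ _ (by positivity)]

theorem tendsto_countPoints_offDiagonal_div :
    Tendsto (fun B : ℝ => (countPoints (symSquare surfaceV \ (diagonalFamily ∪ symSquare baseV)) B : ℝ) / B ^ 3)
      atTop (𝓝 0) := by
  obtain ⟨C, hC⟩ := exists_ncard_offDiagonal_le
  exact tendsto_div_of_le_rpow (C := C) (a := 23 / 8) (by norm_num) (fun B => Nat.cast_nonneg _) fun B hB => (hC B hB).2

theorem tendsto_countPoints_baseV_div :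
    Tendsto (fun B : ℝ => (countPoints (symSquare baseV) B : ℝ) / B ^ 3) atTop (𝓝 baseLine.btConstant) := by
  have h := MetrizedLine.tendsto_countPoints_div MetrizedLine.baseLine_isStandard
  rwa [one_pow, div_one, ← projLine_btConstant, ← baseLine_btConstant, ← baseV_eq_points] at h

/-- Inclusion and exclusion for the family, `V_{0,0}` and the rest; the overlap is `O(B^{5/2})` and
the rest `O(B^{23/8})`. -/
theorem tendsto_countPoints_surfaceV_div :
    Tendsto (fun B : ℝ => (countPoints (symSquare surfaceV) B : ℝ) / B ^ 3) atTop
      (𝓝 (baseLine.btConstant + ∑' y : Projectivization ℚ (Fin 2 → ℚ), (fibreLine y.rep).btConstant)) := by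
  obtain ⟨C, hC⟩ := exists_ncard_splitPairs_le
  obtain ⟨D, hD⟩ := exists_ncard_offDiagonal_le
  let I : ℝ → ℝ := fun B => {s ∈ rationalPoints (diagonalFamily ∩ symSquare baseV) | symHeight s ≤ B}.ncard
  have hsub : ∀ B, {s ∈ rationalPoints (diagonalFamily ∩ symSquare baseV) | symHeight s ≤ B} ⊆
      {s ∈ splitPairs | symHeight s ≤ B} := fun B s hs =>
    ⟨mem_splitPairs_of_mem_diagonalFamily ⟨hs.1.1.1, hs.1.2⟩ hs.1.1.2, hs.2⟩
  have hI : Tendsto (fun B => I B / B ^ 3) atTop (𝓝 0) :=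
    tendsto_div_of_le_rpow (C := C) (a := 5 / 2) (by norm_num) (fun B => Nat.cast_nonneg _) fun B hB =>
      le_trans (Nat.cast_le.mpr (Set.ncard_le_ncard (hsub B) (hC B (by linarith)).1)) (hC B (by linarith)).2
  have h := ((tendsto_countPoints_baseV_div.add tendsto_countPoints_diagonalFamily_div).sub hI).add
    tendsto_countPoints_offDiagonal_div
  rw [sub_zero, add_zero] at h
  refine h.congr' ?_
  filter_upwards [eventually_ge_atTop 1] with B hB
  have hB0 := one_pos.trans_le hB
  have fd := (countPoints_diagonalFamily hB0).1
  have fb : {s ∈ rationalPoints (symSquare baseV) | symHeight s ≤ B}.Finite := by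
    rw [baseV_eq_points]
    exact (MetrizedLine.two_mul_countPoints MetrizedLine.baseLine_isStandard subset_rfl hB0).1
  have fr := (hD B hB).1
  have e1 : {s ∈ rationalPoints diagonalFamily | symHeight s ≤ B} ∩
      {s ∈ rationalPoints (symSquare baseV) | symHeight s ≤ B} =
      {s ∈ rationalPoints (diagonalFamily ∩ symSquare baseV) | symHeight s ≤ B} := by
    ext s
    constructor
    · rintro ⟨⟨⟨h1, h2⟩, h3⟩, ⟨h4, -⟩, -⟩
      exact ⟨⟨⟨h1, h4⟩, h2⟩, h3⟩
    · rintro ⟨⟨⟨h1, h4⟩, h2⟩, h3⟩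
      exact ⟨⟨⟨h1, h2⟩, h3⟩, ⟨h4, h2⟩, h3⟩
  have e2 : ({s ∈ rationalPoints diagonalFamily | symHeight s ≤ B} ∪
      {s ∈ rationalPoints (symSquare baseV) | symHeight s ≤ B}) ∪
      {s ∈ rationalPoints (symSquare surfaceV \ (diagonalFamily ∪ symSquare baseV)) | symHeight s ≤ B} =
      {s ∈ rationalPoints (symSquare surfaceV) | symHeight s ≤ B} := by
    ext s
    constructor
    · rintro ((⟨⟨h1, h2⟩, h3⟩ | ⟨⟨h1, h2⟩, h3⟩) | ⟨⟨⟨h1, -⟩, h2⟩, h3⟩)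
      · exact ⟨⟨h1.1, h2⟩, h3⟩
      · exact ⟨⟨fun x hx => baseV_subset (h1 x hx), h2⟩, h3⟩
      · exact ⟨⟨h1, h2⟩, h3⟩
    · rintro ⟨⟨h1, h2⟩, h3⟩
      by_cases h4 : s ∈ diagonalFamily
      · exact Or.inl (Or.inl ⟨⟨h4, h2⟩, h3⟩)
      by_cases h5 : s ∈ symSquare baseV
      · exact Or.inl (Or.inr ⟨⟨h5, h2⟩, h3⟩)
      · exact Or.inr ⟨⟨⟨h1, fun h => h.elim h4 h5⟩, h2⟩, h3⟩
  have n1 := Set.ncard_union_add_ncard_inter {s ∈ rationalPoints diagonalFamily | symHeight s ≤ B}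
    {s ∈ rationalPoints (symSquare baseV) | symHeight s ≤ B} fd fb
  have n2 := Set.ncard_union_eq (s := {s ∈ rationalPoints diagonalFamily | symHeight s ≤ B} ∪
      {s ∈ rationalPoints (symSquare baseV) | symHeight s ≤ B}) (t := {s ∈ rationalPoints (symSquare surfaceV \
        (diagonalFamily ∪ symSquare baseV)) | symHeight s ≤ B}) (by
    refine Set.disjoint_left.mpr ?_
    rintro s (hs | hs) hs'
    · exact hs'.1.1.2 (Or.inl hs.1.1)
    · exact hs'.1.1.2 (Or.inr hs.1.1)) (fd.union fb) fr
  rw [e1] at n1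
  rw [e2] at n2
  have n3 : (countPoints (symSquare surfaceV) B : ℝ) + I B = countPoints diagonalFamily B + countPoints (symSquare baseV) B +
      countPoints (symSquare surfaceV \ (diagonalFamily ∪ symSquare baseV)) B := by
    simp only [I, countPoints]
    rw [n2]
    push_cast
    have := congrArg (Nat.cast (R := ℝ)) n1
    push_cast at this
    linarith
  rw [eq_sub_of_add_eq n3]
  ring

end Total

/-! ### Comparison with the predicted main terms -/

section Prediction

theorem MetrizedLine.btPrediction_eq {n : ℕ} {Λ : MetrizedLine n} (h : Λ.boundedSections = symSquareSections) (B : ℝ) :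
    Λ.btPrediction B = Λ.btConstant * B ^ 3 := by
  rw [MetrizedLine.btPrediction, MetrizedLine.a_eq h, MetrizedLine.b_eq h, Nat.sub_self, pow_zero, mul_one,
    show B ^ (3 : ℝ) = B ^ 3 by exact_mod_cast Real.rpow_natCast B 3]

theorem isEquivalent_mul_pow_of_tendsto {f : ℝ → ℝ} {c : ℝ} (hc : c ≠ 0)
    (h : Tendsto (fun B => f B / B ^ 3) atTop (𝓝 c)) :
    Asymptotics.IsEquivalent atTop f fun B => c * B ^ 3 := by
  apply Asymptotics.isEquivalent_of_tendsto_one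
  have h1 := h.div_const c
  rw [div_self hc] at h1
  refine h1.congr fun B => ?_
  rw [Pi.div_apply, div_div, mul_comm]

theorem projLine_btConstant_pos : 0 < projLine.btConstant := by
  rw [projLine_btConstant]
  have hs : Summable fun m : ℕ => 1 / ((m : ℝ) + 1) ^ 3 := by
    have h := (summable_nat_add_iff 1).mpr (Real.summable_one_div_nat_pow.mpr (by norm_num : 1 < 3))
    exact_mod_cast h
  exact div_pos (by norm_num) (hs.tsum_pos (fun m => by positivity) 0 (by norm_num))

theorem fibreLine_btConstant_pos {y : Fin 2 → ℚ} (hy : y ≠ 0) : 0 < (fibreLine y).btConstant := by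
  rw [fibreLine_btConstant hy]
  exact div_pos projLine_btConstant_pos (pow_pos (Height.mulHeight_pos _) 9)

theorem fibreLine_btConstant_rep (y : Projectivization ℚ (Fin 2 → ℚ)) :
    (fibreLine y.rep).btConstant = projLine.btConstant * (Height.mulHeight y.rep ^ 9)⁻¹ := by
  rw [fibreLine_btConstant y.rep_nonzero, div_eq_mul_inv]

theorem summable_fibreLine_btConstant :
    Summable fun y : Projectivization ℚ (Fin 2 → ℚ) => (fibreLine y.rep).btConstant := by
  simp_rw [fibreLine_btConstant_rep]
  exact (summable_mulHeight_rep_pow (by norm_num)).mul_left _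

theorem tsum_fibreLine_btConstant_pos :
    0 < ∑' y : Projectivization ℚ (Fin 2 → ℚ), (fibreLine y.rep).btConstant :=
  summable_fibreLine_btConstant.tsum_pos (fun y => (fibreLine_btConstant_pos y.rep_nonzero).le)
    (Projectivization.mk ℚ ![1, 0] fun h => one_ne_zero (congrFun h 0)) (fibreLine_btConstant_pos (Projectivization.rep_nonzero _))

theorem tsum_fibreLine_btPrediction (B : ℝ) :
    ∑' y : Projectivization ℚ (Fin 2 → ℚ), (fibreLine y.rep).btPrediction B =
      (∑' y : Projectivization ℚ (Fin 2 → ℚ), (fibreLine y.rep).btConstant) * B ^ 3 := by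
  rw [← tsum_mul_right]
  exact tsum_congr fun y => MetrizedLine.btPrediction_eq (fibreLine_boundedSections y.rep_nonzero) B

theorem MetrizedLine.isEquivalent_btPrediction {n : ℕ} {Λ : MetrizedLine n}
    (h : Λ.boundedSections = symSquareSections) {H : ℝ} (hH : Λ.IsStandard H)
    (hc : Λ.btConstant = projLine.btConstant / H ^ 9) :
    Asymptotics.IsEquivalent atTop (fun B : ℝ => (countPoints (symSquare Λ.points) B : ℝ)) Λ.btPrediction := by
  have h1 := MetrizedLine.tendsto_countPoints_div hH
  rw [← projLine_btConstant, ← hc] at h1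
  have h2 : Λ.btConstant ≠ 0 := by
    rw [hc]
    exact (div_pos projLine_btConstant_pos (pow_pos (one_pos.trans_le hH.one_le) 9)).ne'
  rw [funext (MetrizedLine.btPrediction_eq h)]
  exact isEquivalent_mul_pow_of_tendsto h2 h1

/-- The heights are computed for a primitive integral representative of `y`. The fibre does not
depend on the representative, and neither does the constant, since the height of `y` does not. -/
theorem symSquare_fibreV_asymptotics {y : Fin 2 → ℚ} (hy : y ≠ 0) :
    IsStronglySaturated (symSquare (fibreV y)) ∧ Asymptotics.IsEquivalent atTop
      (fun B : ℝ => (countPoints (symSquare (fibreV y)) B : ℝ)) (fibreLine y).btPrediction := by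
  obtain ⟨p, hp, c, hc, hy'⟩ := exists_primitive_smul hy
  have hp0 : (fun i => (p i : ℚ)) ≠ 0 := by
    rintro h
    rw [h, smul_zero] at hy'
    exact hy hy'
  have hst := MetrizedLine.fibreLine_isStandard hp
  have hH := mulHeight_of_primitive hp one_ne_zero
  rw [one_smul] at hH
  have hpred : (fibreLine y).btPrediction = (fibreLine fun i => (p i : ℚ)).btPrediction := by
    ext B
    rw [MetrizedLine.btPrediction_eq (fibreLine_boundedSections hy),
      MetrizedLine.btPrediction_eq (fibreLine_boundedSections hp0), fibreLine_btConstant hy, fibreLine_btConstant hp0, hH, hy',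
      mulHeight_of_primitive hp hc]
  rw [hpred, hy', fibreV_smul hc, fibreV_intCast_eq_points hp]
  exact ⟨MetrizedLine.isStronglySaturated hst, MetrizedLine.isEquivalent_btPrediction (fibreLine_boundedSections hp0) hst
    (by rw [fibreLine_btConstant hp0, hH])⟩

end Prediction

end

theorem proposition5p4 :
    -- the lines `V_y` and `V_0` and their parametrisations
    (∀ y : Fin 2 → ℚ, y ≠ 0 → fibreV y = (fibreLine y).points) ∧
    baseV = baseLine.points ∧
    -- `Sym² ℙ¹` is the projective plane, polarised by `𝒪(1)`
    (∃ e : sectionRing symSquareSections ≃ₐ[ℚ] MvPolynomial (Fin 3) ℚ,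
      (∀ (m : ℕ) (x : sectionRing symSquareSections), x ∈ sectionPieces symSquareSections m ↔
        e x ∈ MvPolynomial.homogeneousSubmodule (Fin 3) ℚ m) ∧
      ∀ (i : Fin 3) (x : sectionRing symSquareSections),
        (x : Polynomial (MvPolynomial (Fin 2) ℚ)) =
          Polynomial.monomial 1 (MvPolynomial.esymm (Fin 2) ℚ i) → e x = MvPolynomial.X i) ∧
    -- the natural compactification of each plane is `Sym² ℙ¹`
    (∀ y : Fin 2 → ℚ, y ≠ 0 → (fibreLine y).boundedSections = symSquareSections) ∧
    baseLine.boundedSections = symSquareSections ∧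
    projLine.boundedSections = symSquareSections ∧
    -- the anticanonical bundle of each compactified plane is the cube of the polarisation, and the
    -- Galois group acts trivially on its geometric class group
    (∀ y : Fin 2 → ℚ, y ≠ 0 → (fibreLine y).IsSplit ∧
      ∀ L, (fibreLine y).IsHyperplane L → (fibreLine y).IsCanonical (-(3 : ℤ) • L)) ∧
    (baseLine.IsSplit ∧
      ∀ L, baseLine.IsHyperplane L → baseLine.IsCanonical (-(3 : ℤ) • L)) ∧
    (projLine.IsSplit ∧
      ∀ L, projLine.IsHyperplane L → projLine.IsCanonical (-(3 : ℤ) • L)) ∧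
    -- the exponents
    (∀ y : Fin 2 → ℚ, y ≠ 0 → (fibreLine y).a = 3 ∧ (fibreLine y).b = 1) ∧
    (baseLine.a = 3 ∧ baseLine.b = 1) ∧
    (projLine.a = 3 ∧ projLine.b = 1) ∧
    -- the constants
    projLine.btConstant = 4 / ∑' m : ℕ, 1 / ((m : ℝ) + 1) ^ 3 ∧
    baseLine.btConstant = projLine.btConstant ∧
    (∀ y : Fin 2 → ℚ, y ≠ 0 →
      (fibreLine y).btConstant = projLine.btConstant / Height.mulHeight y ^ 9) ∧
    Summable (fun y : Projectivization ℚ (Fin 2 → ℚ) => (fibreLine y.rep).btConstant) ∧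
    baseLine.btConstant +
        ∑' y : Projectivization ℚ (Fin 2 → ℚ), (fibreLine y.rep).btConstant =
      projLine.btConstant *
        ((∑' y : Projectivization ℚ (Fin 2 → ℚ), (Height.mulHeight y.rep ^ 9)⁻¹) + 1) ∧
    -- the planes are strongly saturated and satisfy the prediction
    (∀ y : Fin 2 → ℚ, y ≠ 0 → IsStronglySaturated (symSquare (fibreV y)) ∧
      Asymptotics.IsEquivalent Filter.atTop
        (fun B : ℝ => (countPoints (symSquare (fibreV y)) B : ℝ)) (fibreLine y).btPrediction) ∧
    (IsStronglySaturated (symSquare baseV) ∧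
      Asymptotics.IsEquivalent Filter.atTop
        (fun B : ℝ => (countPoints (symSquare baseV) B : ℝ)) baseLine.btPrediction) ∧
    Asymptotics.IsEquivalent Filter.atTop
      (fun B : ℝ => (countPoints (symSquare (Set.univ : Set (ProjPt 2))) B : ℝ))
      projLine.btPrediction ∧
    -- the family of the planes `V_{y,y}`
    Asymptotics.IsEquivalent Filter.atTop
      (fun B : ℝ => (countPoints diagonalFamily B : ℝ))
      (fun B => ∑' y : Projectivization ℚ (Fin 2 → ℚ), (fibreLine y.rep).btPrediction B) ∧
    -- the count on `Sym² V`
    Asymptotics.IsEquivalent Filter.atTop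
      (fun B : ℝ => (countPoints (symSquare surfaceV) B : ℝ))
      (fun B => baseLine.btPrediction B +
        ∑' y : Projectivization ℚ (Fin 2 → ℚ), (fibreLine y.rep).btPrediction B) ∧
    Asymptotics.IsLittleO Filter.atTop
      (fun B : ℝ => (countPoints
        (symSquare surfaceV \ (diagonalFamily ∪ symSquare baseV)) B : ℝ))
      (fun B : ℝ => B ^ 3) := by
  refine ⟨fun y hy => fibreV_eq_points hy, baseV_eq_points,
    ⟨symSquareEquiv, fun m x => ?_, fun i x hx => symSquareEquiv_eq_X i x hx⟩,
    fun y hy => fibreLine_boundedSections hy, baseLine_boundedSections, projLine_boundedSections,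
    fun y hy => ⟨MetrizedLine.isSplit (fibreLine_boundedSections hy),
      MetrizedLine.isCanonical (fibreLine_boundedSections hy)⟩,
    ⟨MetrizedLine.isSplit baseLine_boundedSections, MetrizedLine.isCanonical baseLine_boundedSections⟩,
    ⟨MetrizedLine.isSplit projLine_boundedSections, MetrizedLine.isCanonical projLine_boundedSections⟩,
    fun y hy => ⟨MetrizedLine.a_eq (fibreLine_boundedSections hy), MetrizedLine.b_eq (fibreLine_boundedSections hy)⟩,
    ⟨MetrizedLine.a_eq baseLine_boundedSections, MetrizedLine.b_eq baseLine_boundedSections⟩,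
    ⟨MetrizedLine.a_eq projLine_boundedSections, MetrizedLine.b_eq projLine_boundedSections⟩,
    projLine_btConstant, baseLine_btConstant, fun y hy => fibreLine_btConstant hy, summable_fibreLine_btConstant, ?_,
    fun y hy => symSquare_fibreV_asymptotics hy, ⟨?_, ?_⟩, ?_, ?_, ?_, ?_⟩
  · rw [mem_sectionPieces_iff, MvPolynomial.mem_homogeneousSubmodule]
  · simp_rw [fibreLine_btConstant_rep]
    rw [tsum_mul_left, baseLine_btConstant]
    ring
  · rw [baseV_eq_points]
    exact MetrizedLine.isStronglySaturated MetrizedLine.baseLine_isStandard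
  · rw [baseV_eq_points]
    exact MetrizedLine.isEquivalent_btPrediction baseLine_boundedSections MetrizedLine.baseLine_isStandard
      (by rw [baseLine_btConstant, one_pow, div_one])
  · rw [← projLine_points]
    exact MetrizedLine.isEquivalent_btPrediction projLine_boundedSections MetrizedLine.projLine_isStandard
      (by rw [one_pow, div_one])
  · simp_rw [tsum_fibreLine_btPrediction]
    exact isEquivalent_mul_pow_of_tendsto tsum_fibreLine_btConstant_pos.ne' tendsto_countPoints_diagonalFamily_div
  · simp_rw [tsum_fibreLine_btPrediction, MetrizedLine.btPrediction_eq baseLine_boundedSections, ← add_mul]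
    refine isEquivalent_mul_pow_of_tendsto (ne_of_gt ?_) tendsto_countPoints_surfaceV_div
    rw [baseLine_btConstant]
    exact add_pos projLine_btConstant_pos tsum_fibreLine_btConstant_pos
  · refine (Asymptotics.isLittleO_iff_tendsto' ?_).mpr tendsto_countPoints_offDiagonal_div
    filter_upwards [Filter.eventually_gt_atTop 0] with B hB h
    exact absurd h (by positivity)
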